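/- Let $n\ge 1$, let $M^n$ and $N^{n+1}$ be smooth manifolds (Hausdorff, second countable) and let $g$ be a smooth Riemannian metric on $N^{n+1}$. A smooth map $f:M^n\to N^{n+1}$ is a *front* if locally it has a smooth unit normal vector field $\nu$ along $f$ (that is, $g(\nu,\nu)=1$ and $g(df(u),\nu)=0$ for all tangent vectors $u$) such that $(f,[\nu])$ is a Legendrian immersion into the projectivised cotangent bundle, equivalently $(f,\nu):M^n\to TN^{n+1}$ is an immersion. Let $S(\cdot)$ denote the set of points where a map is not an immersion. A front $f$ is a *Morin front* if there are a smooth manifold $W^{n+1}$ and a $C^\infty$ map $\hat f:W^{n+1}\to N^{n+1}$, all of whose singular points are Morin singularities, such that $M^n=S(\hat f)$ (as an embedded submanifold of $W^{n+1}$) and $f=\hat f|_{S(\hat f)}$. Here an $A_k$-Morin singularity ($1\le k\le n+1=:d$) is a map germ which is right-left equivalent to $$(z_1,\dots,z_d)\mapsto (z_1z_d+\dots+z_{k-1}z_d^{k-1}+z_d^{k+1},\,z_1,\dots,z_{d-1})$$ at $0$. Let $f$ be a Morin front, $o\in M^n$ a regular point of $f$ and $\nu_0$ a unit normal vector of $f$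 at $o$. A loop $\gamma$ at $o$ is *co-orientable* if there is a continuous unit normal vector field $\nu(t)$ of $f$ along $\gamma$ with $\nu(0)=\nu(1)$; let $\hat\pi_1(M^n)\subset\pi_1(M^n,o)$ be the subgroup of classes of co-orientable loops. A *null loop* is a closed regular $C^2$ curve $\gamma$ starting at $o$ that meets $S(f)$ at only finitely many parameter values, at each of which $\gamma'(t)\in\ker df$ and $f$ has at $\gamma(t)$ an $A_2$-front singularity, i.e. is right-left equivalent to $(t,x_2,\dots,x_n)\mapsto(2t^3,-3t^2,x_2,\dots,x_n)$ at $0$. For a co-orientable null loop $\gamma$, let $\hat\gamma=f\circ\gamma$, let $\nu$ be the continuous unit normal field along $\gamma$ with $\nu(0)=\nu_0$, let $\nu'$ be its covariant derivative along $\hat\gamma$, and consider the normal curvature map $$C_\gamma:t\mapsto[\,g(\hat\gamma',\hat\gamma'):g(\nu',\hat\gamma')\,]\in P^1(\mathbf R)\qquad(\gamma(t)\notin S(f)).$$ Let $\mu_f(\gamma)\in\mathbf Z$ denote the rotation index of its continuous extension to $[0,1]$. A homomorphism $\hat\rho:\hat\pi_1(M^n)\to\mathbf Z$ is called a Maslov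 representation of $f$ if for every co-orientable null loop $\gamma$ at $o$ the map $C_\gamma$ extends continuously to $[0,1]$ and $\hat\rho([\gamma])=\mu_f(\gamma)$. Then the Maslov representation of the Morin front $f$ is trivial: the trivial homomorphism $\hat\pi_1(M^n)\to\mathbf Z$ is a Maslov representation of $f$, and it is the only one. -/

import Mathlib

open Set Filter Topology
open scoped Manifold ContDiff

universe u v w

noncomputable section

namespace MorinFront

/-- The model space `ℝᵈ`. -/
abbrev Euc (d : ℕ) : Type := EuclideanSpace ℝ (Fin d)

/-! ### Singular points and right-left equivalence -/

section Germs

/-- The set `S(f)` of points at which `f : Xᵃ → Yᵇ` is not an immersion. (If `a = b`: the points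
at which `f` is not a local diffeomorphism.) -/
def singularSet (a b : ℕ) {X : Type*} [TopologicalSpace X] [ChartedSpace (Euc a) X]
    {Y : Type*} [TopologicalSpace Y] [ChartedSpace (Euc b) Y] (f : X → Y) : Set X :=
  {p | ¬ Function.Injective (mfderiv (𝓡 a) (𝓡 b) f p)}

/-- The germ of `f` at `p` is (smoothly) right-left equivalent to the germ at `0` of the map
`h : ℝᵃ → ℝᵇ`, `h 0 = 0`: in suitable smooth charts centred at `p` and at `f p`, the map `f`
is `h`. -/
def IsRightLeftEquivAt {a b : ℕ} {X : Type*} [TopologicalSpace X] [ChartedSpace (Euc a) X]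
    {Y : Type*} [TopologicalSpace Y] [ChartedSpace (Euc b) Y]
    (f : X → Y) (p : X) (h : Euc a → Euc b) : Prop :=
  ∃ φ ∈ IsManifold.maximalAtlas (𝓡 a) ∞ X, ∃ ψ ∈ IsManifold.maximalAtlas (𝓡 b) ∞ Y,
    p ∈ φ.source ∧ f p ∈ ψ.source ∧ φ p = 0 ∧ ψ (f p) = 0 ∧
      ∀ᶠ x in 𝓝 p, f x ∈ ψ.source ∧ ψ (f x) = h (φ x)

end Germs

/-- The normal form of the `A_k`-Morin singularity in dimension `d = n + 1`:
`(z₁, …, z_d) ↦ (z₁ z_d + ⋯ + z_{k-1} z_d^{k-1} + z_d^{k+1}, z₁, …, z_{d-1})`. -/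
def morinForm (n k : ℕ) (z : Euc (n + 1)) : Euc (n + 1) :=
  WithLp.toLp 2 (Fin.cons
    ((∑ i : Fin n, if i.val + 1 < k then z i.castSucc * z (Fin.last n) ^ (i.val + 1) else 0)
      + z (Fin.last n) ^ (k + 1))
    (fun i : Fin n => z i.castSucc))

/-- The normal form of the `A_2`-singularity of fronts of dimension `n = m + 1`:
`(t, x₂, …, x_n) ↦ (2 t³, -3 t², x₂, …, x_n)`. -/
def cuspForm (m : ℕ) (x : Euc (m + 1)) : Euc (m + 2) :=
  WithLp.toLp 2 (Fin.cons (2 * x 0 ^ 3) (Fin.cons (-3 * x 0 ^ 2) (fun i : Fin m => x i.succ)))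

/-! ### Riemannian metrics and covariant differentiation along curves -/

section Riemannian

variable {d : ℕ} {N : Type*} [TopologicalSpace N] [ChartedSpace (Euc d) N]
  [IsManifold (𝓡 d) ∞ N]

/-- A smooth Riemannian metric on a manifold of dimension `d`. -/
abbrev Metric (d : ℕ) (N : Type*) [TopologicalSpace N] [ChartedSpace (Euc d) N]
    [IsManifold (𝓡 d) ∞ N] : Type _ :=
  Bundle.ContMDiffRiemannianMetric (𝓡 d) ∞ (Euc d) (fun x : N => TangentSpace (𝓡 d) x)

/-- The coordinates of the tangent vector `v` at `x` in the chart around `x₀`. -/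
def tangentCoord (x₀ x : N) (v : TangentSpace (𝓡 d) x) : Euc d :=
  (trivializationAt (Euc d) (fun y : N => TangentSpace (𝓡 d) y) x₀ ⟨x, v⟩).2

/-- The metric in the chart around `x₀`: the value `g_y(v, w)` for `y`, `v`, `w` in coordinates. -/
def metricCoord (g : Metric d N) (x₀ : N) (y v w : Euc d) : ℝ :=
  g.inner ((extChartAt (𝓡 d) x₀).symm y)
    ((trivializationAt (Euc d) (fun x : N => TangentSpace (𝓡 d) x) x₀).symm _ v)
    ((trivializationAt (Euc d) (fun x : N => TangentSpace (𝓡 d) x) x₀).symm _ w)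

/-- The Christoffel symbols of the first kind in the chart around `x₀`,
`½ (∂_u g(v, w) + ∂_v g(u, w) - ∂_w g(u, v))`, which is `g(∇_u v, w)` for the Levi-Civita
connection and vector fields `u`, `v`, `w` with constant coordinates. -/
def christoffelFirst (g : Metric d N) (x₀ : N) (y u v w : Euc d) : ℝ :=
  (1 / 2) * (fderiv ℝ (fun z => metricCoord g x₀ z v w) y u
    + fderiv ℝ (fun z => metricCoord g x₀ z u w) y v
    - fderiv ℝ (fun z => metricCoord g x₀ z u v) y w)

/-- The velocity of a curve. -/
def velocity (c : ℝ → N) (t : ℝ) : TangentSpace (𝓡 d) (c t) :=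
  mfderiv 𝓘(ℝ, ℝ) (𝓡 d) c t (1 : ℝ)

/-- `g(∇_{c'} V, w)` at time `t`, where `∇` is the Levi-Civita connection of `g`, `V` is a vector
field along the curve `c` and `w` is a tangent vector at `c t`, computed in the chart around
`c t`. -/
def covDerivInner (g : Metric d N) (c : ℝ → N) (V : ∀ s, TangentSpace (𝓡 d) (c s)) (t : ℝ)
    (w : TangentSpace (𝓡 d) (c t)) : ℝ :=
  metricCoord g (c t) (extChartAt (𝓡 d) (c t) (c t))
      (deriv (fun s => tangentCoord (c t) (c s) (V s)) t) (tangentCoord (c t) (c t) w)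
    + christoffelFirst g (c t) (extChartAt (𝓡 d) (c t) (c t))
      (deriv (fun s => extChartAt (𝓡 d) (c t) (c s)) t)
      (tangentCoord (c t) (c t) (V t)) (tangentCoord (c t) (c t) w)

end Riemannian

/-! ### Fronts and Morin fronts -/

section Fronts

variable {m : ℕ}
  {M : Type u} [TopologicalSpace M] [ChartedSpace (Euc (m + 1)) M]
  {N : Type v} [TopologicalSpace N] [ChartedSpace (Euc (m + 2)) N] [IsManifold (𝓡 (m + 2)) ∞ N]

/-- `ν` is, on the open set `U`, a smooth unit normal vector field of the front `f`:
`g(ν, ν) = 1`, `g(df(u), ν) = 0` for every tangent vector `u`, and `(f, ν)` is an immersion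
(equivalently the Legendrian lift `(f, [ν])` into the projectivised cotangent bundle is one). -/
structure IsLocalUnitNormal (g : Metric (m + 2) N) (f : M → N) (U : Set M)
    (ν : ∀ p : M, TangentSpace (𝓡 (m + 2)) (f p)) : Prop where
  isOpen : IsOpen U
  smooth : ContMDiffOn (𝓡 (m + 1)) (𝓡 (m + 2)).tangent ∞
    (fun p => (⟨f p, ν p⟩ : TangentBundle (𝓡 (m + 2)) N)) U
  unit : ∀ p ∈ U, g.inner (f p) (ν p) (ν p) = 1
  normal : ∀ p ∈ U, ∀ u : TangentSpace (𝓡 (m + 1)) p,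
    g.inner (f p) (mfderiv (𝓡 (m + 1)) (𝓡 (m + 2)) f p u) (ν p) = 0
  immersion : ∀ p ∈ U, Function.Injective
    (mfderiv (𝓡 (m + 1)) (𝓡 (m + 2)).tangent
      (fun q => (⟨f q, ν q⟩ : TangentBundle (𝓡 (m + 2)) N)) p)

/-- `f : Mⁿ → Nⁿ⁺¹` (`n = m + 1`) is a (wave) front: locally it has a smooth unit normal field
`ν` such that `(f, [ν])` is a Legendrian immersion. This does not depend on the metric. -/
def IsFront (g : Metric (m + 2) N) (f : M → N) : Prop :=
  ContMDiff (𝓡 (m + 1)) (𝓡 (m + 2)) ∞ f ∧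
    ∀ p : M, ∃ U : Set M, p ∈ U ∧ ∃ ν, IsLocalUnitNormal g f U ν

/-- The vector `v` is a unit normal vector of the front `f` at the (possibly singular)
point `p`. -/
def IsUnitNormalAt (g : Metric (m + 2) N) (f : M → N) (p : M)
    (v : TangentSpace (𝓡 (m + 2)) (f p)) : Prop :=
  ∃ (U : Set M) (ν : ∀ q : M, TangentSpace (𝓡 (m + 2)) (f q)),
    p ∈ U ∧ IsLocalUnitNormal g f U ν ∧ ν p = v

/-- `f` is a Morin front: a front which is the restriction to its singular set `S(F)` of a
smooth map `F : Wⁿ⁺¹ → Nⁿ⁺¹` all of whose singularities are Morin singularities. The manifold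
`M` is identified with `S(F)` by a smooth embedding `ι`. -/
def IsMorinFront (g : Metric (m + 2) N) (f : M → N) : Prop :=
  IsFront g f ∧
  ∃ (W : Type w) (_ : TopologicalSpace W) (_ : ChartedSpace (Euc (m + 2)) W)
    (_ : IsManifold (𝓡 (m + 2)) ∞ W) (_ : T2Space W) (_ : SecondCountableTopology W)
    (F : W → N) (ι : M → W),
    ContMDiff (𝓡 (m + 2)) (𝓡 (m + 2)) ∞ F ∧
    (∀ q ∈ singularSet (m + 2) (m + 2) F, ∃ k : ℕ, 1 ≤ k ∧ k ≤ m + 2 ∧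
      IsRightLeftEquivAt (a := m + 2) (b := m + 2) F q (morinForm (m + 1) k)) ∧
    Manifold.IsSmoothEmbedding (𝓡 (m + 1)) (𝓡 (m + 2)) ∞ ι ∧
    range ι = singularSet (m + 2) (m + 2) F ∧
    ∀ p, f p = F (ι p)

/-! ### Co-orientable loops, null loops and the Maslov representation -/

/-- The loop `γ` is co-orientable: there is a continuous unit normal vector field of `f`
along `γ` with the same value at both ends. -/
def IsCoorientable (g : Metric (m + 2) N) (f : M → N) {o : M} (γ : Path o o) : Prop :=
  ∃ ν : ∀ t : unitInterval, TangentSpace (𝓡 (m + 2)) (f (γ t)),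
    Continuous (fun t => (⟨f (γ t), ν t⟩ : TangentBundle (𝓡 (m + 2)) N)) ∧
    (∀ t, IsUnitNormalAt g f (γ t) (ν t)) ∧
    (⟨f (γ 0), ν 0⟩ : TangentBundle (𝓡 (m + 2)) N) = ⟨f (γ 1), ν 1⟩

/-- The homotopy class of a loop as an element of the fundamental group. -/
def loopClass {o : M} (γ : Path o o) : FundamentalGroup M o :=
  FundamentalGroup.fromPath (Path.Homotopic.Quotient.mk γ)

/-- The subgroup `π̂₁(M) = ker ρ_f` of `π₁(M)` formed by the classes of co-orientable loops.
(These classes already form a subgroup; it is presented as the subgroup they generate.) -/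
def coorientableSubgroup (g : Metric (m + 2) N) (f : M → N) (o : M) :
    Subgroup (FundamentalGroup M o) :=
  Subgroup.closure {c | ∃ γ : Path o o, IsCoorientable g f γ ∧ loopClass γ = c}

theorem loopClass_mem {g : Metric (m + 2) N} {f : M → N} {o : M} {γ : Path o o}
    (h : IsCoorientable g f γ) : loopClass γ ∈ coorientableSubgroup g f o :=
  Subgroup.subset_closure ⟨γ, h, rfl⟩

/-- A null loop at `o`: a closed regular curve of class `C²` starting at `o` (as a `1`-periodic
curve), which passes through the singular set at only finitely many times in a period, always at
an `A_2`-singular point and with velocity in the kernel of `df`. -/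
structure IsNullLoop (f : M → N) (o : M) (γ : ℝ → M) : Prop where
  contMDiff : ContMDiff 𝓘(ℝ, ℝ) (𝓡 (m + 1)) 2 γ
  periodic : Function.Periodic γ 1
  base : γ 0 = o
  regular : ∀ t, velocity (d := m + 1) γ t ≠ 0
  finite : {t ∈ Icc (0 : ℝ) 1 | γ t ∈ singularSet (m + 1) (m + 2) f}.Finite
  cusp : ∀ t, γ t ∈ singularSet (m + 1) (m + 2) f → IsRightLeftEquivAt (a := m + 1) (b := m + 2) f (γ t) (cuspForm m)
  null : ∀ t, γ t ∈ singularSet (m + 1) (m + 2) f →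
    mfderiv (𝓡 (m + 1)) (𝓡 (m + 2)) f (γ t) (velocity (d := m + 1) γ t) = 0

/-- A null loop, restricted to `[0, 1]`, as a path from `o` to `o`. -/
def IsNullLoop.toPath {f : M → N} {o : M} {γ : ℝ → M} (h : IsNullLoop (m := m) f o γ) :
    Path o o where
  toFun t := γ t
  continuous_toFun := h.contMDiff.continuous.comp continuous_subtype_val
  source' := by simpa using h.base
  target' := by
    have h1 := h.periodic 0
    rw [zero_add, h.base] at h1
    exact h1

/-- The map `t ↦ [a t : b t]` from `[0, 1]` minus `S` into the projective line extends
continuously to `[0, 1]`, and the extension has rotation index `k`: it lifts through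
`θ ↦ [cos θ : sin θ]`, the lift increasing by `k π` over `[0, 1]`. -/
def HasRotationIndex (a b : ℝ → ℝ) (S : Set ℝ) (k : ℤ) : Prop :=
  ∃ θ : ℝ → ℝ, ContinuousOn θ (Icc 0 1) ∧
    (∀ t ∈ Icc (0 : ℝ) 1, t ∉ S →
      (a t, b t) ≠ (0, 0) ∧ Real.cos (θ t) * b t = Real.sin (θ t) * a t) ∧
    θ 1 - θ 0 = k * Real.pi

/-- The number `k` is the rotation index `μ_f(γ)` of the normal curvature map
`[g(γ̂', γ̂') : g(ν', γ̂')]`, `γ̂ = f ∘ γ`, of the loop `γ` with respect to the unit normal field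
`ν` along `γ`. Here `ν'` is the covariant derivative. -/
def HasMaslovNumber (g : Metric (m + 2) N) (f : M → N) (γ : ℝ → M)
    (ν : ∀ t, TangentSpace (𝓡 (m + 2)) (f (γ t))) (k : ℤ) : Prop :=
  HasRotationIndex
    (fun t => g.inner (f (γ t)) (velocity (d := m + 2) (fun s => f (γ s)) t)
      (velocity (d := m + 2) (fun s => f (γ s)) t))
    (fun t => covDerivInner g (fun s => f (γ s)) ν t
      (velocity (d := m + 2) (fun s => f (γ s)) t))
    {t | γ t ∈ singularSet (m + 1) (m + 2) f} k

/-- The homomorphism `Φ : π̂₁(M) → ℤ` is the Maslov representation `[γ] ↦ μ_f(γ)` of `f`, for the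
base point `o` and the unit normal vector `ν₀` at `o`: for every co-orientable null loop `γ` at
`o`, taking the continuous unit normal field `ν` along `γ` with `ν(0) = ν₀ = ν(1)`, the normal
curvature map extends continuously and its rotation index is `Φ [γ]`. -/
def IsMaslovRepresentation (g : Metric (m + 2) N) (f : M → N) (o : M)
    (ν₀ : TangentSpace (𝓡 (m + 2)) (f o))
    (Φ : coorientableSubgroup g f o →* Multiplicative ℤ) : Prop :=
  ∀ (γ : ℝ → M) (h : IsNullLoop (m := m) f o γ) (hc : IsCoorientable g f h.toPath),
    ∃ ν : ∀ t, TangentSpace (𝓡 (m + 2)) (f (γ t)),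
      Continuous (fun t => (⟨f (γ t), ν t⟩ : TangentBundle (𝓡 (m + 2)) N)) ∧
      (∀ t, IsUnitNormalAt g f (γ t) (ν t)) ∧
      (⟨f (γ 0), ν 0⟩ : TangentBundle (𝓡 (m + 2)) N) = ⟨f o, ν₀⟩ ∧
      (⟨f (γ 1), ν 1⟩ : TangentBundle (𝓡 (m + 2)) N) = ⟨f o, ν₀⟩ ∧
      HasMaslovNumber g f γ ν
        (Multiplicative.toAdd (Φ ⟨loopClass h.toPath, loopClass_mem hc⟩))

end Fronts

end MorinFront

end

/-! In Morin coordinates the extension is `F = (P(z), z₁, …, z_{d-1})`. Write `P'`, `P''` for the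
derivatives of `P` in the last variable `z_d`. The front lives on the hypersurface `P' = 0`, the
kernel of `dF` there is the last axis, and `f` is singular exactly where that axis is tangent to the
hypersurface, that is, where `P'' = 0`. At a regular point of `f` the map `F` is a fold, so its
image lies locally on one side of the front. This singles out a normal direction on the whole
regular part. A unit normal `ν` agrees with it exactly when the fold number, `P''` times the inner
product of `ν` with the first coordinate vector, is positive (`FoldPos`). Another normal form
multiplies the fold number by a square (`foldNumber_compare`), so its sign is intrinsic.

Let `a = g(γ̂', γ̂')` and `b = g(ν', γ̂')`. At regular times `a > 0`, so the curvature map `[a : b]`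
can reach `[0 : 1]` only at singular times. Differentiating the normality relation gives `b = (fold
number) * (z_d')² +` terms quadratic in `γ̂'` (`covForm_morinForm`). At a null crossing of a cusp
`γ̂'` vanishes while `P''` vanishes to exactly first order, so `b` dominates `a` and has the sign of
the fold number (`IsNormalField.tendsto_cusp`). Hence the angle `arctan (b / a)`, lowered by `π`
while `ν` points to the fold side, tends to `-π/2` at every cusp from both sides. It is a continuous
lift on the whole loop. The fold side does not depend on the loop and `ν` closes up, so the lift
takes equal values at both ends and the index is zero (`IsNormalField.hasMaslovNumber_zero`). Two
lifts of one map differ by a constant multiple of `π`, so the index is unambiguous.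

Uniqueness of the representation requires enough null loops. Co-orientability is a property of the
homotopy class, since a co-orienting field is a closed lift to the double cover by unit normals
(`IsCoorientable.of_homotopic`). If `n ≥ 2`, every loop at `o` is homotopic to a null loop
(`exists_nullLoop_homotopic`). Near each point there is a convex coordinate ball in which the
singular set is empty or a hyperplane containing a gate, an `A₂`-point where the kernel of `df` is
transverse to it. A path is deformed into a polygon that crosses such hyperplanes only through gates
and along the kernel. Its corners are then smoothed, which is possible whenever consecutive
velocities are not opposite; a generic intermediate point arranges this. If `n = 1`, every regular
curve is admissible but there is no room to turn: an arc is prolonged or traced back, and a regular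
curve cannot return to its starting point with reversed velocity (`not_oppositeAt`). So each class
is trivial or contains a null loop. -/

noncomputable section

namespace MorinFront

set_option linter.unusedSectionVars false

/-! ### Smooth charts and the inverse function theorem -/

section Charts

variable {a b : ℕ} {X : Type*} [TopologicalSpace X] [ChartedSpace (Euc a) X]
  [IsManifold (𝓡 a) ∞ X]
  {Y : Type*} [TopologicalSpace Y] [ChartedSpace (Euc b) Y] [IsManifold (𝓡 b) ∞ Y]

/-- The maximal smooth atlas. -/
abbrev Atlas (a : ℕ) (X : Type*) [TopologicalSpace X] [ChartedSpace (Euc a) X] :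
    Set (OpenPartialHomeomorph X (Euc a)) :=
  IsManifold.maximalAtlas (𝓡 a) ∞ X

omit [IsManifold (𝓡 a) ∞ X] in
theorem Atlas.contMDiffAt {φ : OpenPartialHomeomorph X (Euc a)} (hφ : φ ∈ Atlas a X) {p : X}
    (hp : p ∈ φ.source) : ContMDiffAt (𝓡 a) (𝓡 a) ∞ φ p :=
  contMDiffAt_of_mem_maximalAtlas hφ hp

omit [IsManifold (𝓡 a) ∞ X] in
theorem Atlas.contMDiffAt_symm {φ : OpenPartialHomeomorph X (Euc a)} (hφ : φ ∈ Atlas a X)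
    {x : Euc a} (hx : x ∈ φ.target) : ContMDiffAt (𝓡 a) (𝓡 a) ∞ φ.symm x :=
  contMDiffAt_symm_of_mem_maximalAtlas hφ hx

omit [IsManifold (𝓡 a) ∞ X] in
theorem Atlas.mdifferentiable {φ : OpenPartialHomeomorph X (Euc a)} (hφ : φ ∈ Atlas a X) :
    φ.MDifferentiable (𝓡 a) (𝓡 a) :=
  ⟨(contMDiffOn_of_mem_maximalAtlas hφ).mdifferentiableOn (by simp),
    (contMDiffOn_symm_of_mem_maximalAtlas hφ).mdifferentiableOn (by simp)⟩

/-- The derivative of a chart, as a linear map into the model space. -/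
def dchart (φ : OpenPartialHomeomorph X (Euc a)) (p : X) : TangentSpace (𝓡 a) p →L[ℝ] Euc a :=
  mfderiv (𝓡 a) (𝓡 a) φ p

/-- The derivative of the inverse of a chart. -/
def dchartSymm (φ : OpenPartialHomeomorph X (Euc a)) (x : Euc a) :
    Euc a →L[ℝ] TangentSpace (𝓡 a) (φ.symm x) :=
  mfderiv (𝓡 a) (𝓡 a) φ.symm x

omit [IsManifold (𝓡 a) ∞ X] in
theorem dchart_injective {φ : OpenPartialHomeomorph X (Euc a)} (hφ : φ ∈ Atlas a X)
    {p : X} (hp : p ∈ φ.source) : Function.Injective (dchart φ p) :=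
  (Atlas.mdifferentiable hφ).mfderiv_injective hp

omit [IsManifold (𝓡 a) ∞ X] in
theorem dchart_surjective {φ : OpenPartialHomeomorph X (Euc a)} (hφ : φ ∈ Atlas a X)
    {p : X} (hp : p ∈ φ.source) : Function.Surjective (dchart φ p) :=
  (Atlas.mdifferentiable hφ).mfderiv_surjective hp

omit [IsManifold (𝓡 a) ∞ X] [IsManifold (𝓡 b) ∞ Y] in
theorem contDiffAt_chart_comp {f : X → Y} {φ : OpenPartialHomeomorph X (Euc a)}
    {ψ : OpenPartialHomeomorph Y (Euc b)} (hφ : φ ∈ Atlas a X) (hψ : ψ ∈ Atlas b Y) {x : Euc a}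
    (hx : x ∈ φ.target) (hy : f (φ.symm x) ∈ ψ.source)
    (hf : ContMDiffAt (𝓡 a) (𝓡 b) ∞ f (φ.symm x)) :
    ContDiffAt ℝ ∞ (fun x => ψ (f (φ.symm x))) x := by
  rw [← contMDiffAt_iff_contDiffAt]
  exact (Atlas.contMDiffAt hψ hy).comp x (hf.comp x (Atlas.contMDiffAt_symm hφ hx))

omit [IsManifold (𝓡 a) ∞ X] [IsManifold (𝓡 b) ∞ Y] in
theorem fderiv_chart_comp {f : X → Y} {φ : OpenPartialHomeomorph X (Euc a)}
    {ψ : OpenPartialHomeomorph Y (Euc b)} (hφ : φ ∈ Atlas a X) (hψ : ψ ∈ Atlas b Y) {p : X}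
    (hp : p ∈ φ.source) (hy : f p ∈ ψ.source)
    (hf : ContMDiffAt (𝓡 a) (𝓡 b) ∞ f p) (u : TangentSpace (𝓡 a) p) :
    fderiv ℝ (fun x => ψ (f (φ.symm x))) (φ p) (dchart φ p u)
      = dchart ψ (f p) (mfderiv (𝓡 a) (𝓡 b) f p u) := by
  have h1 : MDifferentiableAt (𝓡 a) (𝓡 a) φ p := (Atlas.mdifferentiable hφ).mdifferentiableAt hp
  have h2 : MDifferentiableAt (𝓡 b) (𝓡 b) ψ (f p) :=
    (Atlas.mdifferentiable hψ).mdifferentiableAt hy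
  have hf' : MDifferentiableAt (𝓡 a) (𝓡 b) f p := hf.mdifferentiableAt (by simp)
  have h3 : MDifferentiableAt (𝓡 a) (𝓡 b) (fun x => ψ (f (φ.symm x))) (φ p) := by
    have := contDiffAt_chart_comp hφ hψ (x := φ p) (f := f) (φ.map_source hp)
      (by rwa [φ.left_inv hp]) (by rwa [φ.left_inv hp])
    exact (this.differentiableAt (by simp)).mdifferentiableAt
  have h4 := mfderiv_comp p h3 h1
  have h5 : ((fun x => ψ (f (φ.symm x))) ∘ φ) =ᶠ[𝓝 p] ψ ∘ f := by
    filter_upwards [φ.open_source.mem_nhds hp] with q hq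
    simp [φ.left_inv hq]
  rw [h5.mfderiv_eq, mfderiv_comp p h2 hf', mfderiv_eq_fderiv] at h4
  exact (DFunLike.congr_fun h4 u).symm

/-- Inverse function theorem, packaged as a chart of the maximal atlas. Smoothness of `H` is needed
on a neighbourhood and not only at `p`, because `χ` and its inverse must be smooth on their whole
domains. The domain is cut down to points where the derivative stays invertible, which is an open
condition. -/
theorem exists_chart_of_injective {H : X → Euc a} {p : X}
    (hHev : ∀ᶠ q in 𝓝 p, ContMDiffAt (𝓡 a) (𝓡 a) ∞ H q)
    (hinj : Function.Injective (mfderiv (𝓡 a) (𝓡 a) H p)) {U : Set X} (hU : U ∈ 𝓝 p) :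
    ∃ χ ∈ Atlas a X, p ∈ χ.source ∧ χ.source ⊆ U ∧ ∀ q ∈ χ.source, χ q = H q := by
  have hH := hHev.self_of_nhds
  set φ := chartAt (Euc a) p with hφd
  have hφ : φ ∈ Atlas a X := IsManifold.chart_mem_maximalAtlas p
  have hp : p ∈ φ.source := mem_chart_source _ p
  have hid : OpenPartialHomeomorph.refl (Euc a) ∈ Atlas a (Euc a) :=
    StructureGroupoid.id_mem_maximalAtlas _
  set h : Euc a → Euc a := fun x => H (φ.symm x) with hh
  have hcd : ContDiffAt ℝ ∞ h (φ p) := by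
    have := contDiffAt_chart_comp (f := H) hφ hid (x := φ p) (φ.map_source hp) (by simp)
      (by rwa [φ.left_inv hp])
    simpa using this
  have hfd : ∀ u, fderiv ℝ h (φ p) (dchart φ p u) = mfderiv (𝓡 a) (𝓡 a) H p u := by
    intro u
    have := fderiv_chart_comp hφ hid hp (by simp) hH u
    have h2 : dchart (OpenPartialHomeomorph.refl (Euc a)) (H p)
        (mfderiv (𝓡 a) (𝓡 a) H p u) = mfderiv (𝓡 a) (𝓡 a) H p u := by
      unfold dchart
      have : ((OpenPartialHomeomorph.refl (Euc a)) : Euc a → Euc a) = id := rfl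
      rw [this, mfderiv_id]; rfl
    rw [h2] at this
    exact this
  have hinj' : Function.Injective (fderiv ℝ h (φ p)) := by
    intro x y hxy
    obtain ⟨u, rfl⟩ := dchart_surjective hφ hp x
    obtain ⟨v, rfl⟩ := dchart_surjective hφ hp y
    rw [hfd, hfd] at hxy
    rw [hinj hxy]
  let L : Euc a ≃L[ℝ] Euc a := (LinearEquiv.ofInjectiveEndo (fderiv ℝ h (φ p)).toLinearMap
    hinj').toContinuousLinearEquiv
  have hL : (L : Euc a →L[ℝ] Euc a) = fderiv ℝ h (φ p) := by ext x; rfl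
  have hder : HasFDerivAt h (L : Euc a →L[ℝ] Euc a) (φ p) := by
    rw [hL]; exact (hcd.differentiableAt (by simp)).hasFDerivAt
  set e := hcd.toOpenPartialHomeomorph h hder (by simp) with he
  have hesrc : φ p ∈ e.source := hcd.mem_toOpenPartialHomeomorph_source hder (by simp)
  have hecoe : (e : Euc a → Euc a) = h := rfl
  -- smoothness of `h` and of the inverse near the points
  have hev1 : ∀ᶠ x in 𝓝 (φ p), ContDiffAt ℝ ∞ h x := by
    have : ∀ᶠ x in 𝓝 (φ p), φ.symm x ∈ {q | ContMDiffAt (𝓡 a) (𝓡 a) ∞ H q} := by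
      apply (φ.symm.continuousAt (by simpa using φ.map_source hp)).eventually_mem
      rw [φ.left_inv hp]
      exact hHev
    filter_upwards [this, φ.open_target.mem_nhds (φ.map_source hp)] with x hx hx2
    simpa using contDiffAt_chart_comp (f := H) hφ hid (x := x) hx2 (by simp) hx
  have hev2 : ∀ᶠ x in 𝓝 (φ p), x ∈ e.source → ContDiffAt ℝ ∞ e.symm (h x) := by
    have hc : ContinuousAt (fderiv ℝ h) (φ p) :=
      (hcd.fderiv_right (m := 0) (by simp)).continuousAt
    have h1 : ∀ᶠ x in 𝓝 (φ p), fderiv ℝ h x ∈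
        range ((↑) : (Euc a ≃L[ℝ] Euc a) → Euc a →L[ℝ] Euc a) := by
      apply hc.eventually_mem
      rw [← hL]
      exact ContinuousLinearEquiv.nhds L
    filter_upwards [h1, hev1] with x hx hx2 hxs
    obtain ⟨L', hL'⟩ := hx
    have h3 : e.symm (h x) = x := e.left_inv hxs
    refine e.contDiffAt_symm (f₀' := L') (e.map_source hxs) ?_ ?_
    · rw [h3, hL', hecoe]
      exact (hx2.differentiableAt (by simp)).hasFDerivAt
    · rw [h3, hecoe]
      exact hx2
  have hevU : ∀ᶠ x in 𝓝 (φ p), φ.symm x ∈ U := by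
    apply (φ.symm.continuousAt (by simpa using φ.map_source hp)).eventually_mem
    rwa [φ.left_inv hp]
  obtain ⟨s, hs, hso, hps⟩ := eventually_nhds_iff.1 (hev1.and (hev2.and hevU))
  let e' := e.restrOpen s hso
  have he's : e'.source = e.source ∩ s := e.restrOpen_source s hso
  let χ := φ.trans e'
  have hχs : χ.source = φ.source ∩ φ ⁻¹' (e.source ∩ s) := by
    simp only [χ, OpenPartialHomeomorph.trans_source, he's]
  have hχ : ∀ q ∈ χ.source, χ q = H q := by
    intro q hq
    rw [hχs] at hq
    change h (φ q) = H q
    simp only [hh, φ.left_inv hq.1]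
  refine ⟨χ, ?_, ?_, ?_, hχ⟩
  · apply OpenPartialHomeomorph.mem_maximalAtlas_of_contMDiffOn
    · intro q hq
      have hq' := hq
      rw [hχs] at hq'
      have h1 : ContMDiffAt (𝓡 a) (𝓡 a) ∞ (h ∘ φ) q :=
        ((contMDiffAt_iff_contDiffAt).2 (hs _ hq'.2.2).1).comp q (Atlas.contMDiffAt hφ hq'.1)
      exact h1.contMDiffWithinAt
    · intro y hy
      have hq := χ.map_target hy
      set q := χ.symm y with hqd
      have hq' := hq
      rw [hχs] at hq'
      have hy' : h (φ q) = y := by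
        have := χ.right_inv hy
        exact this
      have h2 := (hs _ hq'.2.2).2.1 hq'.2.1
      rw [hy'] at h2
      have h3 : e.symm y = φ q := by
        rw [← hy']
        exact e.left_inv hq'.2.1
      have h1 : ContMDiffAt (𝓡 a) (𝓡 a) ∞ (φ.symm ∘ e.symm) y := by
        refine ContMDiffAt.comp y ?_ ((contMDiffAt_iff_contDiffAt).2 h2)
        rw [h3]
        exact Atlas.contMDiffAt_symm hφ (φ.map_source hq'.1)
      exact h1.contMDiffWithinAt
  · rw [hχs]; exact ⟨hp, hesrc, hps⟩
  · intro q hq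
    rw [hχs] at hq
    have := (hs _ hq.2.2).2.2
    rwa [φ.left_inv hq.1] at this

/-! ### Curves in charts -/

omit [IsManifold (𝓡 a) ∞ X] in
theorem contDiffAt_chart_curve {c : ℝ → X} {t : ℝ} {n : ℕ∞ω} (hn : n ≤ ∞)
    {φ : OpenPartialHomeomorph X (Euc a)}
    (hφ : φ ∈ Atlas a X) (hp : c t ∈ φ.source) (hc : ContMDiffAt 𝓘(ℝ, ℝ) (𝓡 a) n c t) :
    ContDiffAt ℝ n (fun s => φ (c s)) t := by
  rw [← contMDiffAt_iff_contDiffAt]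
  exact ((Atlas.contMDiffAt hφ hp).of_le hn).comp t hc

omit [IsManifold (𝓡 a) ∞ X] in
theorem contMDiffAt_symm_curve {x : ℝ → Euc a} {t : ℝ} {n : ℕ∞ω} (hn : n ≤ ∞)
    {φ : OpenPartialHomeomorph X (Euc a)}
    (hφ : φ ∈ Atlas a X) (hp : x t ∈ φ.target) (hc : ContDiffAt ℝ n x t) :
    ContMDiffAt 𝓘(ℝ, ℝ) (𝓡 a) n (fun s => φ.symm (x s)) t :=
  ((Atlas.contMDiffAt_symm hφ hp).of_le hn).comp t (contMDiffAt_iff_contDiffAt.2 hc)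

omit [IsManifold (𝓡 a) ∞ X] in
theorem dchart_velocity {c : ℝ → X} {t : ℝ} {φ : OpenPartialHomeomorph X (Euc a)}
    (hφ : φ ∈ Atlas a X) (hp : c t ∈ φ.source)
    (hc : MDifferentiableAt 𝓘(ℝ, ℝ) (𝓡 a) c t) :
    dchart φ (c t) (velocity (d := a) c t) = deriv (fun s => φ (c s)) t := by
  have h1 := mfderiv_comp t ((Atlas.mdifferentiable hφ).mdifferentiableAt hp) hc
  rw [mfderiv_eq_fderiv] at h1
  exact (DFunLike.congr_fun h1 (1 : ℝ)).symm

omit [IsManifold (𝓡 a) ∞ X] [IsManifold (𝓡 b) ∞ Y] in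
theorem velocity_comp {c : ℝ → X} {t : ℝ} {f : X → Y}
    (hf : MDifferentiableAt (𝓡 a) (𝓡 b) f (c t))
    (hc : MDifferentiableAt 𝓘(ℝ, ℝ) (𝓡 a) c t) :
    velocity (d := b) (fun s => f (c s)) t
      = mfderiv (𝓡 a) (𝓡 b) f (c t) (velocity (d := a) c t) :=
  DFunLike.congr_fun (mfderiv_comp t hf hc) (1 : ℝ)

end Charts

/-! ### The metric in an arbitrary chart -/

section MetricInCharts

variable {d : ℕ} {N : Type*} [TopologicalSpace N] [ChartedSpace (Euc d) N]
  [IsManifold (𝓡 d) ∞ N]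

/-- The Riemannian metric in a chart. -/
def chartMetric (g : Metric d N) (ψ : OpenPartialHomeomorph N (Euc d)) (y : Euc d) :
    Euc d →L[ℝ] Euc d →L[ℝ] ℝ :=
  let B : Euc d →L[ℝ] Euc d →L[ℝ] ℝ := g.inner (ψ.symm y)
  let D : Euc d →L[ℝ] Euc d := dchartSymm ψ y
  B.bilinearComp D D

theorem chartMetric_apply (g : Metric d N) (ψ : OpenPartialHomeomorph N (Euc d)) (y v w : Euc d) :
    chartMetric g ψ y v w = g.inner (ψ.symm y) (dchartSymm ψ y v) (dchartSymm ψ y w) := rfl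

theorem chartMetric_symm (g : Metric d N) (ψ : OpenPartialHomeomorph N (Euc d)) (y v w : Euc d) :
    chartMetric g ψ y v w = chartMetric g ψ y w v := g.symm _ _ _

theorem chartMetric_dchart (g : Metric d N) {ψ : OpenPartialHomeomorph N (Euc d)}
    (hψ : ψ ∈ Atlas d N) {p : N} (hp : p ∈ ψ.source) (v w : TangentSpace (𝓡 d) p) :
    chartMetric g ψ (ψ p) (dchart ψ p v) (dchart ψ p w) = g.inner p v w := by
  have h := (Atlas.mdifferentiable hψ).symm_comp_deriv hp
  have hv : dchartSymm ψ (ψ p) (dchart ψ p v) = v := DFunLike.congr_fun h v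
  have hw : dchartSymm ψ (ψ p) (dchart ψ p w) = w := DFunLike.congr_fun h w
  rw [chartMetric_apply]
  -- The fibre at `ψ.symm (ψ p)` is only propositionally the fibre at `p`. Stating the claim for
  -- vectors of the model space makes substitution possible.
  have key : ∀ (q : N) (v' w' : Euc d), q = p → v' = (v : Euc d) → w' = (w : Euc d) →
      g.inner q v' w' = g.inner p v w := by
    rintro q _ _ rfl rfl rfl; rfl
  exact key _ _ _ (ψ.left_inv hp) hv hw

/-- The field is the tangent map of the inverse chart applied to a constant section. -/
theorem contMDiffAt_dchartSymm {ψ : OpenPartialHomeomorph N (Euc d)}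
    (hψ : ψ ∈ Atlas d N) {y : Euc d} (hy : y ∈ ψ.target) (v : Euc d) :
    ContMDiffAt (𝓡 d) (𝓡 d).tangent ∞
      (fun z => (⟨ψ.symm z, dchartSymm ψ z v⟩ : TangentBundle (𝓡 d) N)) y := by
  have h1 := (contMDiffOn_symm_of_mem_maximalAtlas hψ).contMDiffOn_tangentMapWithin
    (m := ∞) (by simp) ψ.open_target.uniqueMDiffOn
  have h2 : ContMDiffAt (𝓡 d).tangent (𝓡 d).tangent ∞
      (tangentMapWithin (𝓡 d) (𝓡 d) ψ.symm ψ.target) (⟨y, v⟩ : TangentBundle (𝓡 d) (Euc d)) := by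
    refine h1.contMDiffAt ?_
    exact (ψ.open_target.preimage (FiberBundle.continuous_proj (Euc d) _)).mem_nhds hy
  have h3 : ContMDiffAt (𝓡 d) (𝓡 d).tangent ∞
      (fun z => (⟨z, v⟩ : TangentBundle (𝓡 d) (Euc d))) y := by
    exact contMDiffAt_vectorSpace_iff_contDiffAt.2 contDiffAt_const
  have h4 := ContMDiffAt.comp y h2 h3
  refine h4.congr_of_eventuallyEq ?_
  filter_upwards [ψ.open_target.mem_nhds hy] with z hz
  simp only [Function.comp, tangentMapWithin]
  congr 1
  unfold dchartSymm
  rw [mfderivWithin_of_isOpen ψ.open_target hz]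
  rfl

theorem contDiffAt_chartMetric (g : Metric d N) {ψ : OpenPartialHomeomorph N (Euc d)}
    (hψ : ψ ∈ Atlas d N) {y : Euc d} (hy : y ∈ ψ.target) :
    ContDiffAt ℝ ∞ (chartMetric g ψ) y := by
  have key : ∀ {y}, y ∈ ψ.target → ∀ v w, ContDiffAt ℝ ∞ (fun z => chartMetric g ψ z v w) y := by
    intro y hy v w
    rw [← contMDiffAt_iff_contDiffAt]
    have h1 : ContMDiffAt (𝓡 d) ((𝓡 d).prod 𝓘(ℝ, Euc d →L[ℝ] Euc d →L[ℝ] ℝ)) ∞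
        (fun z => (⟨ψ.symm z, g.inner (ψ.symm z)⟩ : Bundle.TotalSpace (Euc d →L[ℝ] Euc d →L[ℝ] ℝ)
          (fun b : N => TangentSpace (𝓡 d) b →L[ℝ] TangentSpace (𝓡 d) b →L[ℝ] ℝ))) y :=
      (g.contMDiff _).comp y (Atlas.contMDiffAt_symm hψ hy)
    have h2 : ContMDiffAt (𝓡 d) ((𝓡 d).prod 𝓘(ℝ, ℝ)) ∞
        (fun z => (⟨ψ.symm z, g.inner (ψ.symm z) (dchartSymm ψ z v) (dchartSymm ψ z w)⟩ :
          Bundle.TotalSpace ℝ (Bundle.Trivial N ℝ))) y :=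
      ContMDiffAt.clm_bundle_apply₂ (F₁ := Euc d) (F₂ := Euc d) h1
        (contMDiffAt_dchartSymm hψ hy v) (contMDiffAt_dchartSymm hψ hy w)
    rw [Bundle.contMDiffAt_totalSpace] at h2
    exact h2.2
  have key2 : ContDiffOn ℝ ∞ (chartMetric g ψ) ψ.target :=
    contDiffOn_clm_apply.2 fun v => contDiffOn_clm_apply.2 fun w z hz =>
      (key hz v w).contDiffWithinAt
  exact key2.contDiffAt (ψ.open_target.mem_nhds hy)

end MetricInCharts

/-! ### Covariant derivative along a curve, tested against the velocity -/

section CovariantDerivative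

/-- `G(V', c') + ½ (∂_V G)(c', c')`: for a metric `G` this is `g(∇_{c'} V, c')`. -/
def covForm {E : Type*} [NormedAddCommGroup E] [NormedSpace ℝ E] (G : E → E →L[ℝ] E →L[ℝ] ℝ)
    (c V : ℝ → E) (t : ℝ) : ℝ :=
  G (c t) (deriv V t) (deriv c t) + 1 / 2 * fderiv ℝ G (c t) (V t) (deriv c t) (deriv c t)

/-- Differentiating `V₂ = Dβ V₁` produces the extra term `D²β(c', V)`. Differentiating the pulled
back metric in the direction `V` produces `D²β(V, c')` twice, with the factor `1/2` in front.
Symmetry of `D²β` and of `G₂` makes the two contributions equal. -/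
theorem covForm_change {E : Type*} [NormedAddCommGroup E] [NormedSpace ℝ E]
    {G₁ G₂ : E → E →L[ℝ] E →L[ℝ] ℝ} {β : E → E} {c₁ V₁ c₂ V₂ : ℝ → E} {t : ℝ}
    (hβ : ContDiffAt ℝ 2 β (c₁ t)) (hG₂ : DifferentiableAt ℝ G₂ (β (c₁ t)))
    (hG₁ : DifferentiableAt ℝ G₁ (c₁ t))
    (hsymm : ∀ v w, G₂ (β (c₁ t)) v w = G₂ (β (c₁ t)) w v)
    (hG : ∀ᶠ y in 𝓝 (c₁ t), ∀ v w, G₁ y v w = G₂ (β y) (fderiv ℝ β y v) (fderiv ℝ β y w))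
    (hc : ∀ᶠ s in 𝓝 t, c₂ s = β (c₁ s))
    (hV : ∀ᶠ s in 𝓝 t, V₂ s = fderiv ℝ β (c₁ s) (V₁ s))
    (hc₁ : DifferentiableAt ℝ c₁ t) (hV₁ : DifferentiableAt ℝ V₁ t) :
    covForm G₂ c₂ V₂ t = covForm G₁ c₁ V₁ t := by
  set y := c₁ t
  have hβ1 : HasFDerivAt β (fderiv ℝ β y) y := (hβ.differentiableAt (by simp)).hasFDerivAt
  have hβ2 : HasFDerivAt (fderiv ℝ β) (fderiv ℝ (fderiv ℝ β) y) y :=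
    ((hβ.fderiv_right (m := 1) (by norm_num)).differentiableAt (by simp)).hasFDerivAt
  have hsnd : IsSymmSndFDerivAt ℝ β y := hβ.isSymmSndFDerivAt (by simp)
  have hc₂ : HasDerivAt c₂ (fderiv ℝ β y (deriv c₁ t)) t :=
    (hβ1.comp_hasDerivAt t hc₁.hasDerivAt).congr_of_eventuallyEq hc
  have hV₂ : HasDerivAt V₂ (fderiv ℝ (fderiv ℝ β) y (deriv c₁ t) (V₁ t)
      + fderiv ℝ β y (deriv V₁ t)) t :=
    ((hβ2.comp_hasDerivAt t hc₁.hasDerivAt).clm_apply hV₁.hasDerivAt).congr_of_eventuallyEq hV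
  have hG1 : ∀ e a b, fderiv ℝ G₁ y e a b
      = fderiv ℝ G₂ (β y) (fderiv ℝ β y e) (fderiv ℝ β y a) (fderiv ℝ β y b)
        + G₂ (β y) (fderiv ℝ (fderiv ℝ β) y e a) (fderiv ℝ β y b)
        + G₂ (β y) (fderiv ℝ β y a) (fderiv ℝ (fderiv ℝ β) y e b) := by
    intro e a b
    have h1 : HasFDerivAt (fun z => G₁ z a b)
        (((fderiv ℝ G₁ y).flip a).flip b) y := by
      have := (hG₁.hasFDerivAt.clm_apply (hasFDerivAt_const a y)).clm_apply (hasFDerivAt_const b y)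
      refine this.congr_fderiv ?_
      ext x; simp
    have hcomp : HasFDerivAt (fun z => G₂ (β z)) ((fderiv ℝ G₂ (β y)).comp (fderiv ℝ β y)) y :=
      HasFDerivAt.comp (g := G₂) (g' := fderiv ℝ G₂ (β y)) y hG₂.hasFDerivAt hβ1
    have h2 := ((hcomp.clm_apply
      (hβ2.clm_apply (hasFDerivAt_const a y))).clm_apply
      (hβ2.clm_apply (hasFDerivAt_const b y)))
    have h3 := h1.unique (h2.congr_of_eventuallyEq (hG.mono fun z hz => hz a b))
    have h4 := DFunLike.congr_fun h3 e
    simp at h4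
    rw [h4]; ring
  unfold covForm
  rw [hc₂.deriv, hV₂.deriv, hc.self_of_nhds, hV.self_of_nhds, hG1, hG.self_of_nhds]
  have h5 := hsnd (deriv c₁ t) (V₁ t)
  have h6 := hsymm (fderiv ℝ β y (deriv c₁ t)) (fderiv ℝ (fderiv ℝ β) y (deriv c₁ t) (V₁ t))
  simp only [map_add, add_apply]
  rw [← h5, h6]; ring

variable {d : ℕ} {N : Type*} [TopologicalSpace N] [ChartedSpace (Euc d) N]
  [IsManifold (𝓡 d) ∞ N]

theorem tangentCoord_eq {x₀ x : N} (hx : x ∈ (chartAt (Euc d) x₀).source)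
    (v : TangentSpace (𝓡 d) x) :
    tangentCoord x₀ x v = dchart (chartAt (Euc d) x₀) x v := by
  have h := TangentBundle.continuousLinearMapAt_trivializationAt (I := 𝓡 d) hx
  have h2 := DFunLike.congr_fun h v
  rw [Bundle.Trivialization.continuousLinearMapAt_apply,
    Bundle.Trivialization.linearMapAt_apply, if_pos (by simpa using hx)] at h2
  exact h2

theorem trivialization_symm_eq {x₀ : N} {y : Euc d} (hy : y ∈ (chartAt (Euc d) x₀).target)
    (v : Euc d) :
    (trivializationAt (Euc d) (fun x : N => TangentSpace (𝓡 d) x) x₀).symm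
      ((chartAt (Euc d) x₀).symm y) v = dchartSymm (chartAt (Euc d) x₀) y v := by
  have hx := (chartAt (Euc d) x₀).map_target hy
  have h := TangentBundle.symmL_trivializationAt (I := 𝓡 d) hx
  have h2 := DFunLike.congr_fun h v
  rw [Bundle.Trivialization.symmL_apply] at h2
  have key : ∀ (h : Euc d → N) (z : Euc d), h = (chartAt (Euc d) x₀).symm → z = y →
      (mfderivWithin (𝓡 d) (𝓡 d) h (range (𝓡 d)) z v : Euc d)
        = (mfderiv (𝓡 d) (𝓡 d) (chartAt (Euc d) x₀).symm y v : Euc d) := by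
    rintro _ _ rfl rfl
    simp only [modelWithCornersSelf_coe, range_id, mfderivWithin_univ]
  · exact h2.trans (key _ _ rfl ((chartAt (Euc d) x₀).right_inv hy))
  · simpa using hx

theorem metricCoord_eq (g : Metric d N) {x₀ : N} {y : Euc d}
    (hy : y ∈ (chartAt (Euc d) x₀).target) (v w : Euc d) :
    metricCoord g x₀ y v w = chartMetric g (chartAt (Euc d) x₀) y v w := by
  rw [chartMetric_apply, ← trivialization_symm_eq hy, ← trivialization_symm_eq hy]
  rfl

/-- Because the tested vector is the velocity itself, two of the three terms in the Christoffel
symbol cancel by symmetry of the metric, and only `½ (∂_V G)(c', c')` remains. -/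
theorem covDerivInner_eq_chartAt (g : Metric d N) {c : ℝ → N}
    (V : ∀ s, TangentSpace (𝓡 d) (c s)) {t : ℝ}
    (hc : MDifferentiableAt 𝓘(ℝ, ℝ) (𝓡 d) c t) :
    covDerivInner g c V t (velocity c t)
      = covForm (chartMetric g (chartAt (Euc d) (c t))) (fun s => chartAt (Euc d) (c t) (c s))
        (fun s => dchart (chartAt (Euc d) (c t)) (c s) (V s)) t := by
  set ψ := chartAt (Euc d) (c t) with hψd
  have hψ : ψ ∈ Atlas d N := IsManifold.chart_mem_maximalAtlas _
  have hp : c t ∈ ψ.source := mem_chart_source _ _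
  have hy : ψ (c t) ∈ ψ.target := ψ.map_source hp
  have he : ∀ q, extChartAt (𝓡 d) (c t) q = ψ q := fun q => by simp [extChartAt, hψd]
  have hev : ∀ᶠ s in 𝓝 t, c s ∈ ψ.source :=
    hc.continuousAt.eventually_mem (ψ.open_source.mem_nhds hp)
  have h1 : deriv (fun s => tangentCoord (c t) (c s) (V s)) t
      = deriv (fun s => dchart ψ (c s) (V s)) t :=
    Filter.EventuallyEq.deriv_eq (hev.mono fun s hs => tangentCoord_eq hs _)
  have h2 : tangentCoord (c t) (c t) (velocity c t) = deriv (fun s => ψ (c s)) t := by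
    rw [tangentCoord_eq hp, dchart_velocity hψ hp hc]
  have h3 : tangentCoord (c t) (c t) (V t) = dchart ψ (c t) (V t) := tangentCoord_eq hp _
  have hG := (contDiffAt_chartMetric g hψ hy).differentiableAt (by simp)
  have h4 : ∀ e a b, fderiv ℝ (fun z => metricCoord g (c t) z a b) (ψ (c t)) e
      = fderiv ℝ (chartMetric g ψ) (ψ (c t)) e a b := by
    intro e a b
    have h5 : (fun z => metricCoord g (c t) z a b) =ᶠ[𝓝 (ψ (c t))]
        fun z => chartMetric g ψ z a b := by
      filter_upwards [ψ.open_target.mem_nhds hy] with z hz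
      exact metricCoord_eq g hz a b
    have h6 := ((hG.hasFDerivAt.clm_apply (hasFDerivAt_const a _)).clm_apply
      (hasFDerivAt_const b _))
    rw [h5.fderiv_eq, h6.fderiv]
    simp
  unfold covDerivInner christoffelFirst covForm
  simp only [he, h1, h2, h3, h4, metricCoord_eq g hy]
  have h7 : ∀ e a b, fderiv ℝ (chartMetric g ψ) (ψ (c t)) e a b
      = fderiv ℝ (chartMetric g ψ) (ψ (c t)) e b a := by
    intro e a b
    rw [← h4, ← h4]
    congr 2
    ext z
    exact g.symm _ _ _
  rw [h7 _ (dchart ψ (c t) (V t))]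
  simp only [hψd] 
  ring

/-- Frees the computation from the preferred chart at `c t`. At a cusp it can then be done in the
target chart of the Morin normal form. -/
theorem covDerivInner_velocity (g : Metric d N) {c : ℝ → N}
    (V : ∀ s, TangentSpace (𝓡 d) (c s)) {t : ℝ}
    (hc : MDifferentiableAt 𝓘(ℝ, ℝ) (𝓡 d) c t)
    {ψ : OpenPartialHomeomorph N (Euc d)} (hψ : ψ ∈ Atlas d N) (hp : c t ∈ ψ.source)
    (hV : DifferentiableAt ℝ (fun s => dchart ψ (c s) (V s)) t) :
    covDerivInner g c V t (velocity c t)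
      = covForm (chartMetric g ψ) (fun s => ψ (c s)) (fun s => dchart ψ (c s) (V s)) t := by
  rw [covDerivInner_eq_chartAt g V hc]
  set ψ₂ := chartAt (Euc d) (c t) with hψd
  have hψ₂ : ψ₂ ∈ Atlas d N := IsManifold.chart_mem_maximalAtlas _
  have hp₂ : c t ∈ ψ₂.source := mem_chart_source _ _
  have hy : ψ (c t) ∈ ψ.target := ψ.map_source hp
  set β : Euc d → Euc d := fun y => ψ₂ (id (ψ.symm y)) with hβ
  have hβc : β (ψ (c t)) = ψ₂ (c t) := by simp [hβ, ψ.left_inv hp]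
  have hβ' : ∀ q ∈ ψ.source ∩ ψ₂.source, ∀ v : TangentSpace (𝓡 d) q,
      fderiv ℝ β (ψ q) (dchart ψ q v) = dchart ψ₂ q v := by
    intro q hq v
    have := fderiv_chart_comp hψ hψ₂ hq.1 (f := id) hq.2 contMDiffAt_id v
    rw [mfderiv_id] at this
    exact this
  have hev : ∀ᶠ s in 𝓝 t, c s ∈ ψ.source ∩ ψ₂.source :=
    hc.continuousAt.eventually_mem ((ψ.open_source.inter ψ₂.open_source).mem_nhds ⟨hp, hp₂⟩)
  refine covForm_change (β := β) ?_ ?_ ?_ ?_ ?_ ?_ ?_ ?_ ?_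
  · refine (contDiffAt_chart_comp (f := id) hψ hψ₂ hy ?_ contMDiffAt_id).of_le (by norm_cast)
    simpa [ψ.left_inv hp] using hp₂
  · rw [hβc]
    exact (contDiffAt_chartMetric g hψ₂ (ψ₂.map_source hp₂)).differentiableAt (by simp)
  · exact (contDiffAt_chartMetric g hψ hy).differentiableAt (by simp)
  · intro v w; exact chartMetric_symm _ _ _ _ _
  · have h1 : ∀ᶠ y in 𝓝 (ψ (c t)), ψ.symm y ∈ ψ.source ∩ ψ₂.source := by
      apply (ψ.symm.continuousAt (by simpa using hy)).eventually_mem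
      rw [ψ.left_inv hp]
      exact (ψ.open_source.inter ψ₂.open_source).mem_nhds ⟨hp, hp₂⟩
    filter_upwards [h1, ψ.open_target.mem_nhds hy] with y hy1 hy2 v w
    set q := ψ.symm y with hq
    have hqy : ψ q = y := ψ.right_inv hy2
    obtain ⟨v, rfl⟩ := dchart_surjective hψ hy1.1 v
    obtain ⟨w, rfl⟩ := dchart_surjective hψ hy1.1 w
    have h2 : β y = ψ₂ q := rfl
    rw [h2, ← hqy, hβ' q hy1, hβ' q hy1, chartMetric_dchart g hψ hy1.1,
      chartMetric_dchart g hψ₂ hy1.2]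
  · filter_upwards [hev] with s hs
    simp [hβ, ψ.left_inv hs.1]
  · filter_upwards [hev] with s hs
    rw [hβ' _ hs]
  · have h := ((Atlas.mdifferentiable hψ).mdifferentiableAt hp).comp t hc
    exact mdifferentiableAt_iff_differentiableAt.1 h
  · exact hV

end CovariantDerivative

/-! ### Continuity and smoothness in the tangent bundle -/

section TangentBundleCharts

variable {d : ℕ} {N : Type*} [TopologicalSpace N] [ChartedSpace (Euc d) N]
  [IsManifold (𝓡 d) ∞ N]

theorem contMDiffAt_dchart {ψ : OpenPartialHomeomorph N (Euc d)} (hψ : ψ ∈ Atlas d N)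
    {x : TangentBundle (𝓡 d) N} (hx : x.1 ∈ ψ.source) :
    ContMDiffAt (𝓡 d).tangent (𝓡 d) ∞
      (fun z : TangentBundle (𝓡 d) N => dchart ψ z.1 z.2) x := by
  have h1 := (contMDiffOn_of_mem_maximalAtlas hψ).contMDiffOn_tangentMapWithin
    (m := ∞) (by simp) ψ.open_source.uniqueMDiffOn
  have hnh : (Bundle.TotalSpace.proj ⁻¹' ψ.source : Set (TangentBundle (𝓡 d) N)) ∈ 𝓝 x :=
    (ψ.open_source.preimage (FiberBundle.continuous_proj (Euc d) _)).mem_nhds hx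
  have h2 := h1.contMDiffAt hnh
  have h3 := (contMDiff_snd_tangentBundle_modelSpace (n := ∞) (Euc d) (𝓡 d)).contMDiffAt.comp x h2
  refine h3.congr_of_eventuallyEq ?_
  filter_upwards [hnh] with z hz
  simp only [Function.comp, tangentMapWithin]
  rw [mfderivWithin_of_isOpen ψ.open_source hz]
  rfl

theorem continuousAt_dchart {Z : Type*} [TopologicalSpace Z] {y : Z → N}
    {a : ∀ z, TangentSpace (𝓡 d) (y z)} {z : Z}
    (ha : ContinuousAt (fun z => (⟨y z, a z⟩ : TangentBundle (𝓡 d) N)) z)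
    {ψ : OpenPartialHomeomorph N (Euc d)} (hψ : ψ ∈ Atlas d N) (hz : y z ∈ ψ.source) :
    ContinuousAt (fun z => dchart ψ (y z) (a z)) z :=
  ContinuousAt.comp (g := fun x : TangentBundle (𝓡 d) N => dchart ψ x.1 x.2)
    (contMDiffAt_dchart hψ hz).continuousAt ha

theorem continuousAt_base {Z : Type*} [TopologicalSpace Z] {y : Z → N}
    {a : ∀ z, TangentSpace (𝓡 d) (y z)} {z : Z}
    (ha : ContinuousAt (fun z => (⟨y z, a z⟩ : TangentBundle (𝓡 d) N)) z) : ContinuousAt y z :=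
  (FiberBundle.continuous_proj (Euc d) (fun x : N => TangentSpace (𝓡 d) x)).continuousAt.comp ha

theorem continuousAt_inner (g : Metric d N) {Z : Type*} [TopologicalSpace Z] {y : Z → N}
    {a b : ∀ z, TangentSpace (𝓡 d) (y z)} {z : Z}
    (ha : ContinuousAt (fun z => (⟨y z, a z⟩ : TangentBundle (𝓡 d) N)) z)
    (hb : ContinuousAt (fun z => (⟨y z, b z⟩ : TangentBundle (𝓡 d) N)) z) :
    ContinuousAt (fun z => g.inner (y z) (a z) (b z)) z := by
  have hψ : chartAt (Euc d) (y z) ∈ Atlas d N := IsManifold.chart_mem_maximalAtlas _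
  set ψ := chartAt (Euc d) (y z)
  have hz : y z ∈ ψ.source := mem_chart_source _ _
  have hy := continuousAt_base ha
  have h1 := continuousAt_dchart ha hψ hz
  have h2 := continuousAt_dchart hb hψ hz
  have h3 : ContinuousAt (fun z => chartMetric g ψ (ψ (y z))) z :=
    ContinuousAt.comp (g := chartMetric g ψ)
      (contDiffAt_chartMetric g hψ (ψ.map_source hz)).continuousAt
      (ContinuousAt.comp (g := ψ) (ψ.continuousAt hz) hy)
  refine ((h3.clm_apply h1).clm_apply h2).congr ?_
  filter_upwards [hy.eventually_mem (ψ.open_source.mem_nhds hz)] with z' hz'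
  exact chartMetric_dchart g hψ hz' _ _

theorem contMDiff_neg_tangentBundle :
    ContMDiff (𝓡 d).tangent (𝓡 d).tangent ∞
      (fun x : TangentBundle (𝓡 d) N => (⟨x.1, -x.2⟩ : TangentBundle (𝓡 d) N)) := by
  intro x
  rw [Bundle.contMDiffAt_totalSpace]
  have hid : ContMDiffAt (𝓡 d).tangent (𝓡 d).tangent ∞
    (fun x : TangentBundle (𝓡 d) N => x) x := contMDiffAt_id
  rw [Bundle.contMDiffAt_totalSpace] at hid
  refine ⟨hid.1, ?_⟩
  refine hid.2.neg.congr_of_eventuallyEq ?_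
  set e := trivializationAt (Euc d) (fun x : N => TangentSpace (𝓡 d) x) x.1
  have hnh : (Bundle.TotalSpace.proj ⁻¹' e.baseSet : Set (TangentBundle (𝓡 d) N)) ∈ 𝓝 x :=
    by
    refine (e.open_baseSet.preimage (FiberBundle.continuous_proj (Euc d) _)).mem_nhds ?_
    exact FiberBundle.mem_baseSet_trivializationAt (Euc d)
      (fun x : N => TangentSpace (𝓡 d) x) x.1
  filter_upwards [hnh] with z hz
  have h := (e.linear ℝ hz).map_neg z.2
  exact h

end TangentBundleCharts

/-! ### Unit normal vectors of a front and their two-valuedness -/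

section UnitNormals

variable {m : ℕ}
  {M : Type u} [TopologicalSpace M] [ChartedSpace (Euc (m + 1)) M]
  {N : Type v} [TopologicalSpace N] [ChartedSpace (Euc (m + 2)) N] [IsManifold (𝓡 (m + 2)) ∞ N]
  {g : Metric (m + 2) N} {f : M → N}

theorem IsLocalUnitNormal.neg {U : Set M} {ν : ∀ p : M, TangentSpace (𝓡 (m + 2)) (f p)}
    (h : IsLocalUnitNormal g f U ν) : IsLocalUnitNormal g f U (fun p => -ν p) where
  isOpen := h.isOpen
  smooth := contMDiff_neg_tangentBundle.comp_contMDiffOn h.smooth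
  unit p hp := by simpa using h.unit p hp
  normal p hp u := by simpa using h.normal p hp u
  immersion p hp := by
    have h1 : MDifferentiableAt (𝓡 (m + 1)) (𝓡 (m + 2)).tangent
        (fun q => (⟨f q, ν q⟩ : TangentBundle (𝓡 (m + 2)) N)) p :=
      (h.smooth.contMDiffAt (h.isOpen.mem_nhds hp)).mdifferentiableAt (by simp)
    have h2 : MDifferentiableAt (𝓡 (m + 1)) (𝓡 (m + 2)).tangent
        (fun q => (⟨f q, -ν q⟩ : TangentBundle (𝓡 (m + 2)) N)) p :=
      ((contMDiff_neg_tangentBundle.comp_contMDiffOn h.smooth).contMDiffAt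
        (h.isOpen.mem_nhds hp)).mdifferentiableAt (by simp)
    have h3 : MDifferentiableAt (𝓡 (m + 2)).tangent (𝓡 (m + 2)).tangent
        (fun x : TangentBundle (𝓡 (m + 2)) N => (⟨x.1, -x.2⟩ : TangentBundle (𝓡 (m + 2)) N))
        ⟨f p, -ν p⟩ :=
      (contMDiff_neg_tangentBundle _).mdifferentiableAt (by simp)
    -- Negation in the fibres is an involution, so the derivative of `(f, ν)` factors through that
    -- of `(f, -ν)`; injectivity of the former forces injectivity of the latter.
    have h4 := mfderiv_comp p h3 h2
    have h5 : ((fun x : TangentBundle (𝓡 (m + 2)) N => (⟨x.1, -x.2⟩ : TangentBundle (𝓡 (m + 2)) N))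
        ∘ fun q => (⟨f q, -ν q⟩ : TangentBundle (𝓡 (m + 2)) N))
        = fun q => (⟨f q, ν q⟩ : TangentBundle (𝓡 (m + 2)) N) := by
      funext q; simp
    rw [h5] at h4
    intro x y hxy
    apply h.immersion p hp
    have := DFunLike.congr_fun h4 x
    have h7 := DFunLike.congr_fun h4 y
    refine this.trans (Eq.trans ?_ h7.symm)
    exact congrArg (mfderiv (𝓡 (m + 2)).tangent (𝓡 (m + 2)).tangent
        (fun x : TangentBundle (𝓡 (m + 2)) N => (⟨x.1, -x.2⟩ : TangentBundle (𝓡 (m + 2)) N))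
        ⟨f p, -ν p⟩) hxy

theorem IsUnitNormalAt.neg {p : M} {v : TangentSpace (𝓡 (m + 2)) (f p)}
    (h : IsUnitNormalAt g f p v) : IsUnitNormalAt g f p (-v) := by
  obtain ⟨U, ν, hp, hν, rfl⟩ := h
  exact ⟨U, _, hp, hν.neg, rfl⟩

theorem IsUnitNormalAt.inner_self {p : M} {v : TangentSpace (𝓡 (m + 2)) (f p)}
    (h : IsUnitNormalAt g f p v) : g.inner (f p) v v = 1 := by
  obtain ⟨U, ν, hp, hν, rfl⟩ := h
  exact hν.unit p hp

theorem IsUnitNormalAt.inner_mfderiv {p : M} {v : TangentSpace (𝓡 (m + 2)) (f p)}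
    (h : IsUnitNormalAt g f p v) (u : TangentSpace (𝓡 (m + 1)) p) :
    g.inner (f p) (mfderiv (𝓡 (m + 1)) (𝓡 (m + 2)) f p u) v = 0 := by
  obtain ⟨U, ν, hp, hν, rfl⟩ := h
  exact hν.normal p hp u

/-- The equality case of Cauchy–Schwarz: `w - g(v, w) v` has squared length `1 - g(v, w)²`. -/
theorem eq_smul_of_inner_sq (y : N) {v w : TangentSpace (𝓡 (m + 2)) y}
    (hv : g.inner y v v = 1) (hw : g.inner y w w = 1) (h : g.inner y v w ^ 2 = 1) :
    w = g.inner y v w • v := by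
  by_contra hne
  have h1 : w - g.inner y v w • v ≠ 0 := sub_ne_zero.2 hne
  have h2 := g.pos y _ h1
  have h3 : g.inner y w v = g.inner y v w := g.symm _ _ _
  simp only [map_sub, map_smul, sub_apply, smul_apply, smul_eq_mul] at h2
  rw [hv, hw, h3] at h2
  nlinarith

/-- At a regular point the image of `df` and `v` together span the tangent space, by dimension. The
vector `w - g(v, w) v` is orthogonal to both, hence zero. -/
theorem inner_sq_of_regular {p : M} (hp : p ∉ singularSet (m + 1) (m + 2) f)
    {v w : TangentSpace (𝓡 (m + 2)) (f p)}
    (hv : g.inner (f p) v v = 1) (hw : g.inner (f p) w w = 1)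
    (hvn : ∀ u, g.inner (f p) (mfderiv (𝓡 (m + 1)) (𝓡 (m + 2)) f p u) v = 0)
    (hwn : ∀ u, g.inner (f p) (mfderiv (𝓡 (m + 1)) (𝓡 (m + 2)) f p u) w = 0) :
    g.inner (f p) v w ^ 2 = 1 := by
  have hinj : Function.Injective (mfderiv (𝓡 (m + 1)) (𝓡 (m + 2)) f p) := not_not.1 hp
  let D : Euc (m + 1) →ₗ[ℝ] Euc (m + 2) :=
    (mfderiv (𝓡 (m + 1)) (𝓡 (m + 2)) f p).toLinearMap
  let B : Euc (m + 2) →L[ℝ] Euc (m + 2) →L[ℝ] ℝ := g.inner (f p)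
  let v' : Euc (m + 2) := v
  let w' : Euc (m + 2) := w
  change B v' v' = 1 at hv
  change B w' w' = 1 at hw
  change ∀ u, B (D u) v' = 0 at hvn
  change ∀ u, B (D u) w' = 0 at hwn
  change B v' w' ^ 2 = 1
  have hDinj : Function.Injective D := hinj
  have hsymm : ∀ a b, B a b = B b a := fun a b => g.symm _ _ _
  have hpos : ∀ a, a ≠ 0 → 0 < B a a := fun a ha => g.pos _ _ ha
  let T : Euc (m + 1) × ℝ →ₗ[ℝ] Euc (m + 2) :=
    D.coprod (LinearMap.toSpanSingleton ℝ _ v')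
  have hT : ∀ u s, T (u, s) = D u + s • v' := fun u s => by simp [T]
  have hTinj : Function.Injective T := by
    rw [injective_iff_map_eq_zero]
    rintro ⟨u, s⟩ h
    rw [hT] at h
    have h1 : B (D u + s • v') v' = 0 := by rw [h]; simp
    simp only [map_add, map_smul, add_apply, smul_apply, hvn, hv, smul_eq_mul] at h1
    have hs : s = 0 := by linarith
    subst hs
    have hu : D u = 0 := by simpa using h
    have : u = 0 := hDinj (by rw [hu, map_zero])
    simp [this]
  have hTsurj : Function.Surjective T := by
    have hfr : Module.finrank ℝ (Euc (m + 1) × ℝ) = Module.finrank ℝ (Euc (m + 2)) := by simp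
    exact (LinearMap.injective_iff_surjective_of_finrank_eq_finrank hfr).1 hTinj
  have hzero : w' - B v' w' • v' = 0 := by
    by_contra hne
    obtain ⟨⟨u, s⟩, hus⟩ := hTsurj (w' - B v' w' • v')
    have h1 := hpos _ hne
    have h2 : B (D u + s • v') (w' - B v' w' • v') = 0 := by
      simp only [map_add, map_sub, map_smul, add_apply, smul_apply, hvn, hwn, hv, smul_eq_mul]
      ring
    rw [← hT, hus] at h2
    linarith
  have h3 : w' = B v' w' • v' := sub_eq_zero.1 hzero
  have h4 : B w' w' = B v' w' ^ 2 := by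
    conv_lhs => rw [h3]
    simp only [map_smul, smul_apply, hv, smul_eq_mul]
    ring
  rw [← h4, hw]

theorem IsUnitNormalAt.inner_sq_of_regular {p : M} (hp : p ∉ singularSet (m + 1) (m + 2) f)
    {v w : TangentSpace (𝓡 (m + 2)) (f p)} (hv : IsUnitNormalAt g f p v)
    (hw : IsUnitNormalAt g f p w) : g.inner (f p) v w ^ 2 = 1 :=
  MorinFront.inner_sq_of_regular hp hv.inner_self hw.inner_self hv.inner_mfderiv hw.inner_mfderiv

theorem IsLocalUnitNormal.continuousAt {U : Set M}
    {ν : ∀ p : M, TangentSpace (𝓡 (m + 2)) (f p)} (h : IsLocalUnitNormal g f U ν) {p : M}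
    (hp : p ∈ U) : ContinuousAt (fun q => (⟨f q, ν q⟩ : TangentBundle (𝓡 (m + 2)) N)) p :=
  (h.smooth.contMDiffAt (h.isOpen.mem_nhds hp)).continuousAt

/-- At a singular point the image of `df` is too small to determine the normal line. The relation is
inherited from nearby regular points, since unit normals extend to continuous local fields. -/
theorem IsUnitNormalAt.inner_sq_of_closure {p : M}
    (hp : p ∈ closure (singularSet (m + 1) (m + 2) f)ᶜ)
    {v w : TangentSpace (𝓡 (m + 2)) (f p)} (hv : IsUnitNormalAt g f p v)
    (hw : IsUnitNormalAt g f p w) : g.inner (f p) v w ^ 2 = 1 := by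
  obtain ⟨U, ν, hpU, hν, rfl⟩ := hv
  obtain ⟨U', ν', hpU', hν', rfl⟩ := hw
  have hc := (continuousAt_inner g (hν.continuousAt hpU) (hν'.continuousAt hpU')).pow 2
  have : (𝓝[(singularSet (m + 1) (m + 2) f)ᶜ] p).NeBot := mem_closure_iff_nhdsWithin_neBot.1 hp
  refine tendsto_nhds_unique_of_eventuallyEq
    (hc.tendsto.mono_left (nhdsWithin_le_nhds (s := (singularSet (m + 1) (m + 2) f)ᶜ)))
    (tendsto_const_nhds (x := (1 : ℝ))) ?_
  filter_upwards [self_mem_nhdsWithin, mem_nhdsWithin_of_mem_nhds (hν.isOpen.mem_nhds hpU),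
    mem_nhdsWithin_of_mem_nhds (hν'.isOpen.mem_nhds hpU')] with q hq hqU hqU'
  exact IsUnitNormalAt.inner_sq_of_regular hq ⟨U, ν, hqU, hν, rfl⟩ ⟨U', ν', hqU', hν', rfl⟩

theorem IsUnitNormalAt.eq_or_eq_neg {p : M}
    (hp : p ∈ closure (singularSet (m + 1) (m + 2) f)ᶜ)
    {v w : TangentSpace (𝓡 (m + 2)) (f p)} (hv : IsUnitNormalAt g f p v)
    (hw : IsUnitNormalAt g f p w) : w = v ∨ w = -v := by
  have h := hv.inner_sq_of_closure hp hw
  have h2 := eq_smul_of_inner_sq (f p) hv.inner_self hw.inner_self h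
  have h' : g.inner (f p) v w * g.inner (f p) v w = 1 := by rw [← sq]; exact h
  rcases mul_self_eq_one_iff.1 h' with h | h
  · left; rw [h2, h, one_smul]
  · right; rw [h2, h, neg_one_smul]

/-- A continuous unit normal field along a curve is locally induced by a smooth local unit normal
field, as soon as it meets the singular set in isolated points. -/
theorem exists_eventually_eq_localUnitNormal {γ : ℝ → M} {t : ℝ} (hγ : ContinuousAt γ t)
    {ν : ∀ t, TangentSpace (𝓡 (m + 2)) (f (γ t))}
    (hν : ContinuousAt (fun t => (⟨f (γ t), ν t⟩ : TangentBundle (𝓡 (m + 2)) N)) t)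
    (hun : ∀ᶠ s in 𝓝 t, IsUnitNormalAt g f (γ s) (ν s))
    (hreg : ∀ᶠ s in 𝓝[≠] t, γ s ∉ singularSet (m + 1) (m + 2) f) :
    ∃ U ν', γ t ∈ U ∧ IsLocalUnitNormal g f U ν' ∧
      ∀ᶠ s in 𝓝 t, γ s ∈ U ∧ ν s = ν' (γ s) := by
  obtain ⟨U, ν', htU, hν', heq⟩ := hun.self_of_nhds
  refine ⟨U, ν', htU, hν', ?_⟩
  have hevU : ∀ᶠ s in 𝓝 t, γ s ∈ U := hγ.eventually_mem (hν'.isOpen.mem_nhds htU)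
  have hc := continuousAt_inner g hν
    (ContinuousAt.comp (f := γ) (g := fun q => (⟨f q, ν' q⟩ : TangentBundle (𝓡 (m + 2)) N))
      (hν'.continuousAt htU) hγ)
  -- The inner product equals `1` at `t` and has square `1` at regular times, so positivity nearby
  -- excludes `-1`.
  have h1 : ∀ᶠ s in 𝓝 t, 0 < g.inner (f (γ s)) (ν s) (ν' (γ s)) := by
    refine hc.eventually (lt_mem_nhds ?_)
    change 0 < g.inner (f (γ t)) (ν t) (ν' (γ t))
    rw [heq, hun.self_of_nhds.inner_self]
    exact one_pos
  have hreg' : ∀ᶠ s in 𝓝 t, s ≠ t → γ s ∉ singularSet (m + 1) (m + 2) f :=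
    eventually_nhdsWithin_iff.1 hreg
  filter_upwards [hevU, hun, h1, hreg'] with s hsU hs1 hs2 hs3
  refine ⟨hsU, ?_⟩
  by_cases hst : s = t
  · subst hst; exact heq.symm
  · have hw : IsUnitNormalAt g f (γ s) (ν' (γ s)) := ⟨U, ν', hsU, hν', rfl⟩
    have h4 := hs1.inner_sq_of_regular (hs3 hst) hw
    have h5 := eq_smul_of_inner_sq _ hs1.inner_self hw.inner_self h4
    have h6 : g.inner (f (γ s)) (ν s) (ν' (γ s)) = 1 := by nlinarith
    rw [h6, one_smul] at h5
    exact h5.symm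

end UnitNormals

/-! ### Calculus of the Morin normal form -/

section MorinCalculus

variable {m k : ℕ}

/-- The last coordinate vector. -/
abbrev eLast (m : ℕ) : Euc (m + 1) := EuclideanSpace.single (Fin.last m) 1

/-- The first component of the Morin normal form. -/
def morinPoly (m k : ℕ) (z : Euc (m + 2)) : ℝ :=
  (∑ i : Fin (m + 1), if i.val + 1 < k then z i.castSucc * z (Fin.last (m + 1)) ^ (i.val + 1)
    else 0) + z (Fin.last (m + 1)) ^ (k + 1)

/-- The derivative of `morinPoly` in the last variable. -/
def morinPoly' (m k : ℕ) (z : Euc (m + 2)) : ℝ :=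
  (∑ i : Fin (m + 1), if i.val + 1 < k then
    ((i.val : ℝ) + 1) * z i.castSucc * z (Fin.last (m + 1)) ^ i.val else 0)
    + ((k : ℝ) + 1) * z (Fin.last (m + 1)) ^ k

/-- The second derivative of `morinPoly` in the last variable. -/
def morinPoly'' (m k : ℕ) (z : Euc (m + 2)) : ℝ :=
  (∑ i : Fin (m + 1), if i.val + 1 < k then
    ((i.val : ℝ) + 1) * i.val * z i.castSucc * z (Fin.last (m + 1)) ^ (i.val - 1) else 0)
    + ((k : ℝ) + 1) * k * z (Fin.last (m + 1)) ^ (k - 1)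

theorem morinForm_zero (z : Euc (m + 2)) : morinForm (m + 1) k z 0 = morinPoly m k z := rfl

theorem morinForm_succ (z : Euc (m + 2)) (i : Fin (m + 1)) :
    morinForm (m + 1) k z i.succ = z i.castSucc := rfl

theorem contDiff_coord {n : ℕ} (i : Fin n) : ContDiff ℝ ∞ (fun z : Euc n => z i) :=
  (EuclideanSpace.proj i : Euc n →L[ℝ] ℝ).contDiff

theorem hasFDerivAt_coord {n : ℕ} (i : Fin n) (z : Euc n) :
    HasFDerivAt (fun z : Euc n => z i) (EuclideanSpace.proj i : Euc n →L[ℝ] ℝ) z :=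
  (EuclideanSpace.proj i : Euc n →L[ℝ] ℝ).hasFDerivAt

theorem contDiff_morinPoly : ContDiff ℝ ∞ (morinPoly m k) := by
  unfold morinPoly
  refine ContDiff.add (ContDiff.sum fun i _ => ?_) ((contDiff_coord _).pow _)
  split_ifs
  · exact (contDiff_coord _).mul ((contDiff_coord _).pow _)
  · exact contDiff_const

theorem contDiff_morinPoly' : ContDiff ℝ ∞ (morinPoly' m k) := by
  unfold morinPoly'
  refine ContDiff.add (ContDiff.sum fun i _ => ?_) (contDiff_const.mul ((contDiff_coord _).pow _))
  split_ifs
  · exact (contDiff_const.mul (contDiff_coord _)).mul ((contDiff_coord _).pow _)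
  · exact contDiff_const

theorem contDiff_morinPoly'' : ContDiff ℝ ∞ (morinPoly'' m k) := by
  unfold morinPoly''
  refine ContDiff.add (ContDiff.sum fun i _ => ?_) (contDiff_const.mul ((contDiff_coord _).pow _))
  split_ifs
  · exact (contDiff_const.mul (contDiff_coord _)).mul ((contDiff_coord _).pow _)
  · exact contDiff_const

theorem contDiff_morinForm : ContDiff ℝ ∞ (morinForm (m + 1) k) := by
  rw [contDiff_euclidean]
  intro i
  refine Fin.cases ?_ (fun j => ?_) i
  · exact contDiff_morinPoly
  · exact contDiff_coord _

theorem fderiv_monomial (c : ℝ) (j : ℕ) (i : Fin (m + 2)) (z v : Euc (m + 2)) :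
    fderiv ℝ (fun z : Euc (m + 2) => c * z i * z (Fin.last (m + 1)) ^ j) z v
      = c * v i * z (Fin.last (m + 1)) ^ j
        + c * j * z i * z (Fin.last (m + 1)) ^ (j - 1) * v (Fin.last (m + 1)) := by
  have h := ((hasFDerivAt_coord i z).const_mul c).mul
    ((hasFDerivAt_coord (Fin.last (m + 1)) z).pow j)
  have h2 : HasFDerivAt (fun z : Euc (m + 2) => c * z i * z (Fin.last (m + 1)) ^ j) _ z := h
  rw [h2.fderiv]
  simp
  ring

theorem fderiv_power (c : ℝ) (j : ℕ) (z v : Euc (m + 2)) :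
    fderiv ℝ (fun z : Euc (m + 2) => c * z (Fin.last (m + 1)) ^ j) z v
      = c * j * z (Fin.last (m + 1)) ^ (j - 1) * v (Fin.last (m + 1)) := by
  have h := ((hasFDerivAt_coord (Fin.last (m + 1)) z).pow j).const_mul c
  have h2 : HasFDerivAt (fun z : Euc (m + 2) => c * z (Fin.last (m + 1)) ^ j) _ z := h
  rw [h2.fderiv]
  simp
  ring

/-- A common template for `morinPoly`, `morinPoly'` and `morinPoly''`. The truncated exponents `e i
- 1` and `e' - 1` are harmless, because the coefficients `e i` and `e'` vanish where truncation
happens. -/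
theorem fderiv_morin_sum (c : Fin (m + 1) → ℝ) (e : Fin (m + 1) → ℕ) (c' : ℝ) (e' : ℕ)
    (z v : Euc (m + 2)) :
    fderiv ℝ (fun z : Euc (m + 2) => (∑ i : Fin (m + 1), if i.val + 1 < k then
        c i * z i.castSucc * z (Fin.last (m + 1)) ^ e i else 0) + c' * z (Fin.last (m + 1)) ^ e') z v
      = (∑ i : Fin (m + 1), if i.val + 1 < k then c i * v i.castSucc * z (Fin.last (m + 1)) ^ e i
        + c i * e i * z i.castSucc * z (Fin.last (m + 1)) ^ (e i - 1) * v (Fin.last (m + 1)) else 0)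
        + c' * e' * z (Fin.last (m + 1)) ^ (e' - 1) * v (Fin.last (m + 1)) := by
  have hd : ∀ i : Fin (m + 1), DifferentiableAt ℝ (fun z : Euc (m + 2) => if i.val + 1 < k then
        c i * z i.castSucc * z (Fin.last (m + 1)) ^ e i else 0) z := by
    intro i
    split_ifs
    · exact (((contDiff_const.mul (contDiff_coord _)).mul
        ((contDiff_coord _).pow _)).differentiable (by simp)).differentiableAt
    · exact differentiableAt_const _
  have hd' : DifferentiableAt ℝ (fun z : Euc (m + 2) => c' * z (Fin.last (m + 1)) ^ e') z :=
    ((contDiff_const.mul ((contDiff_coord _).pow _)).differentiable (by simp)).differentiableAt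
  rw [fderiv_fun_add (DifferentiableAt.fun_sum fun i _ => hd i) hd',
    fderiv_fun_sum fun i _ => hd i]
  simp only [add_apply, sum_apply, fderiv_power]
  congr 1
  refine Finset.sum_congr rfl fun i _ => ?_
  split_ifs
  · exact fderiv_monomial _ _ _ _ _
  · simp

theorem fderiv_morinPoly (z v : Euc (m + 2)) :
    fderiv ℝ (morinPoly m k) z v = (∑ i : Fin (m + 1), if i.val + 1 < k then
      v i.castSucc * z (Fin.last (m + 1)) ^ (i.val + 1) else 0)
        + morinPoly' m k z * v (Fin.last (m + 1)) := by
  have h := fderiv_morin_sum (k := k) (fun _ => 1) (fun i : Fin (m + 1) => i.val + 1) 1 (k + 1) z v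
  simp only [one_mul] at h
  unfold morinPoly morinPoly'
  rw [h, add_mul, Finset.sum_mul, ← add_assoc, ← Finset.sum_add_distrib]
  congr 1
  · refine Finset.sum_congr rfl fun i _ => ?_
    split_ifs <;> push_cast <;> simp
  · push_cast; simp

theorem fderiv_morinPoly' (z v : Euc (m + 2)) :
    fderiv ℝ (morinPoly' m k) z v = (∑ i : Fin (m + 1), if i.val + 1 < k then
      ((i.val : ℝ) + 1) * v i.castSucc * z (Fin.last (m + 1)) ^ i.val else 0)
        + morinPoly'' m k z * v (Fin.last (m + 1)) := by
  have h := fderiv_morin_sum (k := k) (fun i : Fin (m + 1) => (i.val : ℝ) + 1)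
    (fun i : Fin (m + 1) => i.val) (k + 1) k z v
  unfold morinPoly' morinPoly''
  rw [h, add_mul _ _ (v (Fin.last (m + 1))), Finset.sum_mul, ← add_assoc, ← Finset.sum_add_distrib]
  congr 1
  refine Finset.sum_congr rfl fun i _ => ?_
  split_ifs <;> simp

theorem eLast_last : eLast m (Fin.last m) = 1 := by simp [eLast]

theorem eLast_castSucc (i : Fin m) : eLast m i.castSucc = 0 := by
  simp [eLast, Fin.castSucc_ne_last]

theorem fderiv_morinPoly'_eLast (z : Euc (m + 2)) :
    fderiv ℝ (morinPoly' m k) z (eLast (m + 1)) = morinPoly'' m k z := by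
  rw [fderiv_morinPoly', eLast_last]
  simp

/-- For `k ≥ 2` the variable with index `0` enters `P'` linearly with coefficient one, so `P' = 0`
is a smooth hypersurface everywhere. -/
theorem fderiv_morinPoly'_single_zero (hk : 2 ≤ k) (z : Euc (m + 2)) :
    fderiv ℝ (morinPoly' m k) z (EuclideanSpace.single 0 1) = 1 := by
  rw [fderiv_morinPoly', Fin.sum_univ_succ]
  have h0 : (Fin.last (m + 1)) ≠ 0 := Fin.last_pos.ne'
  simp [h0, show 1 < k by omega]

theorem fderiv_morinPoly'_zero (hk : 2 ≤ k) (v : Euc (m + 2)) :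
    fderiv ℝ (morinPoly' m k) 0 v = v 0 := by
  rw [fderiv_morinPoly', Fin.sum_univ_succ]
  have h2 : (0 : ℝ) ^ (k - 1) = 0 := by apply zero_pow; omega
  simp [morinPoly'', show 1 < k by omega, h2]

/-- For `k ≥ 3` the linear part of `P''` does not involve the last variable, in contrast to
`morinPoly''_two`. This is what separates the higher singularities from `A₂`. -/
theorem fderiv_morinPoly''_zero (hk : 3 ≤ k) (hm : 1 ≤ m) (v : Euc (m + 2)) :
    fderiv ℝ (morinPoly'' m k) 0 v = 2 * v 1 := by
  have h := fderiv_morin_sum (k := k) (fun i : Fin (m + 1) => ((i.val : ℝ) + 1) * i.val)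
    (fun i : Fin (m + 1) => i.val - 1) (((k : ℝ) + 1) * k) (k - 1) 0 v
  unfold morinPoly''
  obtain ⟨m, rfl⟩ : ∃ n, m = n + 1 := ⟨m - 1, by omega⟩
  rw [h, Fin.sum_univ_succ, Fin.sum_univ_succ]
  have h2 : (0 : ℝ) ^ (k - 1 - 1) = 0 := by apply zero_pow; omega
  simp [show 2 < k by omega, h2]
  norm_num

theorem morinPoly''_two (z : Euc (m + 2)) : morinPoly'' m 2 z = 6 * z (Fin.last (m + 1)) := by
  unfold morinPoly''
  rw [Fin.sum_univ_succ]
  simp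
  norm_num

theorem morinPoly_two (z : Euc (m + 2)) : morinPoly m 2 z
    = z 0 * z (Fin.last (m + 1)) + z (Fin.last (m + 1)) ^ 3 := by
  unfold morinPoly
  rw [Fin.sum_univ_succ]
  simp

theorem morinPoly'_two (z : Euc (m + 2)) : morinPoly' m 2 z
    = z 0 + 3 * z (Fin.last (m + 1)) ^ 2 := by
  unfold morinPoly'
  rw [Fin.sum_univ_succ]
  simp
  norm_num

theorem fderiv_euc_apply {E : Type*} [NormedAddCommGroup E] [NormedSpace ℝ E] {n : ℕ}
    {h : E → Euc n} {x : E} (hh : DifferentiableAt ℝ h x) (v : E) (i : Fin n) :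
    fderiv ℝ h x v i = fderiv ℝ (fun y => h y i) x v := by
  have := ((EuclideanSpace.proj i : Euc n →L[ℝ] ℝ).hasFDerivAt (x := h x)).comp x hh.hasFDerivAt
  have h2 : HasFDerivAt (fun y => h y i) _ x := this
  rw [h2.fderiv]; rfl

theorem fderiv_morinForm_zero (z v : Euc (m + 2)) :
    fderiv ℝ (morinForm (m + 1) k) z v 0 = fderiv ℝ (morinPoly m k) z v :=
  fderiv_euc_apply ((contDiff_morinForm.differentiable (by simp)) z) v 0

theorem fderiv_morinForm_succ (z v : Euc (m + 2)) (i : Fin (m + 1)) :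
    fderiv ℝ (morinForm (m + 1) k) z v i.succ = v i.castSucc := by
  rw [fderiv_euc_apply ((contDiff_morinForm.differentiable (by simp)) z) v i.succ]
  have h2 : HasFDerivAt (fun y => morinForm (m + 1) k y i.succ) _ z :=
    hasFDerivAt_coord i.castSucc z
  rw [h2.fderiv]; rfl

/-- The kernel of the derivative of the Morin normal form. -/
theorem fderiv_morinForm_eq_zero_iff {z v : Euc (m + 2)} :
    fderiv ℝ (morinForm (m + 1) k) z v = 0 ↔
      v = v (Fin.last (m + 1)) • eLast (m + 1) ∧ morinPoly' m k z * v (Fin.last (m + 1)) = 0 := by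
  constructor
  · intro h
    have h1 : ∀ i : Fin (m + 1), v i.castSucc = 0 := fun i => by
      rw [← fderiv_morinForm_succ (k := k) z v i, h]; rfl
    have h2 := fderiv_morinForm_zero (k := k) z v
    rw [h, fderiv_morinPoly] at h2
    refine ⟨?_, ?_⟩
    · ext i
      refine Fin.lastCases ?_ (fun j => ?_) i
      · simp [eLast]
      · simp [h1]
    · simpa [h1] using h2.symm
  · rintro ⟨h1, h2⟩
    have h3 : ∀ i : Fin (m + 1), v i.castSucc = 0 := fun i => by
      rw [h1]; simp
    ext i
    refine Fin.cases ?_ (fun j => ?_) i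
    · rw [fderiv_morinForm_zero, fderiv_morinPoly, h2]
      simp [h3]
    · rw [fderiv_morinForm_succ, h3]; rfl

end MorinCalculus

/-! ### The front as the singular set of its Morin extension -/

section MorinExtension

variable {m : ℕ}
  {M : Type u} [TopologicalSpace M] [ChartedSpace (Euc (m + 1)) M] [IsManifold (𝓡 (m + 1)) ∞ M]
  {N : Type v} [TopologicalSpace N] [ChartedSpace (Euc (m + 2)) N] [IsManifold (𝓡 (m + 2)) ∞ N]
  {W : Type w} [TopologicalSpace W] [ChartedSpace (Euc (m + 2)) W] [IsManifold (𝓡 (m + 2)) ∞ W]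

/-- `f` is the restriction of `F`, all of whose singularities are Morin singularities, to its
singular set, which is parametrised by the immersion `ι`. -/
structure MorinExtension (f : M → N) (F : W → N) (ι : M → W) : Prop where
  smooth : ContMDiff (𝓡 (m + 2)) (𝓡 (m + 2)) ∞ F
  smooth_emb : ContMDiff (𝓡 (m + 1)) (𝓡 (m + 2)) ∞ ι
  injective : ∀ p, Function.Injective (mfderiv (𝓡 (m + 1)) (𝓡 (m + 2)) ι p)
  mem_singular : ∀ p, ι p ∈ singularSet (m + 2) (m + 2) F
  morin : ∀ p, ∃ k : ℕ, 1 ≤ k ∧ k ≤ m + 2 ∧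
      IsRightLeftEquivAt (a := m + 2) (b := m + 2) F (ι p) (morinForm (m + 1) k)
  eq : ∀ p, f p = F (ι p)

/-- In the charts that come with the immersion, the map is a linear isomorphism applied to `x ↦ (x,
0)`. -/
theorem injective_mfderiv_of_isImmersion {ι : M → W} {p : M}
    (h : Manifold.IsImmersionAt (𝓡 (m + 1)) (𝓡 (m + 2)) ∞ ι p) :
    Function.Injective (mfderiv (𝓡 (m + 1)) (𝓡 (m + 2)) ι p) := by
  have hφ : h.domChart ∈ Atlas (m + 1) M := h.domChart_mem_maximalAtlas
  have hψ : h.codChart ∈ Atlas (m + 2) W := h.codChart_mem_maximalAtlas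
  have hp := h.mem_domChart_source
  have hq := h.mem_codChart_source
  have h1 := fderiv_chart_comp hφ hψ hp hq h.contMDiffAt
  have h2 : (fun x => h.codChart (ι (h.domChart.symm x))) =ᶠ[𝓝 (h.domChart p)]
      fun x => h.equiv (x, 0) := by
    filter_upwards [h.domChart.open_target.mem_nhds (h.domChart.map_source hp)] with x hx
    have hx' : x ∈ (h.domChart.extend (𝓡 (m + 1))).target := by
      simpa [OpenPartialHomeomorph.extend_target] using hx
    have := h.writtenInCharts hx'
    simpa using this
  have h3 : HasFDerivAt (fun x : Euc (m + 1) => h.equiv (x, (0 : h.complement)))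
      ((h.equiv : (Euc (m + 1) × h.complement) →L[ℝ] Euc (m + 2)).comp
        (ContinuousLinearMap.inl ℝ (Euc (m + 1)) h.complement)) (h.domChart p) :=
    ((h.equiv : (Euc (m + 1) × h.complement) →L[ℝ] Euc (m + 2)).comp
        (ContinuousLinearMap.inl ℝ (Euc (m + 1)) h.complement)).hasFDerivAt
  rw [h2.fderiv_eq, h3.fderiv] at h1
  intro x y hxy
  apply dchart_injective hφ hp
  have h4 := (h1 x).trans ((congrArg (dchart h.codChart (ι p)) hxy).trans (h1 y).symm)
  have h5 := h.equiv.injective h4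
  exact (Prod.mk.inj h5).1

theorem IsMorinFront.exists_extension {g : Metric (m + 2) N} {f : M → N}
    (h : IsMorinFront.{u, v, w} g f) :
    ∃ (W : Type w) (_ : TopologicalSpace W) (_ : ChartedSpace (Euc (m + 2)) W)
      (_ : IsManifold (𝓡 (m + 2)) ∞ W) (F : W → N) (ι : M → W), MorinExtension (m := m) f F ι := by
  obtain ⟨_, W, i1, i2, i3, _, _, F, ι, hF, hmor, hι, hr, hf⟩ := h
  have hs : ∀ p, ι p ∈ singularSet (m + 2) (m + 2) F := fun p => hr ▸ mem_range_self p
  exact ⟨W, i1, i2, i3, F, ι, hF, hι.contMDiff,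
    fun p => injective_mfderiv_of_isImmersion (hι.isImmersion.isImmersionAt p), hs,
    fun p => hmor _ (hs p), hf⟩

/-- Charts in which `F` has the Morin normal form near `ι p`. -/
structure IsMorinChart (F : W → N) (ι : M → W) (p : M) (k : ℕ)
    (φ : OpenPartialHomeomorph W (Euc (m + 2))) (ψ : OpenPartialHomeomorph N (Euc (m + 2))) :
    Prop where
  left_mem : φ ∈ Atlas (m + 2) W
  right_mem : ψ ∈ Atlas (m + 2) N
  mem_source : ι p ∈ φ.source
  form : ∀ᶠ x in 𝓝 (ι p), x ∈ φ.source ∧ F x ∈ ψ.source ∧ ψ (F x) = morinForm (m + 1) k (φ x)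

/-- In the chart `ψ`, the front `f` is the Morin normal form composed with the immersion `Z`,
which takes values in the singular set of the normal form. -/
structure IsFrontForm (f : M → N) (k : ℕ) (Z : M → Euc (m + 2))
    (ψ : OpenPartialHomeomorph N (Euc (m + 2))) (p : M) : Prop where
  smooth : ContMDiffAt (𝓡 (m + 1)) (𝓡 (m + 2)) ∞ Z p
  injective : Function.Injective (mfderiv (𝓡 (m + 1)) (𝓡 (m + 2)) Z p)
  mem_source : f p ∈ ψ.source
  form : ψ (f p) = morinForm (m + 1) k (Z p)
  singular : morinPoly' m k (Z p) = 0

variable {f : M → N} {F : W → N} {ι : M → W}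

theorem MorinExtension.exists_chart (h : MorinExtension (m := m) f F ι) (p : M) :
    ∃ k φ ψ, 1 ≤ k ∧ k ≤ m + 2 ∧ φ (ι p) = 0 ∧ IsMorinChart (m := m) F ι p k φ ψ := by
  obtain ⟨k, hk1, hk2, φ, hφ, ψ, hψ, hp, hfp, h0, -, hform⟩ := h.morin p
  exact ⟨k, φ, ψ, hk1, hk2, h0, hφ, hψ, hp,
    (show ∀ᶠ x in 𝓝 (ι p), x ∈ φ.source from φ.open_source.mem_nhds hp).and hform⟩

/-- `IsMorinChart` does not require `φ (ι p) = 0`, so one pair of charts serves all nearby points,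
including those of simpler type. -/
theorem MorinExtension.eventually_isMorinChart (h : MorinExtension (m := m) f F ι) {p : M} {k : ℕ}
    {φ : OpenPartialHomeomorph W (Euc (m + 2))} {ψ : OpenPartialHomeomorph N (Euc (m + 2))}
    (hc : IsMorinChart (m := m) F ι p k φ ψ) :
    ∀ᶠ q in 𝓝 p, IsMorinChart (m := m) F ι q k φ ψ := by
  have h1 := (h.smooth_emb.continuous.tendsto p).eventually (eventually_eventually_nhds.2 hc.form)
  filter_upwards [h1] with q hq
  exact ⟨hc.left_mem, hc.right_mem, hq.self_of_nhds.1, hq⟩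

theorem MorinExtension.eventually_frontForm (h : MorinExtension (m := m) f F ι) {p : M} {k : ℕ}
    {φ : OpenPartialHomeomorph W (Euc (m + 2))} {ψ : OpenPartialHomeomorph N (Euc (m + 2))}
    (hc : IsMorinChart (m := m) F ι p k φ ψ) :
    ∀ᶠ q in 𝓝 p, IsFrontForm f k (fun q => φ (ι q)) ψ q := by
  have h1 := (h.smooth_emb.continuous.tendsto p).eventually (eventually_eventually_nhds.2 hc.form)
  filter_upwards [h1] with q hq
  obtain ⟨hq1, hq2, hq3⟩ := hq.self_of_nhds
  have hZ : ContMDiffAt (𝓡 (m + 1)) (𝓡 (m + 2)) ∞ (fun q => φ (ι q)) q :=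
    (Atlas.contMDiffAt hc.left_mem hq1).comp q (h.smooth_emb q)
  refine ⟨hZ, ?_, ?_, ?_, ?_⟩
  · have h2 := mfderiv_comp q ((Atlas.mdifferentiable hc.left_mem).mdifferentiableAt hq1)
      ((h.smooth_emb q).mdifferentiableAt (by simp))
    intro x y hxy
    apply h.injective q
    apply dchart_injective hc.left_mem hq1
    have h3 := DFunLike.congr_fun h2 x
    have h4 := DFunLike.congr_fun h2 y
    exact h3.symm.trans (Eq.trans hxy h4)
  · rw [h.eq]; exact hq2
  · rw [h.eq]; exact hq3
  -- If `P'` were nonzero, the kernel of the derivative of the normal form would be trivial, and `F`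
  -- would be immersive at `ι q`.
  · by_contra hne
    apply h.mem_singular q
    have h2 := fderiv_chart_comp hc.left_mem hc.right_mem hq1 hq2 (h.smooth (ι q))
    have h3 : (fun x => ψ (F (φ.symm x))) =ᶠ[𝓝 (φ (ι q))] morinForm (m + 1) k := by
      have h4 : ∀ᶠ x in 𝓝 (φ (ι q)), φ.symm x ∈
          {y | y ∈ φ.source ∧ F y ∈ ψ.source ∧ ψ (F y) = morinForm (m + 1) k (φ y)} := by
        apply (φ.symm.continuousAt (by simpa using φ.map_source hq1)).eventually_mem
        rw [φ.left_inv hq1]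
        exact hq
      filter_upwards [h4, φ.open_target.mem_nhds (φ.map_source hq1)] with x hx hx2
      rw [hx.2.2, φ.right_inv hx2]
    rw [h3.fderiv_eq] at h2
    change Function.Injective _
    rw [injective_iff_map_eq_zero]
    intro u hu
    have h5 := h2 u
    rw [hu] at h5
    have h6 : fderiv ℝ (morinForm (m + 1) k) (φ (ι q)) (dchart φ (ι q) u) = 0 :=
      h5.trans (ContinuousLinearMap.map_zero _)
    rw [fderiv_morinForm_eq_zero_iff] at h6
    have h7 := (mul_eq_zero.1 h6.2).resolve_left hne
    rw [h7, zero_smul] at h6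
    exact dchart_injective hc.left_mem hq1 (h6.1.trans (ContinuousLinearMap.map_zero _).symm)

/-! ### Consequences of the normal form -/

theorem mfderiv_comp_euc {n n' : ℕ} {Z : M → Euc n} {G : Euc n → Euc n'} {q : M}
    (hZ : ContMDiffAt (𝓡 (m + 1)) (𝓡 n) ∞ Z q) (hG : ContDiffAt ℝ ∞ G (Z q))
    (u : TangentSpace (𝓡 (m + 1)) q) :
    mfderiv (𝓡 (m + 1)) (𝓡 n') (fun q => G (Z q)) q u
      = fderiv ℝ G (Z q) (mfderiv (𝓡 (m + 1)) (𝓡 n) Z q u) := by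
  have h := mfderiv_comp q (I'' := 𝓡 n') (g := G) (f := Z)
    ((contMDiffAt_iff_contDiffAt.2 hG).mdifferentiableAt (by simp))
    (hZ.mdifferentiableAt (by simp))
  rw [mfderiv_eq_fderiv] at h
  exact DFunLike.congr_fun h u

theorem eventually_mfderiv_frontForm {k : ℕ} {Z : M → Euc (m + 2)}
    {ψ : OpenPartialHomeomorph N (Euc (m + 2))} (hψ : ψ ∈ Atlas (m + 2) N) {q : M}
    (h : ∀ᶠ q in 𝓝 q, IsFrontForm f k Z ψ q)
    (hf : ContMDiffAt (𝓡 (m + 1)) (𝓡 (m + 2)) ∞ f q) (u : TangentSpace (𝓡 (m + 1)) q) :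
    dchart ψ (f q) (mfderiv (𝓡 (m + 1)) (𝓡 (m + 2)) f q u)
      = fderiv ℝ (morinForm (m + 1) k) (Z q) (mfderiv (𝓡 (m + 1)) (𝓡 (m + 2)) Z q u) := by
  have hq := h.self_of_nhds
  rw [← mfderiv_comp_euc hq.smooth contDiff_morinForm.contDiffAt]
  have h1 : (fun q => morinForm (m + 1) k (Z q)) =ᶠ[𝓝 q] ψ ∘ f := by
    filter_upwards [h] with q' hq'
    exact hq'.form.symm
  rw [h1.mfderiv_eq]
  have h2 := mfderiv_comp q ((Atlas.mdifferentiable hψ).mdifferentiableAt hq.mem_source)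
      (hf.mdifferentiableAt (by simp))
  exact (DFunLike.congr_fun h2 u).symm

theorem fderiv_morinPoly'_frontForm {k : ℕ} {Z : M → Euc (m + 2)}
    {ψ : OpenPartialHomeomorph N (Euc (m + 2))} {q : M}
    (h : ∀ᶠ q in 𝓝 q, IsFrontForm f k Z ψ q) (u : TangentSpace (𝓡 (m + 1)) q) :
    fderiv ℝ (morinPoly' m k) (Z q) (mfderiv (𝓡 (m + 1)) (𝓡 (m + 2)) Z q u) = 0 := by
  have hq := h.self_of_nhds
  have h1 := mfderiv_comp q (I'' := 𝓘(ℝ, ℝ)) (g := morinPoly' m k) (f := Z)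
    ((contMDiffAt_iff_contDiffAt.2 contDiff_morinPoly'.contDiffAt).mdifferentiableAt (by simp))
    (hq.smooth.mdifferentiableAt (by simp))
  have h2 : (morinPoly' m k ∘ Z) =ᶠ[𝓝 q] fun _ => (0 : ℝ) := by
    filter_upwards [h] with q' hq'
    exact hq'.singular
  rw [h2.mfderiv_eq, mfderiv_eq_fderiv, mfderiv_const] at h1
  exact (DFunLike.congr_fun h1 u).symm

/-- The image of `dZ` is contained in the kernel of `dP'`, and both have dimension `m + 1`. -/
theorem exists_mfderiv_frontForm {k : ℕ} {Z : M → Euc (m + 2)}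
    {ψ : OpenPartialHomeomorph N (Euc (m + 2))} {q : M}
    (h : ∀ᶠ q in 𝓝 q, IsFrontForm f k Z ψ q) (hL : fderiv ℝ (morinPoly' m k) (Z q) ≠ 0)
    {v : Euc (m + 2)} (hv : fderiv ℝ (morinPoly' m k) (Z q) v = 0) :
    ∃ u : TangentSpace (𝓡 (m + 1)) q, mfderiv (𝓡 (m + 1)) (𝓡 (m + 2)) Z q u = v := by
  let D : Euc (m + 1) →ₗ[ℝ] Euc (m + 2) :=
    (mfderiv (𝓡 (m + 1)) (𝓡 (m + 2)) Z q).toLinearMap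
  have hDinj : Function.Injective D := h.self_of_nhds.injective
  let L : Euc (m + 2) →ₗ[ℝ] ℝ := (fderiv ℝ (morinPoly' m k) (Z q)).toLinearMap
  have hL' : L ≠ 0 := fun h2 => hL (ContinuousLinearMap.ext fun x => DFunLike.congr_fun h2 x)
  have hrange : LinearMap.range D = LinearMap.ker L := by
    apply Submodule.eq_of_le_of_finrank_eq
    · rintro _ ⟨u, rfl⟩
      exact fderiv_morinPoly'_frontForm h u
    · rw [LinearMap.finrank_range_of_inj hDinj]
      have h2 := Module.Dual.finrank_ker_add_one_of_ne_zero (f := L) hL'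
      simp at h2 ⊢
      omega
  have h2 : v ∈ LinearMap.ker L := hv
  rw [← hrange] at h2
  exact h2

/-- Where `P' = 0`, the kernel of the derivative of the normal form is exactly the last axis. -/
theorem mfderiv_eq_zero_iff_frontForm {k : ℕ} {Z : M → Euc (m + 2)}
    {ψ : OpenPartialHomeomorph N (Euc (m + 2))} (hψ : ψ ∈ Atlas (m + 2) N) {q : M}
    (h : ∀ᶠ q in 𝓝 q, IsFrontForm f k Z ψ q)
    (hf : ContMDiffAt (𝓡 (m + 1)) (𝓡 (m + 2)) ∞ f q) (u : TangentSpace (𝓡 (m + 1)) q) :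
    mfderiv (𝓡 (m + 1)) (𝓡 (m + 2)) f q u = 0 ↔
      ∃ r : ℝ, mfderiv (𝓡 (m + 1)) (𝓡 (m + 2)) Z q u = (r • eLast (m + 1) : Euc (m + 2)) := by
  have hq := h.self_of_nhds
  have h1 := eventually_mfderiv_frontForm hψ h hf u
  constructor
  · intro hu
    rw [hu] at h1
    have h2 := fderiv_morinForm_eq_zero_iff.1 (h1.symm.trans (ContinuousLinearMap.map_zero _))
    exact ⟨_, h2.1⟩
  · rintro ⟨r, hr⟩
    apply dchart_injective hψ hq.mem_source
    refine h1.trans (Eq.trans ?_ (ContinuousLinearMap.map_zero (dchart ψ (f q))).symm)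
    rw [hr]
    refine fderiv_morinForm_eq_zero_iff.2 ⟨?_, ?_⟩
    · simp
    · rw [hq.singular, zero_mul]

/-- `f` fails to be immersive exactly when the last axis, the kernel direction of the normal form,
is tangent to `P' = 0`. Since the derivative of `P'` along that axis is `P''`, this means `P'' = 0`.
-/
theorem mem_singularSet_iff_frontForm {k : ℕ} (hk : 2 ≤ k) {Z : M → Euc (m + 2)}
    {ψ : OpenPartialHomeomorph N (Euc (m + 2))} (hψ : ψ ∈ Atlas (m + 2) N) {q : M}
    (h : ∀ᶠ q in 𝓝 q, IsFrontForm f k Z ψ q)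
    (hf : ContMDiffAt (𝓡 (m + 1)) (𝓡 (m + 2)) ∞ f q) :
    q ∈ singularSet (m + 1) (m + 2) f ↔ morinPoly'' m k (Z q) = 0 := by
  have hq := h.self_of_nhds
  change ¬ Function.Injective _ ↔ _
  rw [injective_iff_map_eq_zero]
  push Not
  constructor
  · rintro ⟨u, hu, hu0⟩
    obtain ⟨r, hr⟩ := (mfderiv_eq_zero_iff_frontForm hψ h hf u).1 hu
    have h1 := fderiv_morinPoly'_frontForm h u
    rw [hr] at h1
    replace h1 := (ContinuousLinearMap.map_smul _ _ _).symm.trans h1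
    rw [fderiv_morinPoly'_eLast, smul_eq_mul] at h1
    refine (mul_eq_zero.1 h1).resolve_left fun h2 => hu0 ?_
    rw [h2, zero_smul] at hr
    exact hq.injective (hr.trans (ContinuousLinearMap.map_zero _).symm)
  · intro h1
    have hL : fderiv ℝ (morinPoly' m k) (Z q) ≠ 0 := by
      intro h2
      have h3 := fderiv_morinPoly'_single_zero (m := m) hk (Z q)
      rw [h2] at h3
      exact zero_ne_one h3
    obtain ⟨u, hu⟩ := exists_mfderiv_frontForm h hL ((fderiv_morinPoly'_eLast (Z q)).trans h1)
    refine ⟨u, ?_, ?_⟩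
    · exact (mfderiv_eq_zero_iff_frontForm hψ h hf u).2 ⟨1, by rw [one_smul]; exact hu⟩
    · rintro rfl
      have h2 := hu.symm.trans (ContinuousLinearMap.map_zero _)
      have := congrArg (fun x : Euc (m + 2) => x (Fin.last (m + 1))) h2
      simp only [eLast_last] at this
      exact one_ne_zero this

/-- For a fold, `P''` is the constant `2`, so the kernel direction is never tangent to `P' = 0`. -/
theorem not_mem_singularSet_frontForm {Z : M → Euc (m + 2)}
    {ψ : OpenPartialHomeomorph N (Euc (m + 2))} (hψ : ψ ∈ Atlas (m + 2) N) {q : M}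
    (h : ∀ᶠ q in 𝓝 q, IsFrontForm f 1 Z ψ q)
    (hf : ContMDiffAt (𝓡 (m + 1)) (𝓡 (m + 2)) ∞ f q) :
    q ∉ singularSet (m + 1) (m + 2) f := by
  have hq := h.self_of_nhds
  refine not_not.2 ?_
  rw [injective_iff_map_eq_zero]
  intro u hu
  have h1 := eventually_mfderiv_frontForm hψ h hf u
  rw [hu] at h1
  have h1' := h1.symm.trans (ContinuousLinearMap.map_zero _)
  replace h1' := fderiv_morinForm_eq_zero_iff.1 h1'
  have h2 := fderiv_morinPoly'_frontForm h u
  have h4 := h1'.1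
  rw [h4] at h2
  replace h2 := ((ContinuousLinearMap.map_smul _ _ _).symm.trans h2)
  erw [fderiv_morinPoly'_eLast] at h2
  have h3 : morinPoly'' m 1 (Z q) = 2 := by simp [morinPoly'']; norm_num
  rw [h3] at h2
  apply hq.injective
  refine Eq.trans ?_ (ContinuousLinearMap.map_zero _).symm
  rw [h4]
  have h5 := (smul_eq_zero.1 h2).resolve_right two_ne_zero
  rw [h5, zero_smul]
  rfl

end MorinExtension

/-! ### Adapted charts on the front -/

section FrontCharts

variable {m k : ℕ}
  {M : Type u} [TopologicalSpace M] [ChartedSpace (Euc (m + 1)) M] [IsManifold (𝓡 (m + 1)) ∞ M]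
  {N : Type v} [TopologicalSpace N] [ChartedSpace (Euc (m + 2)) N] [IsManifold (𝓡 (m + 2)) ∞ N]
  {W : Type w} [TopologicalSpace W] [ChartedSpace (Euc (m + 2)) W] [IsManifold (𝓡 (m + 2)) ∞ W]

/-- A smooth map whose derivative is injective on the kernel of the derivative of `morinPoly'`
induces a chart of the front. -/
theorem exists_frontChart {f : M → N} {Z : M → Euc (m + 2)}
    {ψ : OpenPartialHomeomorph N (Euc (m + 2))} {p : M}
    (h : ∀ᶠ q in 𝓝 p, IsFrontForm f k Z ψ q) {G : Euc (m + 2) → Euc (m + 1)}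
    (hG : ContDiff ℝ ∞ G)
    (hGi : ∀ v, fderiv ℝ (morinPoly' m k) (Z p) v = 0 → fderiv ℝ G (Z p) v = 0 → v = 0) :
    ∃ χ ∈ Atlas (m + 1) M, p ∈ χ.source ∧
      (∀ q ∈ χ.source, ∀ᶠ q' in 𝓝 q, IsFrontForm f k Z ψ q') ∧
      (∀ q ∈ χ.source, χ q = G (Z q)) ∧
      ∀ q ∈ χ.source, ∀ u, dchart χ q u
        = fderiv ℝ G (Z q) (mfderiv (𝓡 (m + 1)) (𝓡 (m + 2)) Z q u) := by
  have h1 : ∀ᶠ q in 𝓝 p, ContMDiffAt (𝓡 (m + 1)) (𝓡 (m + 1)) ∞ (fun q => G (Z q)) q := by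
    filter_upwards [h] with q hq
    exact (contMDiffAt_iff_contDiffAt.2 hG.contDiffAt).comp q hq.smooth
  have h2 : Function.Injective (mfderiv (𝓡 (m + 1)) (𝓡 (m + 1)) (fun q => G (Z q)) p) := by
    rw [injective_iff_map_eq_zero]
    intro u hu
    rw [mfderiv_comp_euc h.self_of_nhds.smooth hG.contDiffAt] at hu
    have := hGi _ (fderiv_morinPoly'_frontForm h u) hu
    exact h.self_of_nhds.injective (this.trans (ContinuousLinearMap.map_zero _).symm)
  obtain ⟨χ, hχ, hp, hU, hH⟩ := exists_chart_of_injective h1 h2 (eventually_eventually_nhds.2 h)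
  refine ⟨χ, hχ, hp, fun q hq => hU hq, hH, fun q hq u => ?_⟩
  have h3 : χ =ᶠ[𝓝 q] fun q => G (Z q) := by
    filter_upwards [χ.open_source.mem_nhds hq] with q' hq' using hH q' hq'
  rw [dchart, h3.mfderiv_eq]
  exact mfderiv_comp_euc (hU hq).self_of_nhds.smooth hG.contDiffAt u

theorem contDiff_toLp_cons {E : Type*} [NormedAddCommGroup E] [NormedSpace ℝ E] {n : ℕ}
    {a : E → ℝ} {b : E → Fin n → ℝ} (ha : ContDiff ℝ ∞ a) (hb : ∀ i, ContDiff ℝ ∞ fun z => b z i) :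
    ContDiff ℝ ∞ (fun z => (WithLp.toLp 2 (Fin.cons (a z) (b z)) : Euc (n + 1))) := by
  rw [contDiff_euclidean]
  intro i
  refine Fin.cases ?_ (fun j => ?_) i
  · simpa using ha
  · simpa using hb j

/-- The coordinates on an `A_2`-front in which it is the standard cusp. -/
def cuspCoord (m : ℕ) (z : Euc (m + 2)) : Euc (m + 1) :=
  WithLp.toLp 2 (Fin.cons (-z (Fin.last (m + 1))) (fun i : Fin m => z i.succ.castSucc))

theorem contDiff_cuspCoord : ContDiff ℝ ∞ (cuspCoord m) :=
  contDiff_toLp_cons (contDiff_coord _).neg fun _ => contDiff_coord _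

theorem fderiv_cuspCoord_zero (z v : Euc (m + 2)) :
    fderiv ℝ (cuspCoord m) z v 0 = -v (Fin.last (m + 1)) := by
  rw [fderiv_euc_apply (contDiff_cuspCoord.differentiable (by simp) z)]
  have h2 : HasFDerivAt (fun y => cuspCoord m y 0) _ z := (hasFDerivAt_coord (Fin.last (m + 1)) z).neg
  rw [h2.fderiv]; rfl

theorem fderiv_cuspCoord_succ (z v : Euc (m + 2)) (i : Fin m) :
    fderiv ℝ (cuspCoord m) z v i.succ = v i.succ.castSucc := by
  rw [fderiv_euc_apply (contDiff_cuspCoord.differentiable (by simp) z)]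
  have h2 : HasFDerivAt (fun y => cuspCoord m y i.succ) _ z := hasFDerivAt_coord i.succ.castSucc z
  rw [h2.fderiv]; rfl

/-- On `P' = 0` the variable with index `0` is `-3 z_d²`, which turns `P` into `-2 z_d³`. The
coordinate `t = -z_d` gives the standard cusp, hence the sign in `cuspCoord`. -/
theorem morinForm_two_eq_cuspForm {z : Euc (m + 2)} (hz : morinPoly' m 2 z = 0) :
    morinForm (m + 1) 2 z = cuspForm m (cuspCoord m z) := by
  rw [morinPoly'_two] at hz
  have h0 : z 0 = -3 * z (Fin.last (m + 1)) ^ 2 := by linarith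
  ext i
  refine Fin.cases ?_ (fun i => Fin.cases ?_ (fun j => ?_) i) i
  · rw [morinForm_zero, morinPoly_two, h0]
    simp [cuspForm, cuspCoord]
    ring
  · rw [morinForm_succ]
    simp [cuspForm, cuspCoord, h0]
  · rw [morinForm_succ]
    simp [cuspForm, cuspCoord]

/-- Coordinates of a front near an `A_k`-point, `k ≥ 3`, the first of which defines the singular
set. -/
def foldCoord (m k : ℕ) (z : Euc (m + 2)) : Euc (m + 1) :=
  WithLp.toLp 2 (Fin.cons (morinPoly'' m k z) (fun i : Fin m => z i.succ.succ))

theorem contDiff_foldCoord : ContDiff ℝ ∞ (foldCoord m k) :=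
  contDiff_toLp_cons contDiff_morinPoly'' fun _ => contDiff_coord _

theorem fderiv_foldCoord_zero (z v : Euc (m + 2)) :
    fderiv ℝ (foldCoord m k) z v 0 = fderiv ℝ (morinPoly'' m k) z v :=
  fderiv_euc_apply (contDiff_foldCoord.differentiable (by simp) z) v 0

theorem fderiv_foldCoord_succ (z v : Euc (m + 2)) (i : Fin m) :
    fderiv ℝ (foldCoord m k) z v i.succ = v i.succ.succ := by
  rw [fderiv_euc_apply (contDiff_foldCoord.differentiable (by simp) z)]
  have h2 : HasFDerivAt (fun y => foldCoord m k y i.succ) _ z := hasFDerivAt_coord i.succ.succ z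
  rw [h2.fderiv]; rfl

/-- The derivative of `P''` along the kernel. The summands with index `0` and `1` are at most
quadratic in the last variable of `P`, so only the leading power survives. It serves to locate
`A₂`-points near an `A_k`-point. -/
theorem fderiv_morinPoly''_eLast {z : Euc (m + 2)} (hk : 3 ≤ k)
    (hz : ∀ i : Fin (m + 1), 2 ≤ i.val → z i.castSucc = 0) :
    fderiv ℝ (morinPoly'' m k) z (eLast (m + 1))
      = ((k : ℝ) + 1) * k * (k - 1) * z (Fin.last (m + 1)) ^ (k - 2) := by
  have h := fderiv_morin_sum (k := k) (fun i : Fin (m + 1) => ((i.val : ℝ) + 1) * i.val)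
    (fun i : Fin (m + 1) => i.val - 1) (((k : ℝ) + 1) * k) (k - 1) z (eLast (m + 1))
  unfold morinPoly''
  rw [h, eLast_last, Finset.sum_eq_zero]
  · rw [Nat.cast_sub (by omega), show k - 1 - 1 = k - 2 by omega]
    simp
  · intro i _
    rw [eLast_castSucc]
    rcases Nat.lt_or_ge i.val 2 with h2 | h2
    · have : i.val = 0 ∨ i.val = 1 := by omega
      rcases this with h3 | h3 <;> simp [h3]
    · simp [hz i h2]

/-- A curve in the singular set whose velocity at `p` is a nonzero vector in the kernel of `df`. -/
def HasSingularKernelCurve (f : M → N) (p : M) : Prop :=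
  ∃ c : ℝ → M, c 0 = p ∧ MDifferentiableAt 𝓘(ℝ, ℝ) (𝓡 (m + 1)) c 0 ∧
    velocity (d := m + 1) c 0 ≠ 0 ∧
    mfderiv (𝓡 (m + 1)) (𝓡 (m + 2)) f (c 0) (velocity (d := m + 1) c 0) = 0 ∧
    ∀ᶠ s in 𝓝 (0 : ℝ), c s ∈ singularSet (m + 1) (m + 2) f

end FrontCharts

/-! ### Telling cusps from higher singularities by curves in the singular set -/

section Gates

variable {m k : ℕ}
  {M : Type u} [TopologicalSpace M] [ChartedSpace (Euc (m + 1)) M] [IsManifold (𝓡 (m + 1)) ∞ M]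
  {N : Type v} [TopologicalSpace N] [ChartedSpace (Euc (m + 2)) N] [IsManifold (𝓡 (m + 2)) ∞ N]
  {W : Type w} [TopologicalSpace W] [ChartedSpace (Euc (m + 2)) W] [IsManifold (𝓡 (m + 2)) ∞ W]
  {f : M → N}

theorem contDiff_cuspForm : ContDiff ℝ ∞ (cuspForm m) :=
  contDiff_toLp_cons (contDiff_const.mul ((contDiff_coord 0).pow 3)) fun i => by
    refine Fin.cases ?_ (fun j => ?_) i
    · exact contDiff_const.mul ((contDiff_coord 0).pow 2)
    · exact contDiff_coord j.succ

theorem fderiv_cuspForm_one (x v : Euc (m + 1)) :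
    fderiv ℝ (cuspForm m) x v 1 = -6 * x 0 * v 0 := by
  rw [fderiv_euc_apply (contDiff_cuspForm.differentiable (by simp) x)]
  have h2 : HasFDerivAt (fun y => cuspForm m y 1) _ x :=
    ((hasFDerivAt_coord 0 x).pow 2).const_mul (-3)
  rw [h2.fderiv]
  simp
  ring

theorem fderiv_cuspForm_succ (x v : Euc (m + 1)) (i : Fin m) :
    fderiv ℝ (cuspForm m) x v i.succ.succ = v i.succ := by
  rw [fderiv_euc_apply (contDiff_cuspForm.differentiable (by simp) x)]
  have h2 : HasFDerivAt (fun y => cuspForm m y i.succ.succ) _ x := hasFDerivAt_coord i.succ x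
  rw [h2.fderiv]; rfl

theorem eq_zero_of_fderiv_cuspForm {x v : Euc (m + 1)} (h : fderiv ℝ (cuspForm m) x v = 0)
    (h0 : v 0 = 0) : v = 0 := by
  ext i
  refine Fin.cases h0 (fun j => ?_) i
  rw [← fderiv_cuspForm_succ x v j, h]; rfl

/-- In cusp coordinates the singular set is the hyperplane `x₀ = 0`, while the kernel of the
derivative there is the `x₀`-axis. A velocity in both is zero. -/
theorem not_hasSingularKernelCurve (hf : ContMDiff (𝓡 (m + 1)) (𝓡 (m + 2)) ∞ f) {p : M}
    (h : IsRightLeftEquivAt (a := m + 1) (b := m + 2) f p (cuspForm m)) :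
    ¬ HasSingularKernelCurve (m := m) f p := by
  rintro ⟨c, rfl, hc, hv, hv0, hS⟩
  obtain ⟨φ, hφ, ψ, hψ, hp, hfp, hp0, -, hform⟩ := h
  have key : ∀ᶠ q in 𝓝 (c 0), q ∈ φ.source ∧ ∀ u, fderiv ℝ (cuspForm m) (φ q) (dchart φ q u)
      = dchart ψ (f q) (mfderiv (𝓡 (m + 1)) (𝓡 (m + 2)) f q u) := by
    filter_upwards [eventually_eventually_nhds.2 hform, φ.open_source.mem_nhds hp] with q hq hqs
    refine ⟨hqs, fun u => ?_⟩
    rw [← fderiv_chart_comp hφ hψ hqs hq.self_of_nhds.1 (hf q)]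
    have h4 : ∀ᶠ x in 𝓝 (φ q), φ.symm x ∈ {y | f y ∈ ψ.source ∧ ψ (f y) = cuspForm m (φ y)} := by
      apply (φ.symm.continuousAt (by simpa using φ.map_source hqs)).eventually_mem
      rw [φ.left_inv hqs]
      exact hq
    have h3 : (fun x => ψ (f (φ.symm x))) =ᶠ[𝓝 (φ q)] cuspForm m := by
      filter_upwards [h4, φ.open_target.mem_nhds (φ.map_source hqs)] with x hx hx2
      rw [hx.2, φ.right_inv hx2]
    rw [h3.fderiv_eq]
  have hzero : ∀ᶠ s in 𝓝 (0 : ℝ), φ (c s) 0 = 0 := by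
    filter_upwards [hS, hc.continuousAt.eventually key] with s hs ⟨h1, h2⟩
    by_contra hne
    apply hs
    rw [injective_iff_map_eq_zero]
    intro u hu
    have h3 := h2 u
    rw [hu] at h3
    replace h3 := h3.trans (ContinuousLinearMap.map_zero _)
    have h4 := fderiv_cuspForm_one (φ (c s)) (dchart φ (c s) u)
    rw [h3] at h4
    have h5 : dchart φ (c s) u 0 = 0 := by
      have : -6 * φ (c s) 0 ≠ 0 := mul_ne_zero (by norm_num) hne
      exact (mul_eq_zero.1 h4.symm).resolve_left this
    exact dchart_injective hφ h1 ((eq_zero_of_fderiv_cuspForm h3 h5).trans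
      (ContinuousLinearMap.map_zero _).symm)
  obtain ⟨h1, h2⟩ := key.self_of_nhds
  have h3 := h2 (velocity (d := m + 1) c 0)
  rw [hv0] at h3
  replace h3 := h3.trans (ContinuousLinearMap.map_zero _)
  apply hv
  refine dchart_injective hφ h1 ((eq_zero_of_fderiv_cuspForm h3 ?_).trans
      (ContinuousLinearMap.map_zero _).symm)
  rw [dchart_velocity hφ h1 hc]
  have hd : DifferentiableAt ℝ (fun s => φ (c s)) 0 :=
    (((Atlas.mdifferentiable hφ).mdifferentiableAt hp).comp 0 hc).differentiableAt
  have h4 := ((EuclideanSpace.proj 0 : Euc (m + 1) →L[ℝ] ℝ).hasFDerivAt).comp_hasDerivAt 0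
    hd.hasDerivAt
  have h5 : (fun s => φ (c s) 0) =ᶠ[𝓝 0] fun _ => 0 := hzero
  have h6 := h5.deriv_eq
  rw [deriv_const] at h6
  exact h4.deriv.symm.trans h6

theorem isRightLeftEquivAt_cuspForm {Z : M → Euc (m + 2)}
    {ψ : OpenPartialHomeomorph N (Euc (m + 2))} (hψ : ψ ∈ Atlas (m + 2) N) {p : M}
    (h : ∀ᶠ q in 𝓝 p, IsFrontForm f 2 Z ψ q) (hZ : Z p = 0) :
    IsRightLeftEquivAt (a := m + 1) (b := m + 2) f p (cuspForm m) ∧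
    ∃ χ ∈ Atlas (m + 1) M, p ∈ χ.source ∧
      (∀ q ∈ χ.source, ∀ᶠ q' in 𝓝 q, IsFrontForm f 2 Z ψ q') ∧
      (∀ q ∈ χ.source, χ q = cuspCoord m (Z q)) ∧
      ∀ q ∈ χ.source, ∀ u, dchart χ q u
        = fderiv ℝ (cuspCoord m) (Z q) (mfderiv (𝓡 (m + 1)) (𝓡 (m + 2)) Z q u) := by
  have hc := exists_frontChart h (contDiff_cuspCoord) (by
    intro v hv hv'
    rw [hZ, fderiv_morinPoly'_zero le_rfl] at hv
    ext i
    refine Fin.lastCases ?_ (fun i => Fin.cases hv (fun j => ?_) i) i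
    · have := fderiv_cuspCoord_zero (Z p) v
      rw [hv'] at this
      exact (neg_eq_zero.1 this.symm)
    · rw [← fderiv_cuspCoord_succ (Z p), hv']; rfl)
  refine ⟨?_, hc⟩
  obtain ⟨χ, hχ, hp, hform, heq, -⟩ := hc
  have h0 : cuspCoord m (Z p) = 0 := by
    rw [hZ]
    ext i
    refine Fin.cases ?_ (fun j => ?_) i <;> simp [cuspCoord]
  have hpf := h.self_of_nhds
  refine ⟨χ, hχ, ψ, hψ, hp, hpf.mem_source, (heq p hp).trans h0, ?_, ?_⟩
  · rw [hpf.form, morinForm_two_eq_cuspForm hpf.singular, h0]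
    ext i
    refine Fin.cases ?_ (fun i => Fin.cases ?_ (fun j => ?_) i) i <;> simp [cuspForm]
  · filter_upwards [h, χ.open_source.mem_nhds hp] with q hq hqs
    exact ⟨hq.mem_source, by rw [hq.form, morinForm_two_eq_cuspForm hq.singular, heq q hqs]⟩

/-- At the origin the hypersurface `P' = 0` has tangent space `v 0 = 0`. On it the fold coordinates
have differentials `2 v 1, v 2, …`, which are independent. -/
theorem exists_foldChart {Z : M → Euc (m + 2)} (hk : 3 ≤ k) (hkm : k ≤ m + 2)
    {ψ : OpenPartialHomeomorph N (Euc (m + 2))} {p : M}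
    (h : ∀ᶠ q in 𝓝 p, IsFrontForm f k Z ψ q) (hZ : Z p = 0) :
    ∃ χ ∈ Atlas (m + 1) M, p ∈ χ.source ∧
      (∀ q ∈ χ.source, ∀ᶠ q' in 𝓝 q, IsFrontForm f k Z ψ q') ∧
      (∀ q ∈ χ.source, χ q = foldCoord m k (Z q)) ∧
      ∀ q ∈ χ.source, ∀ u, dchart χ q u
        = fderiv ℝ (foldCoord m k) (Z q) (mfderiv (𝓡 (m + 1)) (𝓡 (m + 2)) Z q u) := by
  refine exists_frontChart h contDiff_foldCoord ?_
  intro v hv hv'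
  obtain ⟨m, rfl⟩ : ∃ n, m = n + 1 := ⟨m - 1, by omega⟩
  rw [hZ, fderiv_morinPoly'_zero (by omega)] at hv
  ext i
  refine Fin.cases hv (fun i => Fin.cases ?_ (fun j => ?_) i) i
  · have := fderiv_foldCoord_zero (k := k) (Z p) v
    rw [hv', hZ, fderiv_morinPoly''_zero hk (by omega)] at this
    have h2 : v 1 = 0 := by
      have : (0 : ℝ) = 2 * v 1 := this
      linarith
    exact h2
  · rw [← fderiv_foldCoord_succ (k := k) (Z p), hv']; rfl

theorem foldCoord_zero (hk : 3 ≤ k) : foldCoord m k 0 = 0 := by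
  ext i
  refine Fin.cases ?_ (fun j => ?_) i
  · have : (0 : ℝ) ^ (k - 1) = 0 := by apply zero_pow; omega
    simp [foldCoord, morinPoly'', this]
  · simp [foldCoord]

/-- For `k ≥ 3` the kernel direction at the centre is tangent to `P'' = 0`. The last axis in the
fold coordinates is the required curve. -/
theorem hasSingularKernelCurve_of_frontForm (hf : ContMDiff (𝓡 (m + 1)) (𝓡 (m + 2)) ∞ f)
    {Z : M → Euc (m + 2)} (hk : 3 ≤ k) (hkm : k ≤ m + 2)
    {ψ : OpenPartialHomeomorph N (Euc (m + 2))} (hψ : ψ ∈ Atlas (m + 2) N) {p : M}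
    (h : ∀ᶠ q in 𝓝 p, IsFrontForm f k Z ψ q) (hZ : Z p = 0) :
    HasSingularKernelCurve (m := m) f p := by
  obtain ⟨χ, hχ, hp, hform, heq, hd⟩ := exists_foldChart hk hkm h hZ
  -- The bounds `3 ≤ k ≤ m + 2` force `m ≥ 1`, so the last fold coordinate differs from the first
  -- one, which is `P''`.
  obtain ⟨m, rfl⟩ : ∃ n, m = n + 1 := ⟨m - 1, by omega⟩
  have hχp : χ p = 0 := by rw [heq p hp, hZ, foldCoord_zero hk]
  have hx : ContDiff ℝ ∞ (fun s : ℝ => s • eLast (m + 1)) := contDiff_id.smul contDiff_const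
  have hx0 : (0 : ℝ) • eLast (m + 1) ∈ χ.target := by
    rw [zero_smul, ← hχp]; exact χ.map_source hp
  have hc0 : χ.symm ((0 : ℝ) • eLast (m + 1)) = p := by
    rw [zero_smul, ← hχp, χ.left_inv hp]
  have hc := (contMDiffAt_symm_curve le_rfl hχ hx0 hx.contDiffAt).mdifferentiableAt (by simp)
  have hmem : ∀ᶠ s in 𝓝 (0 : ℝ), s • eLast (m + 1) ∈ χ.target :=
    hx.continuous.continuousAt.eventually (χ.open_target.mem_nhds hx0)
  have hps : χ.symm ((0 : ℝ) • eLast (m + 1)) ∈ χ.source := by rw [hc0]; exact hp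
  have hvel := dchart_velocity hχ hps hc
  have h1 : (fun s : ℝ => χ (χ.symm (s • eLast (m + 1)))) =ᶠ[𝓝 0] fun s => s • eLast (m + 1) := by
    filter_upwards [hmem] with s hs using χ.right_inv hs
  have h2 : deriv (fun s : ℝ => s • eLast (m + 1)) 0 = eLast (m + 1) := by
    simpa using ((hasDerivAt_id' (0 : ℝ)).smul_const (eLast (m + 1))).deriv
  rw [h1.deriv_eq, h2] at hvel
  refine ⟨fun s => χ.symm (s • eLast (m + 1)), hc0, hc, ?_, ?_, ?_⟩
  · intro h0
    rw [h0] at hvel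
    have h3 := congrArg (fun x : Euc (m + 2) => x (Fin.last (m + 1)))
      (hvel.symm.trans (ContinuousLinearMap.map_zero _))
    simp only [eLast_last] at h3
    exact one_ne_zero h3
  · have hq := hform _ hps
    have hZq : Z (χ.symm ((0 : ℝ) • eLast (m + 1))) = 0 := by rw [hc0, hZ]
    rw [hd _ hps] at hvel
    set u := velocity (d := m + 1 + 1) (fun s : ℝ => χ.symm (s • eLast (m + 1))) 0
    rw [mfderiv_eq_zero_iff_frontForm hψ hq (hf _)]
    have h3 := fderiv_morinPoly'_frontForm hq u
    let V : Euc (m + 1 + 2) :=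
      mfderiv (𝓡 (m + 1 + 1)) (𝓡 (m + 1 + 2)) Z (χ.symm ((0 : ℝ) • eLast (m + 1))) u
    change fderiv ℝ (foldCoord (m + 1) k) _ V = _ at hvel
    change fderiv ℝ (morinPoly' (m + 1) k) _ V = _ at h3
    rw [hZq] at h3 hvel
    rw [fderiv_morinPoly'_zero (by omega)] at h3
    have hsucc : ∀ j : Fin (m + 1), V j.succ.succ = eLast (m + 1) j.succ := fun j => by
      rw [← fderiv_foldCoord_succ (k := k) 0 V j, hvel]
    refine ⟨1, ?_⟩
    rw [one_smul]
    change V = _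
    ext i
    refine Fin.cases ?_ (fun i => Fin.cases ?_ (fun j => ?_) i) i
    · rw [h3]
      exact (eLast_castSucc (m := m + 2) 0).symm
    · have h4 := fderiv_foldCoord_zero (k := k) 0 V
      rw [hvel, fderiv_morinPoly''_zero hk (by omega)] at h4
      have h5 : eLast (m + 1) 0 = 0 := eLast_castSucc (m := m + 1) 0
      rw [h5] at h4
      have h6 : V 1 = 0 := by linarith
      refine h6.trans ?_
      exact (eLast_castSucc (m := m + 2) 1).symm
    · rw [hsucc]
      refine Fin.lastCases ?_ (fun i => ?_) j
      · rw [Fin.succ_last, Fin.succ_last, eLast_last]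
        exact (eLast_last (m := m + 2)).symm
      · rw [Fin.succ_castSucc, Fin.succ_castSucc, eLast_castSucc]
        exact (eLast_castSucc (m := m + 2) _).symm
  · filter_upwards [hmem] with s hs
    have hss := χ.map_target hs
    rw [mem_singularSet_iff_frontForm (by omega) hψ (hform _ hss) (hf _)]
    have h3 := heq _ hss
    rw [χ.right_inv hs] at h3
    have h4 := congrArg (fun x : Euc (m + 2) => x 0) h3
    simpa [foldCoord] using h4.symm

end Gates

/-! ### Convex coordinate balls with a gate -/

section GateCharts

variable {m k : ℕ}
  {M : Type u} [TopologicalSpace M] [ChartedSpace (Euc (m + 1)) M] [IsManifold (𝓡 (m + 1)) ∞ M]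
  {N : Type v} [TopologicalSpace N] [ChartedSpace (Euc (m + 2)) N] [IsManifold (𝓡 (m + 2)) ∞ N]
  {W : Type w} [TopologicalSpace W] [ChartedSpace (Euc (m + 2)) W] [IsManifold (𝓡 (m + 2)) ∞ W]
  {f : M → N}

/-- Charts with convex image are wanted because path classes inside them are then unique. -/
theorem exists_ball_chart {a : ℕ} {X : Type*} [TopologicalSpace X] [ChartedSpace (Euc a) X]
    [IsManifold (𝓡 a) ∞ X] {χ : OpenPartialHomeomorph X (Euc a)} (hχ : χ ∈ Atlas a X) {p : X}
    (hp : p ∈ χ.source) {U : Set X} (hU : U ∈ 𝓝 p) :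
    ∃ χ' ∈ Atlas a X, p ∈ χ'.source ∧ χ'.source ⊆ χ.source ∩ U ∧ (∀ q, χ' q = χ q) ∧
      ∃ r > 0, χ'.target = Metric.ball (χ p) r := by
  have h1 : χ.target ∩ χ.symm ⁻¹' U ∈ 𝓝 (χ p) := by
    refine inter_mem (χ.open_target.mem_nhds (χ.map_source hp)) ?_
    apply (χ.symm.continuousAt (by simpa using χ.map_source hp))
    rwa [χ.left_inv hp]
  obtain ⟨r, hr, hball⟩ := Metric.mem_nhds_iff.1 h1
  -- Restricting the inverse cuts the target, not the source, down to a ball.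
  let χ' := (χ.symm.restrOpen (Metric.ball (χ p) r) Metric.isOpen_ball).symm
  have hs : χ'.source = χ.source ∩ χ ⁻¹' Metric.ball (χ p) r := by
    simp [χ', OpenPartialHomeomorph.restrOpen]
  have ht : χ'.target = Metric.ball (χ p) r := by
    simp only [χ', OpenPartialHomeomorph.symm_target, OpenPartialHomeomorph.restrOpen_source,
      OpenPartialHomeomorph.symm_source]
    exact inter_eq_right.2 fun x hx => (hball hx).1
  refine ⟨χ', ?_, ?_, ?_, fun q => rfl, r, hr, ht⟩
  · refine χ'.mem_maximalAtlas_of_contMDiffOn ?_ ?_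
    · exact (contMDiffOn_of_mem_maximalAtlas hχ).mono fun x hx => (hs ▸ hx).1
    · exact (contMDiffOn_symm_of_mem_maximalAtlas hχ).mono fun x hx => (hball (ht ▸ hx)).1
  · rw [hs]; exact ⟨hp, Metric.mem_ball_self hr⟩
  · rw [hs]
    rintro x ⟨hx, hx'⟩
    refine ⟨hx, ?_⟩
    have := (hball hx').2
    rwa [mem_preimage, χ.left_inv hx] at this

/-- The singular set of `f` in the chart `χ` is a hyperplane, and `q` is an `A_2`-point at which
the kernel of `df` is transverse to it. -/
structure IsGate (f : M → N) (χ : OpenPartialHomeomorph M (Euc (m + 1))) (q : M) : Prop where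
  mem_source : q ∈ χ.source
  singular : ∀ p ∈ χ.source, p ∈ singularSet (m + 1) (m + 2) f ↔ χ p 0 = 0
  cusp : IsRightLeftEquivAt (a := m + 1) (b := m + 2) f q (cuspForm m)
  transverse : ∃ u, mfderiv (𝓡 (m + 1)) (𝓡 (m + 2)) f q u = 0 ∧ dchart χ q u 0 ≠ 0

theorem not_hasSingularKernelCurve_of_chart {χ : OpenPartialHomeomorph M (Euc (m + 1))}
    (hχ : χ ∈ Atlas (m + 1) M) {q : M} (hq : q ∈ χ.source)
    (hS : ∀ p ∈ χ.source, p ∈ singularSet (m + 1) (m + 2) f → χ p 0 = 0)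
    (ht : ∀ u, mfderiv (𝓡 (m + 1)) (𝓡 (m + 2)) f q u = 0 → dchart χ q u 0 = 0 → u = 0) :
    ¬ HasSingularKernelCurve (m := m) f q := by
  rintro ⟨c, rfl, hc, hv, hv0, hSc⟩
  refine hv (ht _ hv0 ?_)
  rw [dchart_velocity hχ hq hc]
  have hd : DifferentiableAt ℝ (fun s => χ (c s)) 0 :=
    (((Atlas.mdifferentiable hχ).mdifferentiableAt hq).comp 0 hc).differentiableAt
  have h4 := ((EuclideanSpace.proj 0 : Euc (m + 1) →L[ℝ] ℝ).hasFDerivAt).comp_hasDerivAt 0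
    hd.hasDerivAt
  have h5 : (fun s => χ (c s) 0) =ᶠ[𝓝 0] fun _ => 0 := by
    filter_upwards [hSc, hc.continuousAt.eventually (χ.open_source.mem_nhds hq)] with s h1 h2
    exact hS _ h2 h1
  have h6 := h5.deriv_eq
  rw [deriv_const] at h6
  exact h4.deriv.symm.trans h6

variable {F : W → N} {ι : M → W}

/-- Reads the Morin type of `F` off `f` alone: singularity excludes `k = 1`, and the absence of a
kernel curve excludes `k ≥ 3`. -/
theorem MorinExtension.cusp_of_not_curve (h : MorinExtension (m := m) f F ι)
    (hf : ContMDiff (𝓡 (m + 1)) (𝓡 (m + 2)) ∞ f) {q : M}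
    (hq : q ∈ singularSet (m + 1) (m + 2) f) (hcurve : ¬ HasSingularKernelCurve (m := m) f q) :
    ∃ φ ψ, φ (ι q) = 0 ∧ IsMorinChart (m := m) F ι q 2 φ ψ := by
  obtain ⟨k, φ, ψ, hk1, hk2, h0, hc⟩ := h.exists_chart q
  have hform := h.eventually_frontForm hc
  rcases Nat.lt_or_ge k 2 with h2 | h2
  · obtain rfl : k = 1 := by omega
    exact absurd hq (not_mem_singularSet_frontForm hc.right_mem hform (hf q))
  · rcases Nat.lt_or_ge 2 k with h3 | h3
    · exact absurd (hasSingularKernelCurve_of_frontForm hf h3 hk2 hc.right_mem hform h0) hcurve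
    · obtain rfl : k = 2 := by omega
      exact ⟨φ, ψ, h0, hc⟩

/-- Every point of a Morin front has arbitrarily small convex coordinate balls which consist of
regular points or contain a gate. -/
theorem MorinExtension.exists_gate_chart (h : MorinExtension (m := m) f F ι)
    (hf : ContMDiff (𝓡 (m + 1)) (𝓡 (m + 2)) ∞ f) (p : M) {U : Set M} (hU : U ∈ 𝓝 p) :
    ∃ χ ∈ Atlas (m + 1) M, p ∈ χ.source ∧ χ.source ⊆ U ∧
      (∃ x r, χ.target = Metric.ball x r) ∧
      ((∀ q ∈ χ.source, q ∉ singularSet (m + 1) (m + 2) f) ∨ ∃ q, IsGate f χ q) := by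
  obtain ⟨k, φ, ψ, hk1, hk2, h0, hc⟩ := h.exists_chart p
  have hform := h.eventually_frontForm hc
  have key : ∀ {χ : OpenPartialHomeomorph M (Euc (m + 1))} {q : M}, q ∈ χ.source →
      2 ≤ k → (∀ᶠ q' in 𝓝 q, IsFrontForm f k (fun q => φ (ι q)) ψ q') →
      morinPoly'' m k (φ (ι q)) = 0 → ∃ u, mfderiv (𝓡 (m + 1)) (𝓡 (m + 2)) f q u = 0 ∧
        mfderiv (𝓡 (m + 1)) (𝓡 (m + 2)) (fun q => φ (ι q)) q u = eLast (m + 1) := by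
    intro χ q hq hk hfq hq0
    have hL : fderiv ℝ (morinPoly' m k) (φ (ι q)) ≠ 0 := by
      intro h2
      have h3 := fderiv_morinPoly'_single_zero (m := m) hk (φ (ι q))
      rw [h2] at h3
      exact zero_ne_one h3
    obtain ⟨u, hu⟩ := exists_mfderiv_frontForm hfq hL ((fderiv_morinPoly'_eLast _).trans hq0)
    exact ⟨u, (mfderiv_eq_zero_iff_frontForm hc.right_mem hfq (hf q) u).2
      ⟨1, by rw [one_smul]; exact hu⟩, hu⟩
  have hdch : ∀ {χ χ' : OpenPartialHomeomorph M (Euc (m + 1))}, (∀ q, χ' q = χ q) →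
      ∀ q u, dchart χ' q u = dchart χ q u := by
    intro χ χ' hχ q u
    rw [dchart, dchart, show (χ' : M → Euc (m + 1)) = χ from funext hχ]
  rcases Nat.lt_or_ge k 2 with hk | hk
  · obtain rfl : k = 1 := by omega
    have h3 : ∀ᶠ q in 𝓝 p, q ∈ U ∧ q ∉ singularSet (m + 1) (m + 2) f := by
      filter_upwards [hU, eventually_eventually_nhds.2 hform] with q hq hq'
      exact ⟨hq, not_mem_singularSet_frontForm hc.right_mem hq' (hf q)⟩
    obtain ⟨χ, hχ, hp, hs, -, r, -, hr⟩ := exists_ball_chart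
      (IsManifold.chart_mem_maximalAtlas (I := 𝓡 (m + 1)) (n := ∞) p) (mem_chart_source _ p) h3
    exact ⟨χ, hχ, hp, fun x hx => (hs hx).2.1, ⟨_, r, hr⟩, Or.inl fun q hq => (hs hq).2.2⟩
  rcases Nat.lt_or_ge 2 k with hk3 | hk3
  -- For `k ≥ 3` the centre itself is not a gate, since the kernel there is tangent to the singular
  -- set; a nearby point has to be found.
  · obtain ⟨χ₀, hχ₀, hp₀, hform₀, heq₀, hd₀⟩ := exists_foldChart hk3 hk2 hform h0
    obtain ⟨χ, hχ, hp, hs, heq, r, hr, htar⟩ := exists_ball_chart hχ₀ hp₀ hU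
    have hχ₀p : χ₀ p = 0 := by rw [heq₀ p hp₀, h0, foldCoord_zero hk3]
    have hsing : ∀ q ∈ χ.source, q ∈ singularSet (m + 1) (m + 2) f ↔ χ q 0 = 0 := by
      intro q hq
      rw [mem_singularSet_iff_frontForm hk hc.right_mem (hform₀ q (hs hq).1) (hf q), heq,
        heq₀ q (hs hq).1]
      rfl
    obtain ⟨m, rfl⟩ : ∃ n, m = n + 1 := ⟨m - 1, by omega⟩
    have hy : (r / 2) • eLast (m + 1) ∈ χ.target := by
      rw [htar, hχ₀p, mem_ball_zero_iff, norm_smul, PiLp.norm_single]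
      simp [abs_of_pos hr, hr]
    -- Moving along the last axis keeps `P'' = 0` and the variables with index `2, …` before the
    -- last equal to zero, while the last variable becomes `r / 2`. There the derivative of `P''`
    -- along the kernel is nonzero.
    set q := χ.symm ((r / 2) • eLast (m + 1)) with hqdef
    have hq : q ∈ χ.source := χ.map_target hy
    have hq₀ := (hs hq).1
    have hχq : foldCoord (m + 1) k (φ (ι q)) = (r / 2) • eLast (m + 1) := by
      rw [← heq₀ q hq₀, ← heq, hqdef, χ.right_inv hy]
    have hlast : φ (ι q) (Fin.last (m + 2)) = r / 2 := by
      have := congrArg (fun x : Euc (m + 2) => x (Fin.last (m + 1))) hχq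
      simpa [foldCoord, ← Fin.succ_last] using this
    have hother : ∀ i : Fin (m + 2), 2 ≤ i.val → φ (ι q) i.castSucc = 0 := by
      intro i hi
      obtain ⟨j, rfl⟩ : ∃ j : Fin m, i = j.succ.succ :=
        ⟨⟨i.val - 2, by omega⟩, by ext; simp; omega⟩
      have := congrArg (fun x : Euc (m + 2) => x j.castSucc.succ) hχq
      simp only [foldCoord, Fin.cons_succ] at this
      refine this.trans ?_
      rw [Fin.succ_castSucc]
      simp
    have hP3 : fderiv ℝ (morinPoly'' (m + 1) k) (φ (ι q)) (eLast (m + 2)) ≠ 0 := by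
      rw [fderiv_morinPoly''_eLast hk3 hother, hlast]
      have h4 : (3 : ℝ) ≤ k := by exact_mod_cast hk3
      have h5 : (0 : ℝ) < (k : ℝ) - 1 := by linarith
      positivity
    have hqS : q ∈ singularSet (m + 1 + 1) (m + 1 + 2) f := by
      rw [hsing q hq, heq, heq₀ q hq₀, hχq]
      simp
    have hq0 := (mem_singularSet_iff_frontForm hk hc.right_mem (hform₀ q hq₀) (hf q)).1 hqS
    have hd1 : ∀ u (r : ℝ), mfderiv (𝓡 (m + 1 + 1)) (𝓡 (m + 1 + 2)) (fun q => φ (ι q)) q u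
        = (r • eLast (m + 2) : Euc (m + 1 + 2)) →
        dchart χ q u 0 = r * fderiv ℝ (morinPoly'' (m + 1) k) (φ (ι q)) (eLast (m + 2)) := by
      intro u r hu
      rw [hdch heq, hd₀ q hq₀, hu]
      refine (fderiv_foldCoord_zero _ _).trans ?_
      rw [map_smul, smul_eq_mul]
    -- The kernel is now transverse to the hyperplane `P'' = 0`, which leaves only the type `A₂` at
    -- `q`.
    have hcurve : ¬ HasSingularKernelCurve (m := m + 1) f q := by
      refine not_hasSingularKernelCurve_of_chart hχ hq (fun p hp => (hsing p hp).1) ?_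
      intro u hu hu'
      obtain ⟨r, hr⟩ := (mfderiv_eq_zero_iff_frontForm hc.right_mem (hform₀ q hq₀) (hf q) u).1 hu
      have h5 := hd1 u r hr
      rw [hu'] at h5
      have h6 := (mul_eq_zero.1 h5.symm).resolve_right hP3
      rw [h6, zero_smul] at hr
      exact (hform₀ q hq₀).self_of_nhds.injective (hr.trans (ContinuousLinearMap.map_zero _).symm)
    refine ⟨χ, hχ, hp, fun x hx => (hs hx).2, ⟨_, r, htar⟩, Or.inr ⟨q, hq, hsing, ?_, ?_⟩⟩
    · obtain ⟨φ', ψ', h0', hc'⟩ := h.cusp_of_not_curve hf hqS hcurve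
      exact (isRightLeftEquivAt_cuspForm hc'.right_mem (h.eventually_frontForm hc') h0').1
    · obtain ⟨u, hu, hu'⟩ := key hq hk (hform₀ q hq₀) hq0
      refine ⟨u, hu, ?_⟩
      rw [hd1 u 1 (by rw [one_smul]; exact hu'), one_mul]
      exact hP3
  · obtain rfl : k = 2 := by omega
    obtain ⟨hcusp, χ₀, hχ₀, hp₀, hform₀, heq₀, hd₀⟩ :=
      isRightLeftEquivAt_cuspForm hc.right_mem hform h0
    obtain ⟨χ, hχ, hp, hs, heq, r, hr, htar⟩ := exists_ball_chart hχ₀ hp₀ hU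
    refine ⟨χ, hχ, hp, fun x hx => (hs hx).2, ⟨_, r, htar⟩, Or.inr ⟨p, hp, ?_, hcusp, ?_⟩⟩
    · intro q hq
      rw [mem_singularSet_iff_frontForm hk hc.right_mem (hform₀ q (hs hq).1) (hf q), heq,
        heq₀ q (hs hq).1, morinPoly''_two]
      simp [cuspCoord]
    · obtain ⟨u, hu, hu'⟩ := key hp hk hform (by rw [h0, morinPoly''_two]; simp)
      refine ⟨u, hu, ?_⟩
      rw [hdch heq, hd₀ p hp₀, hu']
      refine fun h5 => ?_
      have := (fderiv_cuspCoord_zero (φ (ι p)) (eLast (m + 1))).symm.trans h5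
      rw [eLast_last] at this
      norm_num at this

end GateCharts

/-! ### Second derivative along the kernel, and the acceleration formula -/

section FoldCalculus

theorem two_le_infty : (2 : ℕ∞ω) ≤ ∞ := ENat.LEInfty.out

theorem one_add_one_le_infty : (1 : ℕ∞ω) + 1 ≤ ∞ := by
  rw [one_add_one_eq_two]; exact two_le_infty

variable {m k : ℕ}

/-- The first coordinate vector. -/
abbrev eFirst (m : ℕ) : Euc (m + 1) := EuclideanSpace.single 0 1

theorem fderiv_morinForm_eLast (z : Euc (m + 2)) :
    fderiv ℝ (morinForm (m + 1) k) z (eLast (m + 1)) = morinPoly' m k z • eFirst (m + 1) := by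
  ext i
  refine Fin.cases ?_ (fun j => ?_) i
  · rw [fderiv_morinForm_zero, fderiv_morinPoly]
    simp
  · rw [fderiv_morinForm_succ, eLast_castSucc]
    simp

theorem hasDerivAt_line {n : ℕ} (z e : Euc n) (s : ℝ) : HasDerivAt (fun s : ℝ => z + s • e) e s := by
  simpa using ((hasDerivAt_id' s).smul_const e).const_add z

theorem hasDerivAt_morinPoly'_line (z : Euc (m + 2)) :
    HasDerivAt (fun s : ℝ => morinPoly' m k (z + s • eLast (m + 1))) (morinPoly'' m k z) 0 := by
  have h := (contDiff_morinPoly' (m := m) (k := k)).differentiable (by simp) (z + (0 : ℝ) • eLast (m + 1))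
  have := h.hasFDerivAt.comp_hasDerivAt 0 (hasDerivAt_line z (eLast (m + 1)) 0)
  rw [fderiv_morinPoly'_eLast, zero_smul, add_zero] at this
  exact this

theorem differentiable_comp_fderiv_morinForm (L : Euc (m + 2) →L[ℝ] ℝ) :
    Differentiable ℝ fun y => L.comp (fderiv ℝ (morinForm (m + 1) k) y) := by
  have h1 : Differentiable ℝ (fderiv ℝ (morinForm (m + 1) k)) :=
    (contDiff_morinForm.fderiv_right one_add_one_le_infty).differentiable (by simp)
  exact (differentiable_const L).clm_comp h1

theorem fderiv_comp_fderiv_morinForm_eLast (L : Euc (m + 2) →L[ℝ] ℝ) (z : Euc (m + 2)) :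
    fderiv ℝ (fun y => L.comp (fderiv ℝ (morinForm (m + 1) k) y)) z (eLast (m + 1))
      (eLast (m + 1)) = morinPoly'' m k z * L (eFirst (m + 1)) := by
  set B : Euc (m + 2) → Euc (m + 2) →L[ℝ] ℝ :=
    fun y => L.comp (fderiv ℝ (morinForm (m + 1) k) y) with hB
  have h0 : HasFDerivAt B (fderiv ℝ B z) (z + (0 : ℝ) • eLast (m + 1)) := by
    rw [zero_smul, add_zero]
    exact (differentiable_comp_fderiv_morinForm (k := k) L z).hasFDerivAt
  have h1 : HasDerivAt (fun s : ℝ => B (z + s • eLast (m + 1))) (fderiv ℝ B z (eLast (m + 1))) 0 :=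
    HasFDerivAt.comp_hasDerivAt (l := B) 0 h0 (hasDerivAt_line z (eLast (m + 1)) 0)
  have h3 : HasDerivAt (fun s : ℝ => B (z + s • eLast (m + 1)) (eLast (m + 1)))
      (fderiv ℝ B z (eLast (m + 1)) (eLast (m + 1))) 0 := by
    simpa using h1.clm_apply (hasDerivAt_const (0 : ℝ) (eLast (m + 1)))
  have h2 := (hasDerivAt_morinPoly'_line (k := k) z).mul_const (L (eFirst (m + 1)))
  have h4 : (fun s : ℝ => B (z + s • eLast (m + 1)) (eLast (m + 1)))
      = fun s => morinPoly' m k (z + s • eLast (m + 1)) * L (eFirst (m + 1)) := by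
    funext s
    rw [hB, ContinuousLinearMap.comp_apply, fderiv_morinForm_eLast, map_smul, smul_eq_mul]
  rw [h4] at h3
  exact h3.unique h2

/-- The second derivatives, in a normal direction, of two Morin normal forms of the same map along
the kernels of their first derivatives have the same sign. -/
theorem morin_second_derivative_compare {k' : ℕ} {L : Euc (m + 2) →L[ℝ] ℝ}
    {Φ Ψ : Euc (m + 2) → Euc (m + 2)} {z : Euc (m + 2)} (hΦ : ContDiffAt ℝ ∞ Φ z)
    (hΨ : ContDiffAt ℝ ∞ Ψ (morinForm (m + 1) k z))
    (hev : ∀ᶠ x in 𝓝 z, morinForm (m + 1) k' (Φ x) = Ψ (morinForm (m + 1) k x))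
    (hP : morinPoly' m k z = 0)
    (hL : ∀ w, L (fderiv ℝ (morinForm (m + 1) k') (Φ z) w) = 0) :
    ∃ r : ℝ, L (fderiv ℝ Ψ (morinForm (m + 1) k z) (eFirst (m + 1))) * morinPoly'' m k z
      = r ^ 2 * (L (eFirst (m + 1)) * morinPoly'' m k' (Φ z)) := by
  have hF : ContDiff ℝ ∞ (morinForm (m + 1) k) := contDiff_morinForm
  have hF' : ContDiff ℝ ∞ (morinForm (m + 1) k') := contDiff_morinForm
  let e := eLast (m + 1)
  let x : ℝ → Euc (m + 2) := fun s => z + s • e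
  have hx0 : x 0 = z := by simp [x]
  have hx : ∀ s, HasDerivAt x e s := hasDerivAt_line z e
  have hxz : Tendsto x (𝓝 0) (𝓝 z) := by
    have := (hx 0).continuousAt
    rwa [ContinuousAt, hx0] at this
  have hΦ2 : ∀ᶠ y in 𝓝 z, ContDiffAt ℝ 2 Φ y :=
    (hΦ.of_le two_le_infty).eventually (by simp)
  have hΨ2 : ∀ᶠ y in 𝓝 (morinForm (m + 1) k z), ContDiffAt ℝ 2 Ψ y :=
    (hΨ.of_le two_le_infty).eventually (by simp)
  -- The function `u` is differentiated in two ways along the kernel line through `z`, once for each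
  -- normal form. Comparing the second derivatives at `0` gives the identity.
  let u : ℝ → ℝ := fun s => L (Ψ (morinForm (m + 1) k (x s)))
  let M : ℝ → ℝ := fun s => L (fderiv ℝ Ψ (morinForm (m + 1) k (x s)) (eFirst (m + 1)))
  have hu1 : ∀ᶠ s in 𝓝 (0 : ℝ), HasDerivAt u (morinPoly' m k (x s) * M s) s := by
    have h1 : Tendsto (fun s => morinForm (m + 1) k (x s)) (𝓝 0) (𝓝 (morinForm (m + 1) k z)) :=
      (hF.continuous.tendsto z).comp hxz
    filter_upwards [h1.eventually hΨ2] with s hs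
    have h2 := (hF.differentiable (by simp) (x s)).hasFDerivAt.comp_hasDerivAt s (hx s)
    have h3 := (hs.differentiableAt (by simp)).hasFDerivAt.comp_hasDerivAt s h2
    have h4 := L.hasFDerivAt.comp_hasDerivAt s h3
    rw [fderiv_morinForm_eLast, map_smul, map_smul, smul_eq_mul] at h4
    exact h4
  let B : Euc (m + 2) → Euc (m + 2) →L[ℝ] ℝ :=
    fun y => L.comp (fderiv ℝ (morinForm (m + 1) k') y)
  let w : ℝ → Euc (m + 2) := fun s => fderiv ℝ Φ (x s) e
  have hu2 : ∀ᶠ s in 𝓝 (0 : ℝ), HasDerivAt u (B (Φ (x s)) (w s)) s := by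
    filter_upwards [hxz.eventually hΦ2, hxz.eventually (eventually_eventually_nhds.2 hev)]
      with s hs hs2
    have h2 := (hs.differentiableAt (by simp)).hasFDerivAt.comp_hasDerivAt s (hx s)
    have h3 := (hF'.differentiable (by simp) (Φ (x s))).hasFDerivAt.comp_hasDerivAt s h2
    have h4 := L.hasFDerivAt.comp_hasDerivAt s h3
    refine HasDerivAt.congr_of_eventuallyEq h4 ?_
    filter_upwards [(hx s).continuousAt.eventually hs2] with s' hs'
    exact congrArg L hs'.symm
  have heq : (fun s => morinPoly' m k (x s) * M s) =ᶠ[𝓝 0] fun s => B (Φ (x s)) (w s) := by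
    filter_upwards [hu1, hu2] with s h1 h2 using h1.unique h2
  have hM : DifferentiableAt ℝ M 0 := by
    have h1 : ContDiffAt ℝ 1 (fderiv ℝ Ψ) (morinForm (m + 1) k (x 0)) := by
      rw [hx0]; exact hΨ.fderiv_right one_add_one_le_infty
    have h2 : DifferentiableAt ℝ (fun s => morinForm (m + 1) k (x s)) 0 :=
      (hF.differentiable (by simp) (x 0)).comp 0 (hx 0).differentiableAt
    have h3 : DifferentiableAt ℝ (fun s => fderiv ℝ Ψ (morinForm (m + 1) k (x s))) 0 :=
      (h1.differentiableAt (by simp)).comp 0 h2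
    exact L.differentiableAt.comp 0 (h3.clm_apply (differentiableAt_const _))
  have hD1 : HasDerivAt (fun s => morinPoly' m k (x s) * M s) (morinPoly'' m k z * M 0) 0 := by
    have := (hasDerivAt_morinPoly'_line (k := k) z).mul hM.hasDerivAt
    simp only [zero_smul, add_zero, hP, zero_mul] at this
    exact this
  have hBd : Differentiable ℝ B := differentiable_comp_fderiv_morinForm L
  -- The covector annihilates the image of the derivative, so the term containing `w'(0)` drops out
  -- of the second derivative.
  have hB0 : B (Φ z) = 0 := ContinuousLinearMap.ext fun w => hL w
  -- `Φ` carries the kernel of one derivative into the kernel of the other; both kernels lie on the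
  -- last axis.
  obtain ⟨r, hr⟩ : ∃ r : ℝ, w 0 = r • e := by
    have h1 : fderiv ℝ (morinForm (m + 1) k') (Φ z) (w 0) = 0 := by
      have h2 : HasFDerivAt (fun y => morinForm (m + 1) k' (Φ y)) _ z :=
        (hF'.differentiable (by simp) (Φ z)).hasFDerivAt.comp z
          (hΦ.differentiableAt (by simp)).hasFDerivAt
      have h3 : HasFDerivAt (fun y => Ψ (morinForm (m + 1) k y)) _ z :=
        (hΨ.differentiableAt (by simp)).hasFDerivAt.comp z
          (hF.differentiable (by simp) z).hasFDerivAt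
      have h4 := h2.unique (h3.congr_of_eventuallyEq hev)
      have h5 := DFunLike.congr_fun h4 e
      simp only [w, hx0]
      refine h5.trans ?_
      change fderiv ℝ Ψ _ (fderiv ℝ (morinForm (m + 1) k) z e) = 0
      rw [fderiv_morinForm_eLast, hP, zero_smul, map_zero]
    exact ⟨_, (fderiv_morinForm_eq_zero_iff.1 h1).1⟩
  have hD2 : HasDerivAt (fun s => B (Φ (x s)) (w s)) (fderiv ℝ B (Φ z) (w 0) (w 0)) 0 := by
    have h1 : HasDerivAt (fun s => Φ (x s)) (w 0) 0 := by
      have : DifferentiableAt ℝ Φ (x 0) := by rw [hx0]; exact hΦ.differentiableAt (by simp)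
      exact this.hasFDerivAt.comp_hasDerivAt 0 (hx 0)
    have h2 : DifferentiableAt ℝ w 0 := by
      have h3 : DifferentiableAt ℝ (fderiv ℝ Φ) (x 0) := by
        rw [hx0]
        exact (hΦ.fderiv_right one_add_one_le_infty).differentiableAt (by simp)
      exact (h3.comp 0 (hx 0).differentiableAt).clm_apply (differentiableAt_const _)
    have h5 : HasFDerivAt B (fderiv ℝ B (Φ z)) (Φ (x 0)) := by
      rw [hx0]; exact (hBd (Φ z)).hasFDerivAt
    have h6 : HasDerivAt (fun s => B (Φ (x s))) (fderiv ℝ B (Φ z) (w 0)) 0 :=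
      HasFDerivAt.comp_hasDerivAt (l := B) 0 h5 h1
    have h4 := h6.clm_apply h2.hasDerivAt
    rw [hx0, hB0, zero_apply, add_zero] at h4
    exact h4
  have hBe : fderiv ℝ B (Φ z) e e = morinPoly'' m k' (Φ z) * L (eFirst (m + 1)) :=
    fderiv_comp_fderiv_morinForm_eLast L (Φ z)
  have hfin := hD1.unique (hD2.congr_of_eventuallyEq heq)
  rw [hr, map_smul, map_smul, smul_apply, hBe] at hfin
  refine ⟨r, ?_⟩
  simp only [M, hx0, smul_eq_mul] at hfin
  linear_combination hfin

/-- A covector which vanishes on the image of the derivative of the normal form and not at `V`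
does not vanish at the first coordinate vector. -/
theorem eFirst_ne_zero_of_vanishing {L : Euc (m + 2) →L[ℝ] ℝ} {z V : Euc (m + 2)}
    (hL : ∀ w, L (fderiv ℝ (morinForm (m + 1) k) z w) = 0) (hV : L V ≠ 0) :
    L (eFirst (m + 1)) ≠ 0 := by
  intro h0
  apply hV
  let w : Euc (m + 2) := WithLp.toLp 2 (Fin.snoc (fun i : Fin (m + 1) => V i.succ) (0 : ℝ))
  have hw : V = fderiv ℝ (morinForm (m + 1) k) z w
      + (V 0 - fderiv ℝ (morinForm (m + 1) k) z w 0) • eFirst (m + 1) := by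
    ext i
    refine Fin.cases ?_ (fun j => ?_) i
    · simp
    · simp [fderiv_morinForm_succ, w]
  rw [hw, map_add, hL, map_smul, h0, smul_zero, add_zero]

theorem fderiv_morinForm_eq (z w : Euc (m + 2)) :
    fderiv ℝ (morinForm (m + 1) k) z w
      = WithLp.toLp 2 (Fin.cons 0 (fun i : Fin (m + 1) => w i.castSucc))
        + fderiv ℝ (morinPoly m k) z w • eFirst (m + 1) := by
  ext i
  refine Fin.cases ?_ (fun j => ?_) i
  · simp [fderiv_morinForm_zero]
  · simp [fderiv_morinForm_succ]

/-- The acceleration form of a field normal to a Morin normal form along its singular set. -/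
theorem covForm_morinForm {G : Euc (m + 2) → Euc (m + 2) →L[ℝ] Euc (m + 2) →L[ℝ] ℝ}
    {z V : ℝ → Euc (m + 2)} {t : ℝ} (hz : DifferentiableAt ℝ z t)
    (hV : DifferentiableAt ℝ V t) (hG : DifferentiableAt ℝ G (morinForm (m + 1) k (z t)))
    (hP : ∀ᶠ s in 𝓝 t, morinPoly' m k (z s) = 0)
    (hn : ∀ᶠ s in 𝓝 t, ∀ w, G (morinForm (m + 1) k (z s)) (V s)
      (fderiv ℝ (morinForm (m + 1) k) (z s) w) = 0) :
    covForm G (fun s => morinForm (m + 1) k (z s)) V t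
      = G (morinForm (m + 1) k (z t)) (V t) (eFirst (m + 1)) * morinPoly'' m k (z t)
          * deriv z t (Fin.last (m + 1)) ^ 2
        + (1 / 2 * fderiv ℝ G (morinForm (m + 1) k (z t)) (V t)
            (deriv (fun s => morinForm (m + 1) k (z s)) t)
            (deriv (fun s => morinForm (m + 1) k (z s)) t)
          - fderiv ℝ G (morinForm (m + 1) k (z t)) (deriv (fun s => morinForm (m + 1) k (z s)) t)
            (V t) (deriv (fun s => morinForm (m + 1) k (z s)) t)) := by
  have hF : ContDiff ℝ ∞ (morinForm (m + 1) k) := contDiff_morinForm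
  have hP' : ContDiff ℝ ∞ (morinPoly' m k) := contDiff_morinPoly'
  have hc : HasDerivAt (fun s => morinForm (m + 1) k (z s))
      (fderiv ℝ (morinForm (m + 1) k) (z t) (deriv z t)) t :=
    (hF.differentiable (by simp) (z t)).hasFDerivAt.comp_hasDerivAt t hz.hasDerivAt
  -- The velocity is frozen at time `t`. Normality holds against every fixed vector, so it can be
  -- differentiated with `w` constant and no second derivative of `z` is needed.
  let w := deriv z t
  have hzl : HasDerivAt (fun s => z s (Fin.last (m + 1))) (w (Fin.last (m + 1))) t :=
    (hasFDerivAt_coord (Fin.last (m + 1)) (z t)).comp_hasDerivAt t hz.hasDerivAt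
  have hPw : fderiv ℝ (morinPoly' m k) (z t) w = 0 := by
    have h1 := (hP'.differentiable (by simp) (z t)).hasFDerivAt.comp_hasDerivAt t hz.hasDerivAt
    have h2 : (morinPoly' m k ∘ z) =ᶠ[𝓝 t] fun _ => (0 : ℝ) := hP
    exact h1.unique ((hasDerivAt_const t (0 : ℝ)).congr_of_eventuallyEq h2)
  -- Along `P' = 0` the `z_d`-part of `DP(z s) w` disappears. The derivative of the remaining sum is
  -- the coefficient part of `DP'(w)` times `w_d`, and `DP'(w) = 0` turns this into `-P'' w_d²`.
  have hDP : HasDerivAt (fun s => fderiv ℝ (morinPoly m k) (z s) w)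
      (-(morinPoly'' m k (z t) * w (Fin.last (m + 1)) ^ 2)) t := by
    have h1 : HasDerivAt (fun s => ∑ i : Fin (m + 1), if i.val + 1 < k then
        w i.castSucc * z s (Fin.last (m + 1)) ^ (i.val + 1) else 0)
        (∑ i : Fin (m + 1), if i.val + 1 < k then
          w i.castSucc * (((i.val + 1 : ℕ) : ℝ) * z t (Fin.last (m + 1)) ^ i.val
            * w (Fin.last (m + 1))) else 0) t := by
      refine HasDerivAt.fun_sum fun i _ => ?_
      split_ifs
      · simpa using (hzl.pow (i.val + 1)).const_mul (w i.castSucc)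
      · exact hasDerivAt_const _ _
    have h2 : (fun s => fderiv ℝ (morinPoly m k) (z s) w) =ᶠ[𝓝 t]
        fun s => ∑ i : Fin (m + 1), if i.val + 1 < k then
          w i.castSucc * z s (Fin.last (m + 1)) ^ (i.val + 1) else 0 := by
      filter_upwards [hP] with s hs
      rw [fderiv_morinPoly, hs, zero_mul, add_zero]
    refine (h1.congr_of_eventuallyEq h2).congr_deriv ?_
    rw [fderiv_morinPoly'] at hPw
    have h3 : (∑ i : Fin (m + 1), if i.val + 1 < k then
          w i.castSucc * (((i.val + 1 : ℕ) : ℝ) * z t (Fin.last (m + 1)) ^ i.val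
            * w (Fin.last (m + 1))) else 0)
        = (∑ i : Fin (m + 1), if i.val + 1 < k then
          ((i.val : ℝ) + 1) * w i.castSucc * z t (Fin.last (m + 1)) ^ i.val else 0)
            * w (Fin.last (m + 1)) := by
      rw [Finset.sum_mul]
      refine Finset.sum_congr rfl fun i _ => ?_
      split_ifs
      · push_cast; ring
      · simp
    rw [h3]
    linear_combination w (Fin.last (m + 1)) * hPw
  have hX : HasDerivAt (fun s => fderiv ℝ (morinForm (m + 1) k) (z s) w)
      (-(morinPoly'' m k (z t) * w (Fin.last (m + 1)) ^ 2) • eFirst (m + 1)) t := by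
    have := (hDP.smul_const (eFirst (m + 1))).const_add
      (WithLp.toLp 2 (Fin.cons 0 (fun i : Fin (m + 1) => w i.castSucc)))
    refine this.congr_of_eventuallyEq (Eventually.of_forall fun s => ?_)
    exact fderiv_morinForm_eq _ _
  have hGc : HasDerivAt (fun s => G (morinForm (m + 1) k (z s)))
      (fderiv ℝ G (morinForm (m + 1) k (z t)) (fderiv ℝ (morinForm (m + 1) k) (z t) w)) t :=
    HasFDerivAt.comp_hasDerivAt (l := G) t hG.hasFDerivAt hc
  have h5 := (hGc.clm_apply hV.hasDerivAt).clm_apply hX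
  have h6 : (fun s => G (morinForm (m + 1) k (z s)) (V s)
      (fderiv ℝ (morinForm (m + 1) k) (z s) w)) =ᶠ[𝓝 t] fun _ => (0 : ℝ) := by
    filter_upwards [hn] with s hs using hs w
  have h7 := h5.unique ((hasDerivAt_const t (0 : ℝ)).congr_of_eventuallyEq h6)
  simp only [add_apply, map_smul, smul_eq_mul, map_neg, neg_smul] at h7
  rw [covForm, hc.deriv]
  linear_combination h7

end FoldCalculus

/-! ### The side onto which the extension folds -/

section FoldSide

variable {m k : ℕ}
  {M : Type u} [TopologicalSpace M] [ChartedSpace (Euc (m + 1)) M] [IsManifold (𝓡 (m + 1)) ∞ M]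
  {N : Type v} [TopologicalSpace N] [ChartedSpace (Euc (m + 2)) N] [IsManifold (𝓡 (m + 2)) ∞ N]
  {W : Type w} [TopologicalSpace W] [ChartedSpace (Euc (m + 2)) W] [IsManifold (𝓡 (m + 2)) ∞ W]
  {f : M → N} {F : W → N} {ι : M → W} {g : Metric (m + 2) N}

theorem MorinExtension.isClosed_singularSet (h : MorinExtension (m := m) f F ι)
    (hf : ContMDiff (𝓡 (m + 1)) (𝓡 (m + 2)) ∞ f) : IsClosed (singularSet (m + 1) (m + 2) f) := by
  rw [← isOpen_compl_iff, isOpen_iff_mem_nhds]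
  intro p hp
  obtain ⟨χ, -, hpχ, -, -, hS | ⟨q, hq⟩⟩ := h.exists_gate_chart hf p univ_mem
  · exact mem_of_superset (χ.open_source.mem_nhds hpχ) hS
  · have h1 : χ p 0 ≠ 0 := fun h0 => hp ((hq.singular p hpχ).2 h0)
    have h2 : ContinuousAt (fun p => χ p 0) p :=
      (contDiff_coord (0 : Fin (m + 1))).continuous.continuousAt.comp (χ.continuousAt hpχ)
    filter_upwards [χ.open_source.mem_nhds hpχ, h2.eventually_ne h1] with p' hp' hne
    exact fun hS => hne ((hq.singular p' hp').1 hS)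

/-- In a gate chart the singular set is a hyperplane, and a small push along the first axis leaves
it. -/
theorem MorinExtension.dense_regular (h : MorinExtension (m := m) f F ι)
    (hf : ContMDiff (𝓡 (m + 1)) (𝓡 (m + 2)) ∞ f) :
    Dense (singularSet (m + 1) (m + 2) f)ᶜ := by
  intro p
  rw [mem_closure_iff_nhds]
  intro U hU
  obtain ⟨χ, -, hpχ, hU', -, hS | ⟨q, hq⟩⟩ := h.exists_gate_chart hf p hU
  · exact ⟨p, mem_of_mem_nhds hU, hS p hpχ⟩
  · by_cases hp : p ∈ singularSet (m + 1) (m + 2) f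
    · have hp0 := (hq.singular p hpχ).1 hp
      have h1 : ∀ᶠ s in 𝓝[>] (0 : ℝ), χ p + s • eFirst m ∈ χ.target := by
        refine ((hasDerivAt_line (χ p) (eFirst m) 0).continuousAt.eventually ?_).filter_mono
          nhdsWithin_le_nhds
        simpa using χ.open_target.mem_nhds (χ.map_source hpχ)
      obtain ⟨s, hs, hs0⟩ := (h1.and self_mem_nhdsWithin).exists
      refine ⟨χ.symm (χ p + s • eFirst m), hU' (χ.map_target hs), fun hS => ?_⟩
      have := (hq.singular _ (χ.map_target hs)).1 hS
      rw [χ.right_inv hs] at this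
      simp [hp0] at this
      exact (ne_of_gt hs0) this
    · exact ⟨p, mem_of_mem_nhds hU, hp⟩

theorem morinPoly''_ne_zero_of_regular (hk : 1 ≤ k) {Z : M → Euc (m + 2)}
    {ψ : OpenPartialHomeomorph N (Euc (m + 2))} (hψ : ψ ∈ Atlas (m + 2) N) {q : M}
    (h : ∀ᶠ q in 𝓝 q, IsFrontForm f k Z ψ q)
    (hf : ContMDiffAt (𝓡 (m + 1)) (𝓡 (m + 2)) ∞ f q)
    (hq : q ∉ singularSet (m + 1) (m + 2) f) : morinPoly'' m k (Z q) ≠ 0 := by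
  rcases Nat.lt_or_ge k 2 with h2 | h2
  · obtain rfl : k = 1 := by omega
    have h3 : morinPoly'' m 1 (Z q) = 2 := by simp [morinPoly'']; norm_num
    rw [h3]; norm_num
  · exact fun h0 => hq ((mem_singularSet_iff_frontForm h2 hψ h hf).2 h0)

/-- A normal vector at a regular point annihilates the image of the derivative of the Morin normal
form. -/
theorem chartMetric_fderiv_morinForm (g : Metric (m + 2) N) (hk : 1 ≤ k) {Z : M → Euc (m + 2)}
    {ψ : OpenPartialHomeomorph N (Euc (m + 2))} (hψ : ψ ∈ Atlas (m + 2) N) {q : M}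
    (h : ∀ᶠ q in 𝓝 q, IsFrontForm f k Z ψ q)
    (hf : ContMDiffAt (𝓡 (m + 1)) (𝓡 (m + 2)) ∞ f q)
    (hq : q ∉ singularSet (m + 1) (m + 2) f) {v : TangentSpace (𝓡 (m + 2)) (f q)}
    (hv : ∀ u, g.inner (f q) (mfderiv (𝓡 (m + 1)) (𝓡 (m + 2)) f q u) v = 0) (w : Euc (m + 2)) :
    chartMetric g ψ (ψ (f q)) (dchart ψ (f q) v) (fderiv ℝ (morinForm (m + 1) k) (Z q) w) = 0 := by
  have hP := morinPoly''_ne_zero_of_regular hk hψ h hf hq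
  have hL : fderiv ℝ (morinPoly' m k) (Z q) ≠ 0 := by
    intro h2
    have h3 := fderiv_morinPoly'_eLast (m := m) (k := k) (Z q)
    rw [h2] at h3
    exact hP h3.symm
  -- With this `r` the vector `w - r • eLast` is tangent to `P' = 0`. The correction does not change
  -- the image of `w`, since the last axis is the kernel.
  let r := fderiv ℝ (morinPoly' m k) (Z q) w / morinPoly'' m k (Z q)
  obtain ⟨u, hu⟩ := exists_mfderiv_frontForm h hL (v := w - r • eLast (m + 1)) (by
    rw [map_sub, map_smul, fderiv_morinPoly'_eLast, smul_eq_mul, div_mul_cancel₀ _ hP, sub_self])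
  have h1 := eventually_mfderiv_frontForm hψ h hf u
  rw [hu] at h1
  replace h1 := h1.trans (ContinuousLinearMap.map_sub _ _ _)
  rw [map_smul, fderiv_morinForm_eLast, h.self_of_nhds.singular, zero_smul, smul_zero,
    sub_zero] at h1
  rw [← h1, chartMetric_dchart g hψ h.self_of_nhds.mem_source, g.symm]
  exact hv u

/-- The normal component, in the direction of `v`, of the second derivative of a map with Morin
normal form along the kernel of its derivative. -/
def foldNumber (g : Metric (m + 2) N) (f : M → N) (ι : M → W) (k : ℕ)
    (φ : OpenPartialHomeomorph W (Euc (m + 2))) (ψ : OpenPartialHomeomorph N (Euc (m + 2)))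
    (p : M) (v : TangentSpace (𝓡 (m + 2)) (f p)) : ℝ :=
  chartMetric g ψ (ψ (f p)) (dchart ψ (f p) v) (eFirst (m + 1)) * morinPoly'' m k (φ (ι p))

/-- The normal vector `v` at the regular point `p` points to the side onto which `F` folds. -/
def FoldPos (g : Metric (m + 2) N) (f : M → N) (F : W → N) (ι : M → W)
    (p : M) (v : TangentSpace (𝓡 (m + 2)) (f p)) : Prop :=
  ∃ k φ ψ, 1 ≤ k ∧ IsMorinChart (m := m) F ι p k φ ψ ∧ 0 < foldNumber g f ι k φ ψ p v

/-- The fold number is the normal part of the second derivative of `F` along its kernel. Another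
normal form rescales the kernel vector, and the value changes by the square of the factor; the sign
is intrinsic. -/
theorem MorinExtension.foldNumber_compare (h : MorinExtension (m := m) f F ι)
    (hf : ContMDiff (𝓡 (m + 1)) (𝓡 (m + 2)) ∞ f) {k k' : ℕ} (hk' : 1 ≤ k')
    {φ φ' : OpenPartialHomeomorph W (Euc (m + 2))} {ψ ψ' : OpenPartialHomeomorph N (Euc (m + 2))}
    {q : M} (hc : IsMorinChart (m := m) F ι q k φ ψ) (hc' : IsMorinChart (m := m) F ι q k' φ' ψ')
    (hq : q ∉ singularSet (m + 1) (m + 2) f) {v : TangentSpace (𝓡 (m + 2)) (f q)}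
    (hv : ∀ u, g.inner (f q) (mfderiv (𝓡 (m + 1)) (𝓡 (m + 2)) f q u) v = 0) :
    ∃ r : ℝ, foldNumber g f ι k φ ψ q v = r ^ 2 * foldNumber g f ι k' φ' ψ' q v := by
  have hF := (h.eventually_frontForm hc)
  have hF' := (h.eventually_frontForm hc')
  have hs := hF.self_of_nhds
  have hs' := hF'.self_of_nhds
  let L := chartMetric g ψ' (ψ' (f q)) (dchart ψ' (f q) v)
  have hz : φ (ι q) ∈ φ.target := φ.map_source hc.mem_source
  have hy : ψ (f q) ∈ ψ.target := ψ.map_source hs.mem_source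
  have hinv : φ.symm (φ (ι q)) = ι q := φ.left_inv hc.mem_source
  have hinv' : ψ.symm (ψ (f q)) = f q := ψ.left_inv hs.mem_source
  have hΦ : ContDiffAt ℝ ∞ (fun x => φ' (id (φ.symm x))) (φ (ι q)) :=
    contDiffAt_chart_comp hc.left_mem hc'.left_mem hz (by rw [hinv]; exact hc'.mem_source)
      contMDiffAt_id
  have hΨ : ContDiffAt ℝ ∞ (fun x => ψ' (id (ψ.symm x))) (ψ (f q)) :=
    contDiffAt_chart_comp hc.right_mem hc'.right_mem hy (by rw [hinv']; exact hs'.mem_source)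
      contMDiffAt_id
  have hcomp := fderiv_chart_comp (f := id) hc.right_mem hc'.right_mem hs.mem_source hs'.mem_source
    contMDiffAt_id
  have hΦq : φ' (id (φ.symm (φ (ι q)))) = φ' (ι q) := by rw [hinv]; rfl
  have hev : ∀ᶠ x in 𝓝 (φ (ι q)), morinForm (m + 1) k' (φ' (id (φ.symm x)))
      = ψ' (id (ψ.symm (morinForm (m + 1) k x))) := by
    have h1 : Tendsto φ.symm (𝓝 (φ (ι q))) (𝓝 (ι q)) := by
      have := φ.symm.continuousAt (x := φ (ι q)) hz
      rwa [ContinuousAt, hinv] at this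
    filter_upwards [h1.eventually hc.form, h1.eventually hc'.form, φ.open_target.mem_nhds hz]
      with x hx hx' hxt
    rw [id, id, ← hx'.2.2]
    have := hx.2.2
    rw [φ.right_inv hxt] at this
    rw [← this, ψ.left_inv hx.2.1]
  have hform : ψ (f q) = morinForm (m + 1) k (φ (ι q)) := hs.form
  rw [hform] at hΨ
  obtain ⟨r, hr⟩ := morin_second_derivative_compare (L := L) hΦ hΨ hev hs.singular (fun w => by
    rw [hΦq]
    exact chartMetric_fderiv_morinForm g hk' hc'.right_mem hF' (hf q) hq hv w)
  refine ⟨r, ?_⟩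
  have hL : L (fderiv ℝ (fun x => ψ' (id (ψ.symm x))) (morinForm (m + 1) k (φ (ι q)))
      (eFirst (m + 1))) = chartMetric g ψ (ψ (f q)) (dchart ψ (f q) v) (eFirst (m + 1)) := by
    obtain ⟨u, hu⟩ := dchart_surjective hc.right_mem hs.mem_source (eFirst (m + 1))
    rw [← hu, ← hform, hcomp u, chartMetric_dchart g hc.right_mem hs.mem_source]
    have : mfderiv (𝓡 (m + 2)) (𝓡 (m + 2)) id (f q) u = u := by rw [mfderiv_id]; rfl
    erw [this]
    exact chartMetric_dchart g hc'.right_mem hs'.mem_source v u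
  rw [hL, hΦq] at hr
  exact hr

/-- Allows `FoldPos`, an existential over all normal forms, to be tested in any single one. -/
theorem MorinExtension.foldPos_iff (h : MorinExtension (m := m) f F ι)
    (hf : ContMDiff (𝓡 (m + 1)) (𝓡 (m + 2)) ∞ f) (hk : 1 ≤ k)
    {φ : OpenPartialHomeomorph W (Euc (m + 2))} {ψ : OpenPartialHomeomorph N (Euc (m + 2))}
    {q : M} (hc : IsMorinChart (m := m) F ι q k φ ψ)
    (hq : q ∉ singularSet (m + 1) (m + 2) f) {v : TangentSpace (𝓡 (m + 2)) (f q)}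
    (hv : ∀ u, g.inner (f q) (mfderiv (𝓡 (m + 1)) (𝓡 (m + 2)) f q u) v = 0) :
    FoldPos g f F ι q v ↔ 0 < foldNumber g f ι k φ ψ q v := by
  constructor
  · rintro ⟨k', φ', ψ', hk', hc', hpos⟩
    obtain ⟨r, hr⟩ := h.foldNumber_compare hf hk hc' hc hq hv
    rw [hr] at hpos
    exact pos_of_mul_pos_right hpos (sq_nonneg r)
  · exact fun hpos => ⟨k, φ, ψ, hk, hc, hpos⟩

theorem MorinExtension.foldNumber_ne_zero (h : MorinExtension (m := m) f F ι)
    (hf : ContMDiff (𝓡 (m + 1)) (𝓡 (m + 2)) ∞ f) (hk : 1 ≤ k)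
    {φ : OpenPartialHomeomorph W (Euc (m + 2))} {ψ : OpenPartialHomeomorph N (Euc (m + 2))}
    {q : M} (hc : IsMorinChart (m := m) F ι q k φ ψ)
    (hq : q ∉ singularSet (m + 1) (m + 2) f) {v : TangentSpace (𝓡 (m + 2)) (f q)}
    (hv1 : g.inner (f q) v v = 1)
    (hv : ∀ u, g.inner (f q) (mfderiv (𝓡 (m + 1)) (𝓡 (m + 2)) f q u) v = 0) :
    foldNumber g f ι k φ ψ q v ≠ 0 := by
  have hF := h.eventually_frontForm hc
  refine mul_ne_zero ?_
    (morinPoly''_ne_zero_of_regular (Z := fun q => φ (ι q)) hk hc.right_mem hF (hf q) hq)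
  refine eFirst_ne_zero_of_vanishing (V := dchart ψ (f q) v)
    (chartMetric_fderiv_morinForm g (Z := fun q => φ (ι q)) hk hc.right_mem hF (hf q) hq hv) ?_
  rw [chartMetric_dchart g hc.right_mem hF.self_of_nhds.mem_source, hv1]
  exact one_ne_zero

end FoldSide

/-! ### Asymptotics of the normal curvature map at a cusp -/

section CurveCalculus

variable {m k : ℕ}

theorem covForm_congr {d : ℕ} {G : Euc d → Euc d →L[ℝ] Euc d →L[ℝ] ℝ} {c c' V : ℝ → Euc d} {t : ℝ}
    (h : c =ᶠ[𝓝 t] c') : covForm G c V t = covForm G c' V t := by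
  rw [covForm, covForm, h.deriv_eq, h.self_of_nhds]

theorem contDiffAt_deriv {d : ℕ} {c : ℝ → Euc d} {t : ℝ} (hc : ContDiffAt ℝ 2 c t) :
    ContDiffAt ℝ 1 (deriv c) t := by
  have h1 : ContDiffAt ℝ 1 (fderiv ℝ c) t :=
    hc.fderiv_right (m := 1) (by rw [one_add_one_eq_two])
  exact h1.clm_apply (contDiffAt_const (c := (1 : ℝ)))

set_option maxSynthPendingDepth 3 in
theorem continuousAt_fderiv_metric {d : ℕ} {G : Euc d → Euc d →L[ℝ] Euc d →L[ℝ] ℝ}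
    {c : ℝ → Euc d} {t : ℝ} (hc : ContinuousAt c t) (hG : ContDiffAt ℝ 2 G (c t)) :
    ContinuousAt (fun s => fderiv ℝ G (c s)) t := by
  have h1 : ContDiffAt ℝ 1 (fderiv ℝ G) (c t) :=
    hG.fderiv_right (m := 1) (by rw [one_add_one_eq_two])
  exact ContinuousAt.comp (g := fderiv ℝ G) h1.continuousAt hc

set_option maxSynthPendingDepth 3 in
theorem continuousAt_covForm {d : ℕ} {G : Euc d → Euc d →L[ℝ] Euc d →L[ℝ] ℝ} {c V : ℝ → Euc d}
    {t : ℝ} (hc : ContDiffAt ℝ 2 c t) (hV : ContDiffAt ℝ 2 V t) (hG : ContDiffAt ℝ 2 G (c t)) :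
    ContinuousAt (covForm G c V) t := by
  have h1 := (contDiffAt_deriv hc).continuousAt
  have h2 := (contDiffAt_deriv hV).continuousAt
  have h3 := continuousAt_fderiv_metric hc.continuousAt hG
  have h4 : ContinuousAt (fun s => G (c s)) t :=
    ContinuousAt.comp (g := G) hG.continuousAt hc.continuousAt
  exact ((h4.clm_apply h2).clm_apply h1).add
    (continuousAt_const.mul (((h3.clm_apply hV.continuousAt).clm_apply h1).clm_apply h1))

theorem tendsto_clm_apply {α E F : Type*} [NormedAddCommGroup E] [NormedSpace ℝ E]
    [NormedAddCommGroup F] [NormedSpace ℝ F] {l : Filter α} {A : α → E →L[ℝ] F} {v : α → E}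
    {A₀ : E →L[ℝ] F} {v₀ : E} (hA : Tendsto A l (𝓝 A₀)) (hv : Tendsto v l (𝓝 v₀)) :
    Tendsto (fun x => A x (v x)) l (𝓝 (A₀ v₀)) :=
  (isBoundedBilinearMap_apply.continuous.tendsto (A₀, v₀)).comp (hA.prodMk_nhds hv)

theorem tendsto_slope_of_zero {E : Type*} [NormedAddCommGroup E] [NormedSpace ℝ E] {c : ℝ → E}
    {c' : E} {t : ℝ} (h : HasDerivAt c c' t) (h0 : c t = 0) :
    Tendsto (fun s => (s - t)⁻¹ • c s) (𝓝[≠] t) (𝓝 c') := by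
  have := hasDerivAt_iff_tendsto_slope.1 h
  refine this.congr fun s => ?_
  rw [slope_def_module, h0, sub_zero]

set_option maxSynthPendingDepth 3 in
/-- At an `A_2`-point crossed in the null direction, the normal curvature map tends to infinity,
with the sign of the second component given by the fold number. -/
theorem tendsto_covForm_cusp {G : Euc (m + 2) → Euc (m + 2) →L[ℝ] Euc (m + 2) →L[ℝ] ℝ}
    {z V c : ℝ → Euc (m + 2)} {t q : ℝ} (hz : ContDiffAt ℝ 2 z t) (hV : ContDiffAt ℝ 2 V t)
    (hc : c = fun s => morinForm (m + 1) k (z s)) (hG : ContDiffAt ℝ 2 G (c t))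
    (hP : ∀ᶠ s in 𝓝 t, morinPoly' m k (z s) = 0)
    (hn : ∀ᶠ s in 𝓝 t, ∀ w, G (c s) (V s) (fderiv ℝ (morinForm (m + 1) k) (z s) w) = 0)
    (hz0 : morinPoly'' m k (z t) = 0) (hz1 : deriv z t (Fin.last (m + 1)) ≠ 0)
    (hc0 : deriv c t = 0) (hq : HasDerivAt (fun s => morinPoly'' m k (z s)) q t) (hq0 : q ≠ 0)
    (hκ : G (c t) (V t) (eFirst (m + 1)) ≠ 0) :
    Tendsto (fun s => G (c s) (deriv c s) (deriv c s) / covForm G c V s) (𝓝[≠] t) (𝓝 0) ∧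
    ∀ᶠ s in 𝓝[≠] t, 0 < G (c s) (V s) (eFirst (m + 1)) * morinPoly'' m k (z s)
      * covForm G c V s := by
  have hF : ContDiff ℝ ∞ (morinForm (m + 1) k) := contDiff_morinForm
  have hc2 : ContDiffAt ℝ 2 c t := by
    rw [hc]; exact (hF.contDiffAt.of_le two_le_infty).comp t hz
  have hdc := contDiffAt_deriv hc2
  have hdcc : Tendsto (deriv c) (𝓝[≠] t) (𝓝 0) := by
    rw [← hc0]; exact hdc.continuousAt.mono_left nhdsWithin_le_nhds
  have hslope := tendsto_slope_of_zero (hdc.differentiableAt (by simp)).hasDerivAt hc0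
  have hGc : Tendsto (fun s => G (c s)) (𝓝[≠] t) (𝓝 (G (c t))) :=
    (ContinuousAt.comp (g := G) hG.continuousAt hc2.continuousAt).mono_left nhdsWithin_le_nhds
  have hDG : Tendsto (fun s => fderiv ℝ G (c s)) (𝓝[≠] t) (𝓝 (fderiv ℝ G (c t))) :=
    (continuousAt_fderiv_metric hc2.continuousAt hG).mono_left nhdsWithin_le_nhds
  have hVc : Tendsto V (𝓝[≠] t) (𝓝 (V t)) := hV.continuousAt.mono_left nhdsWithin_le_nhds
  have hzc : Tendsto (fun s => deriv z s (Fin.last (m + 1))) (𝓝[≠] t)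
      (𝓝 (deriv z t (Fin.last (m + 1)))) :=
    (ContinuousAt.comp (g := fun z : Euc (m + 2) => z (Fin.last (m + 1)))
      (contDiff_coord (Fin.last (m + 1))).continuous.continuousAt
      (contDiffAt_deriv hz).continuousAt).mono_left nhdsWithin_le_nhds
  -- The velocity `c'` vanishes at `t`: one factor divided by `s - t` stays bounded and the other
  -- tends to zero.
  have hA : Tendsto (fun s => (s - t)⁻¹ * G (c s) (deriv c s) (deriv c s)) (𝓝[≠] t) (𝓝 0) := by
    have := tendsto_clm_apply (tendsto_clm_apply hGc hslope) hdcc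
    rw [map_zero] at this
    refine this.congr fun s => ?_
    simp
  have hQ : Tendsto (fun s => (s - t)⁻¹ * (G (c s) (V s) (eFirst (m + 1)) * morinPoly'' m k (z s)))
      (𝓝[≠] t) (𝓝 (G (c t) (V t) (eFirst (m + 1)) * q)) := by
    have h1 := tendsto_clm_apply (tendsto_clm_apply hGc hVc) (tendsto_const_nhds (x := eFirst (m + 1)))
    refine (h1.mul (tendsto_slope_of_zero hq hz0)).congr fun s => ?_
    rw [smul_eq_mul]; ring
  -- Of the terms in `covForm_morinForm`, those with derivatives of `G` are quadratic in `c'` and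
  -- die after division by `s - t`. Only the fold term is of exact first order.
  have hB : Tendsto (fun s => (s - t)⁻¹ * covForm G c V s) (𝓝[≠] t)
      (𝓝 (G (c t) (V t) (eFirst (m + 1)) * q * deriv z t (Fin.last (m + 1)) ^ 2)) := by
    have h1 := tendsto_clm_apply (tendsto_clm_apply (tendsto_clm_apply hDG hVc) hslope) hdcc
    have h2 := tendsto_clm_apply (tendsto_clm_apply (tendsto_clm_apply hDG hslope) hVc) hdcc
    have h3 := (hQ.mul (hzc.pow 2)).add ((h1.const_mul (1 / 2)).sub h2)
    simp only [map_zero, mul_zero, sub_zero, add_zero] at h3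
    refine h3.congr' ?_
    have hzd : ∀ᶠ s in 𝓝 t, ContDiffAt ℝ 2 z s := hz.eventually (by simp)
    have hVd : ∀ᶠ s in 𝓝 t, ContDiffAt ℝ 2 V s := hV.eventually (by simp)
    have hGd : ∀ᶠ s in 𝓝 t, ContDiffAt ℝ 2 G (c s) :=
      hc2.continuousAt.eventually (hG.eventually (by simp))
    have hev := (((eventually_eventually_nhds.2 hP).and (eventually_eventually_nhds.2 hn)).and
      (hzd.and (hVd.and hGd))).filter_mono (nhdsWithin_le_nhds (s := {t}ᶜ))
    filter_upwards [hev] with s ⟨⟨e1, e2⟩, e3, e4, e5⟩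
    subst hc
    rw [covForm_morinForm (e3.differentiableAt (by simp)) (e4.differentiableAt (by simp))
      (e5.differentiableAt (by simp)) e1 e2]
    simp only [map_smul, smul_apply, smul_eq_mul]
    ring
  have hlim : G (c t) (V t) (eFirst (m + 1)) * q * deriv z t (Fin.last (m + 1)) ^ 2 ≠ 0 :=
    mul_ne_zero (mul_ne_zero hκ hq0) (pow_ne_zero _ hz1)
  have hne : ∀ᶠ s in 𝓝[≠] t, s - t ≠ 0 := by
    filter_upwards [self_mem_nhdsWithin] with s hs using sub_ne_zero.2 hs
  constructor
  · have := hA.div hB hlim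
    rw [zero_div] at this
    refine this.congr' ?_
    filter_upwards [hne] with s hs
    exact mul_div_mul_left _ _ (inv_ne_zero hs)
  · have h1 := hQ.mul hB
    -- Both rescaled quantities have limits that differ by the square `z_d'(t)²`, so the limit of
    -- their product is positive. This is the agreement of signs.
    have hpos : 0 < G (c t) (V t) (eFirst (m + 1)) * q
        * (G (c t) (V t) (eFirst (m + 1)) * q * deriv z t (Fin.last (m + 1)) ^ 2) := by
      have h2 : 0 < (G (c t) (V t) (eFirst (m + 1)) * q) ^ 2 := by positivity
      have h3 : 0 < deriv z t (Fin.last (m + 1)) ^ 2 := by positivity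
      nlinarith [mul_pos h2 h3]
    filter_upwards [h1.eventually (lt_mem_nhds hpos), hne] with s hs hs'
    have h4 : 0 < (s - t)⁻¹ ^ 2 := by positivity
    have h5 : 0 < (s - t)⁻¹ ^ 2 * (G (c s) (V s) (eFirst (m + 1)) * morinPoly'' m k (z s)
      * covForm G c V s) := by
      refine hs.trans_eq ?_
      ring
    exact pos_of_mul_pos_right h5 h4.le

/-- The angle function of a normal curvature map which is finite outside a set of times. -/
theorem continuousAt_angle_of_cusp {a b θ : ℝ → ℝ} {p : ℝ → Prop} [DecidablePred p] {t : ℝ}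
    (hθt : θ t = -(Real.pi / 2))
    (hθ : ∀ᶠ s in 𝓝[≠] t, θ s = Real.arctan (b s / a s) - if p s then Real.pi else 0)
    (hab : Tendsto (fun s => a s / b s) (𝓝[≠] t) (𝓝 0))
    (hb : ∀ᶠ s in 𝓝[≠] t, 0 < a s ∧ b s ≠ 0 ∧ (p s ↔ 0 < b s)) : ContinuousAt θ t := by
  rw [continuousAt_iff_punctured_nhds, hθt]
  -- Inverting the argument of `arctan` costs `π/2` or `-π/2` according to the sign of `b`.
  -- Subtracting `π` when `b > 0` makes both cases the same formula.
  have h1 : Tendsto (fun s => -(Real.pi / 2) - Real.arctan (a s / b s)) (𝓝[≠] t)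
      (𝓝 (-(Real.pi / 2))) := by
    have := ((Real.continuous_arctan.tendsto 0).comp hab).const_sub (-(Real.pi / 2))
    rw [Real.arctan_zero, sub_zero] at this
    exact this
  refine h1.congr' ?_
  filter_upwards [hθ, hb] with s h2 ⟨ha, hb0, hp⟩
  have hinv : b s / a s = (a s / b s)⁻¹ := (inv_div _ _).symm
  rw [h2, hinv]
  split_ifs with h
  · rw [Real.arctan_inv_of_pos (div_pos ha (hp.1 h))]; ring
  · have hneg : b s < 0 := lt_of_le_of_ne (not_lt.1 fun h' => h (hp.2 h')) hb0
    rw [Real.arctan_inv_of_neg (div_neg_of_pos_of_neg ha hneg)]; ring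

end CurveCalculus

/-! ### The normal curvature map of a null curve -/

section NormalCurvature

variable {m k : ℕ}
  {M : Type u} [TopologicalSpace M] [ChartedSpace (Euc (m + 1)) M] [IsManifold (𝓡 (m + 1)) ∞ M]
  {N : Type v} [TopologicalSpace N] [ChartedSpace (Euc (m + 2)) N] [IsManifold (𝓡 (m + 2)) ∞ N]
  {W : Type w} [TopologicalSpace W] [ChartedSpace (Euc (m + 2)) W] [IsManifold (𝓡 (m + 2)) ∞ W]
  {f : M → N} {F : W → N} {ι : M → W} {g : Metric (m + 2) N}
  {γ : ℝ → M} {ν : ∀ t, TangentSpace (𝓡 (m + 2)) (f (γ t))}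

/-- The first component `g(γ̂', γ̂')` of the normal curvature map. -/
def speedSq (g : Metric (m + 2) N) (f : M → N) (γ : ℝ → M) (t : ℝ) : ℝ :=
  g.inner (f (γ t)) (velocity (d := m + 2) (fun s => f (γ s)) t)
    (velocity (d := m + 2) (fun s => f (γ s)) t)

/-- The second component `g(ν', γ̂')` of the normal curvature map. -/
def normalAccel (g : Metric (m + 2) N) (f : M → N) (γ : ℝ → M)
    (ν : ∀ t, TangentSpace (𝓡 (m + 2)) (f (γ t))) (t : ℝ) : ℝ :=
  covDerivInner g (fun s => f (γ s)) ν t (velocity (d := m + 2) (fun s => f (γ s)) t)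

/-- A `C²` curve meeting the singular set at isolated times, with a continuous unit normal field
along it. -/
structure IsNormalField (g : Metric (m + 2) N) (f : M → N) (γ : ℝ → M)
    (ν : ∀ t, TangentSpace (𝓡 (m + 2)) (f (γ t))) : Prop where
  contMDiff : ContMDiff 𝓘(ℝ, ℝ) (𝓡 (m + 1)) 2 γ
  continuous : Continuous (fun t => (⟨f (γ t), ν t⟩ : TangentBundle (𝓡 (m + 2)) N))
  unit : ∀ t, IsUnitNormalAt g f (γ t) (ν t)
  regular : ∀ t, ∀ᶠ s in 𝓝[≠] t, γ s ∉ singularSet (m + 1) (m + 2) f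

/-- A merely continuous unit normal field agrees locally with a smooth local field composed with the
curve, so it is as smooth as the curve. -/
theorem IsNormalField.contDiffAt_dchart (h : IsNormalField g f γ ν)
    {ψ : OpenPartialHomeomorph N (Euc (m + 2))} (hψ : ψ ∈ Atlas (m + 2) N) {t : ℝ}
    (ht : f (γ t) ∈ ψ.source) : ContDiffAt ℝ 2 (fun s => dchart ψ (f (γ s)) (ν s)) t := by
  obtain ⟨U, ν', htU, hν', hev⟩ := exists_eventually_eq_localUnitNormal
    h.contMDiff.continuous.continuousAt h.continuous.continuousAt
    (Eventually.of_forall h.unit) (h.regular t)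
  have h1 : ContMDiffAt (𝓡 (m + 1)) (𝓡 (m + 2)).tangent ∞
      (fun p => (⟨f p, ν' p⟩ : TangentBundle (𝓡 (m + 2)) N)) (γ t) :=
    hν'.smooth.contMDiffAt (hν'.isOpen.mem_nhds htU)
  have h2 : ContMDiffAt (𝓡 (m + 1)) (𝓡 (m + 2)) ∞ (fun p => dchart ψ (f p) (ν' p)) (γ t) :=
    (contMDiffAt_dchart hψ (x := (⟨f (γ t), ν' (γ t)⟩ : TangentBundle (𝓡 (m + 2)) N)) ht).comp
      (γ t) h1
  have h3 : ContMDiffAt 𝓘(ℝ, ℝ) (𝓡 (m + 2)) 2 (fun s => dchart ψ (f (γ s)) (ν' (γ s))) t :=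
    (h2.of_le two_le_infty).comp t (h.contMDiff t)
  rw [contMDiffAt_iff_contDiffAt] at h3
  refine h3.congr_of_eventuallyEq ?_
  filter_upwards [hev] with s hs
  rw [hs.2]

theorem contDiffAt_image_curve (hγ : ContMDiff 𝓘(ℝ, ℝ) (𝓡 (m + 1)) 2 γ)
    (hf : ContMDiff (𝓡 (m + 1)) (𝓡 (m + 2)) ∞ f)
    {ψ : OpenPartialHomeomorph N (Euc (m + 2))} (hψ : ψ ∈ Atlas (m + 2) N) {t : ℝ}
    (ht : f (γ t) ∈ ψ.source) : ContDiffAt ℝ 2 (fun s => ψ (f (γ s))) t :=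
  contDiffAt_chart_curve two_le_infty hψ ht (((hf (γ t)).of_le two_le_infty).comp t (hγ t))

theorem eventually_mem_source {X : Type*} [TopologicalSpace X] {c : ℝ → X} {n : ℕ} {t : ℝ}
    (hc : ContinuousAt c t) {ψ : OpenPartialHomeomorph X (Euc n)} (ht : c t ∈ ψ.source) :
    ∀ᶠ s in 𝓝 t, c s ∈ ψ.source :=
  hc.eventually (ψ.open_source.mem_nhds ht)

theorem speedSq_eq (hγ : ContMDiff 𝓘(ℝ, ℝ) (𝓡 (m + 1)) 2 γ)
    (hf : ContMDiff (𝓡 (m + 1)) (𝓡 (m + 2)) ∞ f)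
    {ψ : OpenPartialHomeomorph N (Euc (m + 2))} (hψ : ψ ∈ Atlas (m + 2) N) {t : ℝ}
    (ht : f (γ t) ∈ ψ.source) : speedSq g f γ t = chartMetric g ψ (ψ (f (γ t)))
      (deriv (fun s => ψ (f (γ s))) t) (deriv (fun s => ψ (f (γ s))) t) := by
  have hc : MDifferentiableAt 𝓘(ℝ, ℝ) (𝓡 (m + 2)) (fun s => f (γ s)) t :=
    (((hf (γ t)).of_le two_le_infty).comp t (hγ t)).mdifferentiableAt (by simp)
  rw [← dchart_velocity hψ ht hc, chartMetric_dchart g hψ ht, speedSq]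

theorem IsNormalField.normalAccel_eq (h : IsNormalField g f γ ν)
    (hf : ContMDiff (𝓡 (m + 1)) (𝓡 (m + 2)) ∞ f)
    {ψ : OpenPartialHomeomorph N (Euc (m + 2))} (hψ : ψ ∈ Atlas (m + 2) N) {t : ℝ}
    (ht : f (γ t) ∈ ψ.source) : normalAccel g f γ ν t = covForm (chartMetric g ψ)
      (fun s => ψ (f (γ s))) (fun s => dchart ψ (f (γ s)) (ν s)) t := by
  have hc : MDifferentiableAt 𝓘(ℝ, ℝ) (𝓡 (m + 2)) (fun s => f (γ s)) t :=
    (((hf (γ t)).of_le two_le_infty).comp t (h.contMDiff t)).mdifferentiableAt (by simp)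
  exact covDerivInner_velocity g ν hc hψ ht
    ((h.contDiffAt_dchart hψ ht).differentiableAt (by simp))

theorem IsNormalField.continuous_normalAccel (h : IsNormalField g f γ ν)
    (hf : ContMDiff (𝓡 (m + 1)) (𝓡 (m + 2)) ∞ f) : Continuous (normalAccel g f γ ν) := by
  rw [continuous_iff_continuousAt]
  intro t
  have hψ : chartAt (Euc (m + 2)) (f (γ t)) ∈ Atlas (m + 2) N :=
    IsManifold.chart_mem_maximalAtlas _
  have ht := mem_chart_source (Euc (m + 2)) (f (γ t))
  refine (continuousAt_covForm (contDiffAt_image_curve h.contMDiff hf hψ ht)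
    (h.contDiffAt_dchart hψ ht) ((contDiffAt_chartMetric g hψ
      ((chartAt (Euc (m + 2)) (f (γ t))).map_source ht)).of_le two_le_infty)).congr ?_
  filter_upwards [eventually_mem_source
    (hf.continuous.comp h.contMDiff.continuous).continuousAt ht] with s hs
  exact (h.normalAccel_eq hf hψ hs).symm

theorem continuous_speedSq (hγ : ContMDiff 𝓘(ℝ, ℝ) (𝓡 (m + 1)) 2 γ)
    (hf : ContMDiff (𝓡 (m + 1)) (𝓡 (m + 2)) ∞ f) : Continuous (speedSq g f γ) := by
  rw [continuous_iff_continuousAt]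
  intro t
  set ψ := chartAt (Euc (m + 2)) (f (γ t))
  have hψ : ψ ∈ Atlas (m + 2) N := IsManifold.chart_mem_maximalAtlas _
  have ht : f (γ t) ∈ ψ.source := mem_chart_source (Euc (m + 2)) (f (γ t))
  have hc := contDiffAt_image_curve hγ hf hψ ht
  have h1 := (contDiffAt_deriv hc).continuousAt
  have h4 : ContinuousAt (fun s => chartMetric g ψ (ψ (f (γ s)))) t :=
    ContinuousAt.comp (g := chartMetric g ψ)
      (contDiffAt_chartMetric g hψ (ψ.map_source ht)).continuousAt hc.continuousAt
  refine ((h4.clm_apply h1).clm_apply h1).congr ?_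
  filter_upwards [eventually_mem_source (hf.continuous.comp hγ.continuous).continuousAt ht]
    with s hs
  exact (speedSq_eq hγ hf hψ hs).symm

theorem speedSq_pos (hγ : ContMDiff 𝓘(ℝ, ℝ) (𝓡 (m + 1)) 2 γ)
    (hf : ContMDiff (𝓡 (m + 1)) (𝓡 (m + 2)) ∞ f) {t : ℝ} (hv : velocity (d := m + 1) γ t ≠ 0)
    (ht : γ t ∉ singularSet (m + 1) (m + 2) f) : 0 < speedSq g f γ t := by
  refine g.pos _ _ ?_
  rw [velocity_comp ((hf (γ t)).mdifferentiableAt (by simp))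
    ((hγ t).mdifferentiableAt (by simp))]
  exact fun h0 => hv (not_not.1 ht (h0.trans (map_zero _).symm))

theorem IsNormalField.continuousAt_foldNumber (h : IsNormalField g f γ ν)
    (he : MorinExtension (m := m) f F ι) (hf : ContMDiff (𝓡 (m + 1)) (𝓡 (m + 2)) ∞ f) {t : ℝ}
    {φ : OpenPartialHomeomorph W (Euc (m + 2))} {ψ : OpenPartialHomeomorph N (Euc (m + 2))}
    (hc : IsMorinChart (m := m) F ι (γ t) k φ ψ) :
    ContinuousAt (fun s => foldNumber g f ι k φ ψ (γ s) (ν s)) t := by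
  have hs := (he.eventually_frontForm hc).self_of_nhds.mem_source
  have h1 := contDiffAt_image_curve h.contMDiff hf hc.right_mem hs
  have h4 : ContinuousAt (fun s => chartMetric g ψ (ψ (f (γ s)))) t :=
    ContinuousAt.comp (g := chartMetric g ψ)
      (contDiffAt_chartMetric g hc.right_mem (ψ.map_source hs)).continuousAt h1.continuousAt
  have h5 : ContinuousAt (fun s => φ (ι (γ s))) t :=
    ContinuousAt.comp (g := φ) (φ.continuousAt hc.mem_source)
      (he.smooth_emb.continuous.comp h.contMDiff.continuous).continuousAt
  exact ((h4.clm_apply (h.contDiffAt_dchart hc.right_mem hs).continuousAt).clm_apply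
    continuousAt_const).mul
      (ContinuousAt.comp (g := morinPoly'' m k) contDiff_morinPoly''.continuous.continuousAt h5)

theorem IsNormalField.eventually_foldPos_iff (h : IsNormalField g f γ ν)
    (he : MorinExtension (m := m) f F ι) (hf : ContMDiff (𝓡 (m + 1)) (𝓡 (m + 2)) ∞ f) {t : ℝ}
    (hk : 1 ≤ k)
    {φ : OpenPartialHomeomorph W (Euc (m + 2))} {ψ : OpenPartialHomeomorph N (Euc (m + 2))}
    (hc : IsMorinChart (m := m) F ι (γ t) k φ ψ) :
    ∀ᶠ s in 𝓝 t, γ s ∉ singularSet (m + 1) (m + 2) f →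
      (FoldPos g f F ι (γ s) (ν s) ↔ 0 < foldNumber g f ι k φ ψ (γ s) (ν s)) := by
  filter_upwards [h.contMDiff.continuous.continuousAt.eventually (he.eventually_isMorinChart hc)]
    with s hs hreg
  exact he.foldPos_iff hf hk hs hreg (h.unit s).inner_mfderiv

/-- The fold number in a fixed normal form is continuous along the curve and nonzero at regular
times, so its sign is locally constant there. -/
theorem IsNormalField.eventually_foldPos_eq (h : IsNormalField g f γ ν)
    (he : MorinExtension (m := m) f F ι) (hf : ContMDiff (𝓡 (m + 1)) (𝓡 (m + 2)) ∞ f) {t : ℝ}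
    (ht : γ t ∉ singularSet (m + 1) (m + 2) f) :
    ∀ᶠ s in 𝓝 t, (FoldPos g f F ι (γ s) (ν s) ↔ FoldPos g f F ι (γ t) (ν t)) := by
  obtain ⟨k, φ, ψ, hk, -, -, hc⟩ := he.exists_chart (γ t)
  have h0 := he.foldNumber_ne_zero hf hk hc ht (h.unit t).inner_self (h.unit t).inner_mfderiv
  have hcont := h.continuousAt_foldNumber he hf hc
  have hev := h.eventually_foldPos_iff he hf hk hc
  have hreg : ∀ᶠ s in 𝓝 t, γ s ∉ singularSet (m + 1) (m + 2) f :=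
    h.contMDiff.continuous.continuousAt.eventually
      ((he.isClosed_singularSet hf).isOpen_compl.mem_nhds ht)
  rcases lt_or_gt_of_ne h0 with h1 | h1
  · filter_upwards [hcont.eventually (gt_mem_nhds h1), hev, hreg] with s h2 h3 h4
    rw [h3 h4, hev.self_of_nhds ht]
    exact iff_of_false h2.not_gt h1.not_gt
  · filter_upwards [hcont.eventually (lt_mem_nhds h1), hev, hreg] with s h2 h3 h4
    rw [h3 h4, hev.self_of_nhds ht]
    exact iff_of_true h2 h1

/-- The behaviour of the normal curvature map of a null curve at an `A_2`-point. -/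
theorem IsNormalField.tendsto_cusp (h : IsNormalField g f γ ν)
    (he : MorinExtension (m := m) f F ι) (hf : ContMDiff (𝓡 (m + 1)) (𝓡 (m + 2)) ∞ f) {t : ℝ}
    (hS : γ t ∈ singularSet (m + 1) (m + 2) f)
    (hcusp : IsRightLeftEquivAt (a := m + 1) (b := m + 2) f (γ t) (cuspForm m))
    (hv : velocity (d := m + 1) γ t ≠ 0)
    (hnull : mfderiv (𝓡 (m + 1)) (𝓡 (m + 2)) f (γ t) (velocity (d := m + 1) γ t) = 0) :
    Tendsto (fun s => speedSq g f γ s / normalAccel g f γ ν s) (𝓝[≠] t) (𝓝 0) ∧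
    ∀ᶠ s in 𝓝[≠] t, normalAccel g f γ ν s ≠ 0 ∧
      (FoldPos g f F ι (γ s) (ν s) ↔ 0 < normalAccel g f γ ν s) := by
  -- The hypothesis concerns only the germ of `f`; this converts it into the normal form of `F` with
  -- `k = 2`, centred at the point.
  obtain ⟨φ, ψ, h0, hc⟩ := he.cusp_of_not_curve hf hS (not_hasSingularKernelCurve hf hcusp)
  have hform := he.eventually_frontForm hc
  have hγc := h.contMDiff.continuous
  have hs := hform.self_of_nhds.mem_source
  have hγform : ∀ᶠ s in 𝓝 t, ∀ᶠ q in 𝓝 (γ s), IsFrontForm f 2 (fun q => φ (ι q)) ψ q :=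
    hγc.continuousAt.eventually (eventually_eventually_nhds.2 hform)
  let z : ℝ → Euc (m + 2) := fun s => φ (ι (γ s))
  let V : ℝ → Euc (m + 2) := fun s => dchart ψ (f (γ s)) (ν s)
  let c : ℝ → Euc (m + 2) := fun s => morinForm (m + 1) 2 (z s)
  have hceq : (fun s => ψ (f (γ s))) =ᶠ[𝓝 t] c := by
    filter_upwards [hγform] with s hs using hs.self_of_nhds.form
  have hιγ : ContMDiffAt 𝓘(ℝ, ℝ) (𝓡 (m + 2)) 2 (fun s => ι (γ s)) t :=
    ((he.smooth_emb (γ t)).of_le two_le_infty).comp t (h.contMDiff t)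
  have hz : ContDiffAt ℝ 2 z t := contDiffAt_chart_curve two_le_infty hc.left_mem hc.mem_source hιγ
  have hV : ContDiffAt ℝ 2 V t := h.contDiffAt_dchart hc.right_mem hs
  have hct : c t = ψ (f (γ t)) := hceq.self_of_nhds.symm
  have hG : ContDiffAt ℝ 2 (chartMetric g ψ) (c t) := by
    rw [hct]; exact (contDiffAt_chartMetric g hc.right_mem (ψ.map_source hs)).of_le two_le_infty
  have hP : ∀ᶠ s in 𝓝 t, morinPoly' m 2 (z s) = 0 := by
    filter_upwards [hγform] with s hs using hs.self_of_nhds.singular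
  have hn' : ∀ᶠ s in 𝓝[≠] t, ∀ w, chartMetric g ψ (c s) (V s)
      (fderiv ℝ (morinForm (m + 1) 2) (z s) w) = 0 := by
    filter_upwards [h.regular t, hγform.filter_mono nhdsWithin_le_nhds,
      hceq.filter_mono nhdsWithin_le_nhds] with s h1 h2 h3 w
    rw [← h3]
    exact chartMetric_fderiv_morinForm g one_le_two hc.right_mem h2 (hf _) h1
      (h.unit s).inner_mfderiv w
  -- At the cusp the image of `dF` is larger than that of `df`, so normality to it is obtained as a
  -- limit from regular times.
  have hn0 : ∀ w, chartMetric g ψ (c t) (V t) (fderiv ℝ (morinForm (m + 1) 2) (z t) w) = 0 := by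
    intro w
    have hF : ContDiff ℝ ∞ (morinForm (m + 1) 2) := contDiff_morinForm
    have h1 : ContinuousAt (fun s => chartMetric g ψ (c s)) t :=
      ContinuousAt.comp (g := chartMetric g ψ) hG.continuousAt
        (hF.continuous.continuousAt.comp hz.continuousAt)
    have h2 : ContinuousAt (fun s => fderiv ℝ (morinForm (m + 1) 2) (z s) w) t :=
      (ContinuousAt.comp (g := fderiv ℝ (morinForm (m + 1) 2))
        (hF.continuous_fderiv (by simp)).continuousAt hz.continuousAt).clm_apply continuousAt_const
    have h3 := ((h1.clm_apply hV.continuousAt).clm_apply h2).mono_left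
      (nhdsWithin_le_nhds (s := {t}ᶜ))
    refine tendsto_nhds_unique h3 (tendsto_const_nhds.congr' ?_)
    filter_upwards [hn'] with s hs using (hs w).symm
  have hn : ∀ᶠ s in 𝓝 t, ∀ w, chartMetric g ψ (c s) (V s)
      (fderiv ℝ (morinForm (m + 1) 2) (z s) w) = 0 := by
    filter_upwards [eventually_nhdsWithin_iff.1 hn'] with s hs
    by_cases hst : s = t
    · rw [hst]; exact hn0
    · exact hs hst
  have hdz : deriv z t = mfderiv (𝓡 (m + 1)) (𝓡 (m + 2)) (fun q => φ (ι q)) (γ t)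
      (velocity (d := m + 1) γ t) := by
    have h1 := velocity_comp (f := fun q => φ (ι q))
      (hform.self_of_nhds.smooth.mdifferentiableAt (by simp))
      ((h.contMDiff t).mdifferentiableAt (by simp))
    refine Eq.trans ?_ h1
    rw [velocity, mfderiv_eq_fderiv]
    rfl
  obtain ⟨r, hr⟩ := (mfderiv_eq_zero_iff_frontForm hc.right_mem hform (hf _) _).1 hnull
  rw [hr] at hdz
  have hr0 : r ≠ 0 := by
    rintro rfl
    rw [zero_smul] at hr
    exact hv (hform.self_of_nhds.injective (hr.trans (ContinuousLinearMap.map_zero _).symm))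
  have hzt : z t = 0 := h0
  have hdc : deriv c t = 0 := by
    have hF : ContDiff ℝ ∞ (morinForm (m + 1) 2) := contDiff_morinForm
    have h1 : HasDerivAt c (fderiv ℝ (morinForm (m + 1) 2) (z t) (deriv z t)) t :=
      (hF.differentiable (by simp) (z t)).hasFDerivAt.comp_hasDerivAt t
        (hz.differentiableAt (by simp)).hasDerivAt
    rw [h1.deriv, hdz, map_smul, fderiv_morinForm_eLast, hP.self_of_nhds, zero_smul, smul_zero]
  have hlast : deriv z t (Fin.last (m + 1)) = r := by rw [hdz]; simp
  -- For `k = 2` one has `P'' = 6 z_d`, and the null direction is `z' = r • eLast` with `r ≠ 0`;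
  -- hence a simple zero.
  have hq : HasDerivAt (fun s => morinPoly'' m 2 (z s)) (6 * r) t := by
    simp only [morinPoly''_two]
    rw [← hlast]
    exact ((hasFDerivAt_coord (Fin.last (m + 1)) (z t)).comp_hasDerivAt t
      (hz.differentiableAt (by simp)).hasDerivAt).const_mul 6
  have hκ : chartMetric g ψ (c t) (V t) (eFirst (m + 1)) ≠ 0 := by
    refine eFirst_ne_zero_of_vanishing (V := V t) hn0 ?_
    rw [hct, chartMetric_dchart g hc.right_mem hs, (h.unit t).inner_self]
    exact one_ne_zero
  obtain ⟨h1, h2⟩ := tendsto_covForm_cusp hz hV rfl hG hP hn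
    (by rw [hzt, morinPoly''_two]; simp) (by rw [hlast]; exact hr0) hdc hq
    (mul_ne_zero (by norm_num) hr0) hκ
  have hsrc := (eventually_mem_source (hf.continuous.comp hγc).continuousAt hs)
  have hceq' := eventually_eventually_nhds.2 hceq
  have hb : ∀ᶠ s in 𝓝 t, normalAccel g f γ ν s = covForm (chartMetric g ψ) c V s := by
    filter_upwards [hsrc, hceq'] with s h3 h4
    rw [h.normalAccel_eq hf hc.right_mem h3]
    exact covForm_congr h4
  have ha : ∀ᶠ s in 𝓝 t, speedSq g f γ s = chartMetric g ψ (c s) (deriv c s) (deriv c s) := by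
    filter_upwards [hsrc, hceq'] with s h3 h4
    rw [speedSq_eq h.contMDiff hf hc.right_mem h3, EventuallyEq.deriv_eq h4, h4.self_of_nhds]
  constructor
  · refine h1.congr' ?_
    filter_upwards [ha.filter_mono nhdsWithin_le_nhds, hb.filter_mono nhdsWithin_le_nhds]
      with s h3 h4
    rw [h3, h4]
  · filter_upwards [h2, hb.filter_mono nhdsWithin_le_nhds, hceq.filter_mono nhdsWithin_le_nhds,
      h.regular t, (h.eventually_foldPos_iff he hf one_le_two hc).filter_mono nhdsWithin_le_nhds]
      with s h3 h4 h5 h6 h7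
    rw [h4, h7 h6]
    have h8 : foldNumber g f ι 2 φ ψ (γ s) (ν s)
        = chartMetric g ψ (c s) (V s) (eFirst (m + 1)) * morinPoly'' m 2 (z s) := by
      rw [← h5]; rfl
    rw [h8]
    exact ⟨right_ne_zero_of_mul h3.ne', pos_iff_pos_of_mul_pos h3⟩

end NormalCurvature

/-! ### Uniqueness of the rotation index -/

section RotationIndex

/-- Two lifts satisfy `sin (θ - θ') = 0` off a finite set, hence everywhere by continuity. Then `(θ
- θ') / π` is continuous and integer valued on an interval, so it is constant. -/
theorem HasRotationIndex.unique {a b : ℝ → ℝ} {S : Set ℝ} {k k' : ℤ}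
    (hS : {t ∈ Icc (0 : ℝ) 1 | t ∈ S}.Finite) (h : HasRotationIndex a b S k)
    (h' : HasRotationIndex a b S k') : k = k' := by
  obtain ⟨θ, hθ, hl, hk⟩ := h
  obtain ⟨θ', hθ', hl', hk'⟩ := h'
  have hcont : ContinuousOn (fun t => Real.sin (θ t - θ' t)) (Icc 0 1) :=
    Real.continuous_sin.comp_continuousOn (hθ.sub hθ')
  have h0 : EqOn (fun t => Real.sin (θ t - θ' t)) (fun _ => 0)
      (Ioo 0 1 ∩ {t ∈ Icc (0 : ℝ) 1 | t ∈ S}ᶜ) := by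
    rintro t ⟨ht, htS⟩
    have htI := Ioo_subset_Icc_self ht
    have htS' : t ∉ S := fun hs => htS ⟨htI, hs⟩
    obtain ⟨hne, h1⟩ := hl t htI htS'
    obtain ⟨-, h2⟩ := hl' t htI htS'
    change Real.sin (θ t - θ' t) = 0
    rw [Real.sin_sub]
    by_cases ha : a t = 0
    · have hb : b t ≠ 0 := fun hb => hne (by rw [ha, hb])
      apply mul_left_cancel₀ hb
      linear_combination (-Real.sin (θ' t)) * h1 + Real.sin (θ t) * h2
    · apply mul_left_cancel₀ ha
      linear_combination (-Real.cos (θ' t)) * h1 + Real.cos (θ t) * h2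
  have hsub : Icc (0 : ℝ) 1 ⊆ closure (Ioo 0 1 ∩ {t ∈ Icc (0 : ℝ) 1 | t ∈ S}ᶜ) := by
    have hd : Dense {t ∈ Icc (0 : ℝ) 1 | t ∈ S}ᶜ := by
      have := dense_univ.sdiff_finite hS
      rwa [← compl_eq_univ_sdiff] at this
    refine (closure_Ioo (zero_ne_one' ℝ)).symm.subset.trans ?_
    exact closure_minimal (hd.open_subset_closure_inter isOpen_Ioo) isClosed_closure
  have hall : EqOn (fun t => Real.sin (θ t - θ' t)) (fun _ => 0) (Icc 0 1) :=
    h0.of_subset_closure hcont continuousOn_const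
      (fun t ht => Ioo_subset_Icc_self ht.1) hsub
  have hconst : (θ 1 - θ' 1) / Real.pi = (θ 0 - θ' 0) / Real.pi := by
    have hdisc : IsDiscrete (range ((↑) : ℤ → ℝ)) :=
      ⟨Int.isClosedEmbedding_coe_real.isEmbedding.toHomeomorph.symm.isEmbedding.discreteTopology⟩
    refine isPreconnected_Icc.constant_of_mapsTo hdisc ((hθ.sub hθ').div_const Real.pi) ?_
      (right_mem_Icc.2 zero_le_one) (left_mem_Icc.2 zero_le_one)
    intro t ht
    obtain ⟨n, hn⟩ := Real.sin_eq_zero_iff.1 (hall ht)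
    refine ⟨n, ?_⟩
    change _ = (θ t - θ' t) / Real.pi
    rw [← hn, mul_div_cancel_right₀ _ Real.pi_ne_zero]
  have hc2 : θ 1 - θ' 1 = θ 0 - θ' 0 := by
    field_simp at hconst
    linarith
  have h3 : ((k : ℝ) - k') * Real.pi = 0 := by linarith
  have h4 := (mul_eq_zero.1 h3).resolve_right Real.pi_ne_zero
  exact_mod_cast sub_eq_zero.1 h4

end RotationIndex

/-! ### Null loops have Maslov number zero -/

section NullLoops

variable {m : ℕ}
  {M : Type u} [TopologicalSpace M] [ChartedSpace (Euc (m + 1)) M] [IsManifold (𝓡 (m + 1)) ∞ M]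
  {N : Type v} [TopologicalSpace N] [ChartedSpace (Euc (m + 2)) N] [IsManifold (𝓡 (m + 2)) ∞ N]
  {W : Type w} [TopologicalSpace W] [ChartedSpace (Euc (m + 2)) W] [IsManifold (𝓡 (m + 2)) ∞ W]
  {f : M → N} {F : W → N} {ι : M → W} {g : Metric (m + 2) N} {o : M}
  {γ : ℝ → M} {ν ν' : ∀ t, TangentSpace (𝓡 (m + 2)) (f (γ t))}

/-- Finiteness is only known on one period. Two translated copies of the exceptional set control the
neighbourhoods of the endpoints, and periodicity does the rest. -/
theorem IsNullLoop.eventually_regular (h : IsNullLoop (m := m) f o γ) (t : ℝ) :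
    ∀ᶠ s in 𝓝[≠] t, γ s ∉ singularSet (m + 1) (m + 2) f := by
  set A := {t ∈ Icc (0 : ℝ) 1 | γ t ∈ singularSet (m + 1) (m + 2) f} with hA
  have hfin : (A ∪ ((fun s => s + 1) '' A ∪ (fun s => s - 1) '' A)).Finite :=
    h.finite.union ((h.finite.image _).union (h.finite.image _))
  have key : ∀ s ∈ Ioo (-1 : ℝ) 2, γ s ∈ singularSet (m + 1) (m + 2) f →
      s ∈ A ∪ ((fun s => s + 1) '' A ∪ (fun s => s - 1) '' A) := by
    intro s hs hS
    rcases lt_or_ge s 0 with h0 | h0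
    · refine Or.inr (Or.inr ⟨s + 1, ⟨⟨by linarith [hs.1], by linarith⟩, ?_⟩, by simp⟩)
      rw [h.periodic]; exact hS
    · rcases le_or_gt s 1 with h1 | h1
      · exact Or.inl ⟨⟨h0, h1⟩, hS⟩
      · refine Or.inr (Or.inl ⟨s - 1, ⟨⟨by linarith, by linarith [hs.2]⟩, ?_⟩, by simp⟩)
        rw [h.periodic.sub_eq]; exact hS
  have hloc : ∀ t₀ ∈ Ico (0 : ℝ) 1, ∀ᶠ s in 𝓝[≠] t₀, γ s ∉ singularSet (m + 1) (m + 2) f := by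
    intro t₀ ht₀
    have h1 := (hfin.subset (sdiff_subset (t := {t₀}))).isClosed.isOpen_compl.mem_nhds
      (show t₀ ∈ _ from fun h => h.2 rfl)
    rw [eventually_nhdsWithin_iff]
    filter_upwards [h1, Ioo_mem_nhds (show -1 < t₀ by linarith [ht₀.1])
      (show t₀ < 2 by linarith [ht₀.2])] with s hs hs' hne hS
    exact hs ⟨key s hs' hS, hne⟩
  have h2 := hloc (Int.fract t) ⟨Int.fract_nonneg t, Int.fract_lt_one t⟩
  rw [eventually_nhdsWithin_iff] at h2 ⊢
  have h3 : Tendsto (fun s => s - (⌊t⌋ : ℝ)) (𝓝 t) (𝓝 (Int.fract t)) := by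
    have : ContinuousAt (fun s => s - (⌊t⌋ : ℝ)) t := by fun_prop
    exact this
  filter_upwards [h3.eventually h2] with s hs hne
  have h4 : γ (s - ⌊t⌋) = γ s := by
    have := h.periodic.sub_zsmul_eq (x := s) ⌊t⌋
    simpa using this
  rw [← h4]
  exact hs fun h5 => hne (sub_left_injective h5)

/-- The inner product of the two fields is continuous with values `±1` on the connected line, and
equals `1` at time `0`. -/
theorem IsNormalField.eq_of_eq_zero (hd : Dense (singularSet (m + 1) (m + 2) f)ᶜ)
    (h : Continuous (fun t => (⟨f (γ t), ν t⟩ : TangentBundle (𝓡 (m + 2)) N)))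
    (hu : ∀ t, IsUnitNormalAt g f (γ t) (ν t))
    (h' : Continuous (fun t => (⟨f (γ t), ν' t⟩ : TangentBundle (𝓡 (m + 2)) N)))
    (hu' : ∀ t, IsUnitNormalAt g f (γ t) (ν' t)) (h0 : ν 0 = ν' 0) : ν = ν' := by
  have hc : ContinuousOn (fun t => g.inner (f (γ t)) (ν t) (ν' t)) univ :=
    fun t _ => (continuousAt_inner g h.continuousAt h'.continuousAt).continuousWithinAt
  have hsq : ∀ t, g.inner (f (γ t)) (ν t) (ν' t) ^ 2 = 1 := fun t =>
    (hu t).inner_sq_of_closure (hd (γ t)) (hu' t)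
  have h1 : ∀ t, g.inner (f (γ t)) (ν t) (ν' t) = 1 := by
    rcases isPreconnected_univ.eq_one_or_eq_neg_one_of_sq_eq hc (fun t _ => hsq t) with h2 | h2
    · exact fun t => h2 (mem_univ t)
    · have h3 := h2 (mem_univ 0)
      simp only [← h0, (hu 0).inner_self, Pi.neg_apply, Pi.one_apply] at h3
      norm_num at h3
  funext t
  have h4 := eq_smul_of_inner_sq (f (γ t)) (hu t).inner_self (hu' t).inner_self (hsq t)
  rw [h1, one_smul] at h4
  exact h4.symm

/-- The unit normal field along a null loop, as a periodic field on the line. -/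
theorem exists_normalField (h : IsNullLoop (m := m) f o γ) (hc : IsCoorientable g f h.toPath)
    (hd : Dense (singularSet (m + 1) (m + 2) f)ᶜ)
    {ν₀ : TangentSpace (𝓡 (m + 2)) (f o)} (hν₀ : IsUnitNormalAt g f o ν₀) :
    ∃ ν : ∀ t, TangentSpace (𝓡 (m + 2)) (f (γ t)), IsNormalField g f γ ν ∧
      Function.Periodic (fun t => (⟨f (γ t), ν t⟩ : TangentBundle (𝓡 (m + 2)) N)) 1 ∧
      (⟨f (γ 0), ν 0⟩ : TangentBundle (𝓡 (m + 2)) N) = ⟨f o, ν₀⟩ := by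
  obtain ⟨μ, hμ, hμu, hμ1⟩ := hc
  let X : unitInterval → TangentBundle (𝓡 (m + 2)) N := fun t => ⟨f (h.toPath t), μ t⟩
  let Y₀ : ℝ → TangentBundle (𝓡 (m + 2)) N := fun t => X (projIcc 0 1 zero_le_one t)
  have hY₀ : Continuous Y₀ := hμ.comp continuous_projIcc
  -- Equality of the field at both ends of `[0, 1]` makes its periodic extension continuous.
  let Y : ℝ → TangentBundle (𝓡 (m + 2)) N := Y₀ ∘ Int.fract
  have hY01 : Y₀ 0 = Y₀ 1 := by
    simp only [Y₀, projIcc_left, projIcc_right]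
    exact hμ1
  have hY : Continuous Y := hY₀.continuousOn.comp_fract'' hY01
  have hpt : ∀ t, h.toPath (projIcc 0 1 zero_le_one (Int.fract t)) = γ t := by
    intro t
    have h1 : ((projIcc 0 1 zero_le_one (Int.fract t) : unitInterval) : ℝ) = Int.fract t := by
      rw [projIcc_of_mem zero_le_one ⟨Int.fract_nonneg t, (Int.fract_lt_one t).le⟩]
    change γ (projIcc 0 1 zero_le_one (Int.fract t) : unitInterval) = γ t
    rw [h1, Int.fract]
    simpa using h.periodic.sub_zsmul_eq (x := t) ⌊t⌋
  let μ' : ∀ t, TangentSpace (𝓡 (m + 2)) (f (γ t)) := fun t => (Y t).2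
  have hYμ : ∀ t, Y t = ⟨f (γ t), μ' t⟩ := by
    intro t
    have key : ∀ (y : N) (v : Euc (m + 2)), y = f (γ t) →
        (⟨y, v⟩ : TangentBundle (𝓡 (m + 2)) N) = ⟨f (γ t), v⟩ := by
      rintro _ v rfl; rfl
    exact key _ _ (congrArg f (hpt t))
  have hμ'u : ∀ t, IsUnitNormalAt g f (γ t) (μ' t) := by
    intro t
    have key : ∀ (p : M) (v : Euc (m + 2)), p = γ t → IsUnitNormalAt g f p v →
        IsUnitNormalAt g f (γ t) v := by
      rintro _ v rfl hv; exact hv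
    exact key _ _ (hpt t) (hμu _)
  have hper : Function.Periodic Y 1 := fun t => by simp [Y]
  have hYeq : Y = fun t => ⟨f (γ t), μ' t⟩ := funext hYμ
  have hN : IsNormalField g f γ μ' :=
    ⟨h.contMDiff, hYeq ▸ hY, hμ'u, h.eventually_regular⟩
  -- The given field starts at `ν₀` or at `-ν₀`; in the second case it is negated.
  have key : ∀ (p : M) (v : Euc (m + 2)), p = o → IsUnitNormalAt g f p v →
      (⟨f p, v⟩ : TangentBundle (𝓡 (m + 2)) N) = ⟨f o, ν₀⟩ ∨
      (⟨f p, -v⟩ : TangentBundle (𝓡 (m + 2)) N) = ⟨f o, ν₀⟩ := by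
    rintro p v rfl hv
    rcases hv.eq_or_eq_neg (hd _) hν₀ with h1 | h1
    · left; rw [h1]
    · right; rw [h1]; rfl
  rcases key (γ 0) (μ' 0) h.base (hμ'u 0) with h1 | h1
  · exact ⟨μ', hN, hYeq ▸ hper, h1⟩
  · refine ⟨fun t => -μ' t, ⟨h.contMDiff, ?_, fun t => (hμ'u t).neg, h.eventually_regular⟩, ?_, h1⟩
    · exact contMDiff_neg_tangentBundle.continuous.comp hN.continuous
    · intro t
      have h2 := hper t
      rw [hYeq] at h2
      exact congrArg (fun x : TangentBundle (𝓡 (m + 2)) N =>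
        (⟨x.1, -x.2⟩ : TangentBundle (𝓡 (m + 2)) N)) h2

theorem covForm_periodic {d : ℕ} {G : Euc d → Euc d →L[ℝ] Euc d →L[ℝ] ℝ} {c V : ℝ → Euc d} {T : ℝ}
    (hc : Function.Periodic c T) (hV : Function.Periodic V T) :
    Function.Periodic (covForm G c V) T := by
  intro t
  have h : ∀ {b : ℝ → Euc d}, Function.Periodic b T → deriv b (t + T) = deriv b t := by
    intro b hb
    rw [← deriv_comp_add_const, show (fun x => b (x + T)) = b from funext hb]
  rw [covForm, covForm, h hc, h hV, hc, hV]

/-- The fold side provides a global choice of branch for the angle. Whenever the curvature map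
passes through infinity, the position of `ν` relative to the fold side switches as well and absorbs
the jump of the arctangent. As that position is the same at both ends of the loop, the lift closes
up. -/
theorem IsNormalField.hasMaslovNumber_zero (hn : IsNormalField g f γ ν)
    (hper : Function.Periodic (fun t => (⟨f (γ t), ν t⟩ : TangentBundle (𝓡 (m + 2)) N)) 1)
    (h : IsNullLoop (m := m) f o γ) (ho : o ∉ singularSet (m + 1) (m + 2) f)
    (he : MorinExtension (m := m) f F ι) (hf : ContMDiff (𝓡 (m + 1)) (𝓡 (m + 2)) ∞ f) :
    HasMaslovNumber g f γ ν 0 := by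
  classical
  let a := speedSq g f γ
  let b := normalAccel g f γ ν
  let S := singularSet (m + 1) (m + 2) f
  let p : ℝ → Prop := fun t => FoldPos g f F ι (γ t) (ν t)
  -- On the side of a cusp with `b > 0` the arctangent tends to `π/2` and is lowered by `π`; on the
  -- side with `b < 0` it tends to `-π/2` unaltered.
  let θ : ℝ → ℝ := fun t => if γ t ∈ S then -(Real.pi / 2) else
    Real.arctan (b t / a t) - if p t then Real.pi else 0
  have ha : Continuous a := continuous_speedSq h.contMDiff hf
  have hb : Continuous b := hn.continuous_normalAccel hf
  have hapos : ∀ t, γ t ∉ S → 0 < a t := fun t ht => speedSq_pos h.contMDiff hf (h.regular t) ht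
  have hθreg : ∀ t, γ t ∉ S → θ t = Real.arctan (b t / a t) - if p t then Real.pi else 0 :=
    fun t ht => if_neg ht
  have hθ : Continuous θ := by
    rw [continuous_iff_continuousAt]
    intro t
    by_cases ht : γ t ∈ S
    · obtain ⟨h1, h2⟩ := hn.tendsto_cusp he hf ht (h.cusp t ht) (h.regular t) (h.null t ht)
      refine continuousAt_angle_of_cusp (a := a) (b := b) (p := p) (if_pos ht) ?_ h1 ?_
      · filter_upwards [hn.regular t] with s hs using hθreg s hs
      · filter_upwards [hn.regular t, h2] with s hs hs2
        exact ⟨hapos s hs, hs2⟩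
    · have hreg : ∀ᶠ s in 𝓝 t, γ s ∉ S :=
        h.contMDiff.continuous.continuousAt.eventually
          ((he.isClosed_singularSet hf).isOpen_compl.mem_nhds ht)
      have h1 : ContinuousAt (fun s => Real.arctan (b s / a s) - if p t then Real.pi else 0) t :=
        (Real.continuous_arctan.continuousAt.comp
          (hb.continuousAt.div ha.continuousAt (hapos t ht).ne')).sub continuousAt_const
      refine h1.congr ?_
      filter_upwards [hreg, hn.eventually_foldPos_eq he hf ht] with s hs hs2
      rw [hθreg s hs]
      simp only [p, hs2]
  have h0 : γ 0 ∉ S := by rw [h.base]; exact ho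
  have hγ1 : γ 1 = γ 0 := by simpa using h.periodic 0
  have h1 : γ 1 ∉ S := by rw [hγ1]; exact h0
  have hp01 : p 1 ↔ p 0 := by
    have key : ∀ (q q' : M) (v : TangentSpace (𝓡 (m + 2)) (f q))
        (v' : TangentSpace (𝓡 (m + 2)) (f q')), q = q' →
        (⟨f q, v⟩ : TangentBundle (𝓡 (m + 2)) N) = ⟨f q', v'⟩ →
        (FoldPos g f F ι q v ↔ FoldPos g f F ι q' v') := by
      rintro q _ v v' rfl hv
      rw [Bundle.TotalSpace.mk_inj.1 hv]
    exact key _ _ _ _ hγ1 hper.eq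
  have hψ : chartAt (Euc (m + 2)) (f (γ 0)) ∈ Atlas (m + 2) N :=
    IsManifold.chart_mem_maximalAtlas _
  set ψ := chartAt (Euc (m + 2)) (f (γ 0))
  have hs0 : f (γ 0) ∈ ψ.source := mem_chart_source _ _
  have hs1 : f (γ 1) ∈ ψ.source := by rw [hγ1]; exact hs0
  have hcper : Function.Periodic (fun s => ψ (f (γ s))) 1 := fun s =>
    congrArg (fun q => ψ (f q)) (h.periodic s)
  have hVper : Function.Periodic (fun s => dchart ψ (f (γ s)) (ν s)) 1 := fun s =>
    congrArg (fun x : TangentBundle (𝓡 (m + 2)) N => dchart ψ x.1 x.2) (hper s)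
  have ha01 : a 1 = a 0 := by
    have hd : deriv (fun s => ψ (f (γ s))) 1 = deriv (fun s => ψ (f (γ s))) 0 := by
      have := deriv_comp_add_const (fun s => ψ (f (γ s))) 1 0
      rw [zero_add] at this
      rw [← this]
      congr 1
      exact funext hcper
    simp only [a]
    rw [speedSq_eq h.contMDiff hf hψ hs0, speedSq_eq h.contMDiff hf hψ hs1, hd, hγ1]
  have hb01 : b 1 = b 0 := by
    simp only [b]
    rw [hn.normalAccel_eq hf hψ hs0, hn.normalAccel_eq hf hψ hs1]
    simpa using covForm_periodic (G := chartMetric g ψ) hcper hVper 0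
  refine ⟨θ, hθ.continuousOn, fun t _ ht => ?_, ?_⟩
  · have hat := hapos t ht
    refine ⟨fun h2 => hat.ne' (congrArg Prod.fst h2), ?_⟩
    have h2 : Real.cos (Real.arctan (b t / a t)) * b t
        = Real.sin (Real.arctan (b t / a t)) * a t := by
      have h3 := Real.tan_mul_cos (Real.cos_arctan_pos (b t / a t)).ne'
      rw [Real.tan_arctan] at h3
      rw [← h3]
      field_simp
    change Real.cos (θ t) * b t = Real.sin (θ t) * a t
    rw [hθreg t ht]
    split_ifs
    · rw [Real.cos_sub_pi, Real.sin_sub_pi]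
      linear_combination -h2
    · rwa [sub_zero]
  · rw [hθreg 1 h1, hθreg 0 h0, ha01, hb01]
    simp [hp01]

/-- The Maslov number of a null loop is well defined. -/
theorem eq_zero_of_hasMaslovNumber (hn : IsNormalField g f γ ν)
    (hper : Function.Periodic (fun t => (⟨f (γ t), ν t⟩ : TangentBundle (𝓡 (m + 2)) N)) 1)
    (h : IsNullLoop (m := m) f o γ) (ho : o ∉ singularSet (m + 1) (m + 2) f)
    (he : MorinExtension (m := m) f F ι) (hf : ContMDiff (𝓡 (m + 1)) (𝓡 (m + 2)) ∞ f)
    (hd : Dense (singularSet (m + 1) (m + 2) f)ᶜ)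
    (h' : Continuous (fun t => (⟨f (γ t), ν' t⟩ : TangentBundle (𝓡 (m + 2)) N)))
    (hu' : ∀ t, IsUnitNormalAt g f (γ t) (ν' t)) (h0 : ν 0 = ν' 0) {k : ℤ}
    (hk : HasMaslovNumber g f γ ν' k) : k = 0 := by
  obtain rfl := IsNormalField.eq_of_eq_zero hd hn.continuous hn.unit h' hu' h0
  exact HasRotationIndex.unique h.finite hk (hn.hasMaslovNumber_zero hper h ho he hf)

end NullLoops

/-! ### The trivial homomorphism as a Maslov representation -/

section MaslovRepresentation

variable {m : ℕ}
  {M : Type u} [TopologicalSpace M] [ChartedSpace (Euc (m + 1)) M] [IsManifold (𝓡 (m + 1)) ∞ M]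
  {N : Type v} [TopologicalSpace N] [ChartedSpace (Euc (m + 2)) N] [IsManifold (𝓡 (m + 2)) ∞ N]
  {W : Type w} [TopologicalSpace W] [ChartedSpace (Euc (m + 2)) W] [IsManifold (𝓡 (m + 2)) ∞ W]
  {f : M → N} {F : W → N} {ι : M → W} {g : Metric (m + 2) N} {o : M}
  {ν₀ : TangentSpace (𝓡 (m + 2)) (f o)}

/-- The trivial homomorphism is a Maslov representation of a Morin front. -/
theorem MorinExtension.isMaslovRepresentation_one (he : MorinExtension (m := m) f F ι)
    (hf : ContMDiff (𝓡 (m + 1)) (𝓡 (m + 2)) ∞ f) (ho : o ∉ singularSet (m + 1) (m + 2) f)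
    (hν₀ : IsUnitNormalAt g f o ν₀) : IsMaslovRepresentation g f o ν₀ 1 := by
  intro γ h hc
  obtain ⟨ν, hn, hper, h0⟩ := exists_normalField h hc (he.dense_regular hf) hν₀
  refine ⟨ν, hn.continuous, hn.unit, h0, ?_, hn.hasMaslovNumber_zero hper h ho he hf⟩
  exact hper.eq.trans h0

theorem MorinExtension.eq_one_of_nullLoop (he : MorinExtension (m := m) f F ι)
    (hf : ContMDiff (𝓡 (m + 1)) (𝓡 (m + 2)) ∞ f) (ho : o ∉ singularSet (m + 1) (m + 2) f)
    (hν₀ : IsUnitNormalAt g f o ν₀) {Φ : coorientableSubgroup g f o →* Multiplicative ℤ}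
    (hΦ : IsMaslovRepresentation g f o ν₀ Φ) {γ : ℝ → M} (h : IsNullLoop (m := m) f o γ)
    (hc : IsCoorientable g f h.toPath) : Φ ⟨loopClass h.toPath, loopClass_mem hc⟩ = 1 := by
  obtain ⟨ν, hn, hper, h0⟩ := exists_normalField h hc (he.dense_regular hf) hν₀
  obtain ⟨ν', hν', hu', h0', -, hk⟩ := hΦ γ h hc
  exact eq_zero_of_hasMaslovNumber hn hper h ho he hf (he.dense_regular hf) hν' hu'
    (Bundle.TotalSpace.mk_inj.1 (h0.trans h0'.symm)) hk

end MaslovRepresentation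

/-! ### The double cover by unit normals and homotopy invariance of co-orientability -/

section Coorientation

variable {m : ℕ}
  {M : Type u} [TopologicalSpace M] [ChartedSpace (Euc (m + 1)) M] [IsManifold (𝓡 (m + 1)) ∞ M]
  {N : Type v} [TopologicalSpace N] [ChartedSpace (Euc (m + 2)) N] [IsManifold (𝓡 (m + 2)) ∞ N]
  {f : M → N} {g : Metric (m + 2) N} {o : M}

/-- The double cover of `M` formed by the unit normal vectors of `f`. -/
def NormalCover (g : Metric (m + 2) N) (f : M → N) : Type (max u v) :=
  {x : M × TangentBundle (𝓡 (m + 2)) N // ∃ v, x.2 = ⟨f x.1, v⟩ ∧ IsUnitNormalAt g f x.1 v}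

instance : TopologicalSpace (NormalCover g f) :=
  inferInstanceAs (TopologicalSpace {x : M × TangentBundle (𝓡 (m + 2)) N //
    ∃ v, x.2 = ⟨f x.1, v⟩ ∧ IsUnitNormalAt g f x.1 v})

namespace NormalCover

/-- The projection of the double cover. -/
def proj (x : NormalCover g f) : M := x.1.1

/-- The point of the double cover given by a unit normal vector. -/
def mk (p : M) (v : TangentSpace (𝓡 (m + 2)) (f p)) (hv : IsUnitNormalAt g f p v) :
    NormalCover g f := ⟨(p, ⟨f p, v⟩), v, rfl, hv⟩

/-- The unit normal vector of a point of the double cover. -/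
def normal (x : NormalCover g f) : TangentSpace (𝓡 (m + 2)) (f x.proj) := x.2.choose

theorem bundle_eq (x : NormalCover g f) :
    x.1.2 = (⟨f x.proj, x.normal⟩ : TangentBundle (𝓡 (m + 2)) N) := x.2.choose_spec.1

theorem isUnitNormalAt (x : NormalCover g f) : IsUnitNormalAt g f x.proj x.normal :=
  x.2.choose_spec.2

theorem continuous_proj : Continuous (proj : NormalCover g f → M) :=
  continuous_fst.comp continuous_subtype_val

theorem continuous_normal : Continuous
    fun x : NormalCover g f => (⟨f x.proj, x.normal⟩ : TangentBundle (𝓡 (m + 2)) N) := by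
  have h : (fun x : NormalCover g f => (⟨f x.proj, x.normal⟩ : TangentBundle (𝓡 (m + 2)) N))
      = fun x => x.1.2 := funext fun x => x.bundle_eq.symm
  rw [h]
  exact continuous_snd.comp continuous_subtype_val

theorem ext_normal {x y : NormalCover g f}
    (h : (x.proj, (⟨f x.proj, x.normal⟩ : TangentBundle (𝓡 (m + 2)) N))
      = (y.proj, ⟨f y.proj, y.normal⟩)) : x = y := by
  apply Subtype.ext
  obtain ⟨h1, h2⟩ := Prod.mk.inj h
  exact Prod.ext h1 (x.bundle_eq.trans (h2.trans y.bundle_eq.symm))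

theorem normal_mk (p : M) (v : TangentSpace (𝓡 (m + 2)) (f p)) (hv : IsUnitNormalAt g f p v) :
    (mk p v hv).normal = v :=
  (Bundle.TotalSpace.mk_inj.1 (mk p v hv).bundle_eq).symm

/-- Over the domain of a local unit normal field `ν` every unit normal is `ν` or `-ν`, by density of
the regular points. The sign of the inner product with `ν` separates the two sheets continuously. -/
theorem isCoveringMap (hd : Dense (singularSet (m + 1) (m + 2) f)ᶜ) (hf : IsFront g f) :
    IsCoveringMap (proj : NormalCover g f → M) := by
  classical
  intro p
  obtain ⟨U, hpU, ν, hν⟩ := hf.2 p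
  have hun : ∀ q ∈ U, IsUnitNormalAt g f q (ν q) := fun q hq => ⟨U, ν, hq, hν, rfl⟩
  let r : (proj : NormalCover g f → M) ⁻¹' U → ℝ := fun x => g.inner (f x.1.proj) x.1.normal (ν x.1.proj)
  have hνc : Continuous fun x : (proj : NormalCover g f → M) ⁻¹' U =>
      (⟨f x.1.proj, ν x.1.proj⟩ : TangentBundle (𝓡 (m + 2)) N) := by
    rw [continuous_iff_continuousAt]
    intro x
    exact ContinuousAt.comp (f := fun x : (proj : NormalCover g f → M) ⁻¹' U => x.1.proj)
      (g := fun q => (⟨f q, ν q⟩ : TangentBundle (𝓡 (m + 2)) N)) (hν.continuousAt x.2)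
      (continuous_proj.comp continuous_subtype_val).continuousAt
  have hr : Continuous r := continuous_iff_continuousAt.2 fun x =>
    continuousAt_inner g (continuous_normal.comp continuous_subtype_val).continuousAt
      hνc.continuousAt
  have hcase : ∀ x : (proj : NormalCover g f → M) ⁻¹' U,
      (0 < r x ∧ x.1.normal = ν x.1.proj) ∨ (¬ 0 < r x ∧ x.1.normal = -ν x.1.proj) := by
    intro x
    have h1 := (hun _ x.2).inner_self
    rcases (hun _ x.2).eq_or_eq_neg (hd x.1.proj) x.1.isUnitNormalAt with h | h
    · left
      refine ⟨?_, h⟩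
      change 0 < g.inner (f x.1.proj) x.1.normal (ν x.1.proj)
      rw [h, h1]; exact one_pos
    · right
      refine ⟨?_, h⟩
      change ¬ 0 < g.inner (f x.1.proj) x.1.normal (ν x.1.proj)
      rw [h, map_neg, neg_apply, h1]; norm_num
  have hr0 : ∀ x, r x ≠ 0 := by
    intro x h0
    rcases hcase x with ⟨h, -⟩ | ⟨-, h⟩
    · exact h.ne' h0
    · have h2 : r x = g.inner (f x.1.proj) x.1.normal (ν x.1.proj) := rfl
      rw [h, map_neg, neg_apply, (hun _ x.2).inner_self] at h2
      rw [h0] at h2; norm_num at h2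
  have hsgn : ∀ (y : U) (b : Bool), IsUnitNormalAt g f y.1 (if b then ν y else -ν y) := by
    intro y b
    split_ifs; exacts [hun _ y.2, (hun _ y.2).neg]
  let inv : U × Bool → (proj : NormalCover g f → M) ⁻¹' U := fun y =>
    ⟨mk y.1 (if y.2 then ν y.1 else -ν y.1) (hsgn y.1 y.2), y.1.2⟩
  have hinv : ∀ (y : U) (b : Bool), (inv (y, b)).1.normal = if b then ν y else -ν y :=
    fun y b => normal_mk y.1 _ (hsgn y b)
  let H : (proj : NormalCover g f → M) ⁻¹' U ≃ₜ U × Bool :=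
    { toFun := fun x => (⟨x.1.proj, x.2⟩, decide (0 < r x))
      invFun := inv
      left_inv := by
        intro x
        apply Subtype.ext
        apply ext_normal
        refine Prod.ext rfl ?_
        change (⟨f x.1.proj, (inv (⟨x.1.proj, x.2⟩, decide (0 < r x))).1.normal⟩ :
          TangentBundle (𝓡 (m + 2)) N) = ⟨f x.1.proj, x.1.normal⟩
        rw [hinv]
        rcases hcase x with ⟨h1, h2⟩ | ⟨h1, h2⟩
        · simp only [h1, decide_true, if_true, ← h2]
        · simp only [h1, decide_false, Bool.false_eq_true, if_false, ← h2]
      right_inv := by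
        rintro ⟨y, b⟩
        refine Prod.ext rfl ?_
        have h1 : r (inv (y, b)) = g.inner (f y) (if b then ν y else -ν y) (ν y) := by
          change g.inner (f y) (inv (y, b)).1.normal (ν y) = _
          rw [hinv]
        change decide (0 < r (inv (y, b))) = b
        rw [h1]
        cases b
        · simp [(hun _ y.2).inner_self]
        · simp [(hun _ y.2).inner_self]
      continuous_toFun := by
        refine Continuous.prodMk ?_ ?_
        · exact (continuous_proj.comp continuous_subtype_val).subtype_mk _
        · rw [continuous_iff_continuousAt]
          intro x
          rcases lt_or_gt_of_ne (hr0 x) with h | h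
          · refine continuousAt_const.congr (f := fun _ => false) ?_
            filter_upwards [hr.continuousAt.eventually (gt_mem_nhds h)] with y hy
            simp [hy.le]
          · refine continuousAt_const.congr (f := fun _ => true) ?_
            filter_upwards [hr.continuousAt.eventually (lt_mem_nhds h)] with y hy
            simp [hy]
      continuous_invFun := by
        rw [continuous_prod_of_discrete_right]
        intro b
        refine Continuous.subtype_mk (Continuous.subtype_mk ?_ _) _
        refine continuous_subtype_val.prodMk ?_
        have h1 : Continuous fun y : U => (⟨f y, ν y⟩ : TangentBundle (𝓡 (m + 2)) N) := by
          rw [continuous_iff_continuousAt]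
          intro y
          exact ContinuousAt.comp (f := fun y : U => y.1)
            (g := fun q => (⟨f q, ν q⟩ : TangentBundle (𝓡 (m + 2)) N)) (hν.continuousAt y.2)
            continuous_subtype_val.continuousAt
        cases b
        · exact contMDiff_neg_tangentBundle.continuous.comp h1
        · exact h1 }
  have hE : IsEvenlyCovered (proj : NormalCover g f → M) p Bool :=
    ⟨inferInstance, U, hpU, hν.isOpen, hν.isOpen.preimage continuous_proj, H, fun x => rfl⟩
  exact hE.to_isEvenlyCovered_preimage

end NormalCover

/-- Co-orientability of a loop depends only on its homotopy class. -/
theorem IsCoorientable.of_homotopic (hd : Dense (singularSet (m + 1) (m + 2) f)ᶜ)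
    (hf : IsFront g f) {γ γ' : Path o o} (h : IsCoorientable g f γ) (hγ : γ.Homotopic γ') :
    IsCoorientable g f γ' := by
  have cov := NormalCover.isCoveringMap hd hf
  obtain ⟨ν, hν, hu, h01⟩ := h
  let e : unitInterval → NormalCover g f := fun t => NormalCover.mk (γ t) (ν t) (hu t)
  have he : Continuous e := (γ.continuous.prodMk hν).subtype_mk _
  have h0 : γ 0 = (e 0).proj := rfl
  have h0' : γ' 0 = (e 0).proj := by rw [← h0]; simp
  -- A co-orienting field is a closed lift to the cover, and lifts of homotopic paths from the same
  -- point have the same end.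
  have hlift : e = cov.liftPath γ.toContinuousMap (e 0) h0 :=
    (cov.eq_liftPath_iff h0).2 ⟨he, rfl, rfl⟩
  have he01 : e 0 = e 1 := by
    apply Subtype.ext
    exact Prod.ext (by change γ 0 = γ 1; simp) h01
  have hend := cov.liftPath_apply_one_eq_of_homotopicRel hγ (e 0) h0 h0'
  let e' := cov.liftPath γ'.toContinuousMap (e 0) h0'
  have he'1 : e' 1 = e 1 := hend.symm.trans (congrFun hlift 1).symm
  have he'0 : e' 0 = e 0 := cov.liftPath_zero _ _ _
  have hproj : ∀ t, (e' t).proj = γ' t := fun t => congrFun (cov.liftPath_lifts _ _ h0') t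
  have key : ∀ (x : NormalCover g f) (p : M), x.proj = p →
      ∃ v, x.1.2 = (⟨f p, v⟩ : TangentBundle (𝓡 (m + 2)) N) ∧ IsUnitNormalAt g f p v := by
    rintro x _ rfl
    exact ⟨x.normal, x.bundle_eq, x.isUnitNormalAt⟩
  choose ν' hν' hu' using fun t => key (e' t) (γ' t) (hproj t)
  have hfun : (fun t => (⟨f (γ' t), ν' t⟩ : TangentBundle (𝓡 (m + 2)) N)) = fun t => (e' t).1.2 :=
    funext fun t => (hν' t).symm
  refine ⟨ν', ?_, hu', ?_⟩
  · rw [hfun]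
    exact continuous_snd.comp (continuous_subtype_val.comp e'.continuous)
  · rw [← hν' 0, ← hν' 1, he'0, he'1, he01]

end Coorientation

/-! ### Homotopy classes of paths carried by a convex parameter set -/

section PathClasses

variable {E F : Type*} [AddCommGroup E] [Module ℝ E] [TopologicalSpace E] [ContinuousAdd E]
  [ContinuousSMul ℝ E] [TopologicalSpace F] {X : Type*} [TopologicalSpace X] {x y z : X}

/-- The class `q` of paths from `x` to `y` is represented by `c ∘ r`, where `r` is a path in `K`
from `a` to `b`. -/
def ClassIn (c : F → X) (K : Set F) (a b : F) (q : Path.Homotopic.Quotient x y) : Prop :=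
  ∃ r : Path a b, (∀ s, r s ∈ K) ∧ ∃ p : Path x y, (∀ s, p s = c (r s)) ∧ Path.Homotopic.Quotient.mk p = q

theorem ClassIn.source {c : F → X} {K : Set F} {a b : F} {q : Path.Homotopic.Quotient x y}
    (h : ClassIn c K a b q) : a ∈ K ∧ c a = x := by
  obtain ⟨r, hr, p, hp, -⟩ := h
  have h1 := hr 0
  have h2 := hp 0
  rw [r.source] at h1 h2
  exact ⟨h1, by rw [← h2, p.source]⟩

theorem ClassIn.target {c : F → X} {K : Set F} {a b : F} {q : Path.Homotopic.Quotient x y}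
    (h : ClassIn c K a b q) : b ∈ K ∧ c b = y := by
  obtain ⟨r, hr, p, hp, -⟩ := h
  have h1 := hr 1
  have h2 := hp 1
  rw [r.target] at h1 h2
  exact ⟨h1, by rw [← h2, p.target]⟩

theorem ClassIn.comp {G : Type*} [TopologicalSpace G] {c : F → X} {K : Set F} {a b : F}
    {q : Path.Homotopic.Quotient x y} (h : ClassIn c K a b q) {φ : F → G} (hφ : ContinuousOn φ K) {c' : G → X}
    {K' : Set G} (hK : MapsTo φ K K') (hc : ∀ t ∈ K, c t = c' (φ t)) :
    ClassIn c' K' (φ a) (φ b) q := by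
  obtain ⟨r, hr, p, hp, hq⟩ := h
  exact ⟨r.map' (hφ.mono (range_subset_iff.2 hr)), fun s => hK (hr s), p,
    fun s => (hp s).trans (hc _ (hr s)), hq⟩

theorem ClassIn.congr {c c' : F → X} {K K' : Set F} {a b : F} {q : Path.Homotopic.Quotient x y}
    (h : ClassIn c K a b q) (hK : K ⊆ K') (hc : ∀ t ∈ K, c t = c' t) : ClassIn c' K' a b q :=
  h.comp (φ := id) continuousOn_id hK hc

theorem ClassIn.trans {c : F → X} {K : Set F} {a b d : F} {q : Path.Homotopic.Quotient x y} {q' : Path.Homotopic.Quotient y z}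
    (h : ClassIn c K a b q) (h' : ClassIn c K b d q') : ClassIn c K a d (q.trans q') := by
  obtain ⟨r, hr, p, hp, rfl⟩ := h
  obtain ⟨r', hr', p', hp', rfl⟩ := h'
  refine ⟨r.trans r', fun s => ?_, p.trans p', fun s => ?_, Path.Homotopic.Quotient.mk_trans _ _⟩
  · rw [Path.trans_apply]; split_ifs; exacts [hr _, hr' _]
  · rw [Path.trans_apply, Path.trans_apply]; split_ifs; exacts [hp _, hp' _]

theorem ClassIn.symm {c : F → X} {K : Set F} {a b : F} {q : Path.Homotopic.Quotient x y}
    (h : ClassIn c K a b q) : ClassIn c K b a q.symm := by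
  obtain ⟨r, hr, p, hp, rfl⟩ := h
  exact ⟨r.symm, fun s => hr _, p.symm, fun s => hp _, Path.Homotopic.Quotient.mk_symm _⟩

theorem ClassIn.refl {c : F → X} {K : Set F} {a : F} (ha : a ∈ K) (h : c a = x) :
    ClassIn c K a a (Path.Homotopic.Quotient.refl x) :=
  ⟨Path.refl a, fun _ => ha, Path.refl x, fun _ => h.symm, Path.Homotopic.Quotient.mk_refl x⟩

theorem exists_classIn {c : E → X} {K : Set E} (hK : Convex ℝ K) (hc : ContinuousOn c K) {a b : E}
    (ha : a ∈ K) (hb : b ∈ K) (hx : c a = x) (hy : c b = y) :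
    ∃ q : Path.Homotopic.Quotient x y, ClassIn c K a b q := by
  have hr : ∀ s, Path.segment a b s ∈ K := fun s =>
    hK.segment_subset ha hb (Path.range_segment a b ▸ mem_range_self s)
  exact ⟨_, Path.segment a b, hr,
    ((Path.segment a b).map' (hc.mono (range_subset_iff.2 hr))).cast hx.symm hy.symm,
    fun s => rfl, rfl⟩

/-- The straight-line homotopy between the two parameter paths stays in `K` and is pushed forward by
`c`. -/
theorem ClassIn.unique {c : E → X} {K : Set E} (hK : Convex ℝ K) (hc : ContinuousOn c K) {a b : E}
    {q q' : Path.Homotopic.Quotient x y} (h : ClassIn c K a b q) (h' : ClassIn c K a b q') : q = q' := by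
  obtain ⟨r, hr, p, hp, rfl⟩ := h
  obtain ⟨r', hr', p', hp', rfl⟩ := h'
  rw [Path.Homotopic.Quotient.eq]
  have hmem : ∀ z : unitInterval × unitInterval,
      (1 - (z.1 : ℝ)) • r z.2 + (z.1 : ℝ) • r' z.2 ∈ K := fun z =>
    hK (hr z.2) (hr' z.2) (by have := z.1.2.2; linarith) z.1.2.1 (by ring)
  refine ⟨{
    toFun := fun z => c ((1 - (z.1 : ℝ)) • r z.2 + (z.1 : ℝ) • r' z.2)
    continuous_toFun := hc.comp_continuous (by fun_prop) hmem
    map_zero_left := fun s => by simp [hp]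
    map_one_left := fun s => by simp [hp']
    prop' := ?_ }⟩
  rintro t s (rfl | rfl)
  · have h1 : (1 - (t : ℝ)) • a + (t : ℝ) • a = a := by rw [← add_smul]; simp
    have h2 := hp 0
    rw [r.source] at h2
    simp [h1, h2]
  · have h1 : (1 - (t : ℝ)) • b + (t : ℝ) • b = b := by rw [← add_smul]; simp
    have h2 := hp 1
    rw [r.target] at h2
    simp [h1, h2]

end PathClasses

/-! ### Smooth transition between two curves -/

section Blend

variable {E : Type*} [NormedAddCommGroup E] [NormedSpace ℝ E]

theorem eventually_sign_of_hasDerivAt {φ : ℝ → ℝ} {d t₀ : ℝ} (h : HasDerivAt φ d t₀) (hd : 0 < d)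
    (h0 : φ t₀ = 0) : ∀ᶠ t in 𝓝 t₀, (t₀ < t → 0 < φ t) ∧ (t < t₀ → φ t < 0) := by
  have h1 : ∀ᶠ t in 𝓝[≠] t₀, 0 < slope φ t₀ t :=
    (hasDerivAt_iff_tendsto_slope.1 h).eventually (lt_mem_nhds hd)
  filter_upwards [eventually_nhdsWithin_iff.1 h1] with t ht
  rcases eq_or_ne t t₀ with rfl | hne
  · simp
  · have h2 := ht hne
    rw [slope_def_field, h0, sub_zero] at h2
    refine ⟨fun h3 => ?_, fun h3 => ?_⟩
    · exact (div_pos_iff_of_pos_right (sub_pos.2 h3)).1 h2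
    · have h4 : t - t₀ < 0 := sub_neg.2 h3
      rcases div_pos_iff.1 h2 with h5 | h5
      · linarith [h5.2]
      · exact h5.1

/-- The curve that passes from `α` to `β` during the time interval `[b, b + δ]`. -/
def blend (α β : ℝ → E) (b δ t : ℝ) : E :=
  α t + Real.smoothTransition ((t - b) / δ) • (β t - α t)

theorem blend_of_le {α β : ℝ → E} {b δ t : ℝ} (hδ : 0 < δ) (ht : t ≤ b) :
    blend α β b δ t = α t := by
  rw [blend, Real.smoothTransition.zero_of_nonpos
    (div_nonpos_of_nonpos_of_nonneg (by linarith) hδ.le), zero_smul, add_zero]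

theorem blend_of_ge {α β : ℝ → E} {b δ t : ℝ} (hδ : 0 < δ) (ht : b + δ ≤ t) :
    blend α β b δ t = β t := by
  rw [blend, Real.smoothTransition.one_of_one_le (by rw [le_div_iff₀ hδ]; linarith), one_smul,
    add_sub_cancel]

theorem blend_mem {α β : ℝ → E} {b δ t : ℝ} {K : Set E} (hK : Convex ℝ K) (hα : α t ∈ K)
    (hβ : β t ∈ K) : blend α β b δ t ∈ K := by
  have h := hK hα hβ (sub_nonneg.2 (Real.smoothTransition.le_one ((t - b) / δ)))
    (Real.smoothTransition.nonneg _) (by ring)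
  convert h using 1
  rw [blend]; module

theorem contDiffAt_blend {α β : ℝ → E} {b δ t : ℝ} (hα : ContDiffAt ℝ 2 α t)
    (hβ : ContDiffAt ℝ 2 β t) : ContDiffAt ℝ 2 (blend α β b δ) t := by
  have h1 : ContDiffAt ℝ 2 (fun t : ℝ => (t - b) / δ) t := by fun_prop
  have h2 : ContDiffAt ℝ 2 (fun t : ℝ => Real.smoothTransition ((t - b) / δ)) t :=
    (Real.smoothTransition.contDiffAt (n := 2)).comp t h1
  exact hα.add (h2.smul (hβ.sub hα))

/-- The velocity is a convex combination of the two velocities plus a nonnegative multiple of `β -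
α`. The inequality `ℓ (α t) ≤ ℓ (β t)` makes that last term harmless, so the blended curve stays
regular. -/
theorem pos_deriv_blend {α β : ℝ → E} {b δ t : ℝ} (hδ : 0 < δ) (hα : ContDiffAt ℝ 2 α t)
    (hβ : ContDiffAt ℝ 2 β t) {ℓ : E →L[ℝ] ℝ} (h1 : 0 < ℓ (deriv α t)) (h2 : 0 < ℓ (deriv β t))
    (h3 : ℓ (α t) ≤ ℓ (β t)) : 0 < ℓ (deriv (blend α β b δ) t) := by
  have hα' := (hα.differentiableAt (by simp)).hasDerivAt
  have hβ' := (hβ.differentiableAt (by simp)).hasDerivAt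
  have hs : HasDerivAt Real.smoothTransition (deriv Real.smoothTransition ((t - b) / δ))
      ((t - b) / δ) :=
    ((Real.smoothTransition.contDiffAt (n := 1)).differentiableAt (by simp)).hasDerivAt
  have hl : HasDerivAt (fun t : ℝ => (t - b) / δ) (1 / δ) t :=
    ((hasDerivAt_id t).sub_const b).div_const δ
  have h := hα'.add ((hs.comp t hl).smul (hβ'.sub hα'))
  have h' : deriv (blend α β b δ) t = _ := h.deriv
  have hd : 0 ≤ deriv Real.smoothTransition ((t - b) / δ) :=
    Real.smoothTransition.monotone.deriv_nonneg
  rw [h']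
  simp only [Function.comp_apply, map_add, map_smul, map_sub, smul_eq_mul, Pi.sub_apply]
  have h4 := Real.smoothTransition.nonneg ((t - b) / δ)
  have h5 := Real.smoothTransition.le_one ((t - b) / δ)
  set h := Real.smoothTransition ((t - b) / δ)
  have h6 : 0 ≤ deriv Real.smoothTransition ((t - b) / δ) * (1 / δ) * (ℓ (β t) - ℓ (α t)) :=
    mul_nonneg (mul_nonneg hd (by positivity)) (sub_nonneg.2 h3)
  have h7 : 0 < (1 - h) * ℓ (deriv α t) + h * ℓ (deriv β t) := by
    rcases h4.eq_or_lt with h8 | h8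
    · rw [← h8]; linarith
    · have := mul_nonneg (sub_nonneg.2 h5) h1.le
      have := mul_pos h8 h2
      linarith
  linarith

/-- Two nonzero vectors that do not point in opposite directions. -/
def Turn (v w : E) : Prop := ∃ ℓ : E →L[ℝ] ℝ, 0 < ℓ v ∧ 0 < ℓ w

end Blend

/-! ### Vectors that are not opposite -/

section Turn

variable {E : Type*} [NormedAddCommGroup E] [InnerProductSpace ℝ E]

theorem turn_of_notMem_span {v w : E} (hv : v ≠ 0) (hw : w ∉ Submodule.span ℝ {v}) :
    Turn v w := by
  have hw0 : w ≠ 0 := fun h => hw (h ▸ Submodule.zero_mem _)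
  have hv' := norm_pos_iff.2 hv
  have hw' := norm_pos_iff.2 hw0
  have h1 : -(‖v‖ * ‖w‖) < inner ℝ v w := by
    refine lt_of_le_of_ne (neg_le_of_abs_le (abs_real_inner_le_norm v w)) fun h => hw ?_
    have h2 : |inner ℝ v w / (‖v‖ * ‖w‖)| = 1 := by
      rw [← h, neg_div, div_self (by positivity), abs_neg, abs_one]
    obtain ⟨-, r, -, hr⟩ := (abs_real_inner_div_norm_mul_norm_eq_one_iff v w).1 h2
    exact Submodule.mem_span_singleton.2 ⟨r, hr.symm⟩
  -- The functional is the inner product with the angle bisector of `v` and `w`.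
  refine ⟨innerSL ℝ (‖w‖ • v + ‖v‖ • w), ?_, ?_⟩
  · simp only [innerSL_apply_apply, inner_add_left, real_inner_smul_left,
      real_inner_self_eq_norm_sq, real_inner_comm v w]
    nlinarith
  · simp only [innerSL_apply_apply, inner_add_left, real_inner_smul_left,
      real_inner_self_eq_norm_sq]
    nlinarith

end Turn

/-! ### The null condition at a single time -/

section NullCurves

variable {m : ℕ}
  {M : Type u} [TopologicalSpace M] [ChartedSpace (Euc (m + 1)) M] [IsManifold (𝓡 (m + 1)) ∞ M]
  {N : Type v} [TopologicalSpace N] [ChartedSpace (Euc (m + 2)) N] [IsManifold (𝓡 (m + 2)) ∞ N]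
  {f : M → N}

/-- The curve `c` is regular of class `C²` at `t`, and if `c t` is a singular point of `f`, it
passes through an `A₂`-singularity in the null direction, meeting the singular set in isolation. -/
structure NullAt (f : M → N) (c : ℝ → M) (t : ℝ) : Prop where
  contMDiffAt : ContMDiffAt 𝓘(ℝ, ℝ) (𝓡 (m + 1)) 2 c t
  velocity_ne : velocity (d := m + 1) c t ≠ 0
  cusp : c t ∈ singularSet (m + 1) (m + 2) f →
    IsRightLeftEquivAt (a := m + 1) (b := m + 2) f (c t) (cuspForm m)
  null : c t ∈ singularSet (m + 1) (m + 2) f →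
    mfderiv (𝓡 (m + 1)) (𝓡 (m + 2)) f (c t) (velocity (d := m + 1) c t) = 0
  isolated : ∀ᶠ s in 𝓝[≠] t, c s ∉ singularSet (m + 1) (m + 2) f

/-- Every regular curve through `p` satisfies the conditions on null curves at `p`. -/
def IsFree (f : M → N) (p : M) : Prop :=
  ∀ (c : ℝ → M) (t : ℝ), c t = p → ContMDiffAt 𝓘(ℝ, ℝ) (𝓡 (m + 1)) 2 c t →
    velocity (d := m + 1) c t ≠ 0 → NullAt (m := m) f c t

theorem isFree_of_notMem (hS : IsClosed (singularSet (m + 1) (m + 2) f)) {p : M}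
    (hp : p ∉ singularSet (m + 1) (m + 2) f) : IsFree (m := m) f p := by
  rintro c t rfl hc hv
  exact ⟨hc, hv, fun h => absurd h hp, fun h => absurd h hp,
    (hc.continuousAt.eventually (hS.isOpen_compl.mem_nhds hp)).filter_mono nhdsWithin_le_nhds⟩

omit [IsManifold (𝓡 (m + 1)) ∞ M] in
theorem mfderiv_eq_zero_transport {p p' : M} (h : p' = p) {v v' : Euc (m + 1)} (hv : v' = v)
    (h0 : mfderiv (𝓡 (m + 1)) (𝓡 (m + 2)) f p (v : TangentSpace (𝓡 (m + 1)) p) = 0) :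
    mfderiv (𝓡 (m + 1)) (𝓡 (m + 2)) f p' (v' : TangentSpace (𝓡 (m + 1)) p') = 0 := by
  subst h hv; exact h0

theorem NullAt.congr {c c' : ℝ → M} {t : ℝ} (h : NullAt (m := m) f c t) (hc : c' =ᶠ[𝓝 t] c) :
    NullAt (m := m) f c' t := by
  have h0 : c' t = c t := hc.self_of_nhds
  have hv : (velocity (d := m + 1) c' t : Euc (m + 1)) = velocity (d := m + 1) c t :=
    congrArg (fun L : ℝ →L[ℝ] Euc (m + 1) => L 1) hc.mfderiv_eq
  refine ⟨h.contMDiffAt.congr_of_eventuallyEq hc, fun h1 => h.velocity_ne (hv.symm.trans h1),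
    fun hs => ?_, fun hs => ?_, ?_⟩
  · rw [h0] at hs ⊢; exact h.cusp hs
  · exact mfderiv_eq_zero_transport h0 hv (h.null (h0 ▸ hs))
  · filter_upwards [h.isolated, hc.filter_mono nhdsWithin_le_nhds] with s hs hs'
    rwa [hs']

omit [IsManifold (𝓡 (m + 1)) ∞ M] in
theorem velocity_comp_affine {c : ℝ → M} {k b t : ℝ}
    (hc : MDifferentiableAt 𝓘(ℝ, ℝ) (𝓡 (m + 1)) c (k * t + b)) :
    velocity (d := m + 1) (fun s => c (k * s + b)) t
      = k • velocity (d := m + 1) c (k * t + b) := by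
  have h1 : HasDerivAt (fun s : ℝ => k * s + b) k t := by
    simpa using ((hasDerivAt_id t).const_mul k).add_const b
  have h2 : HasMFDerivAt 𝓘(ℝ, ℝ) 𝓘(ℝ, ℝ) (fun s : ℝ => k * s + b) t _ :=
    h1.hasFDerivAt.hasMFDerivAt
  have h3 := HasMFDerivAt.comp t hc.hasMFDerivAt h2
  have h4 : velocity (d := m + 1) (fun s => c (k * s + b)) t
      = mfderiv 𝓘(ℝ, ℝ) (𝓡 (m + 1)) c (k * t + b) ((1 : ℝ) • k) :=
    DFunLike.congr_fun h3.mfderiv (1 : ℝ)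
  rw [h4, one_smul]
  have h5 : k = k • (1 : ℝ) := by simp
  exact (congrArg (mfderiv 𝓘(ℝ, ℝ) (𝓡 (m + 1)) c (k * t + b)) h5).trans
    (ContinuousLinearMap.map_smul (mfderiv 𝓘(ℝ, ℝ) (𝓡 (m + 1)) c (k * t + b)) k (1 : ℝ))

theorem NullAt.comp_affine {c : ℝ → M} {k b t : ℝ} (hk : k ≠ 0)
    (h : NullAt (m := m) f c (k * t + b)) :
    NullAt (m := m) f (fun s => c (k * s + b)) t := by
  have hv := velocity_comp_affine (h.contMDiffAt.mdifferentiableAt (by simp))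
  have ht : Tendsto (fun s : ℝ => k * s + b) (𝓝[≠] t) (𝓝[≠] (k * t + b)) := by
    refine tendsto_nhdsWithin_of_tendsto_nhds_of_eventually_within _ ?_ ?_
    · exact (Continuous.tendsto (by fun_prop) t).mono_left nhdsWithin_le_nhds
    · filter_upwards [self_mem_nhdsWithin] with s hs h'
      exact hs (mul_left_cancel₀ hk (add_right_cancel h'))
  refine ⟨?_, ?_, h.cusp, fun hs => ?_, ht.eventually h.isolated⟩
  · refine ContMDiffAt.comp t h.contMDiffAt ?_
    exact ContDiffAt.contMDiffAt (by fun_prop)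
  · rw [hv]
    exact smul_ne_zero hk h.velocity_ne
  · rw [hv]
    have h1 := h.null hs
    exact (ContinuousLinearMap.map_smul _ k _).trans ((congrArg (k • ·) h1).trans (smul_zero k))

omit [IsManifold (𝓡 (m + 1)) ∞ M] in
theorem velocity_ne_zero_iff {c : ℝ → M} {t : ℝ} {χ : OpenPartialHomeomorph M (Euc (m + 1))}
    (hχ : χ ∈ Atlas (m + 1) M) (hp : c t ∈ χ.source)
    (hc : MDifferentiableAt 𝓘(ℝ, ℝ) (𝓡 (m + 1)) c t) :
    velocity (d := m + 1) c t ≠ 0 ↔ deriv (fun s => χ (c s)) t ≠ 0 := by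
  rw [← dchart_velocity hχ hp hc, not_iff_not]
  constructor
  · intro h; rw [h]; exact ContinuousLinearMap.map_zero _
  · intro h
    exact dchart_injective hχ hp (h.trans (ContinuousLinearMap.map_zero _).symm)

omit [IsManifold (𝓡 (m + 1)) ∞ M] in
theorem deriv_chart_symm_curve {x : ℝ → Euc (m + 1)} {t : ℝ}
    {χ : OpenPartialHomeomorph M (Euc (m + 1))} {c : ℝ → M}
    (hp : x t ∈ χ.target) (hx : ContinuousAt x t) (hc : c =ᶠ[𝓝 t] fun s => χ.symm (x s)) :
    deriv (fun s => χ (c s)) t = deriv x t := by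
  apply Filter.EventuallyEq.deriv_eq
  filter_upwards [hc, hx.eventually (χ.open_target.mem_nhds hp)] with s hs hs'
  rw [hs, χ.right_inv hs']

omit [IsManifold (𝓡 (m + 1)) ∞ M] in
theorem velocity_symm_curve_ne_zero {x : ℝ → Euc (m + 1)} {t : ℝ}
    {χ : OpenPartialHomeomorph M (Euc (m + 1))} (hχ : χ ∈ Atlas (m + 1) M)
    (hp : x t ∈ χ.target) (hx : ContDiffAt ℝ 2 x t) (h0 : deriv x t ≠ 0) :
    velocity (d := m + 1) (fun s => χ.symm (x s)) t ≠ 0 := by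
  rw [velocity_ne_zero_iff hχ (χ.map_target hp)
    ((contMDiffAt_symm_curve two_le_infty hχ hp hx).mdifferentiableAt (by simp)),
    deriv_chart_symm_curve hp hx.continuousAt EventuallyEq.rfl]
  exact h0

/-- The passage from a regular curve to a curve given in a chart, during the time interval
`[b, b + δ]`. -/
theorem exists_blend_curve {χ : OpenPartialHomeomorph M (Euc (m + 1))} (hχ : χ ∈ Atlas (m + 1) M)
    {K : Set (Euc (m + 1))} (hK : Convex ℝ K) (hKt : K ⊆ χ.target)
    (hfree : ∀ x ∈ K, IsFree (m := m) f (χ.symm x)) {c : ℝ → M} {β : ℝ → Euc (m + 1)} {b δ : ℝ}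
    (hδ : 0 < δ) {ℓ : Euc (m + 1) →L[ℝ] ℝ}
    (h : ∀ t ∈ Icc b (b + δ), c t ∈ χ.source ∧ χ (c t) ∈ K ∧ β t ∈ K ∧
      ContMDiffAt 𝓘(ℝ, ℝ) (𝓡 (m + 1)) 2 c t ∧ ContDiffAt ℝ 2 β t ∧
      0 < ℓ (deriv (fun s => χ (c s)) t) ∧ 0 < ℓ (deriv β t) ∧ ℓ (χ (c t)) ≤ ℓ (β t)) :
    ∃ c' : ℝ → M, (∀ t ≤ b, c' t = c t) ∧ (∀ t, b + δ ≤ t → c' t = χ.symm (β t)) ∧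
      ∀ t ∈ Icc b (b + δ), NullAt (m := m) f c' t ∧ c' t ∈ χ.source := by
  classical
  have hb : b ∈ Icc b (b + δ) := ⟨le_rfl, by linarith⟩
  have hleft : ∀ t ≤ b, c t ∈ χ.source → χ.symm (blend (fun s => χ (c s)) β b δ t) = c t := by
    intro t ht hs
    rw [blend_of_le hδ ht, χ.left_inv hs]
  -- Before time `b` the curve need not lie in the chart domain, so the chart expression is used
  -- only from `b` on. The two agree near `b`.
  let c' : ℝ → M := fun t => if t < b then c t else χ.symm (blend (fun s => χ (c s)) β b δ t)
  have hc' : ∀ t, b ≤ t → c' =ᶠ[𝓝 t] fun s => χ.symm (blend (fun s => χ (c s)) β b δ s) := by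
    intro t ht
    rcases ht.eq_or_lt with rfl | ht
    · filter_upwards [(h _ hb).2.2.2.1.continuousAt.eventually
        (χ.open_source.mem_nhds (h _ hb).1)] with s hs
      by_cases hsb : s < b
      · simp only [c', hsb, if_true]; exact (hleft s hsb.le hs).symm
      · simp only [c', hsb, if_false]
    · filter_upwards [lt_mem_nhds ht] with s hs
      simp only [c', not_lt.2 (le_of_lt hs), if_false]
  refine ⟨c', fun t ht => ?_, fun t ht => ?_, fun t ht => ?_⟩
  · rcases ht.eq_or_lt with rfl | ht
    · simp only [c', lt_irrefl, if_false]
      exact hleft t le_rfl (h _ hb).1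
    · simp only [c', ht, if_true]
  · have h1 : ¬ t < b := by linarith
    simp only [c', h1, if_false]
    rw [blend_of_ge hδ ht]
  · obtain ⟨h1, h2, h3, h4, h5, h6, h7, h8⟩ := h t ht
    have hα := contDiffAt_chart_curve two_le_infty hχ h1 h4
    have hmem := blend_mem (b := b) (δ := δ) (t := t) (α := fun s => χ (c s)) hK h2 h3
    have hsm := contDiffAt_blend (b := b) (δ := δ) hα h5
    have hne : deriv (blend (fun s => χ (c s)) β b δ) t ≠ 0 := by
      intro h0
      have := pos_deriv_blend (b := b) hδ hα h5 h6 h7 h8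
      rw [h0, map_zero] at this
      exact this.false
    refine ⟨NullAt.congr (hfree _ hmem _ t rfl ?_ ?_) (hc' t ht.1), ?_⟩
    · exact contMDiffAt_symm_curve two_le_infty hχ (hKt hmem) hsm
    · exact velocity_symm_curve_ne_zero hχ (hKt hmem) hsm hne
    · rw [(hc' t ht.1).self_of_nhds]
      exact χ.map_target (hKt hmem)

end NullCurves

/-! ### Null arcs with a prescribed initial germ -/

section Arcs

variable {m : ℕ}
  {M : Type u} [TopologicalSpace M] [ChartedSpace (Euc (m + 1)) M] [IsManifold (𝓡 (m + 1)) ∞ M]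
  {N : Type v} [TopologicalSpace N] [ChartedSpace (Euc (m + 2)) N] [IsManifold (𝓡 (m + 2)) ∞ N]
  {f : M → N} {c₀ c : ℝ → M} {b : ℝ}

/-- The curve `c` is a null curve on `[0, b]`, with the same germ as `c₀` at `0`. -/
structure NullArc (f : M → N) (c₀ c : ℝ → M) (b : ℝ) : Prop where
  germ : c =ᶠ[𝓝 0] c₀
  null : ∀ t ∈ Icc 0 b, NullAt (m := m) f c t

theorem NullArc.continuousOn (h : NullArc (m := m) f c₀ c b) : ContinuousOn c (Icc 0 b) :=
  fun t ht => (h.null t ht).contMDiffAt.continuousAt.continuousWithinAt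

/-- The class of paths in the domain of the chart `χ` from `x` to `y`. -/
abbrev ChartClass (χ : OpenPartialHomeomorph M (Euc (m + 1))) {x y : M}
    (s : Path.Homotopic.Quotient x y) : Prop :=
  ClassIn χ.symm χ.target (χ x) (χ y) s

omit [IsManifold (𝓡 (m + 1)) ∞ M] in
theorem ChartClass.mem_source {χ : OpenPartialHomeomorph M (Euc (m + 1))} {x y : M}
    {s : Path.Homotopic.Quotient x y} (h : ChartClass χ s) : x ∈ χ.source ∧ y ∈ χ.source := by
  refine ⟨?_, ?_⟩
  · have h1 := h.source
    rw [← h1.2]; exact χ.map_target h1.1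
  · have h1 := h.target
    rw [← h1.2]; exact χ.map_target h1.1

omit [IsManifold (𝓡 (m + 1)) ∞ M] in
theorem ClassIn.chartClass {E : Type*} [TopologicalSpace E]
    {χ : OpenPartialHomeomorph M (Euc (m + 1))} {x y : M}
    {s : Path.Homotopic.Quotient x y} {c : E → M} {K : Set E} {a b : E}
    (h : ClassIn c K a b s) (hc : ContinuousOn c K) (hK : ∀ t ∈ K, c t ∈ χ.source) :
    ChartClass χ s := by
  have h1 := h.comp (φ := fun t => χ (c t)) (c' := χ.symm) (K' := χ.target)
    (χ.continuousOn.comp hc hK) (fun t ht => χ.map_source (hK t ht))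
    (fun t ht => (χ.left_inv (hK t ht)).symm)
  rwa [h.source.2, h.target.2] at h1

omit [IsManifold (𝓡 (m + 1)) ∞ M] in
theorem ChartClass.unique {χ : OpenPartialHomeomorph M (Euc (m + 1))} (hχ : Convex ℝ χ.target)
    {x y : M} {s s' : Path.Homotopic.Quotient x y} (h : ChartClass χ s) (h' : ChartClass χ s') :
    s = s' :=
  ClassIn.unique hχ χ.continuousOn_symm h h'

omit [IsManifold (𝓡 (m + 1)) ∞ M] in
theorem exists_chartClass {χ : OpenPartialHomeomorph M (Euc (m + 1))} (hχ : Convex ℝ χ.target)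
    {x y : M} (hx : x ∈ χ.source) (hy : y ∈ χ.source) :
    ∃ s : Path.Homotopic.Quotient x y, ChartClass χ s :=
  exists_classIn hχ χ.continuousOn_symm (χ.map_source hx) (χ.map_source hy) (χ.left_inv hx)
    (χ.left_inv hy)

theorem continuousAt_deriv_of_contDiffAt {E : Type*} [NormedAddCommGroup E] [NormedSpace ℝ E]
    {α : ℝ → E} {t : ℝ} (h : ContDiffAt ℝ 2 α t) : ContinuousAt (deriv α) t := by
  have h1 : ContDiffAt ℝ 1 (fderiv ℝ α) t := h.fderiv_right (by norm_num)
  have h2 : deriv α = fun s => fderiv ℝ α s 1 := funext fun s => by simp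
  rw [h2]
  exact h1.continuousAt.clm_apply continuousAt_const

theorem contMDiffAt_eventually {t : ℝ} (h : ContMDiffAt 𝓘(ℝ, ℝ) (𝓡 (m + 1)) 2 c t) :
    ∀ᶠ s in 𝓝 t, ContMDiffAt 𝓘(ℝ, ℝ) (𝓡 (m + 1)) 2 c s :=
  (contMDiffAt_iff_contMDiffAt_nhds (by simp)).1 h

theorem exists_ball_free {χ : OpenPartialHomeomorph M (Euc (m + 1))} {x : M} (hx : x ∈ χ.source)
    (hfree : ∀ᶠ p in 𝓝 x, IsFree (m := m) f p) : ∃ r > 0, Metric.ball (χ x) r ⊆ χ.target ∧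
      ∀ z ∈ Metric.ball (χ x) r, IsFree (m := m) f (χ.symm z) := by
  have h1 : ∀ᶠ z in 𝓝 (χ x), z ∈ χ.target ∧ IsFree (m := m) f (χ.symm z) := by
    refine Eventually.and (χ.open_target.mem_nhds (χ.map_source hx)) ?_
    have h2 := χ.symm.continuousAt (x := χ x) (by simpa using χ.map_source hx)
    rw [ContinuousAt, χ.left_inv hx] at h2
    exact h2.eventually hfree
  obtain ⟨r, hr, h⟩ := Metric.eventually_nhds_iff_ball.1 h1
  exact ⟨r, hr, fun z hz => (h z hz).1, fun z hz => (h z hz).2⟩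

/-- A null arc can be continued along a straight line in a chart. -/
theorem NullArc.exists_line {χ : OpenPartialHomeomorph M (Euc (m + 1))}
    (hχ : χ ∈ Atlas (m + 1) M) (hconv : Convex ℝ χ.target) (h : NullArc (m := m) f c₀ c b)
    (hb : 0 < b) {o x y : M} {q : Path.Homotopic.Quotient o x} (hq : ClassIn c (Icc 0 b) 0 b q)
    {s : Path.Homotopic.Quotient x y} (hs : ChartClass χ s)
    (hfree : ∀ᶠ p in 𝓝 x, IsFree (m := m) f p)
    (hline : ∀ s ∈ Icc (0 : ℝ) 1,
      NullAt (m := m) f (fun τ => χ.symm (χ x + τ • (χ y - χ x))) s)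
    {ℓ : Euc (m + 1) →L[ℝ] ℝ} (h1 : 0 < ℓ (deriv (fun s => χ (c s)) b))
    (h2 : 0 < ℓ (χ y - χ x)) (κ₀ : ℝ) :
    ∃ (c' : ℝ → M) (b' κ : ℝ), κ₀ < κ ∧ 0 < κ ∧ 0 < b' ∧ NullArc (m := m) f c₀ c' b' ∧
      ClassIn c' (Icc 0 b') 0 b' (q.trans s) ∧
      deriv (fun s => χ (c' s)) b' = κ • (χ y - χ x) := by
  obtain ⟨hx, hy⟩ := hs.mem_source
  have hcb : c b = x := hq.target.2
  set u := χ y - χ x with hu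
  -- The line is traversed fast enough to run ahead of the old curve in the direction `ℓ` just after
  -- `b`, as the blending requires.
  obtain ⟨κ, hκ₀, hκ, hκu⟩ : ∃ κ, κ₀ < κ ∧ 0 < κ ∧ ℓ (deriv (fun s => χ (c s)) b) < κ * ℓ u := by
    refine ⟨max (max κ₀ 0) (ℓ (deriv (fun s => χ (c s)) b) / ℓ u) + 1, ?_, ?_, ?_⟩
    · have := le_max_left (max κ₀ 0) (ℓ (deriv (fun s => χ (c s)) b) / ℓ u)
      have := le_max_left κ₀ 0
      linarith
    · have := le_max_left (max κ₀ 0) (ℓ (deriv (fun s => χ (c s)) b) / ℓ u)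
      have := le_max_right κ₀ 0
      linarith
    · rw [← div_lt_iff₀ h2]
      have := le_max_right (max κ₀ 0) (ℓ (deriv (fun s => χ (c s)) b) / ℓ u)
      linarith
  let β : ℝ → Euc (m + 1) := fun t => χ x + (κ * t + -(κ * b)) • u
  have hβ : ∀ t, HasDerivAt β (κ • u) t := by
    intro t
    have h3 : HasDerivAt (fun t : ℝ => κ * t + -(κ * b)) κ t := by
      simpa using ((hasDerivAt_id t).const_mul κ).add_const (-(κ * b))
    exact (h3.smul_const u).const_add (χ x)
  have hβs : ContDiff ℝ 2 β := by fun_prop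
  have hβb : β b = χ x := by simp [β]
  have hbnull := h.null b ⟨hb.le, le_rfl⟩
  have hcsrc : c b ∈ χ.source := hcb ▸ hx
  have hα := contDiffAt_chart_curve two_le_infty hχ hcsrc hbnull.contMDiffAt
  obtain ⟨r, hr, hrt, hrf⟩ := exists_ball_free hx hfree
  have hev : ∀ᶠ t in 𝓝 b, c t ∈ χ.source ∧ χ (c t) ∈ Metric.ball (χ x) r ∧
      β t ∈ Metric.ball (χ x) r ∧ ContMDiffAt 𝓘(ℝ, ℝ) (𝓡 (m + 1)) 2 c t ∧
      0 < ℓ (deriv (fun s => χ (c s)) t) ∧ (b ≤ t → 0 ≤ ℓ (β t) - ℓ (χ (c t))) := by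
    refine (hbnull.contMDiffAt.continuousAt.eventually (χ.open_source.mem_nhds hcsrc)).and
      (((hα.continuousAt.eventually (Metric.ball_mem_nhds _ hr)).mono
        (fun t ht => by simpa [hcb] using ht)).and
      (((hβs.continuous.continuousAt (x := b)).eventually (Metric.ball_mem_nhds _ hr)).mono
        (fun t ht => by simpa [hβb] using ht) |>.and
      ((contMDiffAt_eventually hbnull.contMDiffAt).and (.and ?_ ?_))))
    · exact ((ℓ.continuous.continuousAt).comp (continuousAt_deriv_of_contDiffAt hα)).eventually
        (lt_mem_nhds h1)
    · have h3 := (ℓ.hasFDerivAt.comp_hasDerivAt b (hβ b)).sub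
        (ℓ.hasFDerivAt.comp_hasDerivAt b (hα.differentiableAt (by simp)).hasDerivAt)
      have h4 := eventually_sign_of_hasDerivAt h3 (by
        rw [map_smul, smul_eq_mul]; linarith) (by simp [hβb, hcb])
      refine h4.mono fun t ht hbt => ?_
      rcases hbt.eq_or_lt with rfl | h5
      · simp [hβb, hcb]
      · exact (ht.1 h5).le
  obtain ⟨ε, hε, hεb⟩ := Metric.eventually_nhds_iff.1 hev
  have hκi : 0 < 1 / κ := by positivity
  -- The line reaches `y` at time `b + 1 / κ`; the bound by `1 / κ` ends the blending before that.
  set δ := min (ε / 2) (1 / κ / 2) with hδ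
  have hδ0 : 0 < δ := by positivity
  have hδε : δ < ε := lt_of_le_of_lt (min_le_left _ _) (by linarith)
  have hδκ : δ < 1 / κ := lt_of_le_of_lt (min_le_right _ _) (by linarith)
  obtain ⟨c', hc1, hc2, hc3⟩ := exists_blend_curve (f := f) (c := c) (β := β) (b := b) hχ
    (convex_ball (χ x) r) hrt hrf hδ0 (ℓ := ℓ) (by
      intro t ht
      obtain ⟨e1, e2, e3, e4, e5, e6⟩ := hεb (y := t) (by
        rw [Real.dist_eq, abs_of_nonneg (by linarith [ht.1])]; linarith [ht.2])
      refine ⟨e1, e2, e3, e4, hβs.contDiffAt, e5, ?_, by linarith [e6 ht.1]⟩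
      rw [(hβ t).deriv, map_smul, smul_eq_mul]; positivity)
  have hmem : ∀ t, b ≤ t → t ≤ b + 1 / κ → κ * t + -(κ * b) ∈ Icc (0 : ℝ) 1 := by
    intro t ht ht'
    have h3 : κ * (t - b) ≤ κ * (1 / κ) := mul_le_mul_of_nonneg_left (by linarith) hκ.le
    have h4 : κ * (1 / κ) = 1 := by field_simp
    have h5 := mul_nonneg hκ.le (sub_nonneg.2 ht)
    constructor <;> nlinarith
  have hseg : ∀ t, b ≤ t → t ≤ b + 1 / κ → β t ∈ χ.target := by
    intro t ht ht'
    have := hconv.add_smul_sub_mem (χ.map_source hx) (χ.map_source hy) (hmem t ht ht')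
    exact this
  have hline' : ∀ t, b + δ < t → c' =ᶠ[𝓝 t] fun s => χ.symm (β s) := fun t ht => by
    filter_upwards [lt_mem_nhds ht] with s hs using hc2 s hs.le
  have hnull : ∀ t ∈ Icc 0 (b + 1 / κ), NullAt (m := m) f c' t := by
    intro t ht
    rcases lt_or_ge t b with h3 | h3
    · refine (h.null t ⟨ht.1, h3.le⟩).congr ?_
      filter_upwards [gt_mem_nhds h3] with s hs using hc1 s hs.le
    rcases le_or_gt t (b + δ) with h4 | h4
    · exact (hc3 t ⟨h3, h4⟩).1
    · exact ((hline _ (hmem t h3 ht.2)).comp_affine hκ.ne').congr (hline' t h4)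
  have hb' : b + 1 / κ ∈ Icc 0 (b + 1 / κ) := ⟨by positivity, le_rfl⟩
  have hβb' : β (b + 1 / κ) = χ y := by
    have h3 : κ * (b + 1 / κ) + -(κ * b) = 1 := by field_simp; ring
    simp only [β, h3, one_smul, hu, add_sub_cancel]
  have hyb : c' (b + 1 / κ) = y := by
    rw [hc2 _ (by linarith), hβb', χ.left_inv hy]
  have harc : NullArc (m := m) f c₀ c' (b + 1 / κ) := by
    refine ⟨?_, hnull⟩
    refine EventuallyEq.trans ?_ h.germ
    filter_upwards [gt_mem_nhds hb] with s hs using hc1 s hs.le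
  refine ⟨c', b + 1 / κ, κ, hκ₀, hκ, by positivity, harc, ?_, ?_⟩
  · have hq1 : ClassIn c' (Icc 0 b) 0 b q := hq.congr subset_rfl fun t ht => (hc1 t ht.2).symm
    have hsub : Icc b (b + 1 / κ) ⊆ Icc 0 (b + 1 / κ) := Icc_subset_Icc_left hb.le
    obtain ⟨s', hs'⟩ := exists_classIn (c := c') (convex_Icc b (b + 1 / κ))
      (harc.continuousOn.mono hsub) ⟨le_rfl, by linarith⟩ ⟨by linarith, le_rfl⟩
      ((hc1 b le_rfl).trans hcb) hyb
    have hs'' : ChartClass χ s' := hs'.chartClass (harc.continuousOn.mono hsub) (by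
      intro t ht
      rcases le_or_gt t (b + δ) with h4 | h4
      · exact (hc3 t ⟨ht.1, h4⟩).2
      · rw [hc2 t h4.le]; exact χ.map_target (hseg t ht.1 ht.2))
    rw [hs.unique hconv hs'']
    exact (hq1.congr (Icc_subset_Icc_right (by linarith)) fun _ _ => rfl).trans
      (hs'.congr hsub fun _ _ => rfl)
  · rw [deriv_chart_symm_curve (hseg _ (by linarith) le_rfl) hβs.continuous.continuousAt
      (hline' _ (by linarith)), (hβ _).deriv]

end Arcs

/-! ### Closing a null arc to a null loop -/

section Closing

variable {m : ℕ}
  {M : Type u} [TopologicalSpace M] [ChartedSpace (Euc (m + 1)) M] [IsManifold (𝓡 (m + 1)) ∞ M]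
  {N : Type v} [TopologicalSpace N] [ChartedSpace (Euc (m + 2)) N] [IsManifold (𝓡 (m + 2)) ∞ N]
  {f : M → N} {c₀ c : ℝ → M} {b : ℝ} {o : M}

/-- An infinite set of singular times would accumulate in the compact interval, contrary to
isolation. -/
theorem finite_singular_times {γ : ℝ → M} (h : ∀ t, NullAt (m := m) f γ t) :
    {t ∈ Icc (0 : ℝ) 1 | γ t ∈ singularSet (m + 1) (m + 2) f}.Finite := by
  by_contra hinf
  obtain ⟨t, -, ht⟩ := Set.Infinite.exists_accPt_of_subset_isCompact hinf isCompact_Icc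
    (fun t ht => ht.1)
  rw [accPt_iff_frequently_nhdsNE] at ht
  exact ht ((h t).isolated.mono fun s hs hs' => hs hs'.2)

/-- A null arc that closes up smoothly is a null loop. -/
theorem exists_nullLoop_of_arc (hb : 0 < b) (hnull : ∀ t ∈ Icc 0 b, NullAt (m := m) f c t)
    (h0 : c =ᶠ[𝓝 0] c₀) (h1 : ∀ᶠ t in 𝓝 b, b ≤ t → c t = c₀ (t - b))
    {q : Path.Homotopic.Quotient o o} (hq : ClassIn c (Icc 0 b) 0 b q) :
    ∃ (γ : ℝ → M) (h : IsNullLoop (m := m) f o γ), Path.Homotopic.Quotient.mk h.toPath = q := by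
  let γ : ℝ → M := fun t => c (b * Int.fract t)
  have hγ : ∀ t, NullAt (m := m) f γ t := by
    intro t
    rcases eq_or_ne (Int.fract t) 0 with ht | ht
    -- At an integer the loop is glued from the end and the beginning of the arc. Past time `b` the
    -- curve `c` agrees with the shifted initial germ, so near `t` both pieces belong to one
    -- reparametrisation of `c` near `b`.
    · have hn : (⌊t⌋ : ℝ) = t := by rw [Int.fract] at ht; linarith
      have h2 := NullAt.comp_affine (f := f) (c := c) (k := b) (b := b - b * ⌊t⌋) (t := t) hb.ne'
        (by
          have h3 : b * t + (b - b * ⌊t⌋) = b := by rw [hn]; ring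
          rw [h3]; exact hnull b ⟨hb.le, le_rfl⟩)
      refine h2.congr ?_
      have hc1 : Tendsto (fun s : ℝ => b * (s - ⌊t⌋)) (𝓝 t) (𝓝 0) := by
        have h3 : b * (t - ⌊t⌋) = 0 := by rw [hn]; ring
        rw [← h3]; exact Continuous.tendsto (by fun_prop) t
      have hc2 : Tendsto (fun s : ℝ => b * s + (b - b * ⌊t⌋)) (𝓝 t) (𝓝 b) := by
        have h3 : b * t + (b - b * ⌊t⌋) = b := by rw [hn]; ring
        conv => rhs; rw [← h3]
        exact Continuous.tendsto (by fun_prop) t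
      filter_upwards [hc1.eventually h0, hc2.eventually h1, lt_mem_nhds (sub_one_lt t),
        gt_mem_nhds (lt_add_one t)] with s e1 e2 e3 e4
      rcases lt_or_ge s t with hs | hs
      · have hfl : ⌊s⌋ = ⌊t⌋ - 1 := by
          rw [Int.floor_eq_iff]; push_cast; constructor <;> linarith
        change c (b * Int.fract s) = _
        rw [Int.fract, hfl]; push_cast; congr 1; ring
      · have hfl : ⌊s⌋ = ⌊t⌋ := by
          rw [Int.floor_eq_iff]; constructor <;> linarith
        change c (b * Int.fract s) = _
        rw [Int.fract, hfl, e1, e2 (by rw [hn]; nlinarith)]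
        congr 1; ring
    · have h3 : b * t + -(b * ⌊t⌋) = b * Int.fract t := by rw [Int.fract]; ring
      have h4 := Int.fract_nonneg t
      have h5 := Int.fract_lt_one t
      have h2 := NullAt.comp_affine (f := f) (c := c) (k := b) (b := -(b * ⌊t⌋)) (t := t) hb.ne'
        (by rw [h3]; exact hnull _ ⟨by positivity, by nlinarith⟩)
      refine h2.congr ?_
      have h6 : (⌊t⌋ : ℝ) < t := by
        have := lt_of_le_of_ne h4 ht.symm
        rw [Int.fract] at this; linarith
      filter_upwards [lt_mem_nhds h6, gt_mem_nhds (Int.lt_floor_add_one t)] with s e1 e2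
      have hfl : ⌊s⌋ = ⌊t⌋ := by rw [Int.floor_eq_iff]; constructor <;> linarith
      change c (b * Int.fract s) = _
      rw [Int.fract, hfl]; congr 1; ring
  have hc0 := hq.source.2
  have hcb := hq.target.2
  have hloop : IsNullLoop (m := m) f o γ := by
    refine ⟨fun t => (hγ t).contMDiffAt, fun t => ?_, ?_, fun t => (hγ t).velocity_ne,
      finite_singular_times hγ, fun t => (hγ t).cusp, fun t => (hγ t).null⟩
    · change c (b * Int.fract (t + 1)) = c (b * Int.fract t)
      rw [Int.fract_add_one]
    · change c (b * Int.fract 0) = o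
      rw [Int.fract_zero, mul_zero, hc0]
  refine ⟨γ, hloop, ?_⟩
  have hcont : ContinuousOn c (Icc 0 b) :=
    fun t ht => (hnull t ht).contMDiffAt.continuousAt.continuousWithinAt
  refine ClassIn.unique (convex_Icc 0 b) hcont ?_ hq
  refine ⟨⟨⟨fun s => b * s, by fun_prop⟩, by simp, by simp⟩, fun s => ?_, hloop.toPath,
    fun s => ?_, rfl⟩
  · have := s.2.1
    have := s.2.2
    exact ⟨by change 0 ≤ b * (s : ℝ); positivity, by change b * (s : ℝ) ≤ b; nlinarith⟩
  · change c (b * Int.fract (s : ℝ)) = c (b * s)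
    rcases s.2.2.eq_or_lt with hs | hs
    · rw [hs, Int.fract_one, mul_zero, mul_one, hc0, hcb]
    · rw [Int.fract_eq_self.2 ⟨s.2.1, hs⟩]

theorem nullAt_line_of_free {χ : OpenPartialHomeomorph M (Euc (m + 1))}
    (hχ : χ ∈ Atlas (m + 1) M) {z u : Euc (m + 1)} (hu : u ≠ 0) {s : ℝ}
    (hs : z + s • u ∈ χ.target) (hf : IsFree (m := m) f (χ.symm (z + s • u))) :
    NullAt (m := m) f (fun τ => χ.symm (z + τ • u)) s := by
  have h1 : ContDiffAt ℝ 2 (fun τ : ℝ => z + τ • u) s := by fun_prop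
  refine hf _ s rfl (contMDiffAt_symm_curve two_le_infty hχ hs h1)
    (velocity_symm_curve_ne_zero hχ hs h1 ?_)
  rw [(hasDerivAt_line z u s).deriv]; exact hu

omit [IsManifold (𝓡 (m + 1)) ∞ M] [ChartedSpace (Euc (m + 1)) M] in
/-- The class of an arc splits at an intermediate time. -/
theorem ClassIn.split {x y z : M} {a d : ℝ} {q : Path.Homotopic.Quotient x z}
    (h : ClassIn c (Icc a d) a d q) (hc : ContinuousOn c (Icc a d)) (hab : a ≤ b) (hbd : b ≤ d)
    (hy : c b = y) : ∃ (q₁ : Path.Homotopic.Quotient x y) (q₂ : Path.Homotopic.Quotient y z),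
      ClassIn c (Icc a b) a b q₁ ∧ ClassIn c (Icc b d) b d q₂ ∧ q = q₁.trans q₂ := by
  have h1 : Icc a b ⊆ Icc a d := Icc_subset_Icc_right hbd
  have h2 : Icc b d ⊆ Icc a d := Icc_subset_Icc_left hab
  obtain ⟨q₁, hq₁⟩ := exists_classIn (convex_Icc a b) (hc.mono h1) ⟨le_rfl, hab⟩ ⟨hab, le_rfl⟩
    h.source.2 hy
  obtain ⟨q₂, hq₂⟩ := exists_classIn (convex_Icc b d) (hc.mono h2) ⟨le_rfl, hbd⟩ ⟨hbd, le_rfl⟩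
    hy h.target.2
  exact ⟨q₁, q₂, hq₁, hq₂, h.unique (convex_Icc a d) hc
    ((hq₁.congr h1 fun _ _ => rfl).trans (hq₂.congr h2 fun _ _ => rfl))⟩

theorem NullArc.mono (h : NullArc (m := m) f c₀ c b) {b' : ℝ} (hb : b' ≤ b) :
    NullArc (m := m) f c₀ c b' :=
  ⟨h.germ, fun t ht => h.null t ⟨ht.1, ht.2.trans hb⟩⟩

/-- The final speed of a null arc can be increased. -/
theorem NullArc.exists_faster {χ : OpenPartialHomeomorph M (Euc (m + 1))}
    (hχ : χ ∈ Atlas (m + 1) M) (hconv : Convex ℝ χ.target) (h : NullArc (m := m) f c₀ c b)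
    (hb : 0 < b) {x : M} {q : Path.Homotopic.Quotient o x} (hq : ClassIn c (Icc 0 b) 0 b q)
    (hx : x ∈ χ.source) (hfree : ∀ᶠ p in 𝓝 x, IsFree (m := m) f p)
    {ℓ : Euc (m + 1) →L[ℝ] ℝ} (h1 : 0 < ℓ (deriv (fun s => χ (c s)) b)) (r₀ : ℝ) :
    ∃ (c' : ℝ → M) (b' : ℝ), 0 < b' ∧ NullArc (m := m) f c₀ c' b' ∧
      ClassIn c' (Icc 0 b') 0 b' q ∧ r₀ < ℓ (deriv (fun s => χ (c' s)) b') := by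
  have hcb : c b = x := hq.target.2
  have hbn := (h.null b ⟨hb.le, le_rfl⟩).contMDiffAt
  have hcsrc : c b ∈ χ.source := hcb ▸ hx
  have hα := contDiffAt_chart_curve two_le_infty hχ hcsrc hbn
  obtain ⟨r, hr, hrt, hrf⟩ := exists_ball_free hx hfree
  have hev : ∀ᶠ t in 𝓝 b, (c t ∈ χ.source ∧ χ (c t) ∈ Metric.ball (χ x) r) ∧
      (0 < ℓ (deriv (fun s => χ (c s)) t) ∧ (t < b → ℓ (χ (c t)) < ℓ (χ x))) ∧
      ∀ᶠ p in 𝓝 (c t), IsFree (m := m) f p := by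
    refine .and (.and ?_ ?_) (.and (.and ?_ ?_) ?_)
    · exact hbn.continuousAt.eventually (χ.open_source.mem_nhds hcsrc)
    · exact (hα.continuousAt.eventually (Metric.ball_mem_nhds _ hr)).mono
        (fun t ht => by simpa [hcb] using ht)
    · exact ((ℓ.continuous.continuousAt).comp (continuousAt_deriv_of_contDiffAt hα)).eventually
        (lt_mem_nhds h1)
    · have h3 := (ℓ.hasFDerivAt.comp_hasDerivAt b
        (hα.differentiableAt (by simp)).hasDerivAt).sub_const (ℓ (χ x))
      have h4 := eventually_sign_of_hasDerivAt h3 h1 (by simp [hcb])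
      exact h4.mono fun t ht hbt => sub_neg.1 (ht.2 hbt)
    · exact hbn.continuousAt.eventually (hcb ▸ hfree.eventually_nhds)
  obtain ⟨ε, hε, hεb⟩ := Metric.eventually_nhds_iff.1 hev
  set δ := min (ε / 2) (b / 2) with hδ
  have hδ0 : 0 < δ := by positivity
  have hδε : δ < ε := lt_of_le_of_lt (min_le_left _ _) (by linarith)
  have hδb : δ < b := lt_of_le_of_lt (min_le_right _ _) (by linarith)
  obtain ⟨⟨e1, e2⟩, ⟨e3, e4⟩, e5⟩ := hεb (y := b - δ) (by
    rw [Real.dist_eq, abs_of_nonpos (by linarith)]; linarith)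
  have e4 := e4 (by linarith)
  have hcont := h.continuousOn
  -- The last stretch of the arc is replaced by a chart segment with the same endpoints, traversed
  -- at high speed; the path class is unchanged.
  obtain ⟨q₁, s, hq₁, hs, rfl⟩ := hq.split hcont (b := b - δ) (by linarith) (by linarith) rfl
  have hs' : ChartClass χ s := hs.chartClass (hcont.mono (Icc_subset_Icc_left (by linarith)))
    fun t ht => (hεb (y := t) (by
      rw [Real.dist_eq, abs_of_nonpos (by linarith [ht.2])]; linarith [ht.1])).1.1
  have hu : 0 < ℓ (χ x - χ (c (b - δ))) := by rw [map_sub]; linarith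
  have hu0 : χ x - χ (c (b - δ)) ≠ 0 := fun h0 => by rw [h0, map_zero] at hu; exact hu.false
  obtain ⟨c', b', κ, hκ, hκ0, hb', hc', hq', hd⟩ := (h.mono (by linarith)).exists_line hχ hconv
    (by linarith) hq₁ hs' e5 (fun τ hτ => by
      have h6 := (convex_ball (χ x) r).add_smul_sub_mem e2 (Metric.mem_ball_self hr) hτ
      exact nullAt_line_of_free hχ hu0 (hrt h6) (hrf _ h6)) e3 hu
    (r₀ / ℓ (χ x - χ (c (b - δ))))
  refine ⟨c', b', hb', hc', hq', ?_⟩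
  rw [hd, map_smul, smul_eq_mul]
  exact (div_lt_iff₀ hu).1 hκ

/-- A null arc from `o` to `o` whose final velocity does not point in the direction opposite to
its initial velocity is homotopic to a null loop. -/
theorem NullArc.exists_nullLoop {χ : OpenPartialHomeomorph M (Euc (m + 1))}
    (hχ : χ ∈ Atlas (m + 1) M) (hconv : Convex ℝ χ.target) (h : NullArc (m := m) f c₀ c b)
    (hb : 0 < b) {q : Path.Homotopic.Quotient o o} (hq : ClassIn c (Icc 0 b) 0 b q)
    (ho : o ∈ χ.source) (hfree : ∀ᶠ p in 𝓝 o, IsFree (m := m) f p)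
    (hturn : Turn (deriv (fun s => χ (c s)) b) (deriv (fun s => χ (c₀ s)) 0)) :
    ∃ (γ : ℝ → M) (h : IsNullLoop (m := m) f o γ), Path.Homotopic.Quotient.mk h.toPath = q := by
  obtain ⟨ℓ, hℓ1, hℓ2⟩ := hturn
  -- With a larger final than initial speed in the direction `ℓ`, and equal positions at time `b`,
  -- the arc lags behind the shifted initial germ just before `b`. The blend from the arc to the
  -- germ is therefore regular.
  obtain ⟨c, b, hb, h, hq, hℓ⟩ := h.exists_faster hχ hconv hb hq ho hfree hℓ1
    (ℓ (deriv (fun s => χ (c₀ s)) 0))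
  have hcb : c b = o := hq.target.2
  have hc₀ : c₀ 0 = o := h.germ.self_of_nhds.symm.trans hq.source.2
  have hc₀n : ContMDiffAt 𝓘(ℝ, ℝ) (𝓡 (m + 1)) 2 c₀ 0 :=
    (h.null 0 ⟨le_rfl, hb.le⟩).contMDiffAt.congr_of_eventuallyEq h.germ.symm
  have hbn := (h.null b ⟨hb.le, le_rfl⟩).contMDiffAt
  have hcsrc : c b ∈ χ.source := hcb ▸ ho
  have hα := contDiffAt_chart_curve two_le_infty hχ hcsrc hbn
  have hβ₀ := contDiffAt_chart_curve two_le_infty hχ (hc₀ ▸ ho) hc₀n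
  let β : ℝ → Euc (m + 1) := fun t => χ (c₀ (t - b))
  have hshift : ContDiffAt ℝ 2 (fun t : ℝ => t - b) b := by fun_prop
  have hβ : ContDiffAt ℝ 2 β b := by
    refine ContDiffAt.comp (g := fun s => χ (c₀ s)) b ?_ hshift
    rw [sub_self]; exact hβ₀
  have hβb : β b = χ o := by simp [β, hc₀]
  have hβd : deriv β b = deriv (fun s => χ (c₀ s)) 0 := by
    have := deriv_comp_sub_const (fun s => χ (c₀ s)) b b
    rw [sub_self] at this; exact this
  obtain ⟨r, hr, hrt, hrf⟩ := exists_ball_free ho hfree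
  have hev : ∀ᶠ t in 𝓝 b, (c t ∈ χ.source ∧ χ (c t) ∈ Metric.ball (χ o) r ∧
      β t ∈ Metric.ball (χ o) r ∧ ContMDiffAt 𝓘(ℝ, ℝ) (𝓡 (m + 1)) 2 c t) ∧ ContDiffAt ℝ 2 β t ∧
      0 < ℓ (deriv (fun s => χ (c s)) t) ∧ 0 < ℓ (deriv β t) ∧
      (t < b → ℓ (χ (c t)) - ℓ (β t) < 0) := by
    refine .and (.and ?_ (.and ?_ (.and ?_ ?_))) (.and ?_ (.and ?_ (.and ?_ ?_)))
    · exact hbn.continuousAt.eventually (χ.open_source.mem_nhds hcsrc)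
    · exact (hα.continuousAt.eventually (Metric.ball_mem_nhds _ hr)).mono
        (fun t ht => by simpa [hcb] using ht)
    · exact (hβ.continuousAt.eventually (Metric.ball_mem_nhds _ hr)).mono
        (fun t ht => by simpa [hβb] using ht)
    · exact contMDiffAt_eventually hbn
    · exact hβ.eventually (by simp)
    · exact ((ℓ.continuous.continuousAt).comp (continuousAt_deriv_of_contDiffAt hα)).eventually
        (lt_mem_nhds (hℓ2.trans hℓ))
    · exact ((ℓ.continuous.continuousAt).comp (continuousAt_deriv_of_contDiffAt hβ)).eventually
        (lt_mem_nhds (by simpa [hβd] using hℓ2))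
    · have h3 := (ℓ.hasFDerivAt.comp_hasDerivAt b (hα.differentiableAt (by simp)).hasDerivAt).sub
        (ℓ.hasFDerivAt.comp_hasDerivAt b (hβ.differentiableAt (by simp)).hasDerivAt)
      have h4 := eventually_sign_of_hasDerivAt h3 (by rw [hβd]; linarith) (by simp [hβb, hcb])
      exact h4.mono fun t ht hbt => ht.2 hbt
  obtain ⟨ε, hε, hεb⟩ := Metric.eventually_nhds_iff.1 hev
  set δ := min (ε / 2) (b / 2) with hδ
  have hδ0 : 0 < δ := by positivity
  have hδε : δ < ε := lt_of_le_of_lt (min_le_left _ _) (by linarith)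
  have hδb : δ < b := lt_of_le_of_lt (min_le_right _ _) (by linarith)
  have hnear : ∀ t ∈ Icc (b - δ) b, dist t b < ε := fun t ht => by
    rw [Real.dist_eq, abs_of_nonpos (by linarith [ht.2])]; linarith [ht.1]
  obtain ⟨c', hc1, hc2, hc3⟩ := exists_blend_curve (f := f) (c := c) (β := β) (b := b - δ) hχ
    (convex_ball (χ o) r) hrt hrf hδ0 (ℓ := ℓ) (by
      intro t ht
      rw [sub_add_cancel] at ht
      obtain ⟨⟨e1, e2, e3, e4⟩, e5, e6, e7, e8⟩ := hεb (hnear t ht)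
      refine ⟨e1, e2, e3, e4, e5, e6, e7, ?_⟩
      rcases ht.2.eq_or_lt with rfl | h5
      · simp [hβb, hcb]
      · linarith [e8 h5])
  rw [sub_add_cancel] at hc2 hc3
  have hnull : ∀ t ∈ Icc 0 b, NullAt (m := m) f c' t := by
    intro t ht
    rcases lt_or_ge t (b - δ) with h3 | h3
    · refine (h.null t ht).congr ?_
      filter_upwards [gt_mem_nhds h3] with s hs using hc1 s hs.le
    · exact (hc3 t ⟨h3, ht.2⟩).1
  have hcont' : ContinuousOn c' (Icc 0 b) :=
    fun t ht => (hnull t ht).contMDiffAt.continuousAt.continuousWithinAt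
  have h0' : c' =ᶠ[𝓝 0] c₀ := by
    refine EventuallyEq.trans ?_ h.germ
    filter_upwards [gt_mem_nhds (show 0 < b - δ by linarith)] with s hs using hc1 s hs.le
  have hc₀s : ∀ᶠ t in 𝓝 b, c₀ (t - b) ∈ χ.source := by
    have h3 : ContinuousAt (fun t => c₀ (t - b)) b :=
      ContinuousAt.comp (g := c₀) (by rw [sub_self]; exact hc₀n.continuousAt)
        hshift.continuousAt
    exact h3.eventually (χ.open_source.mem_nhds (by simpa [hc₀] using ho))
  refine exists_nullLoop_of_arc hb hnull h0' (hc₀s.mono fun t ht hbt => ?_) ?_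
  · rw [hc2 t hbt, χ.left_inv ht]
  · obtain ⟨q₁, s, hq₁, hs, rfl⟩ := hq.split h.continuousOn (b := b - δ) (by linarith)
      (by linarith) rfl
    have hsub : Icc (b - δ) b ⊆ Icc 0 b := Icc_subset_Icc_left (by linarith)
    have hs1 : ChartClass χ s := hs.chartClass (h.continuousOn.mono hsub)
      fun t ht => (hεb (hnear t ht)).1.1
    have hcb' : c' b = o := by rw [hc2 b le_rfl, hβb, χ.left_inv ho]
    obtain ⟨s', hs'⟩ := exists_classIn (c := c') (convex_Icc (b - δ) b) (hcont'.mono hsub)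
      ⟨le_rfl, by linarith⟩ ⟨by linarith, le_rfl⟩ (hc1 _ le_rfl) hcb'
    have hs2 : ChartClass χ s' := hs'.chartClass (hcont'.mono hsub) fun t ht => (hc3 t ht).2
    rw [hs1.unique hconv hs2]
    exact (hq₁.congr (Icc_subset_Icc_right (by linarith)) fun t ht => (hc1 t ht.2).symm).trans
      (hs'.congr hsub fun _ _ => rfl)

end Closing

/-! ### Moving inside convex regions of regular points -/

section Moves

theorem Turn.smul_left {E : Type*} [NormedAddCommGroup E] [NormedSpace ℝ E] {v w : E} {κ : ℝ}
    (hκ : 0 < κ) (h : Turn v w) : Turn (κ • v) w := by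
  obtain ⟨ℓ, h1, h2⟩ := h
  exact ⟨ℓ, by rw [map_smul, smul_eq_mul]; positivity, h2⟩

/-- In dimension at least two, three lines do not cover a nonempty open set. -/
theorem exists_mem_avoiding_lines {m : ℕ} (hm : 1 ≤ m) {H : Set (Euc (m + 1))} (hH : IsOpen H)
    (hne : H.Nonempty) (p v : Fin 3 → Euc (m + 1)) :
    ∃ z ∈ H, ∀ i, z - p i ∉ Submodule.span ℝ {v i} := by
  by_contra! hcon
  have h0 : ∀ i, MeasureTheory.volume
      (AffineSubspace.mk' (p i) (Submodule.span ℝ {v i}) : Set (Euc (m + 1))) = 0 := by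
    intro i
    apply MeasureTheory.Measure.addHaar_affineSubspace
    intro htop
    have h1 := congrArg AffineSubspace.direction htop
    rw [AffineSubspace.direction_mk', AffineSubspace.direction_top] at h1
    have h2 := finrank_span_le_card (R := ℝ) {v i}
    rw [h1, finrank_top, finrank_euclideanSpace_fin, Set.toFinset_singleton,
      Finset.card_singleton] at h2
    omega
  have h1 : MeasureTheory.volume H = 0 := by
    refine MeasureTheory.measure_mono_null (fun z hz => ?_) (MeasureTheory.measure_iUnion_null h0)
    obtain ⟨i, hi⟩ := hcon z hz
    exact mem_iUnion.2 ⟨i, hi⟩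
  exact (hH.measure_pos MeasureTheory.volume hne).ne' h1

variable {m : ℕ}
  {M : Type u} [TopologicalSpace M] [ChartedSpace (Euc (m + 1)) M] [IsManifold (𝓡 (m + 1)) ∞ M]
  {N : Type v} [TopologicalSpace N] [ChartedSpace (Euc (m + 2)) N] [IsManifold (𝓡 (m + 2)) ∞ N]
  {f : M → N} {c₀ c : ℝ → M} {b : ℝ} {o x y : M}

/-- The class `q` of paths contains a null arc with the germ of `c₀` at its beginning. -/
def Reach (f : M → N) (c₀ : ℝ → M) {o x : M} (q : Path.Homotopic.Quotient o x) : Prop :=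
  ∃ (c : ℝ → M) (b : ℝ), 0 < b ∧ NullArc (m := m) f c₀ c b ∧ ClassIn c (Icc 0 b) 0 b q

/-- The class `q` of paths contains a null arc with the germ of `c₀` at its beginning, whose final
velocity is not opposite to the vector `w` in the chart `χ`. -/
def ReachTurn (f : M → N) (c₀ : ℝ → M) (χ : OpenPartialHomeomorph M (Euc (m + 1)))
    (w : Euc (m + 1)) {o x : M} (q : Path.Homotopic.Quotient o x) : Prop :=
  ∃ (c : ℝ → M) (b : ℝ), 0 < b ∧ NullArc (m := m) f c₀ c b ∧ ClassIn c (Icc 0 b) 0 b q ∧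
    Turn (deriv (fun s => χ (c s)) b) w

theorem ReachTurn.reach {χ : OpenPartialHomeomorph M (Euc (m + 1))} {w : Euc (m + 1)}
    {q : Path.Homotopic.Quotient o x} (h : ReachTurn f c₀ χ w q) : Reach (m := m) f c₀ q := by
  obtain ⟨c, b, hb, hc, hq, -⟩ := h
  exact ⟨c, b, hb, hc, hq⟩

theorem Reach.exists_turn {χ : OpenPartialHomeomorph M (Euc (m + 1))}
    (hχ : χ ∈ Atlas (m + 1) M) {q : Path.Homotopic.Quotient o x} (h : Reach (m := m) f c₀ q)
    (hx : x ∈ χ.source) : ∃ v : Euc (m + 1), v ≠ 0 ∧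
      ∀ w, w ∉ Submodule.span ℝ {v} → ReachTurn (m := m) f c₀ χ w q := by
  obtain ⟨c, b, hb, hc, hq⟩ := h
  have hn := hc.null b ⟨hb.le, le_rfl⟩
  have hv := (velocity_ne_zero_iff hχ (hq.target.2 ▸ hx)
    (hn.contMDiffAt.mdifferentiableAt (by simp))).1 hn.velocity_ne
  exact ⟨_, hv, fun w hw => ⟨c, b, hb, hc, hq, turn_of_notMem_span hv hw⟩⟩

/-- Continuation along a straight line in a chart. -/
theorem ReachTurn.line {χ : OpenPartialHomeomorph M (Euc (m + 1))}
    (hχ : χ ∈ Atlas (m + 1) M) (hconv : Convex ℝ χ.target)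
    {q : Path.Homotopic.Quotient o x} (h : ReachTurn (m := m) f c₀ χ (χ y - χ x) q)
    {s : Path.Homotopic.Quotient x y} (hs : ChartClass χ s)
    (hfree : ∀ᶠ p in 𝓝 x, IsFree (m := m) f p)
    (hline : ∀ s ∈ Icc (0 : ℝ) 1,
      NullAt (m := m) f (fun τ => χ.symm (χ x + τ • (χ y - χ x))) s) :
    Reach (m := m) f c₀ (q.trans s) ∧ ∀ w, Turn (χ y - χ x) w →
      ReachTurn (m := m) f c₀ χ w (q.trans s) := by
  obtain ⟨c, b, hb, hc, hq, ℓ, h1, h2⟩ := h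
  obtain ⟨c', b', κ, -, hκ, hb', hc', hq', hd⟩ :=
    hc.exists_line hχ hconv hb hq hs hfree hline h1 h2 0
  exact ⟨⟨c', b', hb', hc', hq'⟩, fun w hw => ⟨c', b', hb', hc', hq', hd ▸ hw.smul_left hκ⟩⟩

/-- Continuation within a convex set of regular points, arriving in a direction not opposite to
`w`. -/
theorem Reach.turn_of_convex (hm : 1 ≤ m) (hS : IsClosed (singularSet (m + 1) (m + 2) f))
    {χ : OpenPartialHomeomorph M (Euc (m + 1))}
    (hχ : χ ∈ Atlas (m + 1) M) (hconv : Convex ℝ χ.target) {H : Set (Euc (m + 1))}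
    (hH : IsOpen H) (hHc : Convex ℝ H) (hHt : H ⊆ χ.target)
    (hreg : ∀ z ∈ H, χ.symm z ∉ singularSet (m + 1) (m + 2) f)
    {q : Path.Homotopic.Quotient o x} (h : Reach (m := m) f c₀ q)
    {s : Path.Homotopic.Quotient x y} (hs : ChartClass χ s) (hx : χ x ∈ H) (hy : χ y ∈ H)
    (hxy : x ≠ y) {w : Euc (m + 1)} (hw : w ≠ 0) :
    ReachTurn (m := m) f c₀ χ w (q.trans s) := by
  obtain ⟨hxs, hys⟩ := hs.mem_source
  have hXY : χ y - χ x ≠ 0 := fun h0 => hxy (χ.injOn hxs hys (sub_eq_zero.1 h0).symm)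
  obtain ⟨v, hv, hturn⟩ := h.exists_turn hχ hxs
  -- A detour through a generic `z`. The three excluded lines pass through `x` along the arriving
  -- velocity `v`, through `x` and `y`, and through `y` along `w`; avoiding them prevents a reversal
  -- of direction at `x`, `z` and `y` respectively.
  obtain ⟨z, hzH, hz⟩ := exists_mem_avoiding_lines hm hH ⟨_, hx⟩ ![χ x, χ x, χ y]
    ![v, χ y - χ x, w]
  have hz1 : z - χ x ∉ Submodule.span ℝ {v} := hz 0
  have hz2 : z - χ x ∉ Submodule.span ℝ {χ y - χ x} := hz 1
  have hz3 : z - χ y ∉ Submodule.span ℝ {w} := hz 2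
  have hzs : χ.symm z ∈ χ.source := χ.map_target (hHt hzH)
  have hzz : χ (χ.symm z) = z := χ.right_inv (hHt hzH)
  obtain ⟨s₁, hs₁⟩ := exists_chartClass hconv hxs hzs
  obtain ⟨s₂, hs₂⟩ := exists_chartClass hconv hzs hys
  have hfree : ∀ p, p ∈ χ.source → χ p ∈ H → ∀ᶠ p' in 𝓝 p, IsFree (m := m) f p' := by
    intro p hp hpH
    have h1 : p ∉ singularSet (m + 1) (m + 2) f := χ.left_inv hp ▸ hreg _ hpH
    filter_upwards [hS.isOpen_compl.mem_nhds h1] with p' hp' using isFree_of_notMem hS hp'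
  have hline : ∀ z₁ ∈ H, ∀ z₂ ∈ H, z₂ - z₁ ≠ 0 → ∀ τ ∈ Icc (0 : ℝ) 1,
      NullAt (m := m) f (fun τ => χ.symm (z₁ + τ • (z₂ - z₁))) τ := by
    intro z₁ h1 z₂ h2 hne τ hτ
    have h3 := hHc.add_smul_sub_mem h1 h2 hτ
    exact nullAt_line_of_free hχ hne (hHt h3) (isFree_of_notMem hS (hreg _ h3))
  have hz10 : z - χ x ≠ 0 := fun h0 => hz1 (h0 ▸ Submodule.zero_mem _)
  have hz30 : χ y - z ≠ 0 := fun h0 => hz3 (by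
    rw [← neg_sub, h0, neg_zero]; exact Submodule.zero_mem _)
  have step₁ := ReachTurn.line hχ hconv (y := χ.symm z) (hturn _ (hzz.symm ▸ hz1)) hs₁
    (hfree x hxs hx) (hzz.symm ▸ hline _ hx _ hzH hz10)
  have turn₁ : Turn (z - χ x) (χ y - z) := by
    refine turn_of_notMem_span hz10 fun hmem => ?_
    obtain ⟨r, hr⟩ := Submodule.mem_span_singleton.1 hmem
    have h1 : χ y - χ x = (1 + r) • (z - χ x) := by
      rw [add_smul, one_smul, hr]; abel
    refine hz2 (Submodule.mem_span_singleton.2 ⟨(1 + r)⁻¹, ?_⟩)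
    have h2 : 1 + r ≠ 0 := fun h0 => hXY (by rw [h1, h0, zero_smul])
    rw [h1, inv_smul_smul₀ h2]
  have turn₂ : Turn (χ y - z) w := by
    refine turn_of_notMem_span hz30 fun hmem => ?_
    obtain ⟨r, hr⟩ := Submodule.mem_span_singleton.1 hmem
    have h2 : r ≠ 0 := fun h0 => hw (by rw [← hr, h0, zero_smul])
    refine hz3 (Submodule.mem_span_singleton.2 ⟨-r⁻¹, ?_⟩)
    rw [← hr, neg_smul, inv_smul_smul₀ h2, neg_sub]
  have step₂ := ReachTurn.line hχ hconv (y := y) (step₁.2 (χ y - χ (χ.symm z))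
    (by rw [hzz]; exact turn₁)) hs₂ (hfree _ hzs (hzz.symm ▸ hzH))
    (by rw [hzz]; exact hline _ hzH _ hy hz30)
  have h3 := step₂.2 w (by rw [hzz]; exact turn₂)
  rw [Path.Homotopic.Quotient.trans_assoc] at h3
  rwa [hs.unique hconv (hs₁.trans hs₂)]

/-- Continuation within a convex set of regular points. -/
theorem Reach.of_convex (hm : 1 ≤ m) (hS : IsClosed (singularSet (m + 1) (m + 2) f))
    {χ : OpenPartialHomeomorph M (Euc (m + 1))}
    (hχ : χ ∈ Atlas (m + 1) M) (hconv : Convex ℝ χ.target) {H : Set (Euc (m + 1))}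
    (hH : IsOpen H) (hHc : Convex ℝ H) (hHt : H ⊆ χ.target)
    (hreg : ∀ z ∈ H, χ.symm z ∉ singularSet (m + 1) (m + 2) f)
    {q : Path.Homotopic.Quotient o x} (h : Reach (m := m) f c₀ q)
    {s : Path.Homotopic.Quotient x y} (hs : ChartClass χ s) (hx : χ x ∈ H) (hy : χ y ∈ H) :
    Reach (m := m) f c₀ (q.trans s) := by
  rcases eq_or_ne x y with rfl | hxy
  · rw [hs.unique hconv (ClassIn.refl (χ.map_source hs.mem_source.1)
      (χ.left_inv hs.mem_source.1)), Path.Homotopic.Quotient.trans_refl]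
    exact h
  · have hXY : χ y - χ x ≠ 0 := fun h0 =>
      hxy (χ.injOn hs.mem_source.1 hs.mem_source.2 (sub_eq_zero.1 h0).symm)
    exact (h.turn_of_convex hm hS hχ hconv hH hHc hHt hreg hs hx hy hxy hXY).reach

end Moves

/-! ### Crossing the singular set at a gate -/

section Gates

variable {m : ℕ}
  {M : Type u} [TopologicalSpace M] [ChartedSpace (Euc (m + 1)) M] [IsManifold (𝓡 (m + 1)) ∞ M]
  {N : Type v} [TopologicalSpace N] [ChartedSpace (Euc (m + 2)) N] [IsManifold (𝓡 (m + 2)) ∞ N]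
  {f : M → N} {c₀ c : ℝ → M} {b : ℝ} {o x y : M}

omit [IsManifold (𝓡 (m + 1)) ∞ M] in
theorem dchart_transport {χ : OpenPartialHomeomorph M (Euc (m + 1))} {p p' : M} (h : p' = p)
    (v : Euc (m + 1)) : dchart χ p' (v : TangentSpace (𝓡 (m + 1)) p')
      = dchart χ p (v : TangentSpace (𝓡 (m + 1)) p) := by
  subst h; rfl

/-- The line through the centre of a gate in the null direction is a null curve. -/
theorem IsGate.nullAt_line (hS : IsClosed (singularSet (m + 1) (m + 2) f))
    {χ : OpenPartialHomeomorph M (Euc (m + 1))} (hχ : χ ∈ Atlas (m + 1) M) {p : M}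
    (hg : IsGate f χ p) {u : TangentSpace (𝓡 (m + 1)) p}
    (hu : mfderiv (𝓡 (m + 1)) (𝓡 (m + 2)) f p u = 0) (hu0 : dchart χ p u 0 ≠ 0)
    {a : ℝ} (ha : a ≠ 0) {z : Euc (m + 1)} {s₀ s : ℝ} (hz : z + s₀ • a • dchart χ p u = χ p)
    (hs : z + s • a • dchart χ p u ∈ χ.target) :
    NullAt (m := m) f (fun τ => χ.symm (z + τ • a • dchart χ p u)) s := by
  set k := a • dchart χ p u with hk
  have hk0 : k 0 ≠ 0 := by simpa [hk] using ⟨ha, hu0⟩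
  have hkne : k ≠ 0 := fun h => hk0 (by rw [h]; rfl)
  have hp0 : χ p 0 = 0 := by
    refine (hg.singular p hg.mem_source).1 fun hinj => hu0 ?_
    have h1 : u = 0 := hinj (hu.trans (ContinuousLinearMap.map_zero _).symm)
    rw [h1]
    exact congrArg (fun v : Euc (m + 1) => v 0) (ContinuousLinearMap.map_zero (dchart χ p))
  have hcoord : ∀ τ : ℝ, (z + τ • k) 0 = (τ - s₀) * k 0 := by
    intro τ
    have h1 : (z + s₀ • k) 0 = 0 := by rw [hz, hp0]
    simp only [PiLp.add_apply, PiLp.smul_apply, smul_eq_mul] at h1 ⊢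
    linarith
  -- The line is transverse to the hyperplane `x₀ = 0` and passes through the gate at time `s₀`, so
  -- it meets the singular set nowhere else.
  have hreg : ∀ τ, z + τ • k ∈ χ.target → τ ≠ s₀ →
      χ.symm (z + τ • k) ∉ singularSet (m + 1) (m + 2) f := by
    intro τ hτ hne hmem
    have h1 := (hg.singular _ (χ.map_target hτ)).1 hmem
    rw [χ.right_inv hτ, hcoord] at h1
    exact mul_ne_zero (sub_ne_zero.2 hne) hk0 h1
  rcases eq_or_ne s s₀ with rfl | hne
  · have hp : χ.symm (z + s • k) = p := by rw [hz, χ.left_inv hg.mem_source]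
    have h1 : ContDiffAt ℝ 2 (fun τ : ℝ => z + τ • k) s := by fun_prop
    have hsm := contMDiffAt_symm_curve two_le_infty hχ hs h1
    have hd : deriv (fun τ : ℝ => z + τ • k) s = k := (hasDerivAt_line z k s).deriv
    have hvel : (velocity (d := m + 1) (fun τ => χ.symm (z + τ • k)) s : Euc (m + 1))
        = (a • u : TangentSpace (𝓡 (m + 1)) p) := by
      apply dchart_injective hχ hg.mem_source
      have h2 := dchart_velocity hχ (c := fun τ => χ.symm (z + τ • k)) (t := s)
        (χ.map_target hs) (hsm.mdifferentiableAt (by simp))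
      rw [deriv_chart_symm_curve hs h1.continuousAt EventuallyEq.rfl, hd] at h2
      refine (dchart_transport hp _).symm.trans (h2.trans ?_)
      exact (ContinuousLinearMap.map_smul (dchart χ p) a u).symm
    refine ⟨hsm, velocity_symm_curve_ne_zero hχ hs h1 (by rw [hd]; exact hkne), fun _ => ?_, fun _ => ?_, ?_⟩
    · rw [hp]; exact hg.cusp
    · refine mfderiv_eq_zero_transport hp hvel ?_
      exact (ContinuousLinearMap.map_smul _ a u).trans
        ((congrArg (a • ·) hu).trans (smul_zero a))
    · have h2 := h1.continuousAt.eventually (χ.open_target.mem_nhds hs)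
      filter_upwards [h2.filter_mono nhdsWithin_le_nhds, self_mem_nhdsWithin] with τ h3 h4
      exact hreg τ h3 h4
  · exact nullAt_line_of_free hχ hkne hs (isFree_of_notMem hS (hreg s hs hne))

/-- Continuation between two regular points of a chart that contains at most one gate. -/
theorem Reach.of_chart (hm : 1 ≤ m) (hS : IsClosed (singularSet (m + 1) (m + 2) f))
    {χ : OpenPartialHomeomorph M (Euc (m + 1))}
    (hχ : χ ∈ Atlas (m + 1) M) (hconv : Convex ℝ χ.target)
    (hgate : (∀ q ∈ χ.source, q ∉ singularSet (m + 1) (m + 2) f) ∨ ∃ q, IsGate f χ q)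
    {q : Path.Homotopic.Quotient o x} (h : Reach (m := m) f c₀ q)
    {s : Path.Homotopic.Quotient x y} (hs : ChartClass χ s)
    (hx : x ∉ singularSet (m + 1) (m + 2) f) (hy : y ∉ singularSet (m + 1) (m + 2) f) :
    Reach (m := m) f c₀ (q.trans s) := by
  obtain ⟨hxs, hys⟩ := hs.mem_source
  rcases hgate with hreg | ⟨p, hg⟩
  · exact h.of_convex hm hS hχ hconv χ.open_target hconv subset_rfl
      (fun z hz => hreg _ (χ.map_target hz)) hs (χ.map_source hxs) (χ.map_source hys)
  -- Half-balls on the two sides of the singular hyperplane: convex, and free of singular points.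
  -- Only the sign of `e` matters.
  let H : ℝ → Set (Euc (m + 1)) := fun e => {z | z ∈ χ.target ∧ 0 < e * z 0}
  have hHo : ∀ e, IsOpen (H e) := fun e =>
    χ.open_target.inter (isOpen_lt (f := fun _ : Euc (m + 1) => (0 : ℝ))
      (g := fun z : Euc (m + 1) => e * z 0) continuous_const (by fun_prop))
  have hHc : ∀ e, Convex ℝ (H e) := by
    intro e
    refine hconv.inter (convex_halfSpace_gt (f := fun z : Euc (m + 1) => e * z 0) ?_ 0)
    constructor
    · intro z z'; simp only [PiLp.add_apply]; ring
    · intro r z; simp only [PiLp.smul_apply, smul_eq_mul]; ring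
  have hHt : ∀ e, H e ⊆ χ.target := fun e z hz => hz.1
  have hHr : ∀ e, ∀ z ∈ H e, χ.symm z ∉ singularSet (m + 1) (m + 2) f := by
    rintro e z ⟨hz, hz0⟩ hmem
    have h1 := (hg.singular _ (χ.map_target hz)).1 hmem
    rw [χ.right_inv hz] at h1
    rw [h1, mul_zero] at hz0
    exact hz0.false
  have hx0 : χ x 0 ≠ 0 := fun h0 => hx ((hg.singular x hxs).2 h0)
  have hy0 : χ y 0 ≠ 0 := fun h0 => hy ((hg.singular y hys).2 h0)
  rcases lt_or_gt_of_ne (mul_ne_zero hx0 hy0) with hneg | hpos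
  swap
  · exact h.of_convex hm hS hχ hconv (hHo (χ x 0)) (hHc _) (hHt _) (hHr _) hs
      ⟨χ.map_source hxs, mul_self_pos.2 hx0⟩ ⟨χ.map_source hys, hpos⟩
  obtain ⟨u, hu, hu0⟩ := hg.transverse
  have hps := hg.mem_source
  have hp0 : χ p 0 = 0 := by
    refine (hg.singular p hps).1 fun hinj => hu0 ?_
    have h1 : u = 0 := hinj (hu.trans (ContinuousLinearMap.map_zero _).symm)
    rw [h1]
    exact congrArg (fun v : Euc (m + 1) => v 0) (ContinuousLinearMap.map_zero (dchart χ p))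
  set k := dchart χ p u with hk
  -- The sign of `e` puts `p - e k` on the side of `x` and `p + e k` on the side of `y`. The point
  -- `p - e k` differs from `x` because the arrival with prescribed direction needs distinct
  -- endpoints.
  obtain ⟨e, he0, hek, hce⟩ : ∃ e : ℝ, e ≠ 0 ∧ 0 < (e * k 0) * χ y 0 ∧
      (χ p - e • k ∈ χ.target ∧ χ p + e • k ∈ χ.target ∧ χ p - e • k ≠ χ x) := by
    have hev : ∀ᶠ e : ℝ in 𝓝 0, χ p - e • k ∈ χ.target ∧ χ p + e • k ∈ χ.target ∧
        χ p - e • k ≠ χ x := by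
      refine .and ?_ (.and ?_ ?_)
      · have h1 : ContinuousAt (fun e : ℝ => χ p - e • k) 0 := by fun_prop
        exact h1.eventually (χ.open_target.mem_nhds (by simpa using χ.map_source hps))
      · have h1 : ContinuousAt (fun e : ℝ => χ p + e • k) 0 := by fun_prop
        exact h1.eventually (χ.open_target.mem_nhds (by simpa using χ.map_source hps))
      · have h1 : ContinuousAt (fun e : ℝ => χ p - e • k) 0 := by fun_prop
        refine h1.eventually_ne fun h0 => ?_
        rw [zero_smul, sub_zero] at h0
        exact hx0 (by rw [← h0, hp0])
    obtain ⟨r, hr, hball⟩ := Metric.eventually_nhds_iff.1 hev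
    have hky : k 0 * χ y 0 ≠ 0 := mul_ne_zero hu0 hy0
    rcases lt_or_gt_of_ne hky with h1 | h1
    · exact ⟨-(r / 2), by linarith, by nlinarith, hball (by
        rw [Real.dist_eq, sub_zero, abs_neg, abs_of_pos (by linarith)]; linarith)⟩
    · exact ⟨r / 2, by linarith, by nlinarith, hball (by
        rw [Real.dist_eq, sub_zero, abs_of_pos (by linarith)]; linarith)⟩
  obtain ⟨ht₁, ht₂, hne⟩ := hce
  have hs₁ := χ.map_target ht₁
  have hs₂ := χ.map_target ht₂
  have hr₁ := χ.right_inv ht₁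
  have hr₂ := χ.right_inv ht₂
  obtain ⟨q₁, hq₁⟩ := exists_chartClass hconv hxs hs₁
  obtain ⟨q₂, hq₂⟩ := exists_chartClass hconv hs₁ hs₂
  obtain ⟨q₃, hq₃⟩ := exists_chartClass hconv hs₂ hys
  have hm₁ : χ p - e • k ∈ H (χ x 0) := by
    refine ⟨ht₁, ?_⟩
    simp only [PiLp.sub_apply, PiLp.smul_apply, smul_eq_mul, hp0, zero_sub]
    have h1 : 0 < χ y 0 * χ y 0 := mul_self_pos.2 hy0
    by_contra! hcon
    nlinarith [mul_pos hek (neg_pos.2 hneg)]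
  have hm₂ : χ p + e • k ∈ H (χ y 0) := by
    refine ⟨ht₂, ?_⟩
    simp only [PiLp.add_apply, PiLp.smul_apply, smul_eq_mul, hp0, zero_add]
    linarith
  have hdiff : χ p + e • k - (χ p - e • k) = (2 * e) • k := by module
  have step₁ := h.turn_of_convex hm hS hχ hconv (hHo _) (hHc _) (hHt _) (hHr (χ x 0)) hq₁
    ⟨χ.map_source hxs, mul_self_pos.2 hx0⟩ (by rw [hr₁]; exact hm₁)
    (fun h0 => hne (by rw [h0, hr₁])) (w := (2 * e) • k)
    (smul_ne_zero (by simpa using he0) fun h0 => hu0 (by rw [h0]; rfl))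
  have hfree₁ : ∀ᶠ p' in 𝓝 (χ.symm (χ p - e • k)), IsFree (m := m) f p' := by
    filter_upwards [hS.isOpen_compl.mem_nhds (hHr _ _ hm₁)] with p' hp'
      using isFree_of_notMem hS hp'
  have step₂ := (ReachTurn.line hχ hconv (y := χ.symm (χ p + e • k)) (by
    rw [hr₁, hr₂, hdiff]; exact step₁) hq₂ hfree₁ (by
    rw [hr₁, hr₂, hdiff]
    intro τ hτ
    refine hg.nullAt_line hS hχ hu hu0 (s₀ := 1 / 2) (mul_ne_zero two_ne_zero he0) ?_ ?_
    · rw [← hk]; module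
    · have h1 := hconv.add_smul_sub_mem ht₁ ht₂ hτ
      rwa [hdiff] at h1)).1
  have step₃ := step₂.of_convex hm hS hχ hconv (hHo _) (hHc _) (hHt _) (hHr (χ y 0)) hq₃
    (by rw [hr₂]; exact hm₂) ⟨χ.map_source hys, mul_self_pos.2 hy0⟩
  rw [Path.Homotopic.Quotient.trans_assoc, Path.Homotopic.Quotient.trans_assoc] at step₃
  rwa [hs.unique hconv (hq₁.trans (hq₂.trans hq₃))]

end Gates

/-! ### Every loop is homotopic to a null loop in dimension at least two -/

section Approach

variable {m : ℕ}
  {M : Type u} [TopologicalSpace M] [ChartedSpace (Euc (m + 1)) M] [IsManifold (𝓡 (m + 1)) ∞ M]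
  {N : Type v} [TopologicalSpace N] [ChartedSpace (Euc (m + 2)) N] [IsManifold (𝓡 (m + 2)) ∞ N]
  {f : M → N} {c₀ c : ℝ → M} {b : ℝ} {o x y : M}

omit [IsManifold (𝓡 (m + 1)) ∞ M] in
/-- Induction over the class of a path, in steps that stay in a chart of a given family. -/
theorem pathClass_induction {𝒞 : Set (OpenPartialHomeomorph M (Euc (m + 1)))}
    (hcov : ∀ p, ∃ χ ∈ 𝒞, p ∈ χ.source)
    {P : ∀ {x : M}, Path.Homotopic.Quotient o x → Prop} (h0 : P (Path.Homotopic.Quotient.refl o))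
    (hstep : ∀ χ ∈ 𝒞, ∀ {x y : M} (q : Path.Homotopic.Quotient o x)
      (s : Path.Homotopic.Quotient x y), ChartClass χ s → P q → P (q.trans s))
    (γ : Path o y) : P (Path.Homotopic.Quotient.mk γ) := by
  obtain ⟨t, ht0, htm, ⟨n, hn⟩, ht⟩ := exists_monotone_Icc_subset_open_cover_unitInterval
    (c := fun χ : 𝒞 => γ ⁻¹' χ.1.source) (fun χ => χ.1.open_source.preimage γ.continuous)
    (fun s _ => by
      obtain ⟨χ, hχ, hs⟩ := hcov (γ s)
      exact mem_iUnion.2 ⟨⟨χ, hχ⟩, hs⟩)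
  have hcont : Continuous γ.extend := γ.continuous_extend
  have key : ∀ k, ∀ (x : M) (q : Path.Homotopic.Quotient o x),
      ClassIn γ.extend (Icc 0 (t k : ℝ)) 0 (t k) q → P q := by
    intro k
    induction k with
    | zero =>
      intro x q hq
      rw [ht0] at hq
      have h1 : o = x := by
        have h2 := hq.source.2
        have h3 := hq.target.2
        exact h2.symm.trans h3
      subst h1
      have h2 : ClassIn γ.extend (Icc 0 ((0 : unitInterval) : ℝ)) 0 ((0 : unitInterval) : ℝ)
          (Path.Homotopic.Quotient.refl o) := ClassIn.refl ⟨le_rfl, le_rfl⟩ hq.source.2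
      rw [hq.unique (convex_Icc _ _) hcont.continuousOn h2]
      exact h0
    | succ k ih =>
      intro x q hq
      have hle : (t k : ℝ) ≤ t (k + 1) := htm (Nat.le_succ k)
      obtain ⟨q₁, s, hq₁, hs, rfl⟩ := hq.split hcont.continuousOn (t k).2.1 hle rfl
      obtain ⟨χ, hχ⟩ := ht k
      refine hstep χ.1 χ.2 q₁ s (hs.chartClass hcont.continuousOn fun τ hτ => ?_) (ih _ _ hq₁)
      have hτ1 : τ ∈ unitInterval := ⟨(t k).2.1.trans hτ.1, hτ.2.trans (t (k + 1)).2.2⟩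
      rw [γ.extend_apply hτ1]
      exact hχ (a := ⟨τ, hτ1⟩) ⟨hτ.1, hτ.2⟩
  refine key n y _ ⟨⟨⟨fun s => s, continuous_subtype_val⟩, by simp, by simp [hn n le_rfl]⟩,
    fun s => ?_, γ, fun s => ?_, rfl⟩
  · have h1 : ((t n : unitInterval) : ℝ) = 1 := by rw [hn n le_rfl]; rfl
    exact ⟨s.2.1, s.2.2.trans h1.ge⟩
  · exact (γ.extend_extends' s).symm

/-- Regular points near the end point of the class `q` are reached by null arcs, in the class of
`q` modified near the end point. -/
def Approach (f : M → N) (c₀ : ℝ → M) {o x : M} (q : Path.Homotopic.Quotient o x) : Prop :=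
  ∀ O ∈ 𝓝 x, ∃ y ∈ O, y ∉ singularSet (m + 1) (m + 2) f ∧
    ∃ β : Path.Homotopic.Quotient y x, ClassIn (id : M → M) O y x β ∧
      Reach (m := m) f c₀ (q.trans β.symm)

/-- The breakpoints of a subdivided path may be singular. `Approach` allows each to be moved to a
nearby regular point, and the connecting pieces `β` cancel in the composed class. -/
theorem Approach.trans (hm : 1 ≤ m) (hS : IsClosed (singularSet (m + 1) (m + 2) f))
    (hd : Dense (singularSet (m + 1) (m + 2) f)ᶜ)
    {χ : OpenPartialHomeomorph M (Euc (m + 1))}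
    (hχ : χ ∈ Atlas (m + 1) M) (hconv : Convex ℝ χ.target)
    (hgate : (∀ q ∈ χ.source, q ∉ singularSet (m + 1) (m + 2) f) ∨ ∃ q, IsGate f χ q)
    {q : Path.Homotopic.Quotient o x} (h : Approach (m := m) f c₀ q)
    {s : Path.Homotopic.Quotient x y} (hs : ChartClass χ s) :
    Approach (m := m) f c₀ (q.trans s) := by
  intro O hO
  obtain ⟨hxs, hys⟩ := hs.mem_source
  obtain ⟨x', hx', hx'S, β, hβ, hR⟩ := h _ (χ.open_source.mem_nhds hxs)
  obtain ⟨χ', -, hyχ', hsub, hχ'e, r, hr, hχ't⟩ := exists_ball_chart hχ hys hO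
  have hconv' : Convex ℝ χ'.target := by rw [hχ't]; exact convex_ball _ _
  obtain ⟨y', hy'S, hy'⟩ := hd.inter_open_nonempty _ χ'.open_source ⟨y, hyχ'⟩
  obtain ⟨β', hβ'⟩ := exists_chartClass hconv' hy'S hyχ'
  have hβ'id : ClassIn (id : M → M) χ'.source y' y β' := by
    have h1 := hβ'.comp (φ := χ'.symm) (c' := (id : M → M)) (K' := χ'.source) χ'.continuousOn_symm
      (fun z hz => χ'.map_target hz) (fun z _ => rfl)
    rwa [χ'.left_inv hy'S, χ'.left_inv hyχ'] at h1
  have hβχ : ChartClass χ β := hβ.chartClass continuousOn_id fun p hp => hp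
  have hβ'χ : ChartClass χ β' := hβ'id.chartClass continuousOn_id fun p hp => (hsub hp).1
  refine ⟨y', (hsub hy'S).2, hy', β', hβ'id.congr (fun p hp => (hsub hp).2) fun _ _ => rfl, ?_⟩
  have h2 := hR.of_chart hm hS hχ hconv hgate ((hβχ.trans hs).trans hβ'χ.symm) hx'S hy'
  have h3 : (q.trans β.symm).trans ((β.trans s).trans β'.symm) = (q.trans s).trans β'.symm := by
    simp only [Path.Homotopic.Quotient.trans_assoc]
    rw [← Path.Homotopic.Quotient.trans_assoc β.symm β, Path.Homotopic.Quotient.symm_trans,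
      Path.Homotopic.Quotient.refl_trans]
  rwa [h3] at h2

/-- Every loop at a regular point is homotopic to a null loop, in dimension at least two. -/
theorem exists_nullLoop_homotopic (hm : 1 ≤ m)
    (hf : ContMDiff (𝓡 (m + 1)) (𝓡 (m + 2)) ∞ f)
    {W : Type w} [TopologicalSpace W] [ChartedSpace (Euc (m + 2)) W] [IsManifold (𝓡 (m + 2)) ∞ W]
    {F : W → N} {ι : M → W} (he : MorinExtension (m := m) f F ι)
    (ho : o ∉ singularSet (m + 1) (m + 2) f) (γ : Path o o) :
    ∃ (c : ℝ → M) (h : IsNullLoop (m := m) f o c),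
      Path.Homotopic.Quotient.mk h.toPath = Path.Homotopic.Quotient.mk γ := by
  have hS := he.isClosed_singularSet hf
  have hd := he.dense_regular hf
  obtain ⟨χ, hχ, hoχ, hreg, ⟨z₀, r₀, hball⟩, -⟩ :=
    he.exists_gate_chart hf o (hS.isOpen_compl.mem_nhds ho)
  have hconv : Convex ℝ χ.target := by rw [hball]; exact convex_ball _ _
  have hreg' : ∀ z ∈ χ.target, χ.symm z ∉ singularSet (m + 1) (m + 2) f :=
    fun z hz => hreg (χ.map_target hz)
  have hfree : ∀ p ∈ χ.source, ∀ᶠ p' in 𝓝 p, IsFree (m := m) f p' := by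
    intro p hp
    filter_upwards [χ.open_source.mem_nhds hp] with p' hp' using isFree_of_notMem hS (hreg hp')
  set u : Euc (m + 1) := eFirst m with hu
  have hu0 : u ≠ 0 := fun h0 => by
    have := congrArg (fun v : Euc (m + 1) => v 0) h0
    simp [hu, eFirst] at this
  let c₀ : ℝ → M := fun t => χ.symm (χ o + t • u)
  have hline : Continuous fun t : ℝ => χ o + t • u := by fun_prop
  have hc₀0 : c₀ 0 = o := by simp [c₀, χ.left_inv hoχ]
  have hnull : ∀ t, χ o + t • u ∈ χ.target → NullAt (m := m) f c₀ t := fun t ht =>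
    nullAt_line_of_free hχ hu0 ht (isFree_of_notMem hS (hreg' _ ht))
  have hev : ∀ U ∈ 𝓝 o, ∀ᶠ t in 𝓝 (0 : ℝ), χ o + t • u ∈ χ.target ∧ c₀ t ∈ U := by
    intro U hU
    have h1 : ∀ᶠ t in 𝓝 (0 : ℝ), χ o + t • u ∈ χ.target :=
      hline.continuousAt.eventually (χ.open_target.mem_nhds (by simpa using χ.map_source hoχ))
    refine h1.and ?_
    have h2 : ContinuousAt c₀ 0 := (hnull 0 h1.self_of_nhds).contMDiffAt.continuousAt
    exact h2.eventually (hc₀0.symm ▸ hU)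
  have hstart : Approach (m := m) f c₀ (Path.Homotopic.Quotient.refl o) := by
    intro O hO
    obtain ⟨r, hr, hball⟩ := Metric.eventually_nhds_iff.1 (hev O hO)
    have hI : ∀ t ∈ Icc 0 (r / 2), χ o + t • u ∈ χ.target ∧ c₀ t ∈ O := fun t ht =>
      hball (by rw [Real.dist_eq, sub_zero, abs_of_nonneg ht.1]; linarith [ht.2])
    have harc : NullArc (m := m) f c₀ c₀ (r / 2) :=
      ⟨EventuallyEq.rfl, fun t ht => hnull t (hI t ht).1⟩
    have hend : r / 2 ∈ Icc 0 (r / 2) := ⟨by positivity, le_rfl⟩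
    obtain ⟨q, hq⟩ := exists_classIn (convex_Icc 0 (r / 2)) harc.continuousOn
      ⟨le_rfl, hend.1⟩ hend hc₀0 rfl
    refine ⟨c₀ (r / 2), (hI _ hend).2, hreg' _ (hI _ hend).1, q.symm, ?_, c₀, r / 2,
      by positivity, harc, ?_⟩
    · have h1 := hq.symm.comp (φ := c₀) (c' := (id : M → M)) (K' := O) harc.continuousOn
        (fun t ht => (hI t ht).2) (fun _ _ => rfl)
      rwa [hc₀0] at h1
    · rw [Path.Homotopic.Quotient.refl_trans]
      exact hq.symm.symm
  have happ : Approach (m := m) f c₀ (Path.Homotopic.Quotient.mk γ) := by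
    refine pathClass_induction (P := fun q => Approach (m := m) f c₀ q)
      (𝒞 := {χ | χ ∈ Atlas (m + 1) M ∧ Convex ℝ χ.target ∧
        ((∀ q ∈ χ.source, q ∉ singularSet (m + 1) (m + 2) f) ∨ ∃ q, IsGate f χ q)})
      (fun p => ?_) hstart (fun χ hχ x y q s hs hq => hq.trans hm hS hd hχ.1 hχ.2.1 hχ.2.2 hs) γ
    obtain ⟨χ, hχ, hpχ, -, ⟨z₀, r₀, hball⟩, hg⟩ := he.exists_gate_chart hf p univ_mem
    exact ⟨χ, ⟨hχ, by rw [hball]; exact convex_ball _ _, hg⟩, hpχ⟩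
  obtain ⟨y, hy, -, β, hβ, hR⟩ := happ _ (χ.open_source.mem_nhds hoχ)
  have hβχ : ChartClass χ β := hβ.chartClass continuousOn_id fun p hp => hp
  obtain ⟨ε, hε, hball'⟩ := Metric.eventually_nhds_iff.1 (hev univ univ_mem)
  have ht : χ o + (ε / 2) • u ∈ χ.target := (hball' (by
    rw [Real.dist_eq, sub_zero, abs_of_nonneg (by positivity)]; linarith)).1
  have hps := χ.map_target ht
  -- The arrival at `o` with prescribed direction needs a starting point distinct from `o`, so the
  -- route goes through this auxiliary point.
  have hpo : χ.symm (χ o + (ε / 2) • u) ≠ o := by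
    intro h0
    have h1 := χ.right_inv ht
    rw [h0] at h1
    have h2 : (ε / 2) • u = 0 := by simpa using h1
    exact smul_ne_zero (by positivity) hu0 h2
  obtain ⟨s₁, hs₁⟩ := exists_chartClass hconv hy hps
  obtain ⟨s₂, hs₂⟩ := exists_chartClass hconv hps hoχ
  have step₁ := hR.of_convex hm hS hχ hconv χ.open_target hconv subset_rfl hreg' hs₁
    (χ.map_source hy) (χ.map_source hps)
  have step₂ := step₁.turn_of_convex hm hS hχ hconv χ.open_target hconv subset_rfl hreg' hs₂
    (χ.map_source hps) (χ.map_source hoχ) hpo hu0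
  have hq : (((Path.Homotopic.Quotient.mk γ).trans β.symm).trans s₁).trans s₂
      = Path.Homotopic.Quotient.mk γ := by
    rw [Path.Homotopic.Quotient.trans_assoc, Path.Homotopic.Quotient.trans_assoc,
      ← hβχ.unique hconv (hs₁.trans hs₂), Path.Homotopic.Quotient.symm_trans,
      Path.Homotopic.Quotient.trans_refl]
  rw [hq] at step₂
  obtain ⟨c, b, hb, hc, hqc, hturn⟩ := step₂
  refine hc.exists_nullLoop hχ hconv hb hqc hoχ (hfree o hoχ) ?_
  have h0 : χ o + (0 : ℝ) • u ∈ χ.target := by simpa using χ.map_source hoχ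
  rwa [deriv_chart_symm_curve h0 hline.continuousAt EventuallyEq.rfl,
    (hasDerivAt_line (χ o) u 0).deriv]

end Approach

/-! ### Dimension one: all regular curves are null, and arcs can be traced back -/

section DimensionOne

variable {m : ℕ}
  {M : Type u} [TopologicalSpace M] [ChartedSpace (Euc (m + 1)) M] [IsManifold (𝓡 (m + 1)) ∞ M]
  {N : Type v} [TopologicalSpace N] [ChartedSpace (Euc (m + 2)) N] [IsManifold (𝓡 (m + 2)) ∞ N]
  {f : M → N} {c₀ c : ℝ → M} {b : ℝ} {o x y : M}

theorem euc_ext (hm : m = 0) {v w : Euc (m + 1)} (h : v 0 = w 0) : v = w := by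
  subst hm
  ext i
  rw [show i = 0 from Fin.ext (by have := i.2; rw [Fin.val_zero]; omega), h]

theorem coord_ne_zero (hm : m = 0) {v : Euc (m + 1)} (h : v ≠ 0) : v 0 ≠ 0 :=
  fun h0 => h (euc_ext hm h0)

theorem eq_smul_of_coord_ne_zero (hm : m = 0) {v : Euc (m + 1)} (h : v 0 ≠ 0) (w : Euc (m + 1)) :
    w = (w 0 / v 0) • v :=
  euc_ext hm (by simp only [PiLp.smul_apply, smul_eq_mul]; field_simp)

theorem turn_of_mul_pos {v w : Euc (m + 1)} (h : 0 < v 0 * w 0) : Turn v w := by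
  refine ⟨v 0 • EuclideanSpace.proj 0, ?_, ?_⟩
  · have : v 0 ≠ 0 := left_ne_zero_of_mul h.ne'
    simpa using mul_self_pos.2 this
  · simpa using h

theorem hasDerivAt_coord {α : ℝ → Euc (m + 1)} {t : ℝ} (h : ContDiffAt ℝ 2 α t) (a : ℝ) :
    HasDerivAt (fun s => a * α s 0) (a * deriv α t 0) t := by
  have h1 := ((EuclideanSpace.proj (𝕜 := ℝ) (0 : Fin (m + 1))).hasFDerivAt (x := α t)).comp_hasDerivAt t
    (h.differentiableAt (by simp)).hasDerivAt
  exact h1.const_mul a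

theorem NullAt.coord_deriv_ne_zero (hm : m = 0) {χ : OpenPartialHomeomorph M (Euc (m + 1))}
    (hχ : χ ∈ Atlas (m + 1) M) {t : ℝ} (h : NullAt (m := m) f c t) (ht : c t ∈ χ.source) :
    deriv (fun s => χ (c s)) t 0 ≠ 0 :=
  coord_ne_zero hm ((velocity_ne_zero_iff hχ ht (h.contMDiffAt.mdifferentiableAt (by simp))).1
    h.velocity_ne)

/-- In dimension one, the conditions on null curves at singular points are automatic. -/
theorem isFree_of_dim_one (hm : m = 0) (hf : ContMDiff (𝓡 (m + 1)) (𝓡 (m + 2)) ∞ f)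
    {W : Type w} [TopologicalSpace W] [ChartedSpace (Euc (m + 2)) W] [IsManifold (𝓡 (m + 2)) ∞ W]
    {F : W → N} {ι : M → W} (he : MorinExtension (m := m) f F ι) (p : M) :
    IsFree (m := m) f p := by
  by_cases hpS : p ∈ singularSet (m + 1) (m + 2) f
  swap
  · exact isFree_of_notMem (he.isClosed_singularSet hf) hpS
  obtain ⟨χ, hχ, hpχ, -, -, hg⟩ := he.exists_gate_chart hf p univ_mem
  rcases hg with hg | ⟨q, hg⟩
  · exact absurd hpS (hg p hpχ)
  have hp0 := (hg.singular p hpχ).1 hpS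
  obtain ⟨u, hu, hu0⟩ := hg.transverse
  have hq0 : χ q 0 = 0 := by
    refine (hg.singular q hg.mem_source).1 fun hinj => hu0 ?_
    have h1 : u = 0 := hinj (hu.trans (ContinuousLinearMap.map_zero _).symm)
    rw [h1]
    exact congrArg (fun v : Euc (m + 1) => v 0) (ContinuousLinearMap.map_zero (dchart χ q))
  -- In dimension one the hyperplane `x₀ = 0` is a point, so the singular point is the gate itself,
  -- and the kernel is the whole tangent line.
  obtain rfl : p = q := χ.injOn hpχ hg.mem_source (euc_ext hm (hp0.trans hq0.symm))
  rintro c t rfl hc hv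
  have hα := contDiffAt_chart_curve two_le_infty hχ hpχ hc
  have hd := (velocity_ne_zero_iff hχ hpχ (hc.mdifferentiableAt (by simp))).1 hv
  refine ⟨hc, hv, fun _ => hg.cusp, fun _ => ?_, ?_⟩
  · have hu1 : (show Euc (m + 1) from u) 0 ≠ 0 := coord_ne_zero hm fun h0 => hu0 (by
      rw [show u = 0 from h0]
      exact congrArg (fun v : Euc (m + 1) => v 0) (ContinuousLinearMap.map_zero (dchart χ (c t))))
    have h1 := eq_smul_of_coord_ne_zero hm hu1 (velocity (d := m + 1) c t)
    refine mfderiv_eq_zero_transport rfl h1 ?_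
    exact (ContinuousLinearMap.map_smul _ _ u).trans ((congrArg _ hu).trans (smul_zero _))
  · have h1 := (hasDerivAt_coord hα 1).eventually_ne
      (by simpa using coord_ne_zero hm hd) (c := 0)
    have h2 := hc.continuousAt.eventually (χ.open_source.mem_nhds hpχ)
    filter_upwards [h1, h2.filter_mono nhdsWithin_le_nhds] with s e1 e2 e3
    exact e1 (by rw [(hg.singular _ e2).1 e3, mul_zero])

/-- In dimension one, a null arc running into the chart domain of `χ` can be traced back to any
point of the domain behind its end, unless it stays in the domain. -/
theorem NullArc.exists_backtrack [T2Space M] (hm : m = 0)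
    {χ : OpenPartialHomeomorph M (Euc (m + 1))} (hχ : χ ∈ Atlas (m + 1) M)
    (hconv : Convex ℝ χ.target) (h : NullArc (m := m) f c₀ c b) (hb : 0 ≤ b)
    (hx : c b ∈ χ.source) (hy : y ∈ χ.source)
    (hd : deriv (fun s => χ (c s)) b 0 * (χ y - χ (c b)) 0 < 0) :
    ∃ t ∈ Icc 0 b, (∀ s ∈ Icc t b, c s ∈ χ.source) ∧ (t = 0 ∨ c t = y) := by
  set d := deriv (fun s => χ (c s)) b 0 with hd_def
  have hseg : segment ℝ (χ y) (χ (c b)) ⊆ χ.target :=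
    hconv.segment_subset (χ.map_source hy) (χ.map_source hx)
  -- This compact arc is closed because `M` is Hausdorff, so the curve cannot leave it backwards
  -- except through its ends.
  set C := χ.symm '' segment ℝ (χ y) (χ (c b)) with hC
  have hCc : IsClosed C := by
    have h1 : IsCompact (segment ℝ (χ y) (χ (c b))) := by
      rw [segment_eq_image_lineMap]
      exact isCompact_Icc.image AffineMap.lineMap_continuous
    exact (h1.image_of_continuousOn (χ.continuousOn_symm.mono hseg)).isClosed
  have hCs : C ⊆ χ.source := by
    rintro _ ⟨z, hz, rfl⟩; exact χ.map_target (hseg hz)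
  have hyx : d * χ y 0 < d * χ (c b) 0 := by
    have h1 : d * (χ y - χ (c b)) 0 = d * χ y 0 - d * χ (c b) 0 := by
      simp only [PiLp.sub_apply]; ring
    linarith
  have hCmem : ∀ p ∈ χ.source, p ∈ C ↔ d * χ y 0 ≤ d * χ p 0 ∧ d * χ p 0 ≤ d * χ (c b) 0 := by
    intro p hp
    constructor
    · rintro ⟨z, ⟨a₁, a₂, h1, h2, h3, rfl⟩, rfl⟩
      rw [χ.right_inv (hseg ⟨a₁, a₂, h1, h2, h3, rfl⟩)]
      obtain rfl : a₁ = 1 - a₂ := by linarith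
      simp only [PiLp.add_apply, PiLp.smul_apply, smul_eq_mul]
      constructor <;> nlinarith
    · rintro ⟨h1, h2⟩
      have hpos : 0 < d * χ (c b) 0 - d * χ y 0 := by linarith
      have hd0 : d ≠ 0 := fun h0 => by rw [h0] at hyx; simp at hyx
      refine ⟨χ p, ⟨(d * χ (c b) 0 - d * χ p 0) / (d * χ (c b) 0 - d * χ y 0),
        (d * χ p 0 - d * χ y 0) / (d * χ (c b) 0 - d * χ y 0), div_nonneg (by linarith) hpos.le,
        div_nonneg (by linarith) hpos.le, ?_, ?_⟩, χ.left_inv hp⟩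
      · rw [← add_div, div_eq_one_iff_eq hpos.ne']; ring
      · apply euc_ext hm
        simp only [PiLp.add_apply, PiLp.smul_apply, smul_eq_mul]
        have h3 : χ (c b) 0 - χ y 0 ≠ 0 := fun h0 => by
          have : d * (χ (c b) 0 - χ y 0) = 0 := by rw [h0, mul_zero]
          linarith
        rw [← mul_sub, ← mul_sub, ← mul_sub, mul_div_mul_left _ _ hd0, mul_div_mul_left _ _ hd0]
        field_simp
        ring
  have hcont := h.continuousOn
  set T := {t | t ∈ Icc 0 b ∧ ∀ s ∈ Icc t b, c s ∈ C} with hT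
  have hbC : c b ∈ C := ⟨_, right_mem_segment ℝ _ _, χ.left_inv hx⟩
  have hbT : b ∈ T := ⟨⟨hb, le_rfl⟩, fun s hs => by rw [le_antisymm hs.2 hs.1]; exact hbC⟩
  have hbdd : BddBelow T := ⟨0, fun t ht => ht.1.1⟩
  set τ := sInf T with hτ
  have hτI : τ ∈ Icc 0 b := ⟨le_csInf ⟨b, hbT⟩ fun t ht => ht.1.1, csInf_le hbdd hbT⟩
  have hgt : ∀ s, τ < s → s ≤ b → c s ∈ C := by
    intro s hs hsb
    obtain ⟨t, ht, hts⟩ := exists_lt_of_csInf_lt ⟨b, hbT⟩ hs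
    exact ht.2 s ⟨hts.le, hsb⟩
  have hτC : ∀ s ∈ Icc τ b, c s ∈ C := by
    intro s hs
    rcases hs.1.eq_or_lt with rfl | h1
    · rcases hτI.2.eq_or_lt with h2 | h2
      · rw [h2]; exact hbC
      · have h3 : Tendsto c (𝓝[>] τ) (𝓝 (c τ)) :=
          (h.null τ hτI).contMDiffAt.continuousAt.tendsto.mono_left nhdsWithin_le_nhds
        refine hCc.mem_of_tendsto h3 ?_
        filter_upwards [Ioo_mem_nhdsGT h2] with s hs using hgt s hs.1 hs.2.le
    · exact hgt s h1 hs.2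
  refine ⟨τ, hτI, fun s hs => hCs (hτC s hs), ?_⟩
  by_contra! hcon
  obtain ⟨hτ0, hτy⟩ := hcon
  have hτpos : 0 < τ := lt_of_le_of_ne hτI.1 (Ne.symm hτ0)
  have hα : ∀ s ∈ Icc τ b, ContDiffAt ℝ 2 (fun s => χ (c s)) s := fun s hs =>
    contDiffAt_chart_curve two_le_infty hχ (hCs (hτC s hs))
      (h.null s ⟨hτI.1.trans hs.1, hs.2⟩).contMDiffAt
  have hτm : τ ∈ Icc τ b := ⟨le_rfl, hτI.2⟩
  have hd0 : d ≠ 0 := fun h0 => by rw [h0] at hyx; simp at hyx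
  -- The coordinate derivative never vanishes on `[τ, b]`, so by Darboux it keeps its sign. Going
  -- back from `τ` still leads towards `y`, contradicting the minimality of `τ`.
  have hpos : 0 < d * deriv (fun s => χ (c s)) τ 0 := by
    rcases hasDerivWithinAt_forall_lt_or_forall_gt_of_forall_ne (convex_Icc τ b)
      (fun s hs => (hasDerivAt_coord (hα s hs) d).hasDerivWithinAt) (m := 0)
      (fun s hs => mul_ne_zero hd0 ((h.null s ⟨hτI.1.trans hs.1, hs.2⟩).coord_deriv_ne_zero hm hχ
        (hCs (hτC s hs)))) with h1 | h1
    · exact absurd (h1 b ⟨hτI.2, le_rfl⟩) (not_lt.2 (mul_self_nonneg d))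
    · exact h1 τ hτm
  have hτs := hCs (hτC τ hτm)
  obtain ⟨e1, e2⟩ := (hCmem _ hτs).1 (hτC τ hτm)
  have e3 : d * χ y 0 < d * χ (c τ) 0 := by
    refine lt_of_le_of_ne e1 fun h0 => hτy ?_
    exact χ.injOn hτs hy (euc_ext hm (mul_left_cancel₀ hd0 h0.symm))
  have h1 := eventually_sign_of_hasDerivAt
    ((hasDerivAt_coord (hα τ hτm) d).sub_const (d * χ (c τ) 0)) hpos (sub_self _)
  have h2 := (hasDerivAt_coord (hα τ hτm) d).continuousAt.eventually (lt_mem_nhds e3)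
  have h3 := (h.null τ hτI).contMDiffAt.continuousAt.eventually (χ.open_source.mem_nhds hτs)
  obtain ⟨ε, hε, hall⟩ := Metric.eventually_nhds_iff.1
    ((h1.and (h2.and h3)).and (lt_mem_nhds hτpos))
  have hnew : τ - ε / 2 ∈ T := by
    refine ⟨⟨?_, by linarith [hτI.2]⟩, fun s hs => ?_⟩
    · exact (hall (y := τ - ε / 2) (by
        rw [Real.dist_eq, abs_of_nonpos (by linarith)]; linarith)).2.le
    · rcases le_or_gt τ s with h4 | h4
      · exact hτC s ⟨h4, hs.2⟩
      · obtain ⟨⟨⟨-, e4⟩, e5, e6⟩, -⟩ := hall (y := s) (by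
          rw [Real.dist_eq, abs_of_nonpos (by linarith)]; linarith [hs.1])
        exact (hCmem _ e6).2 ⟨le_of_lt e5, by linarith [e4 h4]⟩
  have := csInf_le hbdd hnew
  linarith

end DimensionOne

/-! ### Dimension one: no return with reversed velocity -/

section DimensionOne

variable {m : ℕ}
  {M : Type u} [TopologicalSpace M] [ChartedSpace (Euc (m + 1)) M] [IsManifold (𝓡 (m + 1)) ∞ M]
  {N : Type v} [TopologicalSpace N] [ChartedSpace (Euc (m + 2)) N] [IsManifold (𝓡 (m + 2)) ∞ N]
  {f : M → N} {c₀ c : ℝ → M} {b : ℝ} {o x y : M}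

/-- The velocities of `c` at the times `s` and `t` are opposite. -/
def OppositeAt (c : ℝ → M) (s t : ℝ) : Prop :=
  ∃ κ : ℝ, κ < 0 ∧ (velocity (d := m + 1) c t : Euc (m + 1)) = κ • velocity (d := m + 1) c s

theorem oppositeAt_iff (hm : m = 0) {χ : OpenPartialHomeomorph M (Euc (m + 1))}
    (hχ : χ ∈ Atlas (m + 1) M) {s t : ℝ} (hs : NullAt (m := m) f c s)
    (ht : NullAt (m := m) f c t) (hst : c s = c t) (hsrc : c s ∈ χ.source) :
    OppositeAt (m := m) c s t ↔
      deriv (fun s => χ (c s)) s 0 * deriv (fun s => χ (c s)) t 0 < 0 := by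
  have htsrc : c t ∈ χ.source := hst ▸ hsrc
  have es := dchart_velocity hχ hsrc (hs.contMDiffAt.mdifferentiableAt (by simp))
  have et := dchart_velocity hχ htsrc (ht.contMDiffAt.mdifferentiableAt (by simp))
  have hne := hs.coord_deriv_ne_zero hm hχ hsrc
  have key : ∀ κ : ℝ, (velocity (d := m + 1) c t : Euc (m + 1)) = κ • velocity (d := m + 1) c s ↔
      deriv (fun s => χ (c s)) t = κ • deriv (fun s => χ (c s)) s := by
    intro κ
    rw [← es, ← et, dchart_transport hst.symm (velocity (d := m + 1) c t)]
    constructor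
    · intro h
      exact (congrArg (fun v : Euc (m + 1) => dchart χ (c s) v) h).trans
        (ContinuousLinearMap.map_smul (dchart χ (c s)) κ _)
    · intro h
      exact dchart_injective hχ hsrc
        (h.trans (ContinuousLinearMap.map_smul (dchart χ (c s)) κ _).symm)
  constructor
  · rintro ⟨κ, hκ, h⟩
    rw [(key κ).1 h, PiLp.smul_apply, smul_eq_mul]
    nlinarith [mul_self_pos.2 hne]
  · intro h
    refine ⟨deriv (fun s => χ (c s)) t 0 / deriv (fun s => χ (c s)) s 0, ?_,
      (key _).2 (eq_smul_of_coord_ne_zero hm hne _)⟩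
    rcases mul_neg_iff.1 h with ⟨h1, h2⟩ | ⟨h1, h2⟩
    · exact div_neg_of_neg_of_pos h2 h1
    · exact div_neg_of_pos_of_neg h2 h1

/-- A regular curve in a one-dimensional manifold cannot return to a point in the opposite
direction. -/
theorem not_oppositeAt [T2Space M] (hm : m = 0) (hnull : ∀ t ∈ Icc 0 b, NullAt (m := m) f c t)
    (hb : 0 ≤ b) (h0 : c 0 = c b) : ¬ OppositeAt (m := m) c 0 b := by
  intro hopp
  -- The set of opposite returns is compact, so one of shortest duration exists. It will be
  -- shortened, which is the contradiction.
  set D : Set (ℝ × ℝ) := {z | (z.1 ∈ Icc 0 b ∧ z.2 ∈ Icc 0 b) ∧ z.1 ≤ z.2 ∧ c z.1 = c z.2 ∧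
    OppositeAt (m := m) c z.1 z.2} with hD
  have hDsub : D ⊆ Icc 0 b ×ˢ Icc 0 b := fun z hz => hz.1
  have hca : ∀ t ∈ Icc 0 b, ContinuousAt c t := fun t ht => (hnull t ht).contMDiffAt.continuousAt
  have hDc : IsClosed D := by
    refine isClosed_of_closure_subset fun z hz => ?_
    have hfreq : ∃ᶠ z' in 𝓝 z, z' ∈ D := mem_closure_iff_frequently.1 hz
    have hzI : z ∈ Icc 0 b ×ˢ Icc 0 b :=
      (isClosed_Icc.prod isClosed_Icc).closure_subset (closure_mono hDsub hz)
    have hle : z.1 ≤ z.2 :=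
      (isClosed_le continuous_fst continuous_snd).closure_subset
        (closure_mono (fun z' hz' => hz'.2.1) hz)
    have c1 : ContinuousAt (fun z' : ℝ × ℝ => c z'.1) z :=
      ContinuousAt.comp (g := c) (hca _ hzI.1) continuousAt_fst
    have c2 : ContinuousAt (fun z' : ℝ × ℝ => c z'.2) z :=
      ContinuousAt.comp (g := c) (hca _ hzI.2) continuousAt_snd
    have heq : c z.1 = c z.2 := by
      by_contra hne
      obtain ⟨U, V, hU, hV, hUz, hVz, hUV⟩ := t2_separation hne
      obtain ⟨z', hz', h1, h2⟩ := (hfreq.and_eventually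
        ((c1.eventually (hU.mem_nhds hUz)).and (c2.eventually (hV.mem_nhds hVz)))).exists
      exact hUV.le_bot ⟨h1, (show c z'.1 ∈ V by rw [hz'.2.2.1]; exact h2)⟩
    obtain ⟨χ, hχ, hsrc⟩ : ∃ χ ∈ Atlas (m + 1) M, c z.1 ∈ χ.source :=
      ⟨chartAt _ (c z.1), IsManifold.chart_mem_maximalAtlas _, mem_chart_source _ _⟩
    have d1 := continuousAt_deriv_of_contDiffAt
      (contDiffAt_chart_curve two_le_infty hχ hsrc (hnull _ hzI.1).contMDiffAt)
    have d2 := continuousAt_deriv_of_contDiffAt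
      (contDiffAt_chart_curve two_le_infty hχ (heq ▸ hsrc) (hnull _ hzI.2).contMDiffAt)
    have hprod : ContinuousAt (fun z' : ℝ × ℝ => deriv (fun s => χ (c s)) z'.1 0
        * deriv (fun s => χ (c s)) z'.2 0) z := by
      have e : Continuous fun v : Euc (m + 1) => v 0 := by fun_prop
      exact (e.continuousAt.comp (ContinuousAt.comp (g := deriv fun s => χ (c s)) d1
        continuousAt_fst)).mul
        (e.continuousAt.comp (ContinuousAt.comp (g := deriv fun s => χ (c s)) d2 continuousAt_snd))
    refine ⟨hzI, hle, heq, (oppositeAt_iff hm hχ (hnull _ hzI.1) (hnull _ hzI.2) heq hsrc).2 ?_⟩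
    refine lt_of_le_of_ne ?_ (mul_ne_zero ((hnull _ hzI.1).coord_deriv_ne_zero hm hχ hsrc)
      ((hnull _ hzI.2).coord_deriv_ne_zero hm hχ (heq ▸ hsrc)))
    by_contra! hcon
    obtain ⟨z', hz', h1, h2⟩ := (hfreq.and_eventually
      ((hprod.eventually (lt_mem_nhds hcon)).and
        (c1.eventually (χ.open_source.mem_nhds hsrc)))).exists
    have h3 := (oppositeAt_iff hm hχ (hnull _ hz'.1.1) (hnull _ hz'.1.2) hz'.2.2.1 h2).1 hz'.2.2.2
    exact lt_asymm h1 h3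
  have hDcomp : IsCompact D :=
    (isCompact_Icc.prod isCompact_Icc).of_isClosed_subset hDc hDsub
  obtain ⟨⟨s, t⟩, ⟨⟨hsI, htI⟩, hst, heq, hop⟩, hmin⟩ := hDcomp.exists_isMinOn
    ⟨(0, b), ⟨⟨le_rfl, hb⟩, hb, le_rfl⟩, hb, h0, hopp⟩
    (f := fun z : ℝ × ℝ => z.2 - z.1) (by fun_prop)
  simp only at hsI htI hst heq hop
  obtain ⟨χ, hχ, hsrc⟩ : ∃ χ ∈ Atlas (m + 1) M, c s ∈ χ.source :=
    ⟨chartAt _ (c s), IsManifold.chart_mem_maximalAtlas _, mem_chart_source _ _⟩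
  have htsrc : c t ∈ χ.source := heq ▸ hsrc
  have hAB := (oppositeAt_iff hm hχ (hnull _ hsI) (hnull _ htI) heq hsrc).1 hop
  set A := deriv (fun s => χ (c s)) s 0 with hA
  have hA0 : 0 < A * A := mul_self_pos.2 ((hnull _ hsI).coord_deriv_ne_zero hm hχ hsrc)
  have hlt : s < t := by
    refine lt_of_le_of_ne hst ?_
    rintro rfl
    exact lt_asymm hA0 hAB
  have hαs := contDiffAt_chart_curve two_le_infty hχ hsrc (hnull _ hsI).contMDiffAt
  have hαt := contDiffAt_chart_curve two_le_infty hχ htsrc (hnull _ htI).contMDiffAt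
  have e : Continuous fun v : Euc (m + 1) => A * v 0 := by fun_prop
  have hevs : ∀ᶠ s' in 𝓝 s, c s' ∈ χ.source ∧ 0 < A * deriv (fun s => χ (c s)) s' 0 ∧
      (s < s' → A * χ (c s) 0 < A * χ (c s') 0) := by
    refine ((hca s hsI).eventually (χ.open_source.mem_nhds hsrc)).and (.and ?_ ?_)
    · exact (e.continuousAt.comp (continuousAt_deriv_of_contDiffAt hαs)).eventually
        (lt_mem_nhds hA0)
    · exact (eventually_sign_of_hasDerivAt ((hasDerivAt_coord hαs A).sub_const _) hA0
        (sub_self _)).mono fun s' hs' h => sub_pos.1 (hs'.1 h)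
  have hevt : ∀ᶠ t' in 𝓝 t, c t' ∈ χ.source ∧ A * deriv (fun s => χ (c s)) t' 0 < 0 ∧
      (t' < t → A * χ (c t) 0 < A * χ (c t') 0) := by
    refine ((hca t htI).eventually (χ.open_source.mem_nhds htsrc)).and (.and ?_ ?_)
    · exact (e.continuousAt.comp (continuousAt_deriv_of_contDiffAt hαt)).eventually
        (gt_mem_nhds hAB)
    · have h1 := (hasDerivAt_coord hαt (-A)).sub_const (-A * χ (c t) 0)
      refine (eventually_sign_of_hasDerivAt h1 (by linarith) (sub_self _)).mono
        fun t' ht' h => ?_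
      linarith [ht'.2 h]
  obtain ⟨ε₁, hε₁, hall₁⟩ := Metric.eventually_nhds_iff.1 hevs
  obtain ⟨ε₂, hε₂, hall₂⟩ := Metric.eventually_nhds_iff.1 hevt
  set δ := min (ε₂ / 2) ((t - s) / 2) with hδ
  have hts : 0 < t - s := by linarith
  have hδ0 : 0 < δ := by positivity
  have hδ₁ : δ < ε₂ := lt_of_le_of_lt (min_le_left _ _) (by linarith)
  have hδ₂ : δ ≤ (t - s) / 2 := min_le_right _ _
  have hIt : ∀ t' ∈ Icc (t - δ) t, dist t' t < ε₂ := fun t' ht' => by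
    rw [Real.dist_eq, abs_of_nonpos (by linarith [ht'.2])]; linarith [ht'.1]
  have ht₁ := (hall₂ (hIt (t - δ) ⟨le_rfl, by linarith⟩)).2.2 (by linarith)
  rw [← heq] at ht₁
  have hcs : ∀ᶠ s' in 𝓝 s, A * χ (c s') 0 < A * χ (c (t - δ)) 0 :=
    (e.continuousAt.comp hαs.continuousAt).eventually (gt_mem_nhds ht₁)
  obtain ⟨s', ⟨hs'1, hs'2⟩, hs'3, hs'4⟩ := ((hcs.filter_mono nhdsWithin_le_nhds).and
    (Ioo_mem_nhdsGT (show s < s + min ε₁ ((t - s) / 2) by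
      have : 0 < min ε₁ ((t - s) / 2) := by positivity
      linarith))).exists.imp fun s' h => (⟨⟨h.1, h.2.1⟩, h.2.2, trivial⟩ :
        (A * χ (c s') 0 < A * χ (c (t - δ)) 0 ∧ s < s') ∧ s' < s + min ε₁ ((t - s) / 2) ∧ True)
  have hs'5 : s' < s + ε₁ := hs'3.trans_le (by linarith [min_le_left ε₁ ((t - s) / 2)])
  have hs'6 : s' < s + (t - s) / 2 := hs'3.trans_le (by linarith [min_le_right ε₁ ((t - s) / 2)])
  obtain ⟨g1, g2, g3⟩ := hall₁ (y := s') (by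
    rw [Real.dist_eq, abs_of_nonneg (by linarith)]; linarith)
  have g3 := g3 hs'2
  have hcont : ContinuousOn (fun t' => A * χ (c t') 0) (Icc (t - δ) t) := fun t' ht' => by
    have h1 := contDiffAt_chart_curve two_le_infty hχ (hall₂ (hIt t' ht')).1
      (hnull t' ⟨by linarith [hsI.1, ht'.1], ht'.2.trans htI.2⟩).contMDiffAt
    exact (e.continuousAt.comp h1.continuousAt).continuousWithinAt
  -- Just after `s` and just before `t` the curve covers the same side of the common point. A time
  -- `s'` slightly after `s` therefore has a partner `t'` before `t` at the same point, again with
  -- opposite velocity.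
  obtain ⟨t', ht', htt'⟩ := intermediate_value_Icc' (by linarith) hcont
    (⟨by rw [← heq]; exact g3.le, hs'1.le⟩ :
      A * χ (c s') 0 ∈ Icc (A * χ (c t) 0) (A * χ (c (t - δ)) 0))
  simp only at htt'
  obtain ⟨k1, k2, -⟩ := hall₂ (hIt t' ht')
  have hA1 : A ≠ 0 := left_ne_zero_of_mul hA0.ne'
  have hcc : c s' = c t' := χ.injOn g1 k1 (euc_ext hm (mul_left_cancel₀ hA1 htt'.symm))
  have hs'I : s' ∈ Icc 0 b := ⟨by linarith [hsI.1], by linarith [htI.2]⟩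
  have ht'I : t' ∈ Icc 0 b := ⟨by linarith [hsI.1, ht'.1], ht'.2.trans htI.2⟩
  have hmem : (s', t') ∈ D := by
    refine ⟨⟨hs'I, ht'I⟩, ?_, hcc, (oppositeAt_iff hm hχ (hnull _ hs'I) (hnull _ ht'I) hcc g1).2 ?_⟩
    · change s' ≤ t'
      linarith [ht'.1]
    · have h1 := mul_neg_of_pos_of_neg g2 k2
      change deriv (fun s => χ (c s)) s' 0 * deriv (fun s => χ (c s)) t' 0 < 0
      by_contra! hcon
      nlinarith [mul_nonneg hA0.le hcon]
  have : t - s ≤ t' - s' := hmin hmem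
  linarith [ht'.2]

end DimensionOne

/-! ### Dimension one: loops are trivial or homotopic to null loops -/

section DimensionOne

variable {m : ℕ}
  {M : Type u} [TopologicalSpace M] [ChartedSpace (Euc (m + 1)) M] [IsManifold (𝓡 (m + 1)) ∞ M]
  {N : Type v} [TopologicalSpace N] [ChartedSpace (Euc (m + 2)) N] [IsManifold (𝓡 (m + 2)) ∞ N]
  {f : M → N} {c₀ c : ℝ → M} {b : ℝ} {o x y : M}

/-- In dimension one, a null arc can be continued in the direction of its velocity. -/
theorem NullArc.exists_forward (hfree : ∀ p : M, IsFree (m := m) f p)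
    {χ : OpenPartialHomeomorph M (Euc (m + 1))} (hχ : χ ∈ Atlas (m + 1) M)
    (hconv : Convex ℝ χ.target) (h : NullArc (m := m) f c₀ c b) (hb : 0 < b)
    {q : Path.Homotopic.Quotient o x} (hq : ClassIn c (Icc 0 b) 0 b q)
    {s : Path.Homotopic.Quotient x y} (hs : ChartClass χ s)
    (hd : 0 < deriv (fun s => χ (c s)) b 0 * (χ y - χ x) 0) :
    Reach (m := m) f c₀ (q.trans s) := by
  obtain ⟨hxs, hys⟩ := hs.mem_source
  have hne : χ y - χ x ≠ 0 := fun h0 => by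
    rw [h0] at hd; simp at hd
  obtain ⟨ℓ, h1, h2⟩ := turn_of_mul_pos hd
  obtain ⟨c', b', -, -, -, hb', hc', hq', -⟩ := h.exists_line hχ hconv hb hq hs
    (Eventually.of_forall hfree) (fun τ hτ => nullAt_line_of_free hχ hne
      (hconv.add_smul_sub_mem (χ.map_source hxs) (χ.map_source hys) hτ) (hfree _)) h1 h2 0
  exact ⟨c', b', hb', hc', hq'⟩

/-- The start of an arc: the germ is first followed for a short positive time, since a continuation
needs an arc of positive length to blend from. -/
theorem Reach.of_chart_of_dim_one (hfree : ∀ p : M, IsFree (m := m) f p)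
    {χ : OpenPartialHomeomorph M (Euc (m + 1))} (hχ : χ ∈ Atlas (m + 1) M)
    (hconv : Convex ℝ χ.target) (hnull : ∀ᶠ t in 𝓝 (0 : ℝ), NullAt (m := m) f c t) (hc : c 0 = o)
    {s : Path.Homotopic.Quotient o y} (hs : ChartClass χ s)
    (hd : 0 < deriv (fun s => χ (c s)) 0 0 * (χ y - χ o) 0) : Reach (m := m) f c s := by
  obtain ⟨hos, hys⟩ := hs.mem_source
  have hcs : c 0 ∈ χ.source := hc ▸ hos
  have h0 := hnull.self_of_nhds.contMDiffAt
  have hα := contDiffAt_chart_curve two_le_infty hχ hcs h0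
  have e : Continuous fun v : Euc (m + 1) => v 0 := by fun_prop
  have e' : Continuous fun v : Euc (m + 1) => (χ y - v) 0 := by fun_prop
  have hev : ∀ᶠ t in 𝓝 (0 : ℝ), c t ∈ χ.source ∧
      0 < deriv (fun s => χ (c s)) t 0 * (χ y - χ (c t)) 0 := by
    refine (h0.continuousAt.eventually (χ.open_source.mem_nhds hcs)).and ?_
    refine ((e.continuousAt.comp (continuousAt_deriv_of_contDiffAt hα)).mul
      (e'.continuousAt.comp hα.continuousAt)).eventually (lt_mem_nhds ?_)
    simpa [hc] using hd
  obtain ⟨ε, hε, hall⟩ := Metric.eventually_nhds_iff.1 (hnull.and hev)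
  have hI : ∀ t ∈ Icc 0 (ε / 2), dist t 0 < ε := fun t ht => by
    rw [Real.dist_eq, sub_zero, abs_of_nonneg ht.1]; linarith [ht.2]
  have hend : ε / 2 ∈ Icc 0 (ε / 2) := ⟨by positivity, le_rfl⟩
  have harc : NullArc (m := m) f c c (ε / 2) :=
    ⟨EventuallyEq.rfl, fun t ht => (hall (hI t ht)).1⟩
  obtain ⟨q, hq⟩ := exists_classIn (convex_Icc 0 (ε / 2)) harc.continuousOn
    ⟨le_rfl, hend.1⟩ hend hc rfl
  obtain ⟨-, hsrc, hpos⟩ := hall (hI _ hend)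
  obtain ⟨s', hs'⟩ := exists_chartClass hconv hsrc hys
  have hqχ : ChartClass χ q := hq.chartClass harc.continuousOn fun t ht => (hall (hI t ht)).2.1
  rw [hs.unique hconv (hqχ.trans hs')]
  exact harc.exists_forward hfree hχ hconv (by positivity) hq hs' hpos

/-- In dimension one, every loop at a regular point is null-homotopic or homotopic to a null
loop. -/
theorem exists_nullLoop_homotopic_of_dim_one [T2Space M] (hm : m = 0)
    (hf : ContMDiff (𝓡 (m + 1)) (𝓡 (m + 2)) ∞ f)
    {W : Type w} [TopologicalSpace W] [ChartedSpace (Euc (m + 2)) W] [IsManifold (𝓡 (m + 2)) ∞ W]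
    {F : W → N} {ι : M → W} (he : MorinExtension (m := m) f F ι) (γ : Path o o) :
    Path.Homotopic.Quotient.mk γ = Path.Homotopic.Quotient.refl o ∨
    ∃ (c : ℝ → M) (h : IsNullLoop (m := m) f o c),
      Path.Homotopic.Quotient.mk h.toPath = Path.Homotopic.Quotient.mk γ := by
  have hfree : ∀ p : M, IsFree (m := m) f p := isFree_of_dim_one hm hf he
  set 𝒞 : Set (OpenPartialHomeomorph M (Euc (m + 1))) :=
    {χ | χ ∈ Atlas (m + 1) M ∧ Convex ℝ χ.target} with h𝒞
  have hcov : ∀ p, ∃ χ ∈ 𝒞, p ∈ χ.source := by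
    intro p
    obtain ⟨χ, hχ, hpχ, -, ⟨z₀, r₀, hball⟩, -⟩ := he.exists_gate_chart hf p univ_mem
    exact ⟨χ, ⟨hχ, by rw [hball]; exact convex_ball _ _⟩, hpχ⟩
  obtain ⟨χ₀, ⟨hχ₀, hconv₀⟩, ho⟩ := hcov o
  set u : Euc (m + 1) := eFirst m with hu
  have hu1 : u 0 = 1 := by simp [hu, eFirst]
  let c₀ : ℝ → ℝ → M := fun σ t => χ₀.symm (χ₀ o + t • σ • u)
  have hline : ∀ σ : ℝ, Continuous fun t : ℝ => χ₀ o + t • σ • u := fun σ => by fun_prop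
  have htar : ∀ σ, ∀ᶠ t in 𝓝 (0 : ℝ), χ₀ o + t • σ • u ∈ χ₀.target := fun σ =>
    (hline σ).continuousAt.eventually (χ₀.open_target.mem_nhds (by simpa using χ₀.map_source ho))
  have hc₀ : ∀ σ, c₀ σ 0 = o := fun σ => by simp [c₀, χ₀.left_inv ho]
  have hnull : ∀ σ : ℝ, σ ≠ 0 → ∀ᶠ t in 𝓝 (0 : ℝ), NullAt (m := m) f (c₀ σ) t := fun σ hσ =>
    (htar σ).mono fun t ht => nullAt_line_of_free hχ₀ (smul_ne_zero hσ fun h0 => by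
      rw [h0] at hu1; simp at hu1) ht (hfree _)
  have hneg : ∀ χ : OpenPartialHomeomorph M (Euc (m + 1)),
      deriv (fun s => χ (c₀ (-1) s)) 0 = -deriv (fun s => χ (c₀ 1 s)) 0 := by
    intro χ
    have h1 : (fun s => χ (c₀ (-1) s)) = fun s => (fun s => χ (c₀ 1 s)) (-s) := by
      funext s
      simp [c₀]
    have h2 := deriv_comp_neg (fun s => χ (c₀ 1 s)) (0 : ℝ)
    rw [h1, h2, neg_zero]
  -- Arcs of length zero and both initial directions are admitted, because backtracking may consume
  -- the whole arc and force a fresh start the other way.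
  let P : ∀ {x : M}, Path.Homotopic.Quotient o x → Prop := fun q =>
    ∃ σ : ℝ, σ ≠ 0 ∧ ∃ (c : ℝ → M) (b : ℝ), 0 ≤ b ∧ NullArc (m := m) f (c₀ σ) c b ∧
      ClassIn c (Icc 0 b) 0 b q
  have hP : ∀ {x : M} {q : Path.Homotopic.Quotient o x} {σ : ℝ}, σ ≠ 0 →
      Reach (m := m) f (c₀ σ) q → P q := by
    rintro x q σ hσ ⟨c, b, hb, hc, hq⟩
    exact ⟨σ, hσ, c, b, hb.le, hc, hq⟩
  have hrefl : P (Path.Homotopic.Quotient.refl o) := by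
    refine ⟨1, one_ne_zero, c₀ 1, 0, le_rfl, ⟨EventuallyEq.rfl, fun t ht => ?_⟩,
      ClassIn.refl ⟨le_rfl, le_rfl⟩ (hc₀ 1)⟩
    rw [le_antisymm ht.2 ht.1]
    exact (hnull 1 one_ne_zero).self_of_nhds
  have hrefl_of : ∀ {χ : OpenPartialHomeomorph M (Euc (m + 1))}, χ ∈ 𝒞 → ∀ {x : M}
      {s : Path.Homotopic.Quotient x x}, ChartClass χ s → s = Path.Homotopic.Quotient.refl x := by
    intro χ hχ x s hs
    exact hs.unique hχ.2 (ClassIn.refl (χ.map_source hs.mem_source.1)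
      (χ.left_inv hs.mem_source.1))
  have hstart : ∀ χ ∈ 𝒞, ∀ {y : M} (s : Path.Homotopic.Quotient o y), ChartClass χ s → P s := by
    intro χ hχ y s hs
    rcases eq_or_ne o y with rfl | hne
    · rw [hrefl_of hχ hs]; exact hrefl
    have hΔ : (χ y - χ o) 0 ≠ 0 := coord_ne_zero hm fun h0 =>
      hne (χ.injOn hs.mem_source.1 hs.mem_source.2 (sub_eq_zero.1 h0).symm)
    have hD := (hnull 1 one_ne_zero).self_of_nhds.coord_deriv_ne_zero hm hχ.1
      ((hc₀ 1).symm ▸ hs.mem_source.1)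
    rcases lt_or_gt_of_ne (mul_ne_zero hD hΔ) with h1 | h1
    · have hσ : (-1 : ℝ) ≠ 0 := by norm_num
      refine hP hσ (Reach.of_chart_of_dim_one hfree hχ.1 hχ.2 (hnull _ hσ) (hc₀ _) hs ?_)
      rw [hneg χ, PiLp.neg_apply]
      linarith
    · exact hP one_ne_zero (Reach.of_chart_of_dim_one hfree hχ.1 hχ.2 (hnull _ one_ne_zero)
        (hc₀ _) hs h1)
  have hzero : ∀ {x : M} {c : ℝ → M} {q : Path.Homotopic.Quotient o x},
      ClassIn c (Icc 0 0) 0 0 q → ∃ h : o = x, h ▸ q = Path.Homotopic.Quotient.refl o := by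
    intro x c q hq
    obtain rfl : o = x := hq.source.2.symm.trans hq.target.2
    refine ⟨rfl, ClassIn.unique (c := c) (convex_Icc 0 0) ?_ hq
      (ClassIn.refl ⟨le_rfl, le_rfl⟩ hq.source.2)⟩
    rw [Icc_self]; exact continuousOn_singleton _ _
  have hstep : ∀ χ ∈ 𝒞, ∀ {x y : M} (q : Path.Homotopic.Quotient o x)
      (s : Path.Homotopic.Quotient x y), ChartClass χ s → P q → P (q.trans s) := by
    rintro χ hχ x y q s hs ⟨σ, hσ, c, b, hb, hc, hq⟩
    rcases hb.eq_or_lt with rfl | hb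
    · obtain ⟨rfl, h1⟩ := hzero hq
      rw [show q = Path.Homotopic.Quotient.refl o from h1, Path.Homotopic.Quotient.refl_trans]
      exact hstart χ hχ s hs
    rcases eq_or_ne x y with rfl | hne
    · rw [hrefl_of hχ hs, Path.Homotopic.Quotient.trans_refl]
      exact ⟨σ, hσ, c, b, hb.le, hc, hq⟩
    obtain ⟨hxs, hys⟩ := hs.mem_source
    have hcb : c b = x := hq.target.2
    have hΔ : (χ y - χ x) 0 ≠ 0 := coord_ne_zero hm fun h0 =>
      hne (χ.injOn hxs hys (sub_eq_zero.1 h0).symm)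
    have hD := (hc.null b ⟨hb.le, le_rfl⟩).coord_deriv_ne_zero hm hχ.1 (hcb.symm ▸ hxs)
    rcases lt_or_gt_of_ne (mul_ne_zero hD hΔ) with h1 | h1
    swap
    · exact hP hσ (hc.exists_forward hfree hχ.1 hχ.2 hb hq hs h1)
    -- The target lies behind the end of the arc. Either the arc passed through it, and is cut
    -- there, or the arc stays in the chart and the whole class is a chart class from `o`.
    obtain ⟨t, ht, htsrc, hty⟩ := hc.exists_backtrack hm hχ.1 hχ.2 hb.le (hcb.symm ▸ hxs) hys
      (by rw [hcb]; exact h1)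
    have hsub : Icc t b ⊆ Icc 0 b := Icc_subset_Icc_left ht.1
    rcases hty with rfl | rfl
    · exact hstart χ hχ _ ((hq.chartClass hc.continuousOn htsrc).trans hs)
    · obtain ⟨q₁, q₂, hq₁, hq₂, rfl⟩ := hq.split hc.continuousOn ht.1 ht.2 rfl
      have h2 := hrefl_of hχ ((hq₂.chartClass (hc.continuousOn.mono hsub) htsrc).trans hs)
      rw [Path.Homotopic.Quotient.trans_assoc, h2, Path.Homotopic.Quotient.trans_refl]
      exact ⟨σ, hσ, c, t, ht.1, hc.mono ht.2, hq₁⟩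
  obtain ⟨σ, hσ, c, b, hb, hc, hq⟩ := pathClass_induction (P := P) hcov hrefl hstep γ
  rcases hb.eq_or_lt with rfl | hb
  · exact Or.inl (hzero hq).2
  right
  have hcb : c b = o := hq.target.2
  have hc0 : c 0 = o := hq.source.2
  have hn0 := hc.null 0 ⟨le_rfl, hb.le⟩
  have hnb := hc.null b ⟨hb.le, le_rfl⟩
  have hder : deriv (fun s => χ₀ (c₀ σ s)) 0 = deriv (fun s => χ₀ (c s)) 0 :=
    Filter.EventuallyEq.deriv_eq (hc.germ.symm.fun_comp χ₀)
  refine hc.exists_nullLoop hχ₀ hconv₀ hb hq ho (Eventually.of_forall hfree)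
    (turn_of_mul_pos ?_)
  rw [hder, mul_comm]
  have hne := mul_ne_zero (hn0.coord_deriv_ne_zero hm hχ₀ (hc0.symm ▸ ho))
    (hnb.coord_deriv_ne_zero hm hχ₀ (hcb.symm ▸ ho))
  refine lt_of_le_of_ne (not_lt.1 fun h1 => ?_) hne.symm
  exact not_oppositeAt hm hc.null hb.le (hc0.trans hcb.symm)
    ((oppositeAt_iff hm hχ₀ hn0 hnb (hc0.trans hcb.symm) (hc0.symm ▸ ho)).2 h1)

end DimensionOne

/-! ### Uniqueness of the Maslov representation -/

section Uniqueness

variable {m : ℕ}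
  {M : Type u} [TopologicalSpace M] [T2Space M]
  [ChartedSpace (Euc (m + 1)) M] [IsManifold (𝓡 (m + 1)) ∞ M]
  {N : Type v} [TopologicalSpace N] [ChartedSpace (Euc (m + 2)) N] [IsManifold (𝓡 (m + 2)) ∞ N]
  {W : Type w} [TopologicalSpace W] [ChartedSpace (Euc (m + 2)) W] [IsManifold (𝓡 (m + 2)) ∞ W]
  {f : M → N} {F : W → N} {ι : M → W} {g : Metric (m + 2) N} {o : M}

/-- A Maslov representation of a Morin front is trivial. -/
theorem MorinExtension.eq_one_of_isMaslovRepresentation (he : MorinExtension (m := m) f F ι)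
    (hf : IsFront g f) (ho : o ∉ singularSet (m + 1) (m + 2) f)
    {ν₀ : TangentSpace (𝓡 (m + 2)) (f o)} (hν₀ : IsUnitNormalAt g f o ν₀)
    {Φ : coorientableSubgroup g f o →* Multiplicative ℤ}
    (hΦ : IsMaslovRepresentation g f o ν₀ Φ) : Φ = 1 := by
  have key : ∀ (γ : Path o o) (hγ : IsCoorientable g f γ),
      Φ ⟨loopClass γ, loopClass_mem hγ⟩ = 1 := by
    intro γ hγ
    have h1 : Path.Homotopic.Quotient.mk γ = Path.Homotopic.Quotient.refl o ∨
        ∃ (c : ℝ → M) (h : IsNullLoop (m := m) f o c),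
          Path.Homotopic.Quotient.mk h.toPath = Path.Homotopic.Quotient.mk γ := by
      rcases Nat.eq_zero_or_pos m with hm | hm
      · exact exists_nullLoop_homotopic_of_dim_one hm hf.1 he γ
      · exact Or.inr (exists_nullLoop_homotopic hm hf.1 he ho γ)
    rcases h1 with h1 | ⟨c, h, h1⟩
    · have h2 : (⟨loopClass γ, loopClass_mem hγ⟩ : coorientableSubgroup g f o) = 1 :=
        Subtype.ext (congrArg FundamentalGroup.fromPath h1)
      rw [h2, map_one]
    · have hc : IsCoorientable g f h.toPath := hγ.of_homotopic (he.dense_regular hf.1) hf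
        (Path.Homotopic.Quotient.eq.1 h1.symm)
      have h2 : (⟨loopClass γ, loopClass_mem hγ⟩ : coorientableSubgroup g f o)
          = ⟨loopClass h.toPath, loopClass_mem hc⟩ :=
        Subtype.ext (congrArg FundamentalGroup.fromPath h1.symm)
      rw [h2]
      exact he.eq_one_of_nullLoop hf.1 ho hν₀ hΦ h hc
  ext ⟨x, hx⟩
  refine congrArg _ (?_ : Φ ⟨x, hx⟩ = 1)
  -- The group is presented as generated by the classes of co-orientable loops, so triviality on
  -- these classes suffices.
  refine Subgroup.closure_induction (p := fun x hx => Φ ⟨x, hx⟩ = 1) ?_ ?_ ?_ ?_ hx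
  · rintro _ ⟨γ, hγ, rfl⟩
    exact key γ hγ
  · exact map_one Φ
  · intro x y hx hy h1 h2
    exact (map_mul Φ ⟨x, hx⟩ ⟨y, hy⟩).trans (by rw [h1, h2, one_mul])
  · intro x hx h1
    exact (map_inv Φ ⟨x, hx⟩).trans (by rw [h1, inv_one])

end Uniqueness

end MorinFront

end

theorem mainTheorem12 {m : ℕ}
    {M : Type u} [TopologicalSpace M] [T2Space M] [SecondCountableTopology M]
    [ChartedSpace (MorinFront.Euc (m + 1)) M] [IsManifold (𝓡 (m + 1)) ∞ M]
    {N : Type v} [TopologicalSpace N] [T2Space N] [SecondCountableTopology N]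
    [ChartedSpace (MorinFront.Euc (m + 2)) N] [IsManifold (𝓡 (m + 2)) ∞ N]
    (g : MorinFront.Metric (m + 2) N) (f : M → N) (hf : MorinFront.IsMorinFront.{u, v, w} g f)
    (o : M) (ho : o ∉ MorinFront.singularSet (m + 1) (m + 2) f)
    (ν₀ : TangentSpace (𝓡 (m + 2)) (f o)) (hν₀ : MorinFront.IsUnitNormalAt g f o ν₀) :
    MorinFront.IsMaslovRepresentation g f o ν₀ 1 ∧
      ∀ Φ : MorinFront.coorientableSubgroup g f o →* Multiplicative ℤ,
        MorinFront.IsMaslovRepresentation g f o ν₀ Φ → Φ = 1 := by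
  obtain ⟨W, _, _, _, F, ι, he⟩ := hf.exists_extension
  exact ⟨he.isMaslovRepresentation_one hf.1.1 ho hν₀,
    fun Φ hΦ => he.eq_one_of_isMaslovRepresentation hf.1 ho hν₀ hΦ⟩
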